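/- All links are tame links in $\mathbb{R}^3$ with finitely many components: a link $L$ is a finite disjoint union of simple closed curves that some ambient isotopy of $\mathbb{R}^3$ carries to a polygonal link. Two links are isotopic if an ambient isotopy of $\mathbb{R}^3$ carries one to the other; for polygonal links partitioned into two parts, or together with annuli, we work in the piecewise linear (PL) category, i.e. the final homeomorphism of the isotopy is required to be PL and annuli and disks are PL embedded. For a polygonal link partitioned into two parts $A$ and $B$, the overcrossing number $\operatorname{Over}(A,B)$ is the number of crossings of $A$ over $B$, minimized over all regular projections of links isotopic to $A\cup B$ (respecting the partition). A parallel copy of a polygonal link $K$ is a link $K'$ isotopic to $K$ such that corresponding components of $K$ and $K'$ cobound annuli, the entire collection of which is embedded in $\mathbb{R}^3$. The parallel overcrossing number $\operatorname{pov}(L)$ is the minimum of $\operatorname{Over}(K,K')$ over all parallel copies $K'$ of $K$, where $K$ is a polygonal link isotopic to $L$ (and we minimize over $K$ as well). The bridge number of $L$ is the minimum number of local maxima of a height function (a linear coordinate), over all polygonal links isotopic to $L$. A component of $L$ is an unknotted split component if it is an unknot and, after an isotopy of $L$, a plane separates it from all other components of $L$. The reduced bridge number $\operatorname{bridge}(L)$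 is the bridge number of $L$ minus the number of unknotted split components of $L$. A link is trivial if, after an isotopy, its components bound pairwise disjoint embedded disks. Proposition. For any link $L$, $\operatorname{pov}(L)\ge \operatorname{bridge}(L)$. In particular, if $L$ is nontrivial, then $\operatorname{pov}(L)\ge 2$. -/

import Mathlib

open Topology

namespace LinkTheory

/-- Euclidean three-space. -/
abbrev E3 : Type := EuclideanSpace ℝ (Fin 3)

/-! ### Piecewise linear maps, polygons, disks and annuli

`ℝ × ℝ` carries the sup norm, so its spheres and balls about `0` are (boundaries of) squares. -/

/-- `f` is (finitely) piecewise linear on `s`: it is continuous on `s`, and at each point of `s`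
it agrees with one of finitely many affine maps. -/
def IsPLOn {X : Type*} [NormedAddCommGroup X] [NormedSpace ℝ X] (f : X → E3) (s : Set X) : Prop :=
  ContinuousOn f s ∧ ∃ G : Set (X →ᵃ[ℝ] E3), G.Finite ∧ ∀ x ∈ s, ∃ g ∈ G, f x = g x

/-- `f` is a piecewise linear embedding of `s`. -/
def IsPLEmbedding (f : ℝ × ℝ → E3) (s : Set (ℝ × ℝ)) : Prop :=
  IsPLOn f s ∧ Set.InjOn f s

/-- `C` is a simple closed polygon: a PL embedded image of the boundary of a square. -/
def IsPolygon (C : Set E3) : Prop :=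
  ∃ f : ℝ × ℝ → E3, IsPLEmbedding f (Metric.sphere 0 1) ∧ f '' Metric.sphere 0 1 = C

/-- `D` is a PL embedded disk with boundary `C`. -/
def IsPLDisk (D C : Set E3) : Prop :=
  ∃ f : ℝ × ℝ → E3, IsPLEmbedding f (Metric.closedBall 0 1) ∧
    f '' Metric.closedBall 0 1 = D ∧ f '' Metric.sphere 0 1 = C

/-- The standard annulus, a square with a concentric smaller open square removed. -/
def stdAnnulus : Set (ℝ × ℝ) := {p | 1 ≤ ‖p‖ ∧ ‖p‖ ≤ 2}

/-- `A` is a PL embedded annulus with boundary components `C` and `C'`. -/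
def IsPLAnnulus (A C C' : Set E3) : Prop :=
  ∃ f : ℝ × ℝ → E3, IsPLEmbedding f stdAnnulus ∧
    f '' stdAnnulus = A ∧ f '' Metric.sphere 0 1 = C ∧ f '' Metric.sphere 0 2 = C'

/-! ### Ambient isotopy -/

/-- `h` is the final map of an ambient isotopy of `ℝ³`. -/
def IsIsotopicToId (h : E3 ≃ₜ E3) : Prop :=
  ∃ H : unitInterval → (E3 ≃ₜ E3), Continuous (fun p : unitInterval × E3 => H p.1 p.2) ∧
    H 0 = Homeomorph.refl E3 ∧ H 1 = h

/-- Ambient isotopy of families of subsets of `ℝ³` (with labelled members). -/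
def Isotopic {ι : Type*} (L K : ι → Set E3) : Prop :=
  ∃ h : E3 ≃ₜ E3, IsIsotopicToId h ∧ ∀ i, h '' L i = K i

/-- Ambient isotopy in the PL category: the final map is moreover piecewise linear. -/
def PLIsotopic {ι : Type*} (L K : ι → Set E3) : Prop :=
  ∃ h : E3 ≃ₜ E3, IsIsotopicToId h ∧ IsPLOn h Set.univ ∧ ∀ i, h '' L i = K i

/-! ### Links

A link is given by the family of its components, indexed by a finite type. -/

/-- A polygonal link: pairwise disjoint simple closed polygons. -/
def IsPolygonalLink {ι : Type*} (L : ι → Set E3) : Prop :=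
  (∀ i, IsPolygon (L i)) ∧ Pairwise (Function.onFun Disjoint L)

/-- A tame link: pairwise disjoint simple closed curves, carried to a polygonal link by an ambient
isotopy. (The components are disjoint simple closed curves because those of `K` are.) -/
def IsTameLink {ι : Type*} (L : ι → Set E3) : Prop :=
  ∃ K : ι → Set E3, IsPolygonalLink K ∧ Isotopic L K

/-- A trivial link: up to isotopy, the components bound pairwise disjoint embedded disks. -/
def IsTrivialLink {ι : Type*} (L : ι → Set E3) : Prop :=
  ∃ K D : ι → Set E3, Isotopic L K ∧ (∀ i, IsPLDisk (D i) (K i)) ∧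
    Pairwise (Function.onFun Disjoint D)

/-! ### Projections and overcrossings -/

/-- Projection along the third coordinate axis. -/
def proj (x : E3) : ℝ × ℝ := (x 0, x 1)

/-- Near its point `x`, the set `X` is a straight segment in the direction of `u`. -/
def IsStraightAt (X : Set E3) (x u : E3) : Prop :=
  ∃ ε > 0, ∀ y ∈ Metric.ball x ε, y ∈ X ↔ ∃ t : ℝ, y = x + t • u

/-- The projection of `X` is regular: there are no triple points, and at each double point the
two strands are straight and cross transversally in the projection. (In particular no edge
is vertical, no vertex is over or under another point, and there are finitely many double
points if `X` is a polygonal link.) -/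
def HasRegularProjection (X : Set E3) : Prop :=
  (∀ x ∈ X, ∀ y ∈ X, ∀ w ∈ X, proj x = proj y → proj y = proj w → x = y ∨ y = w ∨ x = w) ∧
  (∀ x ∈ X, ∀ y ∈ X, x ≠ y → proj x = proj y →
    ∃ u v : E3, IsStraightAt X x u ∧ IsStraightAt X y v ∧ u 0 * v 1 - u 1 * v 0 ≠ 0)

/-- The crossings of `A` over `B`: pairs of a point of `A` and a point of `B` vertically
below it. -/
def overcrossings (A B : Set E3) : Set (E3 × E3) :=
  {p | p.1 ∈ A ∧ p.2 ∈ B ∧ proj p.1 = proj p.2 ∧ p.2 2 < p.1 2}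

/-- The overcrossing number `Over(A, B)` of a polygonal link partitioned into the parts
`A` (indexed by `ι`) and `B` (indexed by `κ`): the number of crossings of `A` over `B`, minimized
over all regular projections of links isotopic to it. Projecting in one fixed direction is no
restriction, since rotations are isotopic to the identity. -/
noncomputable def overcrossingNumber {ι κ : Type*} (A : ι → Set E3) (B : κ → Set E3) : ℕ∞ :=
  ⨅ (K : ι ⊕ κ → Set E3) (_ : IsPolygonalLink K) (_ : PLIsotopic (Sum.elim A B) K)
    (_ : HasRegularProjection (⋃ i, K i)),
    (overcrossings (⋃ i, K (Sum.inl i)) (⋃ j, K (Sum.inr j))).encard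

/-- `L'` is a parallel copy of the polygonal link `L`: an isotopic link such that corresponding
components cobound annuli, the entire collection of which is embedded. -/
def IsParallelCopy {ι : Type*} (L L' : ι → Set E3) : Prop :=
  IsPolygonalLink L' ∧ PLIsotopic L L' ∧
    ∃ A : ι → Set E3, (∀ i, IsPLAnnulus (A i) (L i) (L' i)) ∧ Pairwise (Function.onFun Disjoint A)

/-- The parallel overcrossing number of a tame link `L`: the minimum of `Over(K, K')` over all
parallel copies `K'` of `K`, where `K` is `L` made polygonal by an isotopy. (Any two polygonal
links isotopic to `L` are isotopic in the PL category, so the choice of `K` is immaterial.) -/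
noncomputable def parallelOvercrossingNumber {ι : Type*} (L : ι → Set E3) : ℕ∞ :=
  ⨅ (K : ι → Set E3) (_ : IsPolygonalLink K) (_ : Isotopic L K)
    (K' : ι → Set E3) (_ : IsParallelCopy K K'), overcrossingNumber K K'

/-! ### The reduced bridge number -/

/-- The local maxima on `X` of the height function (the third coordinate). -/
def localMaxima (X : Set E3) : Set E3 :=
  {x | x ∈ X ∧ IsLocalMaxOn (fun y : E3 => y 2) X x}

/-- The bridge number: the minimum number of local maxima of the height function, over all
polygonal links isotopic to `L`. -/
noncomputable def bridgeNumber {ι : Type*} (L : ι → Set E3) : ℕ∞ :=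
  ⨅ (K : ι → Set E3) (_ : IsPolygonalLink K) (_ : Isotopic L K), (localMaxima (⋃ i, K i)).encard

/-- A simple closed curve is unknotted if, up to isotopy, it bounds an embedded disk. -/
def IsUnknotted (C : Set E3) : Prop :=
  ∃ h : E3 ≃ₜ E3, IsIsotopicToId h ∧ ∃ D, IsPLDisk D (h '' C)

/-- The component `L i` is split: up to isotopy, a plane separates it from the rest of `L`. -/
def IsSplitComponent {ι : Type*} (L : ι → Set E3) (i : ι) : Prop :=
  ∃ K : ι → Set E3, Isotopic L K ∧ (∀ x ∈ K i, 0 < x 2) ∧ ∀ j ≠ i, ∀ x ∈ K j, x 2 < 0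

/-- The set of unknotted split components of `L`. -/
def unknottedSplitComponents {ι : Type*} (L : ι → Set E3) : Set ι :=
  {i | IsUnknotted (L i) ∧ IsSplitComponent L i}

/-- The reduced bridge number: the bridge number minus the number of unknotted split components.
The subtraction does not truncate, see `encard_unknottedSplitComponents_le`. -/
noncomputable def reducedBridgeNumber {ι : Type*} (L : ι → Set E3) : ℕ∞ :=
  bridgeNumber L - (unknottedSplitComponents L).encard

theorem IsPolygon.isCompact {C : Set E3} (h : IsPolygon C) : IsCompact C := by
  obtain ⟨f, hf, rfl⟩ := h
  exact (isCompact_sphere 0 1).image_of_continuousOn hf.1.1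

theorem IsPolygon.nonempty {C : Set E3} (h : IsPolygon C) : C.Nonempty := by
  obtain ⟨f, hf, rfl⟩ := h
  exact ⟨_, Set.mem_image_of_mem f (show ((1 : ℝ), (0 : ℝ)) ∈ Metric.sphere 0 1 by
    simp [Prod.norm_def])⟩

theorem encard_unknottedSplitComponents_le {ι : Type*} [Finite ι] (L : ι → Set E3) :
    (unknottedSplitComponents L).encard ≤ bridgeNumber L := by
  refine le_iInf fun K => le_iInf fun hK => le_iInf fun _ => ?_
  have hmax : ∀ i, ∃ x ∈ K i, IsMaxOn (fun y : E3 => y 2) (K i) x := fun i =>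
    (hK.1 i).isCompact.exists_isMaxOn (hK.1 i).nonempty (by fun_prop)
  choose m hm hmm using hmax
  have hinj : Function.Injective m := by
    intro i j hij
    by_contra hne
    exact Set.disjoint_left.1 (hK.2 hne) (hm i) (hij ▸ hm j)
  have hloc : ∀ i, m i ∈ localMaxima (⋃ i, K i) := by
    intro i
    refine ⟨Set.mem_iUnion.2 ⟨i, hm i⟩, ?_⟩
    have hcl : IsClosed (⋃ j : {j // j ≠ i}, K j) :=
      isClosed_iUnion_of_finite fun j => (hK.1 j).isCompact.isClosed
    have hnot : m i ∈ (⋃ j : {j // j ≠ i}, K j)ᶜ := by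
      intro hmem
      obtain ⟨j, hj⟩ := Set.mem_iUnion.1 hmem
      exact Set.disjoint_left.1 (hK.2 j.2) hj (hm i)
    filter_upwards [mem_nhdsWithin_of_mem_nhds (hcl.isOpen_compl.mem_nhds hnot),
      self_mem_nhdsWithin] with y hy hyK
    obtain ⟨j, hj⟩ := Set.mem_iUnion.1 hyK
    by_cases hji : j = i
    · subst hji
      exact hmm j hj
    · exact absurd (Set.mem_iUnion.2 ⟨⟨j, hji⟩, hj⟩) hy
  calc (unknottedSplitComponents L).encard ≤ (Set.univ : Set ι).encard :=
        Set.encard_le_encard (Set.subset_univ _)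
    _ = (m '' Set.univ).encard := (hinj.encard_image _).symm
    _ ≤ _ := Set.encard_le_encard (by rintro _ ⟨i, -, rfl⟩; exact hloc i)

end LinkTheory

open LinkTheory

/-! Let `K` and `K'` be parallel, drawn in a regular projection with n crossings of `K` over `K'`.
It suffices to find a link isotopic to `K` with at most n local maxima, apart from one for each of
certain unknotted split components.

Straightening (`exists_straightening`). Put a steep, narrow trough just beneath every edge of `K'`
and let the new height of a point be its largest height over the troughs. This is a vertical shear.
It makes all of `K'` positive, and all of `K` negative except near the overcrossings. There a
straight strand of `K` crosses the troughs transversally, and its height decreases strictly away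
from the crossing. So `K` has at most n local maxima above the plane `z = 0`.

Cutting the annuli (`IsAnnulus.exists_curve`, `IsAnnulus.exists_flat_curve`). Triangulate each
annulus so that no triangle crosses the plane. Its outer boundary lies above the plane. Take the
upper region reaching the outer boundary, and then the region of its complement reaching the inner
boundary. The curve bounding the latter together with the hole is isotopic to the component of `K`,
and each of its edges lies either in the plane or in the part of `K` not below the plane. To prove
the isotopy, triangles are added one at a time in an order like an st-numbering (`st_induction`), so
that each new triangle meets the covered part in one or two edges. The Euler characteristic never
increases, and it is 0 both at the start and for the whole annulus. Hence it never drops, the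
frontier never touches itself, and each step slides an edge across a triangle (`moves_across_tri`)
or reverses such a slide.

Counting maxima (`bridgeNumber_le`, `flatComponents_subset`). Push the vertices in the plane down by
distinct small amounts that increase along paths starting at vertices above the plane. No new maxima
arise, except one on each component lying wholly in the plane. Such a component bounds a cone and
can be lowered away from the others, so it is unknotted and split. Subtracting these components
leaves at most n maxima.

The case n ≤ 1 (`isTrivialLink_of_flatCurves`). At most one component leaves the plane. It has a
single peak, and the part of `K` not below the plane lies on one straight strand before the shear,
so a horizontal linear form is injective on it. This allows the vertices of that component to be
removed one at a time by slides across triangles above the plane, until a triangle is left. The flat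
components, moved to different levels below, bound disks in disjoint slabs, so the link is trivial.
-/

namespace LinkTheory

/-! ### Piecewise linear maps -/

/-- Piecewise linearity for maps between arbitrary normed spaces. -/
def PLOn {X Y : Type*} [NormedAddCommGroup X] [NormedSpace ℝ X] [NormedAddCommGroup Y]
    [NormedSpace ℝ Y] (f : X → Y) (s : Set X) : Prop :=
  ContinuousOn f s ∧ ∃ G : Set (X →ᵃ[ℝ] Y), G.Finite ∧ ∀ x ∈ s, ∃ g ∈ G, f x = g x

section PL

variable {X Y Z : Type*} [NormedAddCommGroup X] [NormedSpace ℝ X] [NormedAddCommGroup Y]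
  [NormedSpace ℝ Y] [NormedAddCommGroup Z] [NormedSpace ℝ Z]

theorem PLOn.congr {f g : X → Y} {s : Set X} (h : PLOn f s) (hfg : Set.EqOn g f s) :
    PLOn g s := by
  obtain ⟨h1, G, hG, h2⟩ := h
  exact ⟨h1.congr hfg, G, hG, fun x hx => by rw [hfg hx]; exact h2 x hx⟩

theorem PLOn.comp {g : Y → Z} {f : X → Y} {s : Set X} {t : Set Y} (hg : PLOn g t)
    (hf : PLOn f s) (hst : Set.MapsTo f s t) : PLOn (g ∘ f) s := by
  obtain ⟨hg1, G, hG, hg2⟩ := hg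
  obtain ⟨hf1, F, hF, hf2⟩ := hf
  refine ⟨hg1.comp hf1 hst, Set.image2 (fun a b => a.comp b) G F, hG.image2 _ hF, ?_⟩
  intro x hx
  obtain ⟨b, hb, hbx⟩ := hf2 x hx
  obtain ⟨a, ha, hax⟩ := hg2 (f x) (hst hx)
  exact ⟨a.comp b, Set.mem_image2_of_mem ha hb, by simpa [hbx] using hbx ▸ hax⟩

theorem PLOn.of_affine [FiniteDimensional ℝ X] (g : X →ᵃ[ℝ] Y) (s : Set X) : PLOn g s :=
  ⟨g.continuous_of_finiteDimensional.continuousOn, {g}, Set.finite_singleton g,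
    fun _ _ => ⟨g, rfl, rfl⟩⟩

theorem PLOn.const [FiniteDimensional ℝ X] (c : Y) (s : Set X) : PLOn (fun _ => c) s :=
  PLOn.of_affine (AffineMap.const ℝ X c) s

theorem PLOn.add {f g : X → Y} {s : Set X} (hf : PLOn f s) (hg : PLOn g s) :
    PLOn (fun x => f x + g x) s := by
  obtain ⟨hf1, F, hF, hf2⟩ := hf
  obtain ⟨hg1, G, hG, hg2⟩ := hg
  refine ⟨hf1.add hg1, Set.image2 (fun a b => a + b) F G, hF.image2 _ hG, ?_⟩
  intro x hx
  obtain ⟨a, ha, hax⟩ := hf2 x hx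
  obtain ⟨b, hb, hbx⟩ := hg2 x hx
  exact ⟨a + b, Set.mem_image2_of_mem ha hb, by simp [hax, hbx]⟩

theorem PLOn.clm_comp [FiniteDimensional ℝ Y] {f : X → Y} {s : Set X} (A : Y →ₗ[ℝ] Z) (hf : PLOn f s) :
    PLOn (fun x => A (f x)) s :=
  PLOn.comp (PLOn.of_affine A.toAffineMap Set.univ) hf (Set.mapsTo_univ _ _)

theorem PLOn.const_mul {f : X → ℝ} {s : Set X} (c : ℝ) (hf : PLOn f s) :
    PLOn (fun x => c * f x) s := by
  simpa using hf.clm_comp (c • (LinearMap.id : ℝ →ₗ[ℝ] ℝ))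

theorem PLOn.smul_const {f : X → ℝ} {s : Set X} (hf : PLOn f s) (u : Y) :
    PLOn (fun x => f x • u) s := by
  simpa using hf.clm_comp (LinearMap.toSpanSingleton ℝ Y u)

theorem PLOn.max {f g : X → ℝ} {s : Set X} (hf : PLOn f s) (hg : PLOn g s) :
    PLOn (fun x => max (f x) (g x)) s := by
  obtain ⟨hf1, F, hF, hf2⟩ := hf
  obtain ⟨hg1, G, hG, hg2⟩ := hg
  refine ⟨hf1.sup hg1, F ∪ G, hF.union hG, ?_⟩
  intro x hx
  obtain ⟨a, ha, hax⟩ := hf2 x hx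
  obtain ⟨b, hb, hbx⟩ := hg2 x hx
  rcases max_choice (f x) (g x) with h | h
  · exact ⟨a, Or.inl ha, h.trans hax⟩
  · exact ⟨b, Or.inr hb, h.trans hbx⟩

theorem PLOn.neg {f : X → ℝ} {s : Set X} (hf : PLOn f s) : PLOn (fun x => - f x) s := by
  simpa using hf.const_mul (-1)

theorem PLOn.abs {f : X → ℝ} {s : Set X} (hf : PLOn f s) : PLOn (fun x => |f x|) s :=
  hf.max hf.neg

/-- The inverse of a piecewise linear homeomorphism is piecewise linear. -/
theorem PLOn.symm [FiniteDimensional ℝ X] {h : X ≃ₜ X} (hh : PLOn h Set.univ) :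
    PLOn h.symm Set.univ := by
  obtain ⟨-, G, hG, h2⟩ := hh
  refine ⟨h.symm.continuous.continuousOn, ?_⟩
  have hcl : ∀ g : X →ᵃ[ℝ] X, IsClosed {x | h x = g x} := fun g =>
    isClosed_eq h.continuous g.continuous_of_finiteDimensional
  have := hG.to_subtype
  have : CompleteSpace X := FiniteDimensional.complete ℝ X
  -- By Baire, the pieces with interior already cover a dense set, hence everything after taking
  -- closures. Only these pieces are used, since an affine map agreeing with `h` on a thin set need
  -- not be invertible.
  have hd : Dense (⋃ g : G, interior {x | h x = g.1 x}) :=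
    dense_iUnion_interior_of_closed (fun g => hcl g.1) (by
      ext x; simpa using h2 x trivial)
  have hcov : ∀ x, ∃ g ∈ G, (interior {x | h x = g x}).Nonempty ∧ h x = g x := by
    intro x
    have hx := hd x
    rw [closure_iUnion_of_finite] at hx
    obtain ⟨g, hg⟩ := Set.mem_iUnion.1 hx
    refine ⟨g.1, g.2, closure_nonempty_iff.1 ⟨x, hg⟩, ?_⟩
    exact closure_minimal interior_subset (hcl g.1) hg
  have hinv : ∀ g : X →ᵃ[ℝ] X, (interior {x | h x = g x}).Nonempty →
      ∃ g' : X →ᵃ[ℝ] X, ∀ x, g' (g x) = x := by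
    rintro g ⟨x, hx⟩
    have hinj : Function.Injective g := by
      rw [← AffineMap.linear_injective_iff]
      rw [← LinearMap.ker_eq_bot, LinearMap.ker_eq_bot']
      intro v hv
      -- If the linear part of `g` killed `v`, then `h` would be constant on a short segment in
      -- direction `v` inside the open set where it equals `g`.
      have hcont : Filter.Tendsto (fun t : ℝ => x + t • v) (𝓝[≠] 0) (𝓝 x) := by
        have : ContinuousAt (fun t : ℝ => x + t • v) 0 := by fun_prop
        simpa using (this.tendsto).mono_left nhdsWithin_le_nhds
      obtain ⟨t, ht, ht0⟩ := ((hcont.eventually (isOpen_interior.mem_nhds hx)).and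
        self_mem_nhdsWithin).exists
      have h1 : h (x + t • v) = g (x + t • v) :=
        interior_subset (s := {x | h x = g x}) ht
      have h3 : h x = g x := interior_subset (s := {x | h x = g x}) hx
      have h4 : g (x + t • v) = g x := by
        have := g.map_vadd x (t • v)
        simp only [vadd_eq_add, map_smul, hv, smul_zero, zero_add] at this
        rw [add_comm, this]
      have h5 := h.injective (h1.trans (h4.trans h3.symm))
      have ht0' : t ≠ 0 := ht0
      simpa [ht0'] using h5
    have hlin := g.linear_injective_iff.2 hinj
    obtain ⟨k, hk⟩ := LinearMap.exists_leftInverse_of_injective g.linear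
      (LinearMap.ker_eq_bot.2 hlin)
    refine ⟨k.toAffineMap.comp (AffineMap.id ℝ X - AffineMap.const ℝ X (g 0)) , fun x => ?_⟩
    have h6 : g x - g 0 = g.linear x := by
      have := g.linearMap_vsub x 0
      simpa using this.symm
    have h7 := LinearMap.congr_fun hk x
    simp only [LinearMap.comp_apply, LinearMap.id_apply] at h7
    show k (g x - g 0) = x
    rw [h6, h7]
  choose! inv hinv using hinv
  refine ⟨inv '' {g | g ∈ G}, hG.image _, ?_⟩
  intro y _
  obtain ⟨g, hg, hgi, hgx⟩ := hcov (h.symm y)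
  refine ⟨inv g, ⟨g, hg, rfl⟩, ?_⟩
  rw [← hinv g hgi (h.symm y), ← hgx, h.apply_symm_apply]

end PL

/-! ### Isotopies -/

theorem IsIsotopicToId.refl : IsIsotopicToId (Homeomorph.refl E3) :=
  ⟨fun _ => Homeomorph.refl E3, by simpa using continuous_snd, rfl, rfl⟩

theorem IsIsotopicToId.trans {h k : E3 ≃ₜ E3} (hh : IsIsotopicToId h) (hk : IsIsotopicToId k) :
    IsIsotopicToId (h.trans k) := by
  obtain ⟨H, Hc, H0, H1⟩ := hh
  obtain ⟨K, Kc, K0, K1⟩ := hk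
  refine ⟨fun t => (H t).trans (K t), ?_, ?_, ?_⟩
  · exact Kc.comp (continuous_fst.prodMk Hc)
  · simp only [H0, K0]; rfl
  · simp only [H1, K1]

/-- The isotopy run backwards starts at `h`. Precomposing it with the inverse of `h` makes it start
at the identity. -/
theorem IsIsotopicToId.symm {h : E3 ≃ₜ E3} (hh : IsIsotopicToId h) : IsIsotopicToId h.symm := by
  obtain ⟨H, Hc, H0, H1⟩ := hh
  refine ⟨fun t => h.symm.trans (H (unitInterval.symm t)), ?_, ?_, ?_⟩
  · exact Hc.comp ((unitInterval.continuous_symm.comp continuous_fst).prodMk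
      (h.symm.continuous.comp continuous_snd))
  · ext1 x; simp [H1]
  · ext1 x; simp [H0]

theorem Isotopic.trans {ι : Type*} {L K M : ι → Set E3} (h : Isotopic L K) (k : Isotopic K M) :
    Isotopic L M := by
  obtain ⟨f, hf, hf'⟩ := h
  obtain ⟨g, hg, hg'⟩ := k
  refine ⟨f.trans g, hf.trans hg, fun i => ?_⟩
  rw [← hg' i, ← hf' i, Set.image_image]; rfl

/-- A piecewise linear isotopy that is fixed on `Z` at the end carries `X` to `Y`. -/
def Moves (Z X Y : Set E3) : Prop :=
  ∃ h : E3 ≃ₜ E3, IsIsotopicToId h ∧ PLOn h Set.univ ∧ Set.EqOn h id Z ∧ h '' X = Y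

theorem PLOn.trans {X : Type*} [NormedAddCommGroup X] [NormedSpace ℝ X] {h k : X ≃ₜ X}
    (hh : PLOn h Set.univ) (hk : PLOn k Set.univ) : PLOn (h.trans k) Set.univ :=
  PLOn.comp (g := k) (f := h) hk hh (Set.mapsTo_univ _ _)

theorem Moves.refl (Z X : Set E3) : Moves Z X X :=
  ⟨Homeomorph.refl E3, IsIsotopicToId.refl, PLOn.of_affine (AffineMap.id ℝ E3) _,
    fun _ _ => rfl, by simp⟩

theorem Moves.symm {Z X Y : Set E3} (h : Moves Z X Y) : Moves Z Y X := by
  obtain ⟨f, hf, hpl, hfix, rfl⟩ := h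
  refine ⟨f.symm, hf.symm, hpl.symm, fun x hx => ?_, ?_⟩
  · rw [f.symm_apply_eq]; exact (hfix hx).symm
  · rw [Set.image_image]; simp

theorem Moves.trans {Z X Y W : Set E3} (h : Moves Z X Y) (k : Moves Z Y W) : Moves Z X W := by
  obtain ⟨f, hf, hpl, hfix, rfl⟩ := h
  obtain ⟨g, hg, hpl', hfix', rfl⟩ := k
  refine ⟨f.trans g, hf.trans hg, hpl.trans hpl', fun x hx => ?_, ?_⟩
  · have h1 : f x = x := hfix hx
    have h2 : g x = x := hfix' hx
    simp [h1, h2]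
  · rw [Set.image_image]; rfl

/-! ### Shears -/

/-- The condition on `θ` under which `x ↦ x + θ x • u` is a homeomorphism, monotone on the lines
in direction `u`. -/
def IsShear (u : E3) (θ : E3 → ℝ) : Prop :=
  Continuous θ ∧ ∃ κ : ℝ, 0 < κ ∧ κ ≤ 1 ∧ ∀ x s, 0 ≤ s → θ x - (1 - κ) * s ≤ θ (x + s • u)

theorem IsShear.const_mul {u : E3} {θ : E3 → ℝ} (h : IsShear u θ) {t : ℝ} (h0 : 0 ≤ t)
    (h1 : t ≤ 1) : IsShear u (fun x => t * θ x) := by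
  obtain ⟨hc, κ, hκ, hκ1, hs⟩ := h
  refine ⟨by fun_prop, κ, hκ, hκ1, fun x s hs0 => ?_⟩
  have := mul_le_mul_of_nonneg_left (hs x s hs0) h0
  have h2 : 0 ≤ (1 - κ) * s := mul_nonneg (by linarith) hs0
  nlinarith

/-- Every line in direction `u` is preserved, and on it the map has slope at least `κ`, so it is
bijective. The preimage of `y` is `y + s y • u`, where `s y` is the root of `r y`. The slope bound
also gives `|s y' - s y| ≤ |r y' (s y)| / κ`, whence `s` is continuous. -/
theorem IsShear.exists_homeomorph {u : E3} {θ : E3 → ℝ} (h : IsShear u θ) :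
    ∃ f : E3 ≃ₜ E3, ∀ x, f x = x + θ x • u := by
  obtain ⟨hc, κ, hκ, hκ1, hs⟩ := h
  set r : E3 → ℝ → ℝ := fun y s => s + θ (y + s • u) with hr
  have hmono : ∀ y s s', s ≤ s' → κ * (s' - s) ≤ r y s' - r y s := by
    intro y s s' hss
    have := hs (y + s • u) (s' - s) (by linarith)
    have e : y + s • u + (s' - s) • u = y + s' • u := by module
    rw [e] at this
    simp only [hr]; linarith
  have hrc : ∀ y, Continuous (r y) := fun y => by simp only [hr]; fun_prop
  have hroot : ∀ y, ∃ s, r y s = 0 := by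
    intro y
    have hlo : r y (-(|r y 0| / κ)) ≤ 0 := by
      have := hmono y (-(|r y 0| / κ)) 0 (by have := div_nonneg (abs_nonneg (r y 0)) hκ.le; linarith)
      have e : κ * (0 - -(|r y 0| / κ)) = |r y 0| := by field_simp; ring
      rw [e] at this
      linarith [le_abs_self (r y 0)]
    have hhi : 0 ≤ r y (|r y 0| / κ) := by
      have := hmono y 0 (|r y 0| / κ) (div_nonneg (abs_nonneg (r y 0)) hκ.le)
      have e : κ * (|r y 0| / κ - 0) = |r y 0| := by field_simp; ring
      rw [e] at this
      linarith [neg_abs_le (r y 0)]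
    obtain ⟨s, hs'⟩ := mem_range_of_exists_le_of_exists_ge (hrc y) ⟨_, hlo⟩ ⟨_, hhi⟩
    exact ⟨s, hs'⟩
  choose s hs0 using hroot
  have huniq : ∀ y a, r y a = 0 → a = s y := by
    intro y a ha
    rcases le_total a (s y) with h | h
    · have := hmono y _ _ h
      rw [ha, hs0] at this
      nlinarith
    · have := hmono y _ _ h
      rw [ha, hs0] at this
      nlinarith
  have hsc : Continuous s := by
    rw [continuous_iff_continuousAt]
    intro y
    rw [ContinuousAt, tendsto_iff_dist_tendsto_zero]
    have hlim : Filter.Tendsto (fun y' => |r y' (s y)| / κ) (𝓝 y) (𝓝 0) := by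
      have hc' : Continuous (fun y' => |r y' (s y)| / κ) := by simp only [hr]; fun_prop
      have := hc'.tendsto y
      rwa [hs0, abs_zero, zero_div] at this
    refine squeeze_zero (fun _ => dist_nonneg) (fun y' => ?_) hlim
    rw [le_div_iff₀ hκ, Real.dist_eq]
    rcases le_total (s y') (s y) with h | h
    · have := hmono y' _ _ h
      rw [hs0] at this
      rw [abs_of_nonpos (by linarith)]
      linarith [le_abs_self (r y' (s y))]
    · have := hmono y' _ _ h
      rw [hs0] at this
      rw [abs_of_nonneg (by linarith)]
      linarith [neg_abs_le (r y' (s y))]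
  refine ⟨{ toFun := fun x => x + θ x • u
            invFun := fun y => y + s y • u
            left_inv := fun x => ?_
            right_inv := fun y => ?_
            continuous_toFun := by fun_prop
            continuous_invFun := by fun_prop }, fun x => rfl⟩
  · have : s (x + θ x • u) = - θ x := by
      symm; apply huniq
      have e : x + θ x • u + (-θ x) • u = x := by module
      simp only [hr, e]; ring
    show x + θ x • u + s (x + θ x • u) • u = x
    rw [this]; module
  · have h1 : s y + θ (y + s y • u) = 0 := hs0 y
    have h2 : θ (y + s y • u) = - s y := by linarith
    show y + s y • u + θ (y + s y • u) • u = y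
    rw [h2]; module

/-- The shears with displacement `t * θ`, for `t` between 0 and 1, form the isotopy. -/
theorem IsShear.exists_isotopy {u : E3} {θ : E3 → ℝ} (h : IsShear u θ) :
    ∃ f : E3 ≃ₜ E3, IsIsotopicToId f ∧ ∀ x, f x = x + θ x • u := by
  have hθ := h.1
  choose F hF using fun t : unitInterval =>
    (h.const_mul t.2.1 t.2.2).exists_homeomorph
  refine ⟨F 1, ⟨F, ?_, ?_, rfl⟩, fun x => ?_⟩
  · simp only [hF]; fun_prop
  · ext1 x; simp [hF]
  · simp [hF]

theorem PLOn.shear {u : E3} {θ : E3 → ℝ} (hθ : PLOn θ Set.univ) {f : E3 ≃ₜ E3}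
    (hf : ∀ x, f x = x + θ x • u) : PLOn f Set.univ :=
  ((PLOn.of_affine (AffineMap.id ℝ E3) Set.univ).add (hθ.smul_const u)).congr
    (fun x _ => by simp [hf])

end LinkTheory

namespace LinkTheory

/-! ### Moving an edge of a polygon across a triangle -/

/-- The plane of the triangle will be `r = 0`, with `p` and `q` as coordinates in it. -/
theorem exists_dual_coords {e u : E3} (h : LinearIndependent ℝ ![e, u]) :
    ∃ p q r : E3 →ₗ[ℝ] ℝ, (p e = 1 ∧ q e = 0 ∧ r e = 0) ∧ (p u = 0 ∧ q u = 1 ∧ r u = 0) ∧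
      ∀ x, r x = 0 → x = p x • e + q x • u := by
  obtain ⟨w, hw⟩ := exists_linearIndependent_snoc_of_lt_finrank h (by simp)
  let B := basisOfLinearIndependentOfCardEqFinrank hw (by simp)
  have hB : ⇑B = Fin.snoc ![e, u] w := coe_basisOfLinearIndependentOfCardEqFinrank hw (by simp)
  have h0 : B 0 = e := by rw [hB]; rfl
  have h1 : B 1 = u := by rw [hB]; rfl
  refine ⟨B.coord 0, B.coord 1, B.coord 2, ?_, ?_, fun x hx => ?_⟩
  · rw [← h0]; simp
  · rw [← h1]; simp
  · have := B.sum_repr x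
    rw [Fin.sum_univ_three, h0, h1] at this
    simp only [Module.Basis.coord_apply] at hx ⊢
    rw [hx, zero_smul, add_zero] at this
    exact this.symm

/-- A thin double wedge around a triangle, as the unit ball of a gauge. -/
noncomputable def wedge (p q r : E3 →ₗ[ℝ] ℝ) (ε : ℝ) (x : E3) : ℝ :=
  |p x| + max (q x / (1 + ε)) (-q x / ε) + |r x| / ε

section wedge

variable {p q r : E3 →ₗ[ℝ] ℝ}

theorem max_wedge_nonneg (a : ℝ) {ε : ℝ} (hε : 0 < ε) : 0 ≤ max (a / (1 + ε)) (-a / ε) := by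
  rcases le_total 0 a with h | h
  · exact le_max_of_le_left (by positivity)
  · exact le_max_of_le_right (div_nonneg (by linarith) hε.le)

/-- Shrinking `ε` enlarges the gauge, so bounds obtained for separate values of `ε` hold together
for the smallest one. -/
theorem wedge_anti {ε ε' : ℝ} (hε : 0 < ε) (h : ε ≤ ε') (a c : ℝ) :
    max (a / (1 + ε')) (-a / ε') + |c| / ε' ≤ max (a / (1 + ε)) (-a / ε) + |c| / ε := by
  have hε' : 0 < ε' := hε.trans_le h
  have h3 : |c| / ε' ≤ |c| / ε := div_le_div_of_nonneg_left (abs_nonneg c) hε h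
  refine add_le_add ?_ h3
  rcases le_total 0 a with ha | ha
  · refine max_le (le_max_of_le_left ?_) (le_trans ?_ (max_wedge_nonneg a hε))
    · exact div_le_div_of_nonneg_left ha (by linarith) (by linarith)
    · exact div_nonpos_of_nonpos_of_nonneg (by linarith) hε'.le
  · refine max_le (le_trans ?_ (max_wedge_nonneg a hε)) (le_max_of_le_right ?_)
    · exact div_nonpos_of_nonpos_of_nonneg ha (by linarith)
    · exact div_le_div_of_nonneg_left (by linarith) hε h

/-- As `ε` tends to 0 the gauge terms tend to infinity unless `R = 0` and `0 ≤ Q`, when they tend to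
`Q`. The hypothesis handles this remaining case. The lemma serves both for points off the triangle
and for directions leaving one of its corners. -/
theorem exists_wedge_nonneg {P Q R : ℝ} (h : R = 0 → 0 ≤ Q → ¬ Q ≤ P) :
    ∃ ε₀ > 0, ∀ ε, 0 < ε → ε ≤ ε₀ →
      0 ≤ -P + max (Q / (1 + ε)) (-Q / ε) + |R| / ε := by
  suffices ∃ ε₀ > 0, 0 ≤ -P + max (Q / (1 + ε₀)) (-Q / ε₀) + |R| / ε₀ by
    obtain ⟨ε₀, h0, h1⟩ := this
    refine ⟨ε₀, h0, fun ε hε hle => ?_⟩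
    have := wedge_anti hε hle Q R
    linarith
  by_cases hR : R = 0
  · by_cases hQ : 0 ≤ Q
    · have hPQ := lt_of_not_ge (h hR hQ)
      rcases le_or_gt P 0 with hP | hP
      · refine ⟨1, one_pos, ?_⟩
        have := max_wedge_nonneg Q one_pos
        have := div_nonneg (abs_nonneg R) zero_le_one
        linarith
      · refine ⟨(Q - P) / P, div_pos (by linarith) hP, ?_⟩
        have e : Q / (1 + (Q - P) / P) = P := by
          have : 1 + (Q - P) / P = Q / P := by field_simp; ring
          rw [this]
          have : Q ≠ 0 := by linarith
          field_simp
        have := le_max_left (Q / (1 + (Q - P) / P)) (-Q / ((Q - P) / P))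
        rw [e] at this
        rw [hR, abs_zero, zero_div, e]
        linarith
    · have hQ := lt_of_not_ge hQ
      refine ⟨-Q / (|P| + 1), div_pos (by linarith) (by positivity), ?_⟩
      have e : -Q / (-Q / (|P| + 1)) = |P| + 1 := by
        have : Q ≠ 0 := by linarith
        field_simp
      have := le_max_right (Q / (1 + -Q / (|P| + 1))) (-Q / (-Q / (|P| + 1)))
      rw [e] at this ⊢
      rw [hR, abs_zero, zero_div]
      linarith [le_abs_self P]
  · have hR' : 0 < |R| := abs_pos.2 hR
    refine ⟨|R| / (|P| + 1), by positivity, ?_⟩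
    have e : |R| / (|R| / (|P| + 1)) = |P| + 1 := by field_simp
    have := max_wedge_nonneg Q (show 0 < |R| / (|P| + 1) by positivity)
    rw [e]
    linarith [le_abs_self P]

theorem wedge_continuous (ε : ℝ) : Continuous (wedge p q r ε) := by
  have h1 : Continuous p := p.continuous_of_finiteDimensional
  have h2 : Continuous q := q.continuous_of_finiteDimensional
  have h3 : Continuous r := r.continuous_of_finiteDimensional
  unfold wedge
  fun_prop

/-- The growth rate `1 / (1 + ε)` is less than one. This makes the bump `max 0 (1 - wedge)` an
admissible displacement in direction `u`. -/
theorem wedge_add_smul {u : E3} (hp : p u = 0) (hq : q u = 1) (hr : r u = 0) {ε : ℝ}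
    (hε : 0 < ε) (x : E3) {s : ℝ} (hs : 0 ≤ s) :
    wedge p q r ε (x + s • u) ≤ wedge p q r ε x + s / (1 + ε) := by
  simp only [wedge, map_add, map_smul, hp, hq, hr, smul_eq_mul, mul_zero, add_zero, mul_one]
  have : max ((q x + s) / (1 + ε)) (-(q x + s) / ε) ≤
      max (q x / (1 + ε)) (-q x / ε) + s / (1 + ε) := by
    refine max_le ?_ ?_
    · rw [add_div]
      gcongr
      exact le_max_left _ _
    · have h1 : -(q x + s) / ε ≤ -q x / ε := by gcongr; linarith
      have h2 : 0 ≤ s / (1 + ε) := by positivity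
      have := le_max_right (q x / (1 + ε)) (-q x / ε)
      linarith
  linarith

theorem wedge_plOn (ε : ℝ) : PLOn (wedge p q r ε) Set.univ := by
  have hp := PLOn.of_affine p.toAffineMap Set.univ
  have hq := PLOn.of_affine q.toAffineMap Set.univ
  have hr := PLOn.of_affine r.toAffineMap Set.univ
  refine ((hp.abs.add ((hq.const_mul (1 + ε)⁻¹).max (hq.const_mul (-ε⁻¹)))).add
    (hr.abs.const_mul ε⁻¹)).congr fun x _ => ?_
  simp only [wedge, LinearMap.coe_toAffineMap]
  ring_nf

end wedge

/-- The triangle with the given corners. -/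
def tri (a b c : E3) : Set E3 := convexHull ℝ {a, b, c}

theorem mem_tri_of_coords {m e u x : E3} {P Q : ℝ} (hQ : 0 ≤ Q) (hPQ : |P| + Q ≤ 1)
    (hx : x = m + (P • e + Q • u)) : x ∈ tri (m - e) (m + e) (m + u) := by
  have h1 := abs_le.1 (show |P| ≤ 1 - Q by linarith)
  rw [tri, convexHull_insert (by simp), convexHull_pair, mem_convexJoin]
  rw [hx]
  have key : m + (P • e + Q • u) =
      ((1 - Q - P) / 2) • (m - e) + (((1 - Q + P) / 2) • (m + e) + Q • (m + u)) := by
    module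
  rcases eq_or_lt_of_le (show (1 - Q - P) / 2 ≤ 1 by linarith) with h | h
  · refine ⟨m - e, rfl, m + e, left_mem_segment _ _ _, ?_⟩
    have hQ0 : Q = 0 := by linarith
    have hP : P = -1 := by linarith
    rw [hQ0, hP]
    convert left_mem_segment ℝ (m - e) (m + e) using 1
    module
  · have hpos : 0 < 1 - (1 - Q - P) / 2 := by linarith
    refine ⟨m - e, rfl, (((1 - Q + P) / 2) / (1 - (1 - Q - P) / 2)) • (m + e) +
      (Q / (1 - (1 - Q - P) / 2)) • (m + u), ⟨_, _, ?_, ?_, ?_, rfl⟩, ?_⟩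
    · apply div_nonneg <;> linarith
    · apply div_nonneg <;> linarith
    · rw [← add_div, div_eq_one_iff_eq hpos.ne']; ring
    · refine ⟨(1 - Q - P) / 2, 1 - (1 - Q - P) / 2, by linarith, by linarith, by ring, ?_⟩
      rw [key, smul_add, smul_smul, smul_smul, mul_div_cancel₀ _ hpos.ne',
        mul_div_cancel₀ _ hpos.ne']

/-- Let `m` be the midpoint of `ab` and `u = c - m`. The displacement `max 0 (1 - wedge)` along `u`
equals `1 - |t|` at `m + t • e`, so it lifts `ab` to the path from `a` to `c` to `b`. It vanishes
outside a double wedge that shrinks to the triangle with `ε`. The set `Z₀` leaves the wedge by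
compactness. The segments at `a` and `b` touch the wedge at their endpoints for every `ε`, and are
treated by a condition on their directions. -/
theorem moves_across_tri {a b c : E3} (hind : LinearIndependent ℝ ![b - a, c - a]) {Z₀ : Set E3}
    (hZ₀ : IsCompact Z₀) (hdisj : Disjoint Z₀ (tri a b c)) {Qa Qb : Set E3} (hQa : Qa.Finite)
    (hQb : Qb.Finite) (hQa' : ∀ y ∈ Qa, segment ℝ a y ∩ tri a b c ⊆ {a})
    (hQb' : ∀ y ∈ Qb, segment ℝ b y ∩ tri a b c ⊆ {b}) :
    Moves (Z₀ ∪ (⋃ y ∈ Qa, segment ℝ a y) ∪ (⋃ y ∈ Qb, segment ℝ b y)) (segment ℝ a b)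
      (segment ℝ a c ∪ segment ℝ c b) := by
  set m : E3 := (1 / 2 : ℝ) • (a + b) with hm
  set e : E3 := (1 / 2 : ℝ) • (b - a) with he
  set u : E3 := c - m with hu
  have ha : a = m - e := by rw [hm, he]; module
  have hb : b = m + e := by rw [hm, he]; module
  have hc : c = m + u := by rw [hu]; module
  have hind' : LinearIndependent ℝ ![e, u] := by
    rw [LinearIndependent.pair_iff] at hind ⊢
    intro s t hst
    have h1 : (s / 2 - t / 2) • (b - a) + t • (c - a) = 0 := by
      rw [← hst, hu, he, hm]; module
    obtain ⟨h2, h3⟩ := hind _ _ h1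
    exact ⟨by linarith, h3⟩
  obtain ⟨p, q, r, ⟨pe, qe, re⟩, ⟨pu, qu, ru⟩, hspan⟩ := exists_dual_coords hind'
  have htri : ∀ x, r (x - m) = 0 → 0 ≤ q (x - m) → |p (x - m)| + q (x - m) ≤ 1 →
      x ∈ tri a b c := by
    intro x h1 h2 h3
    rw [ha, hb, hc]
    refine mem_tri_of_coords h2 h3 ?_
    rw [← hspan _ h1]; module
  have hout : ∀ x, x ∉ tri a b c → ∃ ε₀ > 0, ∀ ε, 0 < ε → ε ≤ ε₀ →
      1 < wedge p q r ε (x - m) := by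
    intro x hx
    -- The slack `δ` turns the weak inequality of `exists_wedge_nonneg` into a strict one.
    have : ∃ δ > 0, (r (x - m) = 0 → 0 ≤ q (x - m) → ¬ q (x - m) ≤ (1 + δ) - |p (x - m)|) := by
      by_cases h : r (x - m) = 0 ∧ 0 ≤ q (x - m)
      · have h2 : 1 < |p (x - m)| + q (x - m) := by
          by_contra hcon
          exact hx (htri x h.1 h.2 (not_lt.1 hcon))
        refine ⟨(|p (x - m)| + q (x - m) - 1) / 2, by linarith, fun _ _ => ?_⟩
        linarith
      · exact ⟨1, one_pos, fun h1 h2 => absurd ⟨h1, h2⟩ h⟩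
    obtain ⟨δ, hδ, hδ'⟩ := this
    obtain ⟨ε₀, h0, h1⟩ := exists_wedge_nonneg hδ'
    refine ⟨ε₀, h0, fun ε hε hle => ?_⟩
    have := h1 ε hε hle
    simp only [wedge]
    linarith
  have hcompact : ∃ ε₀ > 0, ∀ ε, 0 < ε → ε ≤ ε₀ → ∀ x ∈ Z₀, 1 < wedge p q r ε (x - m) := by
    obtain ⟨n, hn⟩ := hZ₀.elim_directed_cover
      (fun n : ℕ => {x | 1 < wedge p q r (1 / (n + 1 : ℝ)) (x - m)})
      (fun n => isOpen_lt continuous_const ((wedge_continuous _).comp (by fun_prop)))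
      (by
        intro x hx
        obtain ⟨ε₀, h0, h1⟩ := hout x (Set.disjoint_left.1 hdisj hx)
        obtain ⟨n, hn⟩ := exists_nat_one_div_lt h0
        exact Set.mem_iUnion.2 ⟨n, h1 _ (by positivity) hn.le⟩)
      (by
        refine Monotone.directed_le fun n k hnk x hx => ?_
        simp only [Set.mem_ofPred_eq, wedge] at hx ⊢
        have := wedge_anti (ε := 1 / (k + 1 : ℝ)) (ε' := 1 / (n + 1 : ℝ)) (by positivity)
          (by gcongr) (q (x - m)) (r (x - m))
        linarith)
    refine ⟨1 / (n + 1 : ℝ), by positivity, fun ε hε hle x hx => ?_⟩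
    have h1 : 1 < wedge p q r (1 / (n + 1 : ℝ)) (x - m) := hn hx
    have := wedge_anti hε hle (q (x - m)) (r (x - m))
    simp only [wedge] at h1 ⊢
    linarith
  have hsegment : ∀ σ : ℝ, |σ| = 1 → ∀ y, segment ℝ (m + σ • e) y ∩ tri a b c ⊆ {m + σ • e} →
      ∃ ε₀ > 0, ∀ ε, 0 < ε → ε ≤ ε₀ →
        ∀ x ∈ segment ℝ (m + σ • e) y, 1 ≤ wedge p q r ε (x - m) := by
    intro σ hσ y hy
    have hσ2 : σ * σ = 1 := by rw [← abs_mul_abs_self, hσ, one_mul]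
    set v : E3 := y - (m + σ • e) with hv
    by_cases hv0 : v = 0
    · refine ⟨1, one_pos, fun ε hε _ x hx => ?_⟩
      rw [show y = m + σ • e from sub_eq_zero.1 hv0, segment_same] at hx
      rw [hx]
      simp [wedge, pe, qe, re, hσ]
    -- A direction violating this would point into the triangle. The `s` chosen here is small enough
    -- to stay on the segment and on the near side of the line through `m` and `c`, so the segment
    -- would meet the triangle in a second point.
    have hcone : r v = 0 → 0 ≤ q v → ¬ q v ≤ - σ * p v := by
      intro h1 h2 h3
      have hnn : 0 ≤ - σ * p v := h2.trans h3
      set s : ℝ := 1 / (-σ * p v + 1) with hs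
      have hs0 : 0 < s := by positivity
      have hs1 : s ≤ 1 := by
        rw [hs, div_le_one (by positivity)]; linarith
      have hsp : s * (- σ * p v) ≤ 1 := by
        rw [hs, div_mul_eq_mul_div, one_mul, div_le_one (by positivity)]; linarith
      have hmem : m + σ • e + s • v ∈ segment ℝ (m + σ • e) y :=
        ⟨1 - s, s, by linarith, hs0.le, by ring, by rw [hv]; module⟩
      have e1 : m + σ • e + s • v - m = σ • e + s • v := by module
      have hin : m + σ • e + s • v ∈ tri a b c := by
        apply htri <;> rw [e1] <;> simp only [map_add, map_smul, smul_eq_mul, pe, qe, re, h1]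
        · ring
        · have := mul_nonneg hs0.le h2; linarith
        · have e2 : |σ * 1 + s * p v| = 1 - s * (-σ * p v) := by
            have : σ * 1 + s * p v = σ * (1 - s * (-σ * p v)) := by
              have : σ * (1 - s * (-σ * p v)) = σ + s * (σ * σ) * p v := by ring
              rw [this, hσ2]; ring
            rw [this, abs_mul, hσ, one_mul, abs_of_nonneg (by linarith)]
          rw [e2]
          have := mul_le_mul_of_nonneg_left h3 hs0.le
          linarith
      have h4 : m + σ • e + s • v = m + σ • e := hy ⟨hmem, hin⟩
      have h5 : s • v = 0 := by simpa using h4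
      rcases smul_eq_zero.1 h5 with h6 | h6
      · exact hs0.ne' h6
      · exact hv0 h6
    -- The lower bound for the gauge at `m + σ • e + s • v` is 1 plus a nonnegative multiple of `s`,
    -- so one condition on `v` settles the whole segment.
    obtain ⟨ε₀, h0, h1⟩ := exists_wedge_nonneg hcone
    refine ⟨ε₀, h0, fun ε hε hle x hx => ?_⟩
    obtain ⟨s, hs, hx⟩ : ∃ s : ℝ, 0 ≤ s ∧ x = m + (σ • e + s • v) := by
      obtain ⟨s, t, hs, ht, hst, rfl⟩ := hx
      refine ⟨t, ht, ?_⟩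
      rw [show s = 1 - t by linarith, hv]; module
    have h2 := mul_nonneg hs (h1 ε hε hle)
    have hmax : max (s * q v / (1 + ε)) (-(s * q v) / ε) =
        s * max (q v / (1 + ε)) (-q v / ε) := by
      rw [mul_max_of_nonneg _ _ hs]; congr 1 <;> ring
    have habs : σ * (σ * 1 + s * p v) ≤ |σ * 1 + s * p v| := by
      refine (le_abs_self _).trans ?_
      rw [abs_mul, hσ, one_mul]
    have e3 : x - m = σ • e + s • v := by rw [hx]; module
    rw [e3]
    simp only [wedge, map_add, map_smul, smul_eq_mul, pe, qe, re, mul_zero, zero_add]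
    rw [hmax, abs_mul s, abs_of_nonneg hs, mul_div_assoc]
    have e4 : σ * (σ * 1 + s * p v) = 1 + s * (σ * p v) := by
      rw [mul_add, mul_one, hσ2]; ring
    nlinarith
  have hεex : ∃ ε > 0, (∀ x ∈ Z₀, 1 < wedge p q r ε (x - m)) ∧
      (∀ y ∈ Qa, ∀ x ∈ segment ℝ a y, 1 ≤ wedge p q r ε (x - m)) ∧
      (∀ y ∈ Qb, ∀ x ∈ segment ℝ b y, 1 ≤ wedge p q r ε (x - m)) := by
    have ev : ∀ {P : ℝ → Prop}, (∃ ε₀ > 0, ∀ ε, 0 < ε → ε ≤ ε₀ → P ε) →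
        ∀ᶠ ε in 𝓝[>] (0 : ℝ), P ε := by
      rintro P ⟨ε₀, h0, h1⟩
      filter_upwards [Ioc_mem_nhdsGT h0] with ε hε using h1 ε hε.1 hε.2
    have e1 := ev hcompact
    have e2 : ∀ᶠ ε in 𝓝[>] (0 : ℝ), ∀ y ∈ Qa, ∀ x ∈ segment ℝ a y,
        1 ≤ wedge p q r ε (x - m) := by
      refine (Filter.eventually_all_finite hQa).2 fun y hy => ?_
      have e5 : a = m + (-1 : ℝ) • e := by rw [ha]; module
      have h1 := hQa' y hy
      have := ev (hsegment (-1) (by simp) y (by rw [← e5]; exact h1))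
      rwa [← e5] at this
    have e3 : ∀ᶠ ε in 𝓝[>] (0 : ℝ), ∀ y ∈ Qb, ∀ x ∈ segment ℝ b y,
        1 ≤ wedge p q r ε (x - m) := by
      refine (Filter.eventually_all_finite hQb).2 fun y hy => ?_
      have e5 : b = m + (1 : ℝ) • e := by rw [hb]; module
      have h1 := hQb' y hy
      have := ev (hsegment 1 (by simp) y (by rw [← e5]; exact h1))
      rwa [← e5] at this
    obtain ⟨ε, ⟨⟨h1, h2⟩, h3⟩, h4⟩ := (((e1.and e2).and e3).and self_mem_nhdsWithin).exists
    exact ⟨ε, h4, h1, h2, h3⟩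
  obtain ⟨ε, hε, hεZ, hεa, hεb⟩ := hεex
  set θ : E3 → ℝ := fun x => max 0 (1 - wedge p q r ε (x - m)) with hθ
  have hshear : IsShear u θ := by
    refine ⟨?_, 1 - 1 / (1 + ε), ?_, ?_, ?_⟩
    · have := (wedge_continuous (p := p) (q := q) (r := r) ε).comp
        (show Continuous fun x : E3 => x - m by fun_prop)
      exact continuous_const.max (continuous_const.sub this)
    · rw [sub_pos, div_lt_one (by linarith)]; linarith
    · have : 0 ≤ 1 / (1 + ε) := by positivity
      linarith
    · intro x s hs
      have h1 := wedge_add_smul pu qu ru hε (x - m) hs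
      have e1 : x + s • u - m = x - m + s • u := by module
      have h2 : 0 ≤ s / (1 + ε) := by positivity
      simp only [hθ, e1]
      rw [show (1 - (1 - 1 / (1 + ε))) * s = s / (1 + ε) by ring, sub_le_iff_le_add]
      refine max_le ?_ ?_
      · exact add_nonneg (le_max_left _ _) h2
      · have := le_max_right 0 (1 - wedge p q r ε (x - m + s • u))
        linarith
  have hpl : PLOn θ Set.univ := by
    refine PLOn.max (PLOn.const 0 _) ?_
    have h1 : PLOn (fun x : E3 => wedge p q r ε (x - m)) Set.univ :=
      PLOn.comp (wedge_plOn ε) (PLOn.of_affine (AffineMap.id ℝ E3 - AffineMap.const ℝ E3 m) _)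
        (Set.mapsTo_univ _ _)
    simpa [sub_eq_add_neg] using (PLOn.const (1 : ℝ) Set.univ).add h1.neg
  obtain ⟨f, hf, hfx⟩ := hshear.exists_isotopy
  have hfix : ∀ x, 1 ≤ wedge p q r ε (x - m) → f x = x := by
    intro x hx
    rw [hfx, hθ]
    simp only
    rw [max_eq_left (by linarith)]; simp
  refine ⟨f, hf, PLOn.shear hpl hfx, ?_, ?_⟩
  · rintro x ((hx | hx) | hx)
    · exact hfix x (hεZ x hx).le
    · obtain ⟨y, hy, hx⟩ := Set.mem_iUnion₂.1 hx
      exact hfix x (hεa y hy x hx)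
    · obtain ⟨y, hy, hx⟩ := Set.mem_iUnion₂.1 hx
      exact hfix x (hεb y hy x hx)
  · have hft : ∀ t : ℝ, |t| ≤ 1 → f (m + t • e) = m + t • e + (1 - |t|) • u := by
      intro t ht
      rw [hfx, hθ]
      have e1 : m + t • e - m = t • e := by module
      simp only [e1, wedge, map_smul, pe, qe, re, smul_eq_mul, mul_zero, mul_one]
      simp only [zero_div, neg_zero, max_self, abs_zero, add_zero]
      rw [max_eq_right (by linarith)]
    ext x
    constructor
    · rintro ⟨_, ⟨s, t, hs, ht, hst, rfl⟩, rfl⟩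
      have e1 : s • a + t • b = m + (t - s) • e := by
        rw [ha, hb]
        have : s = 1 - t := by linarith
        rw [this]; module
      have habs : |t - s| ≤ 1 := abs_le.2 ⟨by linarith, by linarith⟩
      rw [e1, hft _ habs]
      rcases le_total t s with h | h
      · left
        refine ⟨s - t, 1 - (s - t), by linarith, by linarith, by ring, ?_⟩
        rw [abs_of_nonpos (by linarith), ha, hc]
        module
      · right
        refine ⟨1 - (t - s), t - s, by linarith, by linarith, by ring, ?_⟩
        rw [abs_of_nonneg (by linarith), hb, hc]
        module
    · have hmemseg : ∀ t : ℝ, |t| ≤ 1 → m + t • e ∈ segment ℝ a b := by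
        intro t ht
        have := abs_le.1 ht
        refine ⟨(1 - t) / 2, (1 + t) / 2, by linarith, by linarith, by ring, ?_⟩
        rw [ha, hb]; module
      rintro (⟨s, t, hs, ht, hst, rfl⟩ | ⟨s, t, hs, ht, hst, rfl⟩)
      · have h1 : |-s| ≤ 1 := abs_le.2 ⟨by linarith, by linarith⟩
        refine ⟨m + (-s) • e, hmemseg _ h1, ?_⟩
        rw [hft _ h1, abs_neg, abs_of_nonneg hs, ha, hc]
        rw [show t = 1 - s by linarith]; module
      · have h1 : |t| ≤ 1 := abs_le.2 ⟨by linarith, by linarith⟩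
        refine ⟨m + t • e, hmemseg _ h1, ?_⟩
        rw [hft _ h1, abs_of_nonneg ht, hb, hc]
        rw [show s = 1 - t by linarith]; module

end LinkTheory

namespace LinkTheory

/-! ### Ordering the vertices of a graph between a source and a sink -/

section STOrder

variable {α : Type*} {adj : α → α → Prop} {A B : α → Prop}

/-- `W` is a union of connected components of the graph induced on `U`. -/
def ClosedIn (adj : α → α → Prop) (U W : Finset α) : Prop :=
  W ⊆ U ∧ ∀ s ∈ W, ∀ t ∈ U, adj s t → t ∈ W

open Classical in
/-- The union of the components of `U` that do not meet `B`. -/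
noncomputable def lost (adj : α → α → Prop) (B : α → Prop) (U : Finset α) : Finset α :=
  U.filter fun t => ∃ W, ClosedIn adj U W ∧ t ∈ W ∧ ∀ w ∈ W, ¬ B w

theorem lost_closedIn (U : Finset α) : ClosedIn adj U (lost adj B U) := by
  classical
  refine ⟨Finset.filter_subset _ _, fun s hs t ht hst => ?_⟩
  obtain ⟨hsU, W, hW, hsW, hB⟩ := Finset.mem_filter.1 hs
  exact Finset.mem_filter.2 ⟨ht, W, hW, hW.2 s hsW t ht hst, hB⟩

theorem not_of_mem_lost {U : Finset α} {t : α} (ht : t ∈ lost adj B U) : ¬ B t := by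
  classical
  obtain ⟨-, W, -, htW, hB⟩ := Finset.mem_filter.1 ht
  exact hB t htW

theorem subset_lost {U W : Finset α} (hW : ClosedIn adj U W) (hB : ∀ w ∈ W, ¬ B w) :
    W ⊆ lost adj B U := by
  classical
  exact fun t ht => Finset.mem_filter.2 ⟨hW.1 ht, W, hW, ht, hB⟩

/-- Among the candidates for the next vertex, take one whose removal cuts the smallest set `L` off
from `B`. If `L` is nonempty, `hAB` puts another candidate `w` into `L`. Removing `w` instead cuts
off a set `L'`. If `L'` contains `t`, then `L' ∪ L` is a part of `V \ S` without access to `B`,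
against `hP`. Otherwise `L' ∪ L` is cut off by `t` as well, so `L'` is contained in `L` without `w`,
against minimality. -/
theorem exists_step [DecidableEq α] (hadj : ∀ s t, adj s t → adj t s) {V S : Finset α} (hSV : S ⊆ V) (hne : S ≠ V)
    (hP : ∀ W, ClosedIn adj (V \ S) W → W.Nonempty → ∃ w ∈ W, B w)
    (hA : ∀ W, ClosedIn adj V W → W.Nonempty → ∃ w ∈ W, A w)
    (hAB : ∀ v W, ClosedIn adj (V.erase v) W → W.Nonempty → ∃ w ∈ W, A w ∨ B w) :
    ∃ t ∈ V \ S, (A t ∨ ∃ s ∈ S, adj s t) ∧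
      ∀ W, ClosedIn adj ((V \ S).erase t) W → W.Nonempty → ∃ w ∈ W, B w := by
  classical
  set Cnd := (V \ S).filter fun t => A t ∨ ∃ s ∈ S, adj s t with hCnd
  have hCne : Cnd.Nonempty := by
    by_contra hemp
    rw [Finset.not_nonempty_iff_eq_empty] at hemp
    have hno : ∀ t ∈ V \ S, ¬ (A t ∨ ∃ s ∈ S, adj s t) := fun t ht h =>
      Finset.notMem_empty t (hemp ▸ Finset.mem_filter.2 ⟨ht, h⟩)
    obtain ⟨w, hw, hAw⟩ := hA (V \ S) ⟨Finset.sdiff_subset, fun s hs t ht hst => by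
      by_contra htn
      have htS : t ∈ S := by
        by_contra h; exact htn (Finset.mem_sdiff.2 ⟨ht, h⟩)
      exact hno s hs (Or.inr ⟨t, htS, hadj _ _ hst⟩)⟩ (by
        rw [Finset.sdiff_nonempty]; exact fun h => hne (Finset.Subset.antisymm hSV h))
    exact hno w hw (Or.inl hAw)
  obtain ⟨t, htC, htmin⟩ := Finset.exists_min_image Cnd
    (fun t => (lost adj B ((V \ S).erase t)).card) hCne
  obtain ⟨htU, htA⟩ := Finset.mem_filter.1 htC
  refine ⟨t, htU, htA, ?_⟩
  set L := lost adj B ((V \ S).erase t) with hL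
  have hLcl : ClosedIn adj ((V \ S).erase t) L := lost_closedIn _
  have hLempty : L = ∅ := by
    by_contra hLne
    have hLne := Finset.nonempty_iff_ne_empty.2 hLne
    have hw : ∃ w ∈ L, w ∈ Cnd := by
      by_contra hno
      push Not at hno
      have hcl : ClosedIn adj (V.erase t) L := by
        refine ⟨fun x hx => ?_, fun s hs u hu hsu => ?_⟩
        · have := hLcl.1 hx
          simp only [Finset.mem_erase, Finset.mem_sdiff] at this ⊢
          exact ⟨this.1, this.2.1⟩
        · by_cases huS : u ∈ S
          · exact absurd (Finset.mem_filter.2 ⟨Finset.mem_of_mem_erase (hLcl.1 hs),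
              Or.inr ⟨u, huS, hadj _ _ hsu⟩⟩) (hno s hs)
          · refine hLcl.2 s hs u ?_ hsu
            simp only [Finset.mem_erase, Finset.mem_sdiff] at hu ⊢
            exact ⟨hu.1, hu.2, huS⟩
      obtain ⟨w, hw, hABw⟩ := hAB t L hcl hLne
      rcases hABw with h | h
      · exact hno w hw (Finset.mem_filter.2 ⟨Finset.mem_of_mem_erase (hLcl.1 hw), Or.inl h⟩)
      · exact not_of_mem_lost hw h
    obtain ⟨w, hwL, hwC⟩ := hw
    set L' := lost adj B ((V \ S).erase w) with hL'
    have hL'cl : ClosedIn adj ((V \ S).erase w) L' := lost_closedIn _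
    have hB : ∀ x ∈ L' ∪ L, ¬ B x := fun x hx => by
      rcases Finset.mem_union.1 hx with h | h <;> exact not_of_mem_lost h
    have hUsub : L' ∪ L ⊆ V \ S := fun x hx => by
      rcases Finset.mem_union.1 hx with h | h
      · exact Finset.mem_of_mem_erase (hL'cl.1 h)
      · exact Finset.mem_of_mem_erase (hLcl.1 h)
    have hstep : ∀ s ∈ L' ∪ L, ∀ u ∈ V \ S, u ≠ t → adj s u → u ∈ L' ∪ L := by
      intro s hs u hu hut hsu
      rcases Finset.mem_union.1 hs with h | h
      · by_cases huw : u = w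
        · exact Finset.mem_union_right _ (huw ▸ hwL)
        · exact Finset.mem_union_left _ (hL'cl.2 s h u (Finset.mem_erase.2 ⟨huw, hu⟩) hsu)
      · exact Finset.mem_union_right _ (hLcl.2 s h u (Finset.mem_erase.2 ⟨hut, hu⟩) hsu)
    by_cases htL' : t ∈ L'
    · obtain ⟨x, hx, hBx⟩ := hP (L' ∪ L) ⟨hUsub, fun s hs u hu hsu => by
        by_cases hut : u = t
        · exact Finset.mem_union_left _ (hut ▸ htL')
        · exact hstep s hs u hu hut hsu⟩ ⟨t, Finset.mem_union_left _ htL'⟩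
      exact hB x hx hBx
    · have hsub : L' ∪ L ⊆ L := by
        refine subset_lost ⟨fun x hx => Finset.mem_erase.2 ⟨?_, hUsub hx⟩, fun s hs u hu hsu =>
          hstep s hs u (Finset.mem_of_mem_erase hu) (Finset.ne_of_mem_erase hu) hsu⟩ hB
        rintro rfl
        rcases Finset.mem_union.1 hx with h | h
        · exact htL' h
        · exact Finset.notMem_erase _ _ (hLcl.1 h)
      have hlt : L'.card < L.card := by
        refine Finset.card_lt_card ⟨Finset.union_subset_left hsub, fun h => ?_⟩
        exact Finset.notMem_erase _ _ (hL'cl.1 (h hwL))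
      exact absurd (htmin w hwC) (not_le.2 hlt)
  intro W hW hWne
  by_contra hno
  push Not at hno
  obtain ⟨w, hw⟩ := hWne
  exact Finset.notMem_empty w (hLempty ▸ subset_lost hW hno hw)

/-- This is an st-numbering: the vertices are listed so that each touches the source or an earlier
vertex, and the sink or a later one. The hypothesis `hAB` takes the place of 2-connectedness. The
invariant of the induction is that every component of what remains reaches the sink. -/
theorem st_induction [DecidableEq α] (hadj : ∀ s t, adj s t → adj t s) {V : Finset α}
    (hA : ∀ W, ClosedIn adj V W → W.Nonempty → ∃ w ∈ W, A w)
    (hB : ∀ W, ClosedIn adj V W → W.Nonempty → ∃ w ∈ W, B w)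
    (hAB : ∀ v W, ClosedIn adj (V.erase v) W → W.Nonempty → ∃ w ∈ W, A w ∨ B w)
    {Q : Finset α → Prop} (h0 : Q ∅)
    (hQ : ∀ S t, S ⊆ V → t ∈ V → t ∉ S → (A t ∨ ∃ s ∈ S, adj s t) →
      (B t ∨ ∃ u ∈ V, u ∉ S ∧ u ≠ t ∧ adj t u) → Q S → Q (insert t S)) : Q V := by
  suffices ∀ n (S : Finset α), S ⊆ V → (V \ S).card = n →
      (∀ W, ClosedIn adj (V \ S) W → W.Nonempty → ∃ w ∈ W, B w) → Q S → Q V from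
    this _ ∅ (Finset.empty_subset _) rfl (by simpa using hB) h0
  intro n
  induction n with
  | zero =>
    intro S hS hn _ hq
    rw [Finset.card_eq_zero, Finset.sdiff_eq_empty_iff_subset] at hn
    rwa [← Finset.Subset.antisymm hS hn]
  | succ n ih =>
    intro S hS hn hP hq
    have hne : S ≠ V := by rintro rfl; simp at hn
    obtain ⟨t, ht, htA, htP⟩ := exists_step hadj hS hne hP hA hAB
    obtain ⟨htV, htS⟩ := Finset.mem_sdiff.1 ht
    have e : V \ insert t S = (V \ S).erase t := by
      rw [Finset.sdiff_insert]
    refine ih (insert t S) (Finset.insert_subset htV hS) ?_ (by rwa [e]) (hQ S t hS htV htS htA ?_ hq)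
    · rw [e, Finset.card_erase_of_mem ht, hn]; rfl
    · by_contra hno
      push Not at hno
      obtain ⟨w, hw, hBw⟩ := hP {t} ⟨by simpa using ⟨htV, htS⟩, fun s hs u hu hsu => by
        rw [Finset.mem_singleton] at hs ⊢
        subst hs
        by_contra hus
        obtain ⟨huV, huS⟩ := Finset.mem_sdiff.1 hu
        exact hno.2 u huV huS hus hsu⟩ (Finset.singleton_nonempty t)
      rw [Finset.mem_singleton] at hw
      exact hno.1 (hw ▸ hBw)

end STOrder

/-! ### Triangulated annuli -/

/-- The edges of a family of triangles. -/
def faceEdges (S : Finset (Finset ℕ)) : Finset (Finset ℕ) :=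
  S.biUnion fun t => t.powersetCard 2

/-- The vertices of a family of simplices. -/
def verts (E : Finset (Finset ℕ)) : Finset ℕ := E.biUnion id

theorem mem_faceEdges {S : Finset (Finset ℕ)} {g : Finset ℕ} :
    g ∈ faceEdges S ↔ g.card = 2 ∧ ∃ t ∈ S, g ⊆ t := by
  simp only [faceEdges, Finset.mem_biUnion, Finset.mem_powersetCard]
  grind

theorem mem_verts {E : Finset (Finset ℕ)} {v : ℕ} : v ∈ verts E ↔ ∃ g ∈ E, v ∈ g := by
  simp [verts]

/-- Two triangles share an edge. -/
def ShareEdge (s t : Finset ℕ) : Prop := ∃ g : Finset ℕ, g.card = 2 ∧ g ⊆ s ∧ g ⊆ t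

theorem ShareEdge.symm (s t : Finset ℕ) (h : ShareEdge s t) : ShareEdge t s := by
  obtain ⟨g, h1, h2, h3⟩ := h
  exact ⟨g, h1, h3, h2⟩

/-- A triangle has an edge in `I`. -/
def Touches (I : Finset (Finset ℕ)) (t : Finset ℕ) : Prop := ∃ g ∈ I, g ⊆ t

/-- Every vertex of the graph `C` has exactly two neighbours. -/
def TwoRegular (C : Finset (Finset ℕ)) : Prop :=
  ∀ v ∈ verts C, ∃ x y, x ≠ y ∧ ∀ w, {v, w} ∈ C ↔ (w = x ∨ w = y)

/-- How many triangles of `S` contain the edge `g`, counting the hole bounded by `I` as one. -/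
def incidence (I S : Finset (Finset ℕ)) (g : Finset ℕ) : ℕ :=
  (S.filter (g ⊆ ·)).card + if g ∈ I then 1 else 0

/-- A combinatorial triangulation of an annulus, with triangles `T` and boundary components
`I` and `O`. -/
structure IsAnnulus (T I O : Finset (Finset ℕ)) : Prop where
  card_tri : ∀ t ∈ T, t.card = 3
  inner_subset : I ⊆ faceEdges T
  outer_subset : O ⊆ faceEdges T
  incidence_eq : ∀ g ∈ faceEdges T, incidence I T g + (if g ∈ O then 1 else 0) = 2
  inner_regular : TwoRegular I
  inner_card : (verts I).card = I.card
  euler : ((verts (faceEdges T)).card : ℤ) - (faceEdges T).card + T.card = 0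
  conn_inner : ∀ W, ClosedIn ShareEdge T W → W.Nonempty → ∃ w ∈ W, Touches I w
  conn_outer : ∀ W, ClosedIn ShareEdge T W → W.Nonempty → ∃ w ∈ W, Touches O w
  conn_erase : ∀ r W, ClosedIn ShareEdge (T.erase r) W → W.Nonempty →
    ∃ w ∈ W, Touches I w ∨ Touches O w

/-- The curve bounding the union of the hole `I` and the triangles `S`. -/
def frontierCurve (T I S : Finset (Finset ℕ)) : Finset (Finset ℕ) :=
  (faceEdges T).filter fun g => incidence I S g = 1

/-- The edges in the closure of the union of the hole `I` and the triangles `S`. -/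
def coveredEdges (T I S : Finset (Finset ℕ)) : Finset (Finset ℕ) :=
  (faceEdges T).filter fun g => 1 ≤ incidence I S g

/-- The Euler characteristic of the part of the annulus covered by the triangles `S`. -/
def eulerChar (T I S : Finset (Finset ℕ)) : ℤ :=
  ((verts (coveredEdges T I S)).card : ℤ) - (coveredEdges T I S).card + S.card

/-- `C'` arises from `C` by replacing the edge `ab` with `ac` and `cb`. -/
def CurveMove (C C' : Finset (Finset ℕ)) (a b c : ℕ) : Prop :=
  a ≠ b ∧ a ≠ c ∧ b ≠ c ∧ {a, b} ∈ C ∧ c ∉ verts C ∧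
    C' = insert {a, c} (insert {c, b} (C.erase {a, b}))

theorem incidence_insert {I S : Finset (Finset ℕ)} {t : Finset ℕ} (ht : t ∉ S) (g : Finset ℕ) :
    incidence I (insert t S) g = incidence I S g + if g ⊆ t then 1 else 0 := by
  unfold incidence
  rw [Finset.filter_insert]
  split_ifs <;> simp [ht]

theorem incidence_mono {I S S' : Finset (Finset ℕ)} (h : S ⊆ S') (g : Finset ℕ) :
    incidence I S g ≤ incidence I S' g := by
  unfold incidence
  gcongr

theorem pair_eq_pair_iff {a b c d : ℕ} :
    ({a, b} : Finset ℕ) = {c, d} ↔ a = c ∧ b = d ∨ a = d ∧ b = c := by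
  rw [← Finset.coe_inj]
  simpa using Set.pair_eq_pair_iff

theorem edge_subset_triple {a b c : ℕ} (hab : a ≠ b) (hac : a ≠ c) (hbc : b ≠ c)
    {g : Finset ℕ} (hg : g.card = 2) :
    g ⊆ ({a, b, c} : Finset ℕ) ↔ g = {a, b} ∨ g = {a, c} ∨ g = {c, b} := by
  constructor
  · intro h
    obtain ⟨x, y, hxy, rfl⟩ := Finset.card_eq_two.1 hg
    have hx := h (show x ∈ ({x, y} : Finset ℕ) by simp)
    have hy := h (show y ∈ ({x, y} : Finset ℕ) by simp)
    simp only [Finset.mem_insert, Finset.mem_singleton] at hx hy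
    rcases hx with rfl | rfl | rfl <;> rcases hy with rfl | rfl | rfl <;>
      simp_all [Finset.pair_comm]
  · rintro (rfl | rfl | rfl) <;> simp [Finset.insert_subset_iff]

theorem TwoRegular.curveMove {C C' : Finset (Finset ℕ)} {a b c : ℕ} (hC : TwoRegular C)
    (h : CurveMove C C' a b c) : TwoRegular C' := by
  obtain ⟨hab, hac, hbc, habC, hc, rfl⟩ := h
  have hcn : ∀ w, {c, w} ∉ C := fun w hw => hc (mem_verts.2 ⟨_, hw, by simp⟩)
  have hcn' : ∀ w, {w, c} ∉ C := fun w hw => hc (mem_verts.2 ⟨_, hw, by simp⟩)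
  have hmem : ∀ v w : ℕ, ({v, w} : Finset ℕ) ∈ insert {a, c} (insert {c, b} (C.erase {a, b})) ↔
      (v = a ∧ w = c ∨ v = c ∧ w = a) ∨ (v = c ∧ w = b ∨ v = b ∧ w = c) ∨
        ¬ (v = a ∧ w = b ∨ v = b ∧ w = a) ∧ {v, w} ∈ C := by
    intro v w
    simp only [Finset.mem_insert, Finset.mem_erase, ne_eq, pair_eq_pair_iff]
  intro v hv
  simp only [hmem]
  by_cases hvc : v = c
  · subst hvc
    refine ⟨a, b, hab, fun w => ?_⟩
    have := hcn w
    grind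
  have hvC : v ∈ verts C := by
    obtain ⟨g, hg, hvg⟩ := mem_verts.1 hv
    simp only [Finset.mem_insert, Finset.mem_erase] at hg
    rcases hg with rfl | rfl | hg
    · exact mem_verts.2 ⟨_, habC, by simp_all⟩
    · exact mem_verts.2 ⟨_, habC, by simp_all⟩
    · exact mem_verts.2 ⟨_, hg.2, hvg⟩
  obtain ⟨x, y, hxy, hw⟩ := hC v hvC
  have hcv := hcn' v
  rw [hw] at hcv
  by_cases hva : v = a
  · subst hva
    have := (hw b).1 habC
    rcases this with rfl | rfl
    · exact ⟨c, y, by grind, fun w => by rw [hw]; grind⟩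
    · exact ⟨c, x, by grind, fun w => by rw [hw]; grind⟩
  by_cases hvb : v = b
  · subst hvb
    have := (hw a).1 (by rwa [Finset.pair_comm])
    rcases this with rfl | rfl
    · exact ⟨c, y, by grind, fun w => by rw [hw]; grind⟩
    · exact ⟨c, x, by grind, fun w => by rw [hw]; grind⟩
  · exact ⟨x, y, hxy, fun w => by rw [hw]; grind⟩

/-- Removing a vertex `c` with neighbours `a`, `b` from a two-regular graph. -/
theorem TwoRegular.remove {C : Finset (Finset ℕ)} {a b c : ℕ} (hC : TwoRegular C) (hab : a ≠ b)
    (hac : a ≠ c) (hbc : b ≠ c) (h1 : {a, c} ∈ C) (h2 : {c, b} ∈ C) (h3 : {a, b} ∉ C)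
    (hcard : ∀ g ∈ C, g.card = 2) :
    TwoRegular (insert {a, b} ((C.erase {a, c}).erase {c, b})) ∧
      CurveMove (insert {a, b} ((C.erase {a, c}).erase {c, b})) C a b c := by
  have hvert : ∀ {v w : ℕ}, {v, w} ∈ C → v ∈ verts C := fun h => mem_verts.2 ⟨_, h, by simp⟩
  have h1' : {c, a} ∈ C := by rwa [Finset.pair_comm]
  have h2' : {b, c} ∈ C := by rwa [Finset.pair_comm]
  obtain ⟨x, y, hxy, hcw⟩ := hC c (hvert h2)
  have hcn : ∀ w, {c, w} ∈ C → w = a ∨ w = b := by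
    intro w hw
    have e1 := (hcw a).1 h1'
    have e2 := (hcw b).1 h2
    have e3 := (hcw w).1 hw
    grind
  have hmem : ∀ v w : ℕ, ({v, w} : Finset ℕ) ∈ insert {a, b} ((C.erase {a, c}).erase {c, b}) ↔
      (v = a ∧ w = b ∨ v = b ∧ w = a) ∨ ¬ (v = c ∧ w = b ∨ v = b ∧ w = c) ∧
        ¬ (v = a ∧ w = c ∨ v = c ∧ w = a) ∧ {v, w} ∈ C := by
    intro v w
    simp only [Finset.mem_insert, Finset.mem_erase, ne_eq, pair_eq_pair_iff]
  have hcnot : c ∉ verts (insert {a, b} ((C.erase {a, c}).erase {c, b})) := by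
    intro hc
    obtain ⟨g, hg, hcg⟩ := mem_verts.1 hc
    have hg2 : g.card = 2 := by
      simp only [Finset.mem_insert, Finset.mem_erase] at hg
      rcases hg with rfl | hg
      · exact Finset.card_pair hab
      · exact hcard g hg.2.2
    obtain ⟨w, rfl⟩ : ∃ w, g = {c, w} := by
      obtain ⟨u, w, -, rfl⟩ := Finset.card_eq_two.1 hg2
      simp only [Finset.mem_insert, Finset.mem_singleton] at hcg
      rcases hcg with rfl | rfl
      · exact ⟨w, rfl⟩
      · exact ⟨u, Finset.pair_comm _ _⟩
    rw [hmem] at hg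
    have := hcn w
    grind
  refine ⟨fun v hv => ?_, hab, hac, hbc, by simp, hcnot, ?_⟩
  · simp only [hmem]
    have hvc : v ≠ c := by rintro rfl; exact hcnot hv
    have hvC : v ∈ verts C := by
      obtain ⟨g, hg, hvg⟩ := mem_verts.1 hv
      simp only [Finset.mem_insert, Finset.mem_erase] at hg
      rcases hg with rfl | hg
      · simp only [Finset.mem_insert, Finset.mem_singleton] at hvg
        rcases hvg with rfl | rfl
        · exact hvert h1
        · exact hvert h2'
      · exact mem_verts.2 ⟨_, hg.2.2, hvg⟩
    obtain ⟨x, y, hxy, hw⟩ := hC v hvC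
    by_cases hva : v = a
    · subst hva
      rw [hw] at h1 h3
      rcases h1 with rfl | rfl
      · exact ⟨b, y, by grind, fun w => by rw [hw]; grind⟩
      · exact ⟨b, x, by grind, fun w => by rw [hw]; grind⟩
    by_cases hvb : v = b
    · subst hvb
      rw [Finset.pair_comm, hw] at h3
      rw [hw] at h2'
      rcases h2' with rfl | rfl
      · exact ⟨a, y, by grind, fun w => by rw [hw]; grind⟩
      · exact ⟨a, x, by grind, fun w => by rw [hw]; grind⟩
    · exact ⟨x, y, hxy, fun w => by rw [hw]; grind⟩
  · ext g
    simp only [Finset.mem_insert, Finset.mem_erase]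
    by_cases hg1 : g = {a, c}
    · simp [hg1, h1]
    by_cases hg2 : g = {c, b}
    · simp [hg2, h2]
    by_cases hg3 : g = {a, b}
    · subst hg3; simp [h3, hg1, hg2]
    · simp [hg1, hg2, hg3]

end LinkTheory

namespace LinkTheory

/-! ### Sweeping an annulus by triangles, with control of the Euler characteristic -/

namespace IsAnnulus

variable {T I O : Finset (Finset ℕ)}

theorem incidence_le (h : IsAnnulus T I O) {g : Finset ℕ} (hg : g ∈ faceEdges T) :
    incidence I T g ≤ 2 := by
  have := h.incidence_eq g hg
  omega

/-- The triangle `t` itself still has to use one of the two places at `g`. -/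
theorem incidence_le_one (h : IsAnnulus T I O) {S : Finset (Finset ℕ)} {t g : Finset ℕ}
    (hS : S ⊆ T) (ht : t ∈ T) (htS : t ∉ S) (hg : g.card = 2) (hgt : g ⊆ t) :
    incidence I S g ≤ 1 := by
  have h1 := incidence_insert (I := I) htS g
  have h2 := incidence_mono (I := I) (Finset.insert_subset ht hS) g
  have h3 := h.incidence_le (mem_faceEdges.2 ⟨hg, t, ht, hgt⟩)
  rw [if_pos hgt] at h1
  omega

theorem exists_covered {S : Finset (Finset ℕ)} {t : Finset ℕ} (h : IsAnnulus T I O)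
    (hA : Touches I t ∨ ∃ s ∈ S, ShareEdge s t) :
    ∃ g : Finset ℕ, g.card = 2 ∧ g ⊆ t ∧ 1 ≤ incidence I S g := by
  rcases hA with ⟨g, hg, hgt⟩ | ⟨s, hs, g, hg, hgs, hgt⟩
  · exact ⟨g, (mem_faceEdges.1 (h.inner_subset hg)).1, hgt, by simp [incidence, hg]⟩
  · refine ⟨g, hg, hgt, ?_⟩
    have : 0 < (S.filter (g ⊆ ·)).card := Finset.card_pos.2 ⟨s, Finset.mem_filter.2 ⟨hs, hgs⟩⟩
    unfold incidence
    omega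

/-- The two places at the common edge are taken by `t` and by the outer boundary or the later
triangle `u`, so none is left for `S` or the hole. -/
theorem exists_uncovered {S : Finset (Finset ℕ)} {t : Finset ℕ} (h : IsAnnulus T I O)
    (hS : S ⊆ T) (ht : t ∈ T) (htS : t ∉ S)
    (hB : Touches O t ∨ ∃ u ∈ T, u ∉ S ∧ u ≠ t ∧ ShareEdge t u) :
    ∃ g : Finset ℕ, g.card = 2 ∧ g ⊆ t ∧ incidence I S g = 0 := by
  rcases hB with ⟨g, hg, hgt⟩ | ⟨u, hu, huS, hut, g, hg, hgt, hgu⟩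
  · have hg' := h.outer_subset hg
    refine ⟨g, (mem_faceEdges.1 hg').1, hgt, ?_⟩
    have h1 := h.incidence_eq g hg'
    have h2 := incidence_insert (I := I) htS g
    have h3 := incidence_mono (I := I) (Finset.insert_subset ht hS) g
    rw [if_pos hg] at h1
    rw [if_pos hgt] at h2
    omega
  · refine ⟨g, hg, hgt, ?_⟩
    have h1 := h.incidence_le (mem_faceEdges.2 ⟨hg, t, ht, hgt⟩)
    have h2 := incidence_insert (I := I) htS g
    have h3 := incidence_insert (I := I) (S := insert t S) (t := u) (by simp [hut, huS]) g
    have h4 := incidence_mono (I := I)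
      (Finset.insert_subset hu (Finset.insert_subset ht hS)) g
    rw [if_pos hgt] at h2
    rw [if_pos hgu] at h3
    omega

/-- A triangle to be added shares one or two edges with the covered part. -/
theorem cases_of_step (h : IsAnnulus T I O) {S : Finset (Finset ℕ)} {t : Finset ℕ} (hS : S ⊆ T)
    (ht : t ∈ T) (htS : t ∉ S) (h1 : ∃ g : Finset ℕ, g.card = 2 ∧ g ⊆ t ∧ 1 ≤ incidence I S g)
    (h0 : ∃ g : Finset ℕ, g.card = 2 ∧ g ⊆ t ∧ incidence I S g = 0) :
    ∃ a b c, a ≠ b ∧ a ≠ c ∧ b ≠ c ∧ t = {a, b, c} ∧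
      (incidence I S {a, b} = 1 ∧ incidence I S {a, c} = 0 ∧ incidence I S {c, b} = 0 ∨
        incidence I S {a, b} = 0 ∧ incidence I S {a, c} = 1 ∧ incidence I S {c, b} = 1) := by
  obtain ⟨x, y, z, hxy, hxz, hyz, rfl⟩ := Finset.card_eq_three.1 (h.card_tri t ht)
  have b1 := h.incidence_le_one hS ht htS (Finset.card_pair hxy) (by simp [Finset.insert_subset_iff])
  have b2 := h.incidence_le_one hS ht htS (Finset.card_pair hxz) (by simp [Finset.insert_subset_iff])
  have b3 := h.incidence_le_one hS ht htS (Finset.card_pair hyz.symm)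
    (by simp [Finset.insert_subset_iff])
  obtain ⟨g, hg, hgt, hg1⟩ := h1
  obtain ⟨g', hg', hgt', hg1'⟩ := h0
  rw [edge_subset_triple hxy hxz hyz hg] at hgt
  rw [edge_subset_triple hxy hxz hyz hg'] at hgt'
  have key : ∀ i j k : ℕ, i ≤ 1 → j ≤ 1 → k ≤ 1 → (1 ≤ i ∨ 1 ≤ j ∨ 1 ≤ k) →
      (i = 0 ∨ j = 0 ∨ k = 0) → (i = 1 ∧ j = 0 ∧ k = 0 ∨ i = 0 ∧ j = 1 ∧ k = 1) ∨
        (j = 1 ∧ i = 0 ∧ k = 0 ∨ j = 0 ∧ i = 1 ∧ k = 1) ∨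
        (k = 1 ∧ i = 0 ∧ j = 0 ∨ k = 0 ∧ i = 1 ∧ j = 1) := by omega
  have hex := key _ _ _ b1 b2 b3
    (by rcases hgt with rfl | rfl | rfl <;> simp_all) (by
      rcases hgt' with rfl | rfl | rfl <;> simp_all)
  rcases hex with hex | hex | hex
  · exact ⟨x, y, z, hxy, hxz, hyz, rfl, hex⟩
  · refine ⟨x, z, y, hxz, hxy, hyz.symm, by rw [Finset.pair_comm y z], ?_⟩
    rwa [Finset.pair_comm y z]
  · refine ⟨z, y, x, hyz.symm, hxz.symm, hxy.symm, ?_, ?_⟩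
    · ext w; simp; tauto
    · rw [Finset.pair_comm z x]
      rcases hex with hex | hex
      · exact Or.inl ⟨hex.1, hex.2.2, hex.2.1⟩
      · exact Or.inr ⟨hex.1, hex.2.2, hex.2.1⟩

theorem mem_verts_of_pair {C : Finset (Finset ℕ)} {a b : ℕ} (h : {a, b} ∈ C) :
    a ∈ verts C ∧ b ∈ verts C :=
  ⟨mem_verts.2 ⟨_, h, by simp⟩, mem_verts.2 ⟨_, h, by simp⟩⟩

section Step

variable {S : Finset (Finset ℕ)} {a b c : ℕ}

theorem coveredEdges_insert_one (ht : {a, b, c} ∈ T) (htS : {a, b, c} ∉ S)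
    (hab : a ≠ b) (hac : a ≠ c) (hbc : b ≠ c) (h1 : incidence I S {a, b} = 1) :
    coveredEdges T I (insert {a, b, c} S) =
      insert {a, c} (insert {c, b} (coveredEdges T I S)) := by
  ext g
  simp only [coveredEdges, Finset.mem_filter, Finset.mem_insert, incidence_insert htS]
  have hmem : ∀ g : Finset ℕ, g.card = 2 → g ⊆ {a, b, c} → g ∈ faceEdges T := fun g h2 h3 =>
    mem_faceEdges.2 ⟨h2, _, ht, h3⟩
  constructor
  · rintro ⟨hg, hg1⟩
    have := edge_subset_triple hab hac hbc (mem_faceEdges.1 hg).1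
    split_ifs at hg1 with hsub
    · rcases this.1 hsub with rfl | rfl | rfl
      · exact Or.inr (Or.inr ⟨hg, h1.ge⟩)
      · exact Or.inl rfl
      · exact Or.inr (Or.inl rfl)
    · exact Or.inr (Or.inr ⟨hg, hg1⟩)
  · rintro (rfl | rfl | ⟨hg, hg1⟩)
    · have : ({a, c} : Finset ℕ) ⊆ {a, b, c} := by simp [Finset.insert_subset_iff]
      exact ⟨hmem _ (Finset.card_pair hac) this, by rw [if_pos this]; omega⟩
    · have : ({c, b} : Finset ℕ) ⊆ {a, b, c} := by simp [Finset.insert_subset_iff]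
      exact ⟨hmem _ (Finset.card_pair hbc.symm) this, by rw [if_pos this]; omega⟩
    · exact ⟨hg, by omega⟩

theorem coveredEdges_insert_two (ht : {a, b, c} ∈ T) (htS : {a, b, c} ∉ S)
    (hab : a ≠ b) (hac : a ≠ c) (hbc : b ≠ c)
    (h1 : incidence I S {a, c} = 1) (h2 : incidence I S {c, b} = 1) :
    coveredEdges T I (insert {a, b, c} S) = insert {a, b} (coveredEdges T I S) := by
  ext g
  simp only [coveredEdges, Finset.mem_filter, Finset.mem_insert, incidence_insert htS]
  constructor
  · rintro ⟨hg, hg1⟩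
    have := edge_subset_triple hab hac hbc (mem_faceEdges.1 hg).1
    split_ifs at hg1 with hsub
    · rcases this.1 hsub with rfl | rfl | rfl
      · exact Or.inl rfl
      · exact Or.inr ⟨hg, h1.ge⟩
      · exact Or.inr ⟨hg, h2.ge⟩
    · exact Or.inr ⟨hg, hg1⟩
  · rintro (rfl | ⟨hg, hg1⟩)
    · have : ({a, b} : Finset ℕ) ⊆ {a, b, c} := by simp [Finset.insert_subset_iff]
      exact ⟨mem_faceEdges.2 ⟨Finset.card_pair hab, _, ht, this⟩, by rw [if_pos this]; omega⟩
    · exact ⟨hg, by omega⟩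

theorem frontierCurve_insert_one (ht : {a, b, c} ∈ T) (htS : {a, b, c} ∉ S)
    (hab : a ≠ b) (hac : a ≠ c) (hbc : b ≠ c) (h1 : incidence I S {a, b} = 1)
    (h2 : incidence I S {a, c} = 0) (h3 : incidence I S {c, b} = 0) :
    frontierCurve T I (insert {a, b, c} S) =
      insert {a, c} (insert {c, b} ((frontierCurve T I S).erase {a, b})) := by
  ext g
  simp only [frontierCurve, Finset.mem_filter, Finset.mem_insert, Finset.mem_erase,
    incidence_insert htS]
  have hmem : ∀ g : Finset ℕ, g.card = 2 → g ⊆ {a, b, c} → g ∈ faceEdges T := fun g h2 h3 =>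
    mem_faceEdges.2 ⟨h2, _, ht, h3⟩
  constructor
  · rintro ⟨hg, hg1⟩
    have := edge_subset_triple hab hac hbc (mem_faceEdges.1 hg).1
    split_ifs at hg1 with hsub
    · rcases this.1 hsub with rfl | rfl | rfl
      · omega
      · exact Or.inl rfl
      · exact Or.inr (Or.inl rfl)
    · exact Or.inr (Or.inr ⟨fun e => hsub (this.2 (Or.inl e)), hg, hg1⟩)
  · rintro (rfl | rfl | ⟨hgab, hg, hg1⟩)
    · have : ({a, c} : Finset ℕ) ⊆ {a, b, c} := by simp [Finset.insert_subset_iff]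
      exact ⟨hmem _ (Finset.card_pair hac) this, by rw [if_pos this]; omega⟩
    · have : ({c, b} : Finset ℕ) ⊆ {a, b, c} := by simp [Finset.insert_subset_iff]
      exact ⟨hmem _ (Finset.card_pair hbc.symm) this, by rw [if_pos this]; omega⟩
    · refine ⟨hg, ?_⟩
      rw [if_neg, hg1]
      rw [edge_subset_triple hab hac hbc (mem_faceEdges.1 hg).1]
      rintro (rfl | rfl | rfl)
      · exact hgab rfl
      · omega
      · omega

theorem frontierCurve_insert_two (ht : {a, b, c} ∈ T) (htS : {a, b, c} ∉ S)
    (hab : a ≠ b) (hac : a ≠ c) (hbc : b ≠ c) (h1 : incidence I S {a, b} = 0)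
    (h2 : incidence I S {a, c} = 1) (h3 : incidence I S {c, b} = 1) :
    frontierCurve T I (insert {a, b, c} S) =
      insert {a, b} (((frontierCurve T I S).erase {a, c}).erase {c, b}) := by
  ext g
  simp only [frontierCurve, Finset.mem_filter, Finset.mem_insert, Finset.mem_erase,
    incidence_insert htS]
  constructor
  · rintro ⟨hg, hg1⟩
    have := edge_subset_triple hab hac hbc (mem_faceEdges.1 hg).1
    split_ifs at hg1 with hsub
    · rcases this.1 hsub with rfl | rfl | rfl
      · exact Or.inl rfl
      · omega
      · omega
    · exact Or.inr ⟨fun e => hsub (this.2 (Or.inr (Or.inr e))),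
        fun e => hsub (this.2 (Or.inr (Or.inl e))), hg, hg1⟩
  · rintro (rfl | ⟨hgcb, hgac, hg, hg1⟩)
    · have : ({a, b} : Finset ℕ) ⊆ {a, b, c} := by simp [Finset.insert_subset_iff]
      exact ⟨mem_faceEdges.2 ⟨Finset.card_pair hab, _, ht, this⟩, by rw [if_pos this]; omega⟩
    · refine ⟨hg, ?_⟩
      rw [if_neg, hg1]
      rw [edge_subset_triple hab hac hbc (mem_faceEdges.1 hg).1]
      rintro (rfl | rfl | rfl)
      · omega
      · exact hgac rfl
      · exact hgcb rfl

theorem verts_insert (C : Finset (Finset ℕ)) (g : Finset ℕ) :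
    verts (insert g C) = g ∪ verts C := by
  simp [verts, Finset.biUnion_insert]

/-- The step adds one triangle and two edges, and the vertex `c` unless it was already there. So the
characteristic drops exactly when the new frontier would run into the covered part at `c`. -/
theorem eulerChar_insert_one (ht : {a, b, c} ∈ T) (htS : {a, b, c} ∉ S)
    (hab : a ≠ b) (hac : a ≠ c) (hbc : b ≠ c) (h1 : incidence I S {a, b} = 1)
    (h2 : incidence I S {a, c} = 0) (h3 : incidence I S {c, b} = 0) :
    eulerChar T I (insert {a, b, c} S) =
      eulerChar T I S - if c ∈ verts (coveredEdges T I S) then 1 else 0 := by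
  have habC : {a, b} ∈ coveredEdges T I S := Finset.mem_filter.2
    ⟨mem_faceEdges.2 ⟨Finset.card_pair hab, _, ht, by simp [Finset.insert_subset_iff]⟩, h1.ge⟩
  have hn1 : {c, b} ∉ coveredEdges T I S := fun h => by
    have := (Finset.mem_filter.1 h).2
    omega
  have hn2 : {a, c} ∉ insert {c, b} (coveredEdges T I S) := fun h => by
    rcases Finset.mem_insert.1 h with h | h
    · rw [pair_eq_pair_iff] at h
      omega
    · have := (Finset.mem_filter.1 h).2
      omega
  obtain ⟨hva, hvb⟩ := mem_verts_of_pair habC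
  have hv : verts (coveredEdges T I (insert {a, b, c} S)) =
      insert c (verts (coveredEdges T I S)) := by
    rw [coveredEdges_insert_one ht htS hab hac hbc h1, verts_insert, verts_insert]
    ext v
    simp only [Finset.mem_union, Finset.mem_insert, Finset.mem_singleton]
    constructor
    · rintro ((rfl | rfl) | (rfl | rfl) | h) <;> simp [*]
    · tauto
  rw [eulerChar, eulerChar, hv, coveredEdges_insert_one ht htS hab hac hbc h1,
    Finset.card_insert_of_notMem hn2, Finset.card_insert_of_notMem hn1,
    Finset.card_insert_of_notMem htS]
  split_ifs with hc
  · rw [Finset.insert_eq_of_mem hc]; push_cast; ring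
  · rw [Finset.card_insert_of_notMem hc]; push_cast; ring

/-- One triangle and one edge are added, and no vertex. -/
theorem eulerChar_insert_two (ht : {a, b, c} ∈ T) (htS : {a, b, c} ∉ S)
    (hab : a ≠ b) (hac : a ≠ c) (hbc : b ≠ c) (h1 : incidence I S {a, b} = 0)
    (h2 : incidence I S {a, c} = 1) (h3 : incidence I S {c, b} = 1) :
    eulerChar T I (insert {a, b, c} S) = eulerChar T I S := by
  have hmem : ∀ g : Finset ℕ, g.card = 2 → g ⊆ {a, b, c} → incidence I S g = 1 →
      g ∈ coveredEdges T I S := fun g h2 h3 h4 => Finset.mem_filter.2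
    ⟨mem_faceEdges.2 ⟨h2, _, ht, h3⟩, h4.ge⟩
  have hva := (mem_verts_of_pair (hmem _ (Finset.card_pair hac)
    (by simp [Finset.insert_subset_iff]) h2)).1
  have hvb := (mem_verts_of_pair (hmem _ (Finset.card_pair hbc.symm)
    (by simp [Finset.insert_subset_iff]) h3)).2
  have hn1 : {a, b} ∉ coveredEdges T I S := fun h => by
    have := (Finset.mem_filter.1 h).2
    omega
  have hv : verts (coveredEdges T I (insert {a, b, c} S)) = verts (coveredEdges T I S) := by
    rw [coveredEdges_insert_two ht htS hab hac hbc h2 h3, verts_insert]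
    ext v
    simp only [Finset.mem_union, Finset.mem_insert, Finset.mem_singleton]
    constructor
    · rintro ((rfl | rfl) | h) <;> assumption
    · tauto
  rw [eulerChar, eulerChar, hv, coveredEdges_insert_two ht htS hab hac hbc h2 h3,
    Finset.card_insert_of_notMem hn1, Finset.card_insert_of_notMem htS]
  push_cast; ring

end Step

/-- The hole is not counted as a face. Only the boundary `I` remains, which has as many vertices as
edges. -/
theorem eulerChar_empty (h : IsAnnulus T I O) : eulerChar T I ∅ = 0 := by
  have : coveredEdges T I ∅ = I := by
    ext g
    simp only [coveredEdges, Finset.mem_filter, incidence, Finset.filter_empty,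
      Finset.card_empty, zero_add]
    constructor
    · rintro ⟨-, h2⟩
      by_contra hg
      simp [hg] at h2
    · exact fun hg => ⟨h.inner_subset hg, by simp [hg]⟩
  rw [eulerChar, this, h.inner_card]
  simp

theorem eulerChar_univ (h : IsAnnulus T I O) : eulerChar T I T = 0 := by
  have : coveredEdges T I T = faceEdges T := by
    refine Finset.filter_true_of_mem fun g hg => ?_
    obtain ⟨-, t, ht, hgt⟩ := mem_faceEdges.1 hg
    have : 0 < (T.filter (g ⊆ ·)).card := Finset.card_pos.2 ⟨t, Finset.mem_filter.2 ⟨ht, hgt⟩⟩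
    unfold incidence
    omega
  rw [eulerChar, this, h.euler]

theorem frontierCurve_empty (h : IsAnnulus T I O) : frontierCurve T I ∅ = I := by
  ext g
  simp only [frontierCurve, Finset.mem_filter, incidence, Finset.filter_empty,
    Finset.card_empty, zero_add]
  constructor
  · rintro ⟨-, h2⟩
    by_contra hg
    simp [hg] at h2
  · exact fun hg => ⟨h.inner_subset hg, by simp [hg]⟩

/-- A set of triangles is obtained by adding triangles one by one, each sharing some but not all
of its edges with the part already covered. -/
inductive Grows (T I : Finset (Finset ℕ)) : Finset (Finset ℕ) → Prop
  | empty : Grows T I ∅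
  | step (S : Finset (Finset ℕ)) (t : Finset ℕ) : Grows T I S → S ⊆ T → t ∈ T → t ∉ S →
      (∃ g : Finset ℕ, g.card = 2 ∧ g ⊆ t ∧ 1 ≤ incidence I S g) →
      (∃ g : Finset ℕ, g.card = 2 ∧ g ⊆ t ∧ incidence I S g = 0) → Grows T I (insert t S)

theorem eulerChar_insert_le (h : IsAnnulus T I O) {S : Finset (Finset ℕ)} {t : Finset ℕ}
    (hS : S ⊆ T) (ht : t ∈ T) (htS : t ∉ S)
    (h1 : ∃ g : Finset ℕ, g.card = 2 ∧ g ⊆ t ∧ 1 ≤ incidence I S g)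
    (h0 : ∃ g : Finset ℕ, g.card = 2 ∧ g ⊆ t ∧ incidence I S g = 0) :
    eulerChar T I (insert t S) ≤ eulerChar T I S := by
  obtain ⟨a, b, c, hab, hac, hbc, rfl, ⟨e1, e2, e3⟩ | ⟨e1, e2, e3⟩⟩ :=
    h.cases_of_step hS ht htS h1 h0
  · rw [eulerChar_insert_one ht htS hab hac hbc e1 e2 e3]
    split_ifs <;> omega
  · rw [eulerChar_insert_two ht htS hab hac hbc e1 e2 e3]

theorem Grows.eulerChar_le (h : IsAnnulus T I O) {S : Finset (Finset ℕ)} (hS : Grows T I S) :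
    eulerChar T I S ≤ 0 := by
  induction hS with
  | empty => exact h.eulerChar_empty.le
  | step S t _ hST ht htS h1 h0 ih => exact (h.eulerChar_insert_le hST ht htS h1 h0).trans ih

/-- As long as the Euler characteristic does not drop, the frontier stays a simple closed curve
and changes by moves across triangles. -/
theorem Grows.frontierCurve (h : IsAnnulus T I O) {Q : Finset (Finset ℕ) → Prop} (hQ0 : Q I)
    (hQ : ∀ C C' a b c, {a, b, c} ∈ T → C ⊆ faceEdges T → C' ⊆ faceEdges T →
      CurveMove C C' a b c → (Q C ↔ Q C'))
    {S : Finset (Finset ℕ)} (hS : Grows T I S) (hχ : 0 ≤ eulerChar T I S) :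
    Q (frontierCurve T I S) ∧ TwoRegular (LinkTheory.frontierCurve T I S) := by
  induction hS with
  | empty => rw [h.frontierCurve_empty]; exact ⟨hQ0, h.inner_regular⟩
  | step S t hgr hST ht htS h1 h0 ih =>
    have hle := Grows.eulerChar_le h hgr
    have hle' := h.eulerChar_insert_le hST ht htS h1 h0
    obtain ⟨ihQ, ihR⟩ := ih (by omega)
    obtain ⟨a, b, c, hab, hac, hbc, rfl, ⟨e1, e2, e3⟩ | ⟨e1, e2, e3⟩⟩ :=
      h.cases_of_step hST ht htS h1 h0
    -- The characteristic was at most 0 before the step and is at least 0 after it, so it did not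
    -- drop.
    · have hc : c ∉ verts (coveredEdges T I S) := by
        intro hc
        rw [eulerChar_insert_one ht htS hab hac hbc e1 e2 e3, if_pos hc] at hχ
        omega
      have hmove : CurveMove (LinkTheory.frontierCurve T I S)
          (LinkTheory.frontierCurve T I (insert {a, b, c} S)) a b c := by
        refine ⟨hab, hac, hbc, Finset.mem_filter.2 ⟨mem_faceEdges.2 ⟨Finset.card_pair hab, _, ht,
          by simp [Finset.insert_subset_iff]⟩, e1⟩, fun hcv => hc ?_,
          frontierCurve_insert_one ht htS hab hac hbc e1 e2 e3⟩
        obtain ⟨g, hg, hcg⟩ := mem_verts.1 hcv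
        obtain ⟨hg1, hg2⟩ := Finset.mem_filter.1 hg
        exact mem_verts.2 ⟨g, Finset.mem_filter.2 ⟨hg1, hg2.ge⟩, hcg⟩
      exact ⟨(hQ _ _ a b c ht (Finset.filter_subset _ _) (Finset.filter_subset _ _) hmove).1 ihQ,
        ihR.curveMove hmove⟩
    -- With two shared edges the move goes the other way: the old frontier arises from the new one
    -- by replacing `ab` with `ac` and `cb`.
    · have hmem : ∀ g : Finset ℕ, g.card = 2 → g ⊆ {a, b, c} → incidence I S g = 1 →
          g ∈ LinkTheory.frontierCurve T I S := fun g h2 h3 h4 => Finset.mem_filter.2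
        ⟨mem_faceEdges.2 ⟨h2, _, ht, h3⟩, h4⟩
      obtain ⟨r1, r2⟩ := ihR.remove hab hac hbc
        (hmem _ (Finset.card_pair hac) (by simp [Finset.insert_subset_iff]) e2)
        (hmem _ (Finset.card_pair hbc.symm) (by simp [Finset.insert_subset_iff]) e3)
        (fun h => by have := (Finset.mem_filter.1 h).2; omega)
        (fun g hg => (mem_faceEdges.1 (Finset.mem_filter.1 hg).1).1)
      rw [← frontierCurve_insert_two ht htS hab hac hbc e1 e2 e3] at r1 r2
      exact ⟨(hQ _ _ a b c ht (Finset.filter_subset _ _) (Finset.filter_subset _ _) r2).2 ihQ, r1⟩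

/-- If some triangles, among them those at the outer boundary, are marked as upper, then the inner
boundary can be moved across triangles to a curve, each edge of which either belongs to the inner
boundary and to an upper triangle, or separates an upper triangle from one that is not. -/
theorem exists_curve (h : IsAnnulus T I O) (up : Finset ℕ → Prop)
    (hO : ∀ t ∈ T, Touches O t → up t) {Q : Finset (Finset ℕ) → Prop} (hQ0 : Q I)
    (hQ : ∀ C C' a b c, {a, b, c} ∈ T → C ⊆ faceEdges T → C' ⊆ faceEdges T →
      CurveMove C C' a b c → (Q C ↔ Q C')) :
    ∃ C, Q C ∧ TwoRegular C ∧ C ⊆ faceEdges T ∧ ∀ g ∈ C, (∃ t ∈ T, g ⊆ t ∧ up t) ∧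
      (g ∈ I ∨ ∃ t ∈ T, g ⊆ t ∧ ¬ up t) := by
  classical
  set U := T.filter up with hU
  set Y := lost ShareEdge (Touches O) U with hY
  set X := U \ Y with hX
  set L := lost ShareEdge (Touches I) (T \ X) with hL
  set S := (T \ X) \ L with hS
  have hYcl : ClosedIn ShareEdge U Y := lost_closedIn _
  have hLcl : ClosedIn ShareEdge (T \ X) L := lost_closedIn _
  have hST : S ⊆ T := Finset.sdiff_subset.trans Finset.sdiff_subset
  have hUT : U ⊆ T := Finset.filter_subset _ _
  have hXclosed : ∀ s ∈ X, ∀ t ∈ U, ShareEdge s t → t ∈ X := by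
    intro s hs t ht hst
    rw [hX, Finset.mem_sdiff] at hs ⊢
    exact ⟨ht, fun htY => hs.2 (hYcl.2 t htY s hs.1 (ShareEdge.symm _ _ hst))⟩
  have hSclosed : ∀ s ∈ S, ∀ t ∈ T, t ∉ X → ShareEdge s t → t ∈ S := by
    intro s hs t ht htX hst
    rw [hS, Finset.mem_sdiff] at hs ⊢
    exact ⟨Finset.mem_sdiff.2 ⟨ht, htX⟩, fun htL => hs.2 (hLcl.2 t htL s hs.1
      (ShareEdge.symm _ _ hst))⟩
  have hOX : ∀ t ∈ T, Touches O t → t ∈ X := fun t ht htO =>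
    Finset.mem_sdiff.2 ⟨Finset.mem_filter.2 ⟨ht, hO t ht htO⟩, fun hY => not_of_mem_lost hY htO⟩
  have hXS : ∀ t ∈ X, t ∉ S := fun t ht htS =>
    (Finset.mem_sdiff.1 (Finset.mem_sdiff.1 htS).1).2 ht
  have hIS : ∀ t ∈ T, t ∉ X → Touches I t → t ∈ S := fun t ht htX htI =>
    Finset.mem_sdiff.2 ⟨Finset.mem_sdiff.2 ⟨ht, htX⟩, fun hL => not_of_mem_lost hL htI⟩
  -- Order the triangles of `S` with the hole as source. The sink is the outer boundary together
  -- with the triangles outside `S`.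
  have hgrow : Grows T I S := by
    refine st_induction (adj := ShareEdge) (A := Touches I)
      (B := fun t => Touches O t ∨ ∃ u ∈ T, u ∉ S ∧ ShareEdge t u) ShareEdge.symm ?_ ?_ ?_
      Grows.empty ?_
    · intro W hW hWne
      by_contra hno
      push Not at hno
      have : W ⊆ L := by
        have hWL : W ∪ L ⊆ L := by
          refine subset_lost ⟨?_, ?_⟩ ?_
          · exact Finset.union_subset (hW.1.trans Finset.sdiff_subset) hLcl.1
          · intro s hs t ht hst
            by_cases htL : t ∈ L
            · exact Finset.mem_union_right _ htL
            · rcases Finset.mem_union.1 hs with hs | hs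
              · exact Finset.mem_union_left _ (hW.2 s hs t (Finset.mem_sdiff.2 ⟨ht, htL⟩) hst)
              · exact Finset.mem_union_right _ (hLcl.2 s hs t ht hst)
          · intro w hw
            rcases Finset.mem_union.1 hw with hw | hw
            · exact hno w hw
            · exact not_of_mem_lost hw
        exact Finset.union_subset_left hWL
      obtain ⟨w, hw⟩ := hWne
      exact (Finset.mem_sdiff.1 (hW.1 hw)).2 (this hw)
    · intro W hW hWne
      by_contra hno
      push Not at hno
      obtain ⟨w, hw, hwO⟩ := h.conn_outer W ⟨hW.1.trans hST, fun s hs t ht hst => by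
        by_contra htW
        exact (hno s hs).2 t ht (fun htS => htW (hW.2 s hs t htS hst)) hst⟩ hWne
      exact (hno w hw).1 hwO
    · intro v W hW hWne
      by_contra hno
      push Not at hno
      obtain ⟨w, hw, hwO⟩ := h.conn_erase v W ⟨hW.1.trans (Finset.erase_subset_erase _ hST),
        fun s hs t ht hst => by
          obtain ⟨htv, htT⟩ := Finset.mem_erase.1 ht
          by_contra htW
          exact (hno s hs).2.2 t htT
            (fun htS => htW (hW.2 s hs t (Finset.mem_erase.2 ⟨htv, htS⟩) hst)) hst⟩ hWne
      rcases hwO with hw' | hw'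
      · exact (hno w hw).1 hw'
      · exact (hno w hw).2.1 hw'
    · intro S' t hS' ht htS' hA hB hgr
      refine Grows.step S' t hgr (hS'.trans hST) (hST ht) htS' (h.exists_covered hA)
        (h.exists_uncovered (hS'.trans hST) (hST ht) htS' ?_)
      rcases hB with (hB | ⟨u, hu, huS, hut⟩) | ⟨u, hu, huS, hne, hut⟩
      · exact Or.inl hB
      · exact Or.inr ⟨u, hu, fun h => huS (hS' h), fun h => huS (h ▸ ht), hut⟩
      · exact Or.inr ⟨u, hST hu, huS, hne, hut⟩
  -- Continue the growth from `S` to all of `T`. The characteristic does not rise and ends at 0, so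
  -- it was at least 0 at `S`.
  have hχ : 0 ≤ eulerChar T I S := by
    have key : eulerChar T I (S ∪ (T \ S)) ≤ eulerChar T I S := by
      refine st_induction (adj := ShareEdge) (V := T \ S)
        (A := fun t => Touches I t ∨ ∃ u ∈ S, ShareEdge u t)
        (B := Touches O) (Q := fun R => eulerChar T I (S ∪ R) ≤ eulerChar T I S)
        ShareEdge.symm ?_ ?_ ?_ (by simp) ?_
      · intro W hW hWne
        by_contra hno
        push Not at hno
        obtain ⟨w, hw, hwO⟩ := h.conn_inner W ⟨hW.1.trans Finset.sdiff_subset,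
          fun s hs t ht hst => by
            by_contra htW
            refine (hno s hs).2 t ?_ (ShareEdge.symm _ _ hst)
            by_contra htS
            exact htW (hW.2 s hs t (Finset.mem_sdiff.2 ⟨ht, htS⟩) hst)⟩ hWne
        exact (hno w hw).1 hwO
      · intro W hW hWne
        by_contra hno
        push Not at hno
        -- A component of the rest that misses the outer boundary cannot meet `X`, since it would
        -- contain a whole component of upper triangles, and those in `X` reach the outer boundary.
        have hWX : ∀ w ∈ W, w ∉ X := by
          intro w hw hwX
          have hsub : W ∩ X ⊆ Y := by
            refine subset_lost ⟨fun t ht => ?_, fun s hs t ht hst => ?_⟩ fun t ht =>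
              hno t (Finset.mem_inter.1 ht).1
            · exact (Finset.mem_sdiff.1 (Finset.mem_inter.1 ht).2).1
            · obtain ⟨hsW, hsX⟩ := Finset.mem_inter.1 hs
              have htX := hXclosed s hsX t ht hst
              exact Finset.mem_inter.2 ⟨hW.2 s hsW t (Finset.mem_sdiff.2 ⟨hUT ht, hXS t htX⟩) hst,
                htX⟩
          exact (Finset.mem_sdiff.1 hwX).2 (hsub (Finset.mem_inter.2 ⟨hw, hwX⟩))
        obtain ⟨w, hw, hwO⟩ := h.conn_outer W ⟨hW.1.trans Finset.sdiff_subset,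
          fun s hs t ht hst => by
            refine hW.2 s hs t (Finset.mem_sdiff.2 ⟨ht, fun htS => ?_⟩) hst
            obtain ⟨hsT, hsS⟩ := Finset.mem_sdiff.1 (hW.1 hs)
            exact hsS (hSclosed t htS s hsT (hWX s hs) (ShareEdge.symm _ _ hst))⟩ hWne
        exact hno w hw hwO
      · intro v W hW hWne
        by_contra hno
        push Not at hno
        obtain ⟨w, hw, hwO⟩ := h.conn_erase v W
          ⟨hW.1.trans (Finset.erase_subset_erase _ Finset.sdiff_subset), fun s hs t ht hst => by
            obtain ⟨htv, htT⟩ := Finset.mem_erase.1 ht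
            by_contra htW
            refine (hno s hs).1.2 t ?_ (ShareEdge.symm _ _ hst)
            by_contra htS
            exact htW (hW.2 s hs t (Finset.mem_erase.2 ⟨htv, Finset.mem_sdiff.2 ⟨htT, htS⟩⟩) hst)⟩
          hWne
        rcases hwO with hw' | hw'
        · exact (hno w hw).1.1 hw'
        · exact (hno w hw).2 hw'
      · intro R t hR ht htR hA hB hle
        obtain ⟨htT, htS⟩ := Finset.mem_sdiff.1 ht
        have hsub : S ∪ R ⊆ T := Finset.union_subset hST (hR.trans Finset.sdiff_subset)
        have htn : t ∉ S ∪ R := by simp [htS, htR]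
        show eulerChar T I (S ∪ insert t R) ≤ _
        rw [Finset.union_insert]
        refine (h.eulerChar_insert_le hsub htT htn (h.exists_covered ?_)
          (h.exists_uncovered hsub htT htn ?_)).trans hle
        · rcases hA with (hA | ⟨u, hu, hut⟩) | ⟨u, hu, hut⟩
          · exact Or.inl hA
          · exact Or.inr ⟨u, Finset.mem_union_left _ hu, hut⟩
          · exact Or.inr ⟨u, Finset.mem_union_right _ hu, hut⟩
        · rcases hB with hB | ⟨u, hu, huR, hut, hsh⟩
          · exact Or.inl hB
          · obtain ⟨huT, huS⟩ := Finset.mem_sdiff.1 hu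
            exact Or.inr ⟨u, huT, by simp [huS, huR], hut, hsh⟩
    rw [Finset.union_sdiff_of_subset hST, h.eulerChar_univ] at key
    exact key
  obtain ⟨hq, hreg⟩ := Grows.frontierCurve h hQ0 hQ hgrow hχ
  refine ⟨_, hq, hreg, Finset.filter_subset _ _, fun g hg => ?_⟩
  obtain ⟨hgT, hg1⟩ := Finset.mem_filter.1 hg
  have hg2 := (mem_faceEdges.1 hgT).1
  have hinc := h.incidence_eq g hgT
  unfold incidence at hg1 hinc
  -- A frontier edge on the hole has no triangle of `S`, so the triangle of `T` on it was kept out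
  -- by `X` and is upper.
  by_cases hgI : g ∈ I
  · rw [if_pos hgI] at hg1
    have hSempty : ∀ t ∈ S, ¬ g ⊆ t := by
      have : S.filter (g ⊆ ·) = ∅ := Finset.card_eq_zero.1 (by omega)
      intro t ht hgt
      exact Finset.notMem_empty t (this ▸ Finset.mem_filter.2 ⟨ht, hgt⟩)
    obtain ⟨-, t, ht, hgt⟩ := mem_faceEdges.1 hgT
    refine ⟨⟨t, ht, hgt, ?_⟩, Or.inl hgI⟩
    by_contra hup
    refine hSempty t (hIS t ht (fun htX => hup ?_) ⟨g, hgI, hgt⟩) hgt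
    exact (Finset.mem_filter.1 (Finset.mem_sdiff.1 htX).1).2
  -- Otherwise the edge has one triangle `t` in `S` and another triangle `t'` outside. The latter is
  -- in `X`, or it would have been absorbed into `S`. Then `t` is not upper, or it would have been
  -- absorbed into `X`.
  · rw [if_neg hgI, add_zero] at hg1
    obtain ⟨t, htf⟩ := Finset.card_eq_one.1 hg1
    have htm : t ∈ S.filter (g ⊆ ·) := by rw [htf]; exact Finset.mem_singleton_self t
    obtain ⟨htS, hgt⟩ := Finset.mem_filter.1 htm
    have htX : t ∉ X := fun hX => hXS t hX htS
    have hgO : g ∉ O := fun hgO => htX (hOX t (hST htS) ⟨g, hgO, hgt⟩)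
    rw [if_neg hgI, if_neg hgO, add_zero, add_zero] at hinc
    obtain ⟨t', ht', hne⟩ := Finset.exists_mem_ne (by omega : 1 < (T.filter (g ⊆ ·)).card) t
    obtain ⟨ht'T, hgt'⟩ := Finset.mem_filter.1 ht'
    have ht'S : t' ∉ S := fun h => hne (by
      have : t' ∈ S.filter (g ⊆ ·) := Finset.mem_filter.2 ⟨h, hgt'⟩
      rwa [htf, Finset.mem_singleton] at this)
    have ht'X : t' ∈ X := by
      by_contra hX
      exact ht'S (hSclosed t htS t' ht'T hX ⟨g, hg2, hgt, hgt'⟩)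
    refine ⟨⟨t', ht'T, hgt', (Finset.mem_filter.1 (Finset.mem_sdiff.1 ht'X).1).2⟩,
      Or.inr ⟨t, hST htS, hgt, fun hup => htX ?_⟩⟩
    exact hXclosed t' ht'X t (Finset.mem_filter.2 ⟨hST htS, hup⟩) ⟨g, hg2, hgt', hgt⟩

end IsAnnulus

end LinkTheory

namespace LinkTheory

/-! ### Bisecting an edge of a complex -/

/-- The simplices replacing `t` when the edge `ab` is bisected at the new vertex `p`. -/
def children (a b p : ℕ) (t : Finset ℕ) : Finset (Finset ℕ) :=
  if a ∈ t ∧ b ∈ t then {insert p (t.erase b), insert p (t.erase a)} else {t}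

/-- The complex obtained by bisecting the edge `ab` at the new vertex `p`. -/
def bisect (a b p : ℕ) (C : Finset (Finset ℕ)) : Finset (Finset ℕ) := C.biUnion (children a b p)

section Bisect

variable {a b p : ℕ}

theorem mem_bisect {C : Finset (Finset ℕ)} {t' : Finset ℕ} :
    t' ∈ bisect a b p C ↔ ∃ t ∈ C, t' ∈ children a b p t := by simp [bisect]

/-- The simplex from which a simplex of the bisected complex arises. -/
def parent (a b p : ℕ) (t' : Finset ℕ) : Finset ℕ :=
  if p ∈ t' then insert a (insert b (t'.erase p)) else t'

theorem parent_of_mem_children {t t' : Finset ℕ} (hp : p ∉ t)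
    (ht : t' ∈ children a b p t) : parent a b p t' = t := by
  unfold children at ht
  split_ifs at ht with h
  · simp only [Finset.mem_insert, Finset.mem_singleton] at ht
    have hpa : p ≠ a := fun e => hp (e ▸ h.1)
    have hpb : p ≠ b := fun e => hp (e ▸ h.2)
    rcases ht with rfl | rfl
    · rw [parent, if_pos (Finset.mem_insert_self _ _)]
      ext v
      simp only [Finset.mem_insert, Finset.mem_erase]
      grind
    · rw [parent, if_pos (Finset.mem_insert_self _ _)]
      ext v
      simp only [Finset.mem_insert, Finset.mem_erase]
      grind
  · rw [Finset.mem_singleton] at ht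
    rw [ht, parent, if_neg hp]

theorem disjoint_children {C : Finset (Finset ℕ)} (hp : ∀ t ∈ C, p ∉ t) :
    (C : Set (Finset ℕ)).PairwiseDisjoint (children a b p) := by
  intro t ht t' ht' hne
  rw [Function.onFun, Finset.disjoint_left]
  intro s hs hs'
  exact hne ((parent_of_mem_children (hp t ht) hs).symm.trans
    (parent_of_mem_children (hp t' ht') hs'))

theorem bisect_eq_self {C : Finset (Finset ℕ)} (h : ∀ t ∈ C, ¬ (a ∈ t ∧ b ∈ t)) :
    bisect a b p C = C := by
  have : C.biUnion (children a b p) = C.biUnion fun t => {t} :=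
    Finset.biUnion_congr rfl fun t ht => by rw [children, if_neg (h t ht)]
  rw [bisect, this, Finset.biUnion_singleton_eq_self]

theorem children_ne {t : Finset ℕ} (hab : a ≠ b) (hp : p ∉ t) (ha : a ∈ t) :
    insert p (t.erase b) ≠ insert p (t.erase a) := by
  intro h
  have : a ∈ insert p (t.erase b) := by simp [ha, hab]
  rw [h] at this
  simp only [Finset.mem_insert, Finset.mem_erase, ne_eq, not_true_eq_false, false_and, or_false]
    at this
  exact hp (this ▸ ha)

theorem card_bisect {C : Finset (Finset ℕ)} (hab : a ≠ b) (hp : ∀ t ∈ C, p ∉ t) :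
    (bisect a b p C).card = C.card + (C.filter fun t => a ∈ t ∧ b ∈ t).card := by
  rw [bisect, Finset.card_biUnion (disjoint_children hp), Finset.card_filter,
    Finset.card_eq_sum_ones, ← Finset.sum_add_distrib]
  refine Finset.sum_congr rfl fun t ht => ?_
  unfold children
  split_ifs with h
  · rw [Finset.card_pair (children_ne hab (hp t ht) h.1)]
  · simp

theorem card_of_mem_children {t t' : Finset ℕ} (hp : p ∉ t) (ht : t' ∈ children a b p t) :
    t'.card = t.card := by
  unfold children at ht
  split_ifs at ht with h
  · simp only [Finset.mem_insert, Finset.mem_singleton] at ht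
    rcases ht with rfl | rfl
    · rw [Finset.card_insert_of_notMem (fun h' => hp (Finset.mem_of_mem_erase h')),
        Finset.card_erase_add_one h.2]
    · rw [Finset.card_insert_of_notMem (fun h' => hp (Finset.mem_of_mem_erase h')),
        Finset.card_erase_add_one h.1]
  · rw [Finset.mem_singleton] at ht
    rw [ht]

theorem eq_pair_of_mem {g : Finset ℕ} (hab : a ≠ b) (hg : g.card = 2) (ha : a ∈ g) (hb : b ∈ g) :
    g = {a, b} := by
  refine (Finset.eq_of_subset_of_card_le ?_ (by rw [hg, Finset.card_pair hab])).symm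
  simp [Finset.insert_subset_iff, ha, hb]

theorem bisect_edges {I : Finset (Finset ℕ)} (hab : a ≠ b)
    (hI : ∀ g ∈ I, g.card = 2) (h : {a, b} ∈ I) :
    bisect a b p I = insert {a, p} (insert {p, b} (I.erase {a, b})) := by
  have e1 : children a b p {a, b} = {{a, p}, {p, b}} := by
    rw [children, if_pos (by simp)]
    congr 1
    · ext v; simp only [Finset.mem_insert, Finset.mem_erase, Finset.mem_singleton]; grind
    · congr 1; ext v; simp only [Finset.mem_insert, Finset.mem_erase, Finset.mem_singleton]; grind
  have e2 : bisect a b p (I.erase {a, b}) = I.erase {a, b} := by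
    refine bisect_eq_self fun g hg hh => ?_
    obtain ⟨hg1, hg2⟩ := Finset.mem_erase.1 hg
    exact hg1 (eq_pair_of_mem hab (hI g hg2) hh.1 hh.2)
  rw [← Finset.insert_erase h]
  conv_lhs => rw [bisect, Finset.biUnion_insert, e1]
  rw [show Finset.biUnion (I.erase {a, b}) (children a b p) = I.erase {a, b} from e2]
  ext g
  simp only [Finset.mem_union, Finset.mem_insert, Finset.mem_singleton, Finset.mem_erase]
  tauto

theorem mem_bisect_edges {I : Finset (Finset ℕ)} (hab : a ≠ b)
    (hI : ∀ g ∈ I, g.card = 2) {g : Finset ℕ} :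
    g ∈ bisect a b p I ↔ ({a, b} ∈ I ∧ (g = {a, p} ∨ g = {p, b})) ∨ (g ∈ I ∧ g ≠ {a, b}) := by
  by_cases h : {a, b} ∈ I
  · rw [bisect_edges hab hI h]
    simp only [Finset.mem_insert, Finset.mem_erase]
    tauto
  · rw [bisect_eq_self fun g hg hh => h (eq_pair_of_mem hab (hI g hg) hh.1 hh.2 ▸ hg)]
    constructor
    · exact fun hg => Or.inr ⟨hg, fun e => h (e ▸ hg)⟩
    · rintro (h' | h')
      · exact absurd h'.1 h
      · exact h'.1

/-- The edge of the bisected complex that takes the role of `g`. -/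
def halfEdge (a b p : ℕ) (g : Finset ℕ) : Finset ℕ := if g = {a, b} then {a, p} else g

theorem card_halfEdge {g : Finset ℕ} (hpa : p ≠ a) (hg : g.card = 2) :
    (halfEdge a b p g).card = 2 := by
  unfold halfEdge
  split_ifs
  · exact Finset.card_pair hpa.symm
  · exact hg

/-- The half edge depends on `g` alone and not on `t`. Hence triangles sharing `g` have children
sharing `halfEdge a b p g`, and adjacency survives the bisection. -/
theorem exists_child_halfEdge {t g : Finset ℕ} (hab : a ≠ b) (hg : g.card = 2) (hgt : g ⊆ t) :
    ∃ t' ∈ children a b p t, halfEdge a b p g ⊆ t' := by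
  unfold halfEdge
  by_cases h : a ∈ t ∧ b ∈ t
  · rw [children, if_pos h]
    split_ifs with hgab
    · exact ⟨_, Finset.mem_insert_self _ _, by simp [Finset.insert_subset_iff, hab, h.1]⟩
    · by_cases hb : b ∈ g
      · have ha : a ∉ g := fun ha => hgab (eq_pair_of_mem hab hg ha hb)
        exact ⟨insert p (t.erase a), by simp, fun v hv => by
          simp only [Finset.mem_insert, Finset.mem_erase]
          exact Or.inr ⟨fun e => ha (e ▸ hv), hgt hv⟩⟩
      · exact ⟨_, Finset.mem_insert_self _ _, fun v hv => by
          simp only [Finset.mem_insert, Finset.mem_erase]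
          exact Or.inr ⟨fun e => hb (e ▸ hv), hgt hv⟩⟩
  · rw [children, if_neg h]
    refine ⟨t, Finset.mem_singleton_self t, ?_⟩
    rwa [if_neg]
    rintro rfl
    exact h ⟨hgt (by simp), hgt (by simp)⟩

theorem halfEdge_mem_bisect {I : Finset (Finset ℕ)} {g : Finset ℕ} (hab : a ≠ b) (hI : ∀ g ∈ I, g.card = 2) (hg : g ∈ I) : halfEdge a b p g ∈ bisect a b p I := by
  rw [mem_bisect_edges hab hI, halfEdge]
  split_ifs with h
  · exact Or.inl ⟨h ▸ hg, Or.inl rfl⟩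
  · exact Or.inr ⟨hg, h⟩

/-- The two halves of a split triangle share the edge from `p` to the third vertex. An unsplit
triangle shares any edge with itself. -/
theorem share_children {t s s' : Finset ℕ} (hp : p ∉ t) (ht : t.card = 3)
    (hs : s ∈ children a b p t) (hs' : s' ∈ children a b p t) (hab : a ≠ b) : ShareEdge s s' := by
  unfold children at hs hs'
  split_ifs at hs hs' with h
  · obtain ⟨c, hc⟩ : ∃ c, c ∈ (t.erase a).erase b := by
      refine Finset.card_pos.1 ?_
      rw [Finset.card_erase_of_mem (Finset.mem_erase.2 ⟨hab.symm, h.2⟩),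
        Finset.card_erase_of_mem h.1, ht]
      norm_num
    simp only [Finset.mem_erase] at hc
    refine ⟨{p, c}, Finset.card_pair fun e => hp (e ▸ hc.2.2), ?_, ?_⟩
    · simp only [Finset.mem_insert, Finset.mem_singleton] at hs
      rcases hs with rfl | rfl <;> simp [Finset.insert_subset_iff, hc]
    · simp only [Finset.mem_insert, Finset.mem_singleton] at hs'
      rcases hs' with rfl | rfl <;> simp [Finset.insert_subset_iff, hc]
  · rw [Finset.mem_singleton] at hs hs'
    obtain ⟨g, hgt, hg⟩ := Finset.exists_subset_card_eq (show 2 ≤ t.card by omega)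
    exact ⟨g, hg, hs ▸ hgt, hs' ▸ hgt⟩

theorem faceEdges_bisect {T : Finset (Finset ℕ)} (hab : a ≠ b) (hp : ∀ t ∈ T, p ∉ t)
    (hT : ∀ t ∈ T, t.card = 3) {g : Finset ℕ} :
    g ∈ faceEdges (bisect a b p T) ↔ g ∈ bisect a b p (faceEdges T) ∨
      ∃ c, g = {p, c} ∧ c ≠ a ∧ c ≠ b ∧ {a, b, c} ∈ T := by
  constructor
  · intro hg
    obtain ⟨hg2, t', ht', hgt⟩ := mem_faceEdges.1 hg
    obtain ⟨t, ht, htt'⟩ := mem_bisect.1 ht'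
    have hpt := hp t ht
    unfold children at htt'
    split_ifs at htt' with h
    · have hpa : p ≠ a := fun e => hpt (e ▸ h.1)
      have hpb : p ≠ b := fun e => hpt (e ▸ h.2)
      have hcard : ∀ g ∈ faceEdges T, g.card = 2 := fun g hg => (mem_faceEdges.1 hg).1
      have habT : {a, b} ∈ faceEdges T :=
        mem_faceEdges.2 ⟨Finset.card_pair hab, t, ht, by simp [Finset.insert_subset_iff, h]⟩
      have hsub : t' ⊆ insert p t ∧ ¬ (a ∈ t' ∧ b ∈ t') := by
        simp only [Finset.mem_insert, Finset.mem_singleton] at htt'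
        rcases htt' with rfl | rfl
        · refine ⟨Finset.insert_subset_insert _ (Finset.erase_subset _ _), fun h' => ?_⟩
          simpa [hpb.symm] using h'.2
        · refine ⟨Finset.insert_subset_insert _ (Finset.erase_subset _ _), fun h' => ?_⟩
          simpa [hpa.symm] using h'.1
      by_cases hpg : p ∈ g
      · obtain ⟨c, hpc, rfl⟩ : ∃ c, p ≠ c ∧ g = {p, c} := by
          obtain ⟨x, y, hxy, rfl⟩ := Finset.card_eq_two.1 hg2
          simp only [Finset.mem_insert, Finset.mem_singleton] at hpg
          rcases hpg with rfl | rfl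
          · exact ⟨y, hxy, rfl⟩
          · exact ⟨x, hxy.symm, Finset.pair_comm _ _⟩
        have hct : c ∈ t := by
          have := hsub.1 (hgt (show c ∈ ({p, c} : Finset ℕ) by simp))
          exact (Finset.mem_insert.1 this).resolve_left hpc.symm
        by_cases hca : c = a
        · subst hca
          exact Or.inl ((mem_bisect_edges hab hcard).2
            (Or.inl ⟨habT, Or.inl (Finset.pair_comm _ _)⟩))
        by_cases hcb : c = b
        · subst hcb
          exact Or.inl ((mem_bisect_edges hab hcard).2 (Or.inl ⟨habT, Or.inr rfl⟩))
        refine Or.inr ⟨c, rfl, hca, hcb, ?_⟩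
        have : ({a, b, c} : Finset ℕ) = t := by
          refine Finset.eq_of_subset_of_card_le ?_ ?_
          · simp [Finset.insert_subset_iff, h, hct]
          · rw [hT t ht, Finset.card_eq_three.2 ⟨a, b, c, hab, Ne.symm hca, Ne.symm hcb, rfl⟩]
        rwa [this]
      · left
        rw [mem_bisect_edges hab hcard]
        refine Or.inr ⟨mem_faceEdges.2 ⟨hg2, t, ht, fun v hv => ?_⟩, ?_⟩
        · exact (Finset.mem_insert.1 (hsub.1 (hgt hv))).resolve_left fun e => hpg (e ▸ hv)
        · rintro rfl
          exact hsub.2 ⟨hgt (by simp), hgt (by simp)⟩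
    · left
      rw [Finset.mem_singleton] at htt'
      subst htt'
      have hgT : g ∈ faceEdges T := mem_faceEdges.2 ⟨hg2, t', ht, hgt⟩
      refine mem_bisect.2 ⟨g, hgT, ?_⟩
      rw [children, if_neg fun h' => h ⟨hgt h'.1, hgt h'.2⟩]
      exact Finset.mem_singleton_self g
  · rintro (hg | ⟨c, rfl, hca, hcb, hc⟩)
    · obtain ⟨e, he, hge⟩ := mem_bisect.1 hg
      obtain ⟨he2, t, ht, het⟩ := mem_faceEdges.1 he
      have hpt := hp t ht
      refine mem_faceEdges.2 ⟨(card_of_mem_children (fun h => hpt (het h)) hge).trans he2, ?_⟩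
      unfold children at hge
      split_ifs at hge with h
      · have hch : children a b p t = {insert p (t.erase b), insert p (t.erase a)} := by
          rw [children, if_pos ⟨het h.1, het h.2⟩]
        simp only [Finset.mem_insert, Finset.mem_singleton] at hge
        rcases hge with rfl | rfl
        · exact ⟨insert p (t.erase b), mem_bisect.2 ⟨t, ht, by rw [hch]; simp⟩,
            Finset.insert_subset_insert _ (Finset.erase_subset_erase _ het)⟩
        · exact ⟨insert p (t.erase a), mem_bisect.2 ⟨t, ht, by rw [hch]; simp⟩,
            Finset.insert_subset_insert _ (Finset.erase_subset_erase _ het)⟩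
      · rw [Finset.mem_singleton] at hge
        subst hge
        obtain ⟨t', ht', hgt'⟩ := exists_child_halfEdge (p := p) hab he2 het
        refine ⟨t', mem_bisect.2 ⟨t, ht, ht'⟩, ?_⟩
        rwa [halfEdge, if_neg] at hgt'
        rintro rfl
        exact h (by simp)
    · have hpt := hp _ hc
      simp only [Finset.mem_insert, Finset.mem_singleton, not_or] at hpt
      refine mem_faceEdges.2 ⟨Finset.card_pair hpt.2.2, insert p (({a, b, c} : Finset ℕ).erase b),
        mem_bisect.2 ⟨_, hc, ?_⟩, ?_⟩
      · rw [children, if_pos (by simp)]; simp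
      · simp [Finset.insert_subset_iff, hcb]

theorem card_filter_bisect {T : Finset (Finset ℕ)} (hp : ∀ t ∈ T, p ∉ t) (g : Finset ℕ) :
    ((bisect a b p T).filter (g ⊆ ·)).card =
      ∑ t ∈ T, ((children a b p t).filter (g ⊆ ·)).card := by
  rw [bisect, Finset.filter_biUnion, Finset.card_biUnion]
  intro t ht t' ht' hne
  exact (disjoint_children hp ht ht' hne).mono (Finset.filter_subset _ _) (Finset.filter_subset _ _)

/-- Since `t` has three vertices, an edge of `t` other than `ab` contains exactly one of `a` and
`b`, and so lies in exactly one half. -/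
theorem card_filter_children_old {t g : Finset ℕ} (hab : a ≠ b) (ht : t.card = 3)
    (hpg : p ∉ g) (hg : g.card = 2) (hgab : g ≠ {a, b}) :
    ((children a b p t).filter (g ⊆ ·)).card = if g ⊆ t then 1 else 0 := by
  have hsub : ∀ s : Finset ℕ, g ⊆ insert p s ↔ g ⊆ s := fun s =>
    Finset.subset_insert_iff_of_notMem hpg
  have her : ∀ x, g ⊆ t.erase x ↔ g ⊆ t ∧ x ∉ g := fun x => Finset.subset_erase
  unfold children
  split_ifs with h hgt hgt
  · simp only [Finset.filter_insert, Finset.filter_singleton, hsub, her]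
    by_cases hb : b ∈ g
    · have ha : a ∉ g := fun ha => hgab (eq_pair_of_mem hab hg ha hb)
      simp [ha, hb, hgt]
    · by_cases ha : a ∈ g
      · simp [ha, hb, hgt]
      · exfalso
        have hle : ({a, b} ∪ g : Finset ℕ).card ≤ t.card :=
          Finset.card_le_card (Finset.union_subset (by simp [Finset.insert_subset_iff, h]) hgt)
        rw [Finset.card_union_of_disjoint (by
          rw [Finset.disjoint_left]; intro x hx hxg
          simp only [Finset.mem_insert, Finset.mem_singleton] at hx
          rcases hx with rfl | rfl
          · exact ha hxg
          · exact hb hxg), Finset.card_pair hab, hg, ht] at hle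
        omega
  · simp only [Finset.filter_insert, Finset.filter_singleton, hsub, her]
    simp [hgt]
  · rw [Finset.filter_singleton, if_pos hgt]; rfl
  · rw [Finset.filter_singleton, if_neg hgt]; rfl

theorem card_filter_children_half {t g : Finset ℕ} (hab : a ≠ b) (hpt : p ∉ t)
    (hpa : p ≠ a) (hpb : p ≠ b) (hg : g = {a, p} ∨ g = {p, b}) :
    ((children a b p t).filter (g ⊆ ·)).card = if {a, b} ⊆ t then 1 else 0 := by
  unfold children
  rcases hg with rfl | rfl <;> split_ifs with h h' h' <;>
    simp_all [Finset.filter_insert, Finset.filter_singleton, Finset.insert_subset_iff, hpa.symm,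
      hpb.symm, hab.symm]

theorem card_filter_children_new {t : Finset ℕ} {c : ℕ} (hab : a ≠ b) (hpt : p ∉ t)
    (hca : c ≠ a) (hcb : c ≠ b) (hcp : c ≠ p) :
    ((children a b p t).filter ({p, c} ⊆ ·)).card = if {a, b, c} ⊆ t then 2 else 0 := by
  unfold children
  by_cases h : a ∈ t ∧ b ∈ t
  · rw [if_pos h]
    simp only [Finset.filter_insert, Finset.filter_singleton, Finset.insert_subset_iff,
      Finset.singleton_subset_iff, Finset.mem_insert, Finset.mem_erase, true_or, true_and, hcp,
      false_or, hca, hcb, ne_eq, not_false_eq_true, h]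
    split_ifs
    · exact Finset.card_pair (children_ne hab hpt h.1)
    · rfl
  · rw [if_neg h, if_neg (fun h' => h ⟨h' (by simp), h' (by simp)⟩), Finset.filter_singleton,
      if_neg fun h' => hpt (h' (by simp))]
    rfl

variable {T I O : Finset (Finset ℕ)}

theorem incidence_bisect_old (hab : a ≠ b) (hp : ∀ t ∈ T, p ∉ t)
    (hT : ∀ t ∈ T, t.card = 3) (hI : ∀ g ∈ I, g.card = 2) {g : Finset ℕ} (hg : g.card = 2)
    (hpg : p ∉ g) (hgab : g ≠ {a, b}) :
    incidence (bisect a b p I) (bisect a b p T) g = incidence I T g := by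
  have : g ∈ bisect a b p I ↔ g ∈ I := by
    rw [mem_bisect_edges hab hI]
    constructor
    · rintro (⟨-, rfl | rfl⟩ | h)
      · simp at hpg
      · simp at hpg
      · exact h.1
    · exact fun h => Or.inr ⟨h, hgab⟩
  unfold incidence
  rw [card_filter_bisect hp, Finset.sum_congr rfl fun t ht =>
    card_filter_children_old hab (hT t ht) hpg hg hgab, ← Finset.card_filter]
  simp only [this]

theorem mem_bisect_half (hab : a ≠ b) (hI : ∀ g ∈ I, g.card = 2)
    (hpI : ∀ g ∈ I, p ∉ g) {g : Finset ℕ} (hg : g = {a, p} ∨ g = {p, b}) :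
    g ∈ bisect a b p I ↔ {a, b} ∈ I := by
  rw [mem_bisect_edges hab hI]
  constructor
  · rintro (h | h)
    · exact h.1
    · exact absurd (by rcases hg with rfl | rfl <;> simp) (hpI g h.1)
  · exact fun h => Or.inl ⟨h, hg⟩

theorem incidence_bisect_half (hab : a ≠ b) (hpa : p ≠ a) (hpb : p ≠ b) (hp : ∀ t ∈ T, p ∉ t)
    (hI : ∀ g ∈ I, g.card = 2) (hpI : ∀ g ∈ I, p ∉ g) {g : Finset ℕ}
    (hg : g = {a, p} ∨ g = {p, b}) :
    incidence (bisect a b p I) (bisect a b p T) g = incidence I T {a, b} := by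
  unfold incidence
  rw [card_filter_bisect hp, Finset.sum_congr rfl fun t ht =>
    card_filter_children_half hab (hp t ht) hpa hpb hg, ← Finset.card_filter]
  simp only [mem_bisect_half hab hI hpI hg]

theorem notMem_bisect_new (hab : a ≠ b) (hI : ∀ g ∈ I, g.card = 2)
    (hpI : ∀ g ∈ I, p ∉ g) {c : ℕ} (hca : c ≠ a) (hcb : c ≠ b) : {p, c} ∉ bisect a b p I := by
  rw [mem_bisect_edges hab hI]
  rintro (⟨-, h | h⟩ | h)
  · rw [pair_eq_pair_iff] at h; omega
  · rw [pair_eq_pair_iff] at h; omega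
  · exact hpI _ h.1 (by simp)

theorem incidence_bisect_new (hab : a ≠ b) (hp : ∀ t ∈ T, p ∉ t)
    (hT : ∀ t ∈ T, t.card = 3) (hI : ∀ g ∈ I, g.card = 2) (hpI : ∀ g ∈ I, p ∉ g) {c : ℕ}
    (hca : c ≠ a) (hcb : c ≠ b) (hcp : c ≠ p) (hc : {a, b, c} ∈ T) :
    incidence (bisect a b p I) (bisect a b p T) {p, c} = 2 := by
  unfold incidence
  rw [card_filter_bisect hp, Finset.sum_congr rfl fun t ht =>
    card_filter_children_new hab (hp t ht) hca hcb hcp,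
    if_neg (notMem_bisect_new hab hI hpI hca hcb),
    Finset.sum_eq_single_of_mem _ hc, if_pos (Finset.Subset.refl _)]
  intro t ht hne
  rw [if_neg]
  intro hsub
  refine hne (Finset.eq_of_subset_of_card_le hsub ?_).symm
  rw [hT t ht, hT _ hc]

theorem card_verts_bisect_inner (hab : a ≠ b) (hpa : p ≠ a) (hpb : p ≠ b)
    (hI : ∀ g ∈ I, g.card = 2) (hpI : ∀ g ∈ I, p ∉ g) (h : (verts I).card = I.card) :
    (verts (bisect a b p I)).card = (bisect a b p I).card := by
  by_cases habI : {a, b} ∈ I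
  · have hv : verts (bisect a b p I) = insert p (verts I) := by
      ext v
      simp only [mem_verts, Finset.mem_insert, mem_bisect_edges hab hI]
      constructor
      · rintro ⟨g, ⟨-, rfl | rfl⟩ | ⟨hg, -⟩, hv⟩
        · simp only [Finset.mem_insert, Finset.mem_singleton] at hv
          rcases hv with rfl | rfl
          · exact Or.inr ⟨_, habI, by simp⟩
          · exact Or.inl rfl
        · simp only [Finset.mem_insert, Finset.mem_singleton] at hv
          rcases hv with rfl | rfl
          · exact Or.inl rfl
          · exact Or.inr ⟨_, habI, by simp⟩
        · exact Or.inr ⟨g, hg, hv⟩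
      · rintro (rfl | ⟨g, hg, hv⟩)
        · exact ⟨{a, v}, Or.inl ⟨habI, Or.inl rfl⟩, by simp⟩
        · by_cases hgab : g = {a, b}
          · subst hgab
            simp only [Finset.mem_insert, Finset.mem_singleton] at hv
            rcases hv with rfl | rfl
            · exact ⟨{v, p}, Or.inl ⟨habI, Or.inl rfl⟩, by simp⟩
            · exact ⟨{p, v}, Or.inl ⟨habI, Or.inr rfl⟩, by simp⟩
          · exact ⟨g, Or.inr ⟨hg, hgab⟩, hv⟩
    have hf : I.filter (fun t => a ∈ t ∧ b ∈ t) = {{a, b}} := by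
      ext g
      simp only [Finset.mem_filter, Finset.mem_singleton]
      constructor
      · exact fun hg => eq_pair_of_mem hab (hI g hg.1) hg.2.1 hg.2.2
      · rintro rfl; exact ⟨habI, by simp⟩
    rw [hv, card_bisect hab hpI, hf, Finset.card_insert_of_notMem, h, Finset.card_singleton]
    intro hpv
    obtain ⟨g, hg, hpg⟩ := mem_verts.1 hpv
    exact hpI g hg hpg
  · rwa [bisect_eq_self fun g hg hh => habI (eq_pair_of_mem hab (hI g hg) hh.1 hh.2 ▸ hg)]

/-- If `k` triangles contain `ab`, there is one new vertex, the number of edges grows by `1 + k` and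
the number of triangles by `k`. -/
theorem euler_bisect (hab : a ≠ b) (hpa : p ≠ a) (hpb : p ≠ b) (hp : ∀ t ∈ T, p ∉ t)
    (hT : ∀ t ∈ T, t.card = 3) (habT : {a, b} ∈ faceEdges T)
    (h : ((verts (faceEdges T)).card : ℤ) - (faceEdges T).card + T.card = 0) :
    ((verts (faceEdges (bisect a b p T))).card : ℤ) - (faceEdges (bisect a b p T)).card +
      (bisect a b p T).card = 0 := by
  have hE2 : ∀ g ∈ faceEdges T, g.card = 2 := fun g hg => (mem_faceEdges.1 hg).1
  have hEp : ∀ g ∈ faceEdges T, p ∉ g := fun g hg hpg => by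
    obtain ⟨-, t, ht, hgt⟩ := mem_faceEdges.1 hg
    exact hp t ht (hgt hpg)
  set F := T.filter fun t => a ∈ t ∧ b ∈ t with hF
  have hedges : faceEdges (bisect a b p T) =
      bisect a b p (faceEdges T) ∪ F.image fun t => insert p ((t.erase a).erase b) := by
    ext g
    rw [faceEdges_bisect hab hp hT, Finset.mem_union, Finset.mem_image]
    refine or_congr_right ⟨?_, ?_⟩
    · rintro ⟨c, rfl, hca, hcb, hc⟩
      refine ⟨_, Finset.mem_filter.2 ⟨hc, by simp⟩, ?_⟩
      congr 1
      ext v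
      simp only [Finset.mem_erase, Finset.mem_insert, Finset.mem_singleton]
      grind
    · rintro ⟨t, ht, rfl⟩
      obtain ⟨htT, ha, hb⟩ := Finset.mem_filter.1 ht
      obtain ⟨c, hc⟩ : ∃ c, (t.erase a).erase b = {c} := by
        rw [← Finset.card_eq_one, Finset.card_erase_of_mem (Finset.mem_erase.2 ⟨hab.symm, hb⟩),
          Finset.card_erase_of_mem ha, hT t htT]
      have hc' : c ∈ (t.erase a).erase b := by rw [hc]; exact Finset.mem_singleton_self c
      simp only [Finset.mem_erase] at hc'
      refine ⟨c, by rw [hc], hc'.2.1, hc'.1, ?_⟩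
      have : ({a, b, c} : Finset ℕ) = t := by
        rw [← Finset.insert_erase ha, ← Finset.insert_erase (Finset.mem_erase.2 ⟨hab.symm, hb⟩), hc]
      rwa [this]
  have hdisj : Disjoint (bisect a b p (faceEdges T))
      (F.image fun t => insert p ((t.erase a).erase b)) := by
    rw [Finset.disjoint_left]
    intro g hg hg'
    obtain ⟨t, -, rfl⟩ := Finset.mem_image.1 hg'
    rw [mem_bisect_edges hab hE2] at hg
    rcases hg with ⟨-, h' | h'⟩ | h'
    · have : a ∈ insert p ((t.erase a).erase b) := by rw [h']; simp
      simp [hpa.symm] at this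
    · have : b ∈ insert p ((t.erase a).erase b) := by rw [h']; simp
      simp [hpb.symm] at this
    · exact hEp _ h'.1 (by simp)
  have hcardF : (F.image fun t => insert p ((t.erase a).erase b)).card = F.card := by
    refine Finset.card_image_of_injOn fun t ht t' ht' heq => ?_
    obtain ⟨htT, ha, hb⟩ := Finset.mem_filter.1 ht
    obtain ⟨htT', ha', hb'⟩ := Finset.mem_filter.1 ht'
    have h1 : p ∉ (t.erase a).erase b := fun h => hp t htT (by simp at h; exact h.2.2)
    have h2 : p ∉ (t'.erase a).erase b := fun h => hp t' htT' (by simp at h; exact h.2.2)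
    have h3 : (t.erase a).erase b = (t'.erase a).erase b := by
      have := congrArg (fun s : Finset ℕ => s.erase p) heq
      simpa [Finset.erase_insert h1, Finset.erase_insert h2] using this
    rw [← Finset.insert_erase ha, ← Finset.insert_erase (Finset.mem_erase.2 ⟨hab.symm, hb⟩), h3,
      Finset.insert_erase (Finset.mem_erase.2 ⟨hab.symm, hb'⟩), Finset.insert_erase ha']
  have hfab : (faceEdges T).filter (fun t => a ∈ t ∧ b ∈ t) = {{a, b}} := by
    ext g
    simp only [Finset.mem_filter, Finset.mem_singleton]
    constructor
    · exact fun hg => eq_pair_of_mem hab (hE2 g hg.1) hg.2.1 hg.2.2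
    · rintro rfl; exact ⟨habT, by simp⟩
  have hverts : verts (faceEdges (bisect a b p T)) = insert p (verts (faceEdges T)) := by
    ext v
    simp only [mem_verts, Finset.mem_insert]
    constructor
    · rintro ⟨g, hg, hvg⟩
      by_cases hvp : v = p
      · exact Or.inl hvp
      right
      rw [faceEdges_bisect hab hp hT] at hg
      rcases hg with hg | ⟨c, rfl, hca, hcb, hc⟩
      · rw [mem_bisect_edges hab hE2] at hg
        rcases hg with ⟨-, rfl | rfl⟩ | hg
        · exact ⟨_, habT, by simp_all⟩
        · exact ⟨_, habT, by simp_all⟩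
        · exact ⟨g, hg.1, hvg⟩
      · refine ⟨{a, c}, mem_faceEdges.2 ⟨Finset.card_pair hca.symm, _, hc, ?_⟩, by simp_all⟩
        simp [Finset.insert_subset_iff]
    · rintro (rfl | ⟨g, hg, hvg⟩)
      · exact ⟨{a, v}, (faceEdges_bisect hab hp hT).2
          (Or.inl ((mem_bisect_edges hab hE2).2 (Or.inl ⟨habT, Or.inl rfl⟩))), by simp⟩
      · by_cases hgab : g = {a, b}
        · subst hgab
          simp only [Finset.mem_insert, Finset.mem_singleton] at hvg
          rcases hvg with rfl | rfl
          · exact ⟨{v, p}, (faceEdges_bisect hab hp hT).2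
              (Or.inl ((mem_bisect_edges hab hE2).2 (Or.inl ⟨habT, Or.inl rfl⟩))), by simp⟩
          · exact ⟨{p, v}, (faceEdges_bisect hab hp hT).2
              (Or.inl ((mem_bisect_edges hab hE2).2 (Or.inl ⟨habT, Or.inr rfl⟩))), by simp⟩
        · exact ⟨g, (faceEdges_bisect hab hp hT).2
            (Or.inl ((mem_bisect_edges hab hE2).2 (Or.inr ⟨hg, hgab⟩))), hvg⟩
  have hpv : p ∉ verts (faceEdges T) := fun hpv => by
    obtain ⟨g, hg, hpg⟩ := mem_verts.1 hpv
    exact hEp g hg hpg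
  rw [hverts, hedges, Finset.card_insert_of_notMem hpv, Finset.card_union_of_disjoint hdisj,
    hcardF, card_bisect hab hEp, hfab, card_bisect hab hp, Finset.card_singleton]
  push_cast
  linarith

theorem exists_touches_bisect (hab : a ≠ b)
    (hI : ∀ g ∈ I, g.card = 2) {t : Finset ℕ} (ht : Touches I t) :
    ∃ t' ∈ children a b p t, Touches (bisect a b p I) t' := by
  obtain ⟨g, hg, hgt⟩ := ht
  obtain ⟨t', ht', hgt'⟩ := exists_child_halfEdge (p := p) hab (hI g hg) hgt
  exact ⟨t', ht', _, halfEdge_mem_bisect hab hI hg, hgt'⟩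

/-- The parents of a family of simplices of the bisected complex that is closed under
adjacency. -/
theorem closedIn_parents (hab : a ≠ b) (hpa : p ≠ a) (hp : ∀ t ∈ T, p ∉ t)
    (hT : ∀ t ∈ T, t.card = 3) {U W : Finset (Finset ℕ)} (hU : U ⊆ T)
    {U' : Finset (Finset ℕ)} (hUU : ∀ t ∈ U, children a b p t ⊆ U')
    (hW : ClosedIn ShareEdge U' W) :
    ClosedIn ShareEdge U (U.filter fun t => ∃ s ∈ children a b p t, s ∈ W) ∧
      ∀ t ∈ U.filter (fun t => ∃ s ∈ children a b p t, s ∈ W), children a b p t ⊆ W := by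
  have hall : ∀ t ∈ U.filter (fun t => ∃ s ∈ children a b p t, s ∈ W), children a b p t ⊆ W := by
    intro t ht s' hs'
    obtain ⟨htU, s, hs, hsW⟩ := Finset.mem_filter.1 ht
    exact hW.2 s hsW s' (hUU t htU hs') (share_children (hp t (hU htU)) (hT t (hU htU)) hs hs' hab)
  refine ⟨⟨Finset.filter_subset _ _, fun s hs t ht hst => ?_⟩, hall⟩
  obtain ⟨g, hg, hgs, hgt⟩ := hst
  obtain ⟨s', hs', hgs'⟩ := exists_child_halfEdge (p := p) hab hg hgs
  obtain ⟨t', ht', hgt'⟩ := exists_child_halfEdge (p := p) hab hg hgt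
  exact Finset.mem_filter.2 ⟨ht, t', ht', hW.2 s' (hall s hs hs') t' (hUU t ht ht')
    ⟨_, card_halfEdge hpa hg, hgs', hgt'⟩⟩

/-- Incidences are checked separately for old edges, the halves of `ab`, and the new edges at `p`.
The connectedness conditions are pulled back to the parents. Only the removal of a single half of a
split triangle needs an extra argument. -/
theorem IsAnnulus.bisect (h : IsAnnulus T I O) (hab : a ≠ b) (habT : {a, b} ∈ faceEdges T)
    (hp : ∀ t ∈ T, p ∉ t) :
    IsAnnulus (bisect a b p T) (LinkTheory.bisect a b p I) (LinkTheory.bisect a b p O) := by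
  have hT := h.card_tri
  have hmemp : ∀ {C : Finset (Finset ℕ)}, C ⊆ faceEdges T → ∀ g ∈ C, g.card = 2 ∧ p ∉ g := by
    intro C hC g hg
    obtain ⟨h2, t, ht, hgt⟩ := mem_faceEdges.1 (hC hg)
    exact ⟨h2, fun hpg => hp t ht (hgt hpg)⟩
  have hI : ∀ g ∈ I, g.card = 2 := fun g hg => (hmemp h.inner_subset g hg).1
  have hpI : ∀ g ∈ I, p ∉ g := fun g hg => (hmemp h.inner_subset g hg).2
  have hO : ∀ g ∈ O, g.card = 2 := fun g hg => (hmemp h.outer_subset g hg).1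
  have hpO : ∀ g ∈ O, p ∉ g := fun g hg => (hmemp h.outer_subset g hg).2
  have hE : ∀ g ∈ faceEdges T, g.card = 2 := fun g hg => (mem_faceEdges.1 hg).1
  have hpab := (hmemp (Finset.Subset.refl _) _ habT).2
  simp only [Finset.mem_insert, Finset.mem_singleton, not_or] at hpab
  have hpa : p ≠ a := hpab.1
  have hpb : p ≠ b := hpab.2
  have hmono : ∀ {C : Finset (Finset ℕ)}, C ⊆ faceEdges T →
      LinkTheory.bisect a b p C ⊆ faceEdges (LinkTheory.bisect a b p T) := by
    intro C hC g hg
    refine (faceEdges_bisect hab hp hT).2 (Or.inl ?_)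
    obtain ⟨e, he, hge⟩ := mem_bisect.1 hg
    exact mem_bisect.2 ⟨e, hC he, hge⟩
  have hchild : ∀ t ∈ T, children a b p t ⊆ LinkTheory.bisect a b p T := fun t ht s hs =>
    mem_bisect.2 ⟨t, ht, hs⟩
  have hne : ∀ {W : Finset (Finset ℕ)}, W ⊆ LinkTheory.bisect a b p T → W.Nonempty →
      (T.filter fun t => ∃ s ∈ children a b p t, s ∈ W).Nonempty := by
    rintro W hW ⟨s, hs⟩
    obtain ⟨t, ht, hst⟩ := mem_bisect.1 (hW hs)
    exact ⟨t, Finset.mem_filter.2 ⟨ht, s, hst, hs⟩⟩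
  have hconn : ∀ {J : Finset (Finset ℕ)}, (∀ g ∈ J, g.card = 2) →
      (∀ W, ClosedIn ShareEdge T W → W.Nonempty → ∃ w ∈ W, Touches J w) →
      ∀ W, ClosedIn ShareEdge (LinkTheory.bisect a b p T) W → W.Nonempty →
        ∃ w ∈ W, Touches (LinkTheory.bisect a b p J) w := by
    intro J hJ hc W hW hWne
    obtain ⟨hcl, hall⟩ := closedIn_parents hab hpa hp hT (Finset.Subset.refl T) hchild hW
    obtain ⟨t, ht, htJ⟩ := hc _ hcl (hne hW.1 hWne)
    obtain ⟨s, hs, hsJ⟩ := exists_touches_bisect hab hJ htJ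
    exact ⟨s, hall t ht hs, hsJ⟩
  refine ⟨?_, hmono h.inner_subset, hmono h.outer_subset, ?_, ?_,
    card_verts_bisect_inner hab hpa hpb hI hpI h.inner_card,
    euler_bisect hab hpa hpb hp hT habT h.euler, hconn hI h.conn_inner, hconn hO h.conn_outer, ?_⟩
  · intro t' ht'
    obtain ⟨t, ht, htt'⟩ := mem_bisect.1 ht'
    exact (card_of_mem_children (hp t ht) htt').trans (hT t ht)
  · intro g hg
    rcases (faceEdges_bisect hab hp hT).1 hg with hg' | ⟨c, rfl, hca, hcb, hc⟩
    · rcases (mem_bisect_edges hab hE).1 hg' with ⟨-, hg'⟩ | ⟨hg', hgab⟩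
      · rw [incidence_bisect_half hab hpa hpb hp hI hpI hg']
        simp only [mem_bisect_half hab hO hpO hg']
        exact h.incidence_eq _ habT
      · have hpg := (hmemp (Finset.Subset.refl _) g hg').2
        rw [incidence_bisect_old hab hp hT hI (hE g hg') hpg hgab]
        have : g ∈ LinkTheory.bisect a b p O ↔ g ∈ O := by
          rw [mem_bisect_edges hab hO]
          constructor
          · rintro (⟨-, rfl | rfl⟩ | h)
            · simp at hpg
            · simp at hpg
            · exact h.1
          · exact fun h => Or.inr ⟨h, hgab⟩
        simp only [this]
        exact h.incidence_eq g hg'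
    · have hcp : c ≠ p := fun e => hp _ hc (by simp [e])
      rw [incidence_bisect_new hab hp hT hI hpI hca hcb hcp hc,
        if_neg (notMem_bisect_new hab hO hpO hca hcb)]
  · by_cases habI : {a, b} ∈ I
    · refine h.inner_regular.curveMove (a := a) (b := b) (c := p) ⟨hab, hpa.symm, hpb.symm, habI, ?_,
        bisect_edges hab hI habI⟩
      intro hpv
      obtain ⟨g, hg, hpg⟩ := mem_verts.1 hpv
      exact hpI g hg hpg
    · rw [bisect_eq_self fun g hg hh => habI (eq_pair_of_mem hab (hI g hg) hh.1 hh.2 ▸ hg)]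
      exact h.inner_regular
  · intro r W hW hWne
    by_cases hr : r ∈ LinkTheory.bisect a b p T
    swap
    · rw [Finset.erase_eq_of_notMem hr] at hW
      obtain ⟨w, hw, hwI⟩ := hconn hI h.conn_inner W hW hWne
      exact ⟨w, hw, Or.inl hwI⟩
    obtain ⟨t₀, ht₀, hrt₀⟩ := mem_bisect.1 hr
    have huniq : ∀ t ∈ T, ∀ s ∈ children a b p t, s = r → t = t₀ := by
      rintro t ht s hs rfl
      rw [← parent_of_mem_children (hp t ht) hs, ← parent_of_mem_children (hp t₀ ht₀) hrt₀]
    have hchild' : ∀ t ∈ T.erase t₀, children a b p t ⊆ (LinkTheory.bisect a b p T).erase r := by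
      intro t ht s hs
      obtain ⟨htne, htT⟩ := Finset.mem_erase.1 ht
      exact Finset.mem_erase.2 ⟨fun e => htne (huniq t htT s hs e), hchild t htT hs⟩
    obtain ⟨hcl, hall⟩ := closedIn_parents hab hpa hp hT (Finset.erase_subset t₀ T) hchild' hW
    by_cases hne' : ((T.erase t₀).filter fun t => ∃ s ∈ children a b p t, s ∈ W).Nonempty
    · obtain ⟨t, ht, htJ⟩ := h.conn_erase t₀ _ hcl hne'
      rcases htJ with htJ | htJ
      · obtain ⟨s, hs, hsJ⟩ := exists_touches_bisect hab hI htJ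
        exact ⟨s, hall t ht hs, Or.inl hsJ⟩
      · obtain ⟨s, hs, hsJ⟩ := exists_touches_bisect hab hO htJ
        exact ⟨s, hall t ht hs, Or.inr hsJ⟩
    -- Here `W` contains only children of the parent of `r`, so `s` is the other half, and it
    -- carries one half of `ab`. Either that is a boundary edge, or the triangle across `ab`
    -- contributes an adjacent child to `W`, a contradiction.
    obtain ⟨s, hs⟩ := hWne
    obtain ⟨hsr, hsT⟩ := Finset.mem_erase.1 (hW.1 hs)
    obtain ⟨t, ht, hst⟩ := mem_bisect.1 hsT
    have htt₀ : t = t₀ := by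
      by_contra htne
      exact hne' ⟨t, Finset.mem_filter.2 ⟨Finset.mem_erase.2 ⟨htne, ht⟩, s, hst, hs⟩⟩
    subst htt₀
    have habt : a ∈ t ∧ b ∈ t := by
      by_contra hn
      rw [children, if_neg hn, Finset.mem_singleton] at hst hrt₀
      exact hsr (hst.trans hrt₀.symm)
    obtain ⟨g, hg, hgs⟩ : ∃ g : Finset ℕ, (g = {a, p} ∨ g = {p, b}) ∧ g ⊆ s := by
      rw [children, if_pos habt, Finset.mem_insert, Finset.mem_singleton] at hst
      rcases hst with rfl | rfl
      · exact ⟨{a, p}, Or.inl rfl, by simp [Finset.insert_subset_iff, habt, hab]⟩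
      · exact ⟨{p, b}, Or.inr rfl, by simp [Finset.insert_subset_iff, habt, hab.symm]⟩
    have hinc := h.incidence_eq _ habT
    by_cases habI : {a, b} ∈ I
    · exact ⟨s, hs, Or.inl ⟨g, (mem_bisect_half hab hI hpI hg).2 habI, hgs⟩⟩
    by_cases habO : {a, b} ∈ O
    · exact ⟨s, hs, Or.inr ⟨g, (mem_bisect_half hab hO hpO hg).2 habO, hgs⟩⟩
    exfalso
    rw [incidence, if_neg habI, if_neg habO, add_zero, add_zero] at hinc
    obtain ⟨u, hu, hut⟩ := Finset.exists_mem_ne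
      (by omega : 1 < (T.filter (({a, b} : Finset ℕ) ⊆ ·)).card) t
    obtain ⟨huT, hu⟩ := Finset.mem_filter.1 hu
    have ha : a ∈ u := hu (by simp)
    have hb : b ∈ u := hu (by simp)
    obtain ⟨s', hs', hgs'⟩ : ∃ s' ∈ children a b p u, g ⊆ s' := by
      rw [children, if_pos ⟨ha, hb⟩]
      rcases hg with rfl | rfl
      · exact ⟨insert p (u.erase b), by simp, by simp [Finset.insert_subset_iff, ha, hab]⟩
      · exact ⟨insert p (u.erase a), by simp, by simp [Finset.insert_subset_iff, hb, hab.symm]⟩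
    have hu' : u ∈ T.erase t := Finset.mem_erase.2 ⟨hut, huT⟩
    have hg2 : g.card = 2 := by
      rcases hg with rfl | rfl
      · exact Finset.card_pair hpa.symm
      · exact Finset.card_pair hpb
    exact hne' ⟨u, Finset.mem_filter.2 ⟨hu', s', hs', hW.2 s hs s' (hchild' u hu' hs')
      ⟨g, hg2, hgs, hgs'⟩⟩⟩

end Bisect
end LinkTheory

namespace LinkTheory

/-! ### Geometric complexes -/

/-- The barycentric weights of the points of the simplex `t`. -/
def Bary (t : Finset ℕ) (w : ℕ →₀ ℝ) : Prop :=
  (∀ v, 0 ≤ w v) ∧ w.support ⊆ t ∧ Finsupp.linearCombination ℝ (fun _ => (1 : ℝ)) w = 1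

section Cell

variable {X : Type*} [AddCommGroup X] [Module ℝ X]

/-- The point with given barycentric weights. -/
noncomputable abbrev bpt (pos : ℕ → X) : (ℕ →₀ ℝ) →ₗ[ℝ] X := Finsupp.linearCombination ℝ pos

/-- The simplex spanned by the positions of the elements of `t`. -/
def cell (pos : ℕ → X) (t : Finset ℕ) : Set X := bpt pos '' {w | Bary t w}

/-- The simplices of `T`, with vertices at `pos`, meet along common faces. -/
def GeomInj (T : Finset (Finset ℕ)) (pos : ℕ → X) : Prop :=
  ∀ s ∈ T, ∀ t ∈ T, ∀ w w', Bary s w → Bary t w' → bpt pos w = bpt pos w' → w = w'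

theorem Bary.single {t : Finset ℕ} {v : ℕ} (hv : v ∈ t) : Bary t (Finsupp.single v 1) := by
  refine ⟨fun u => ?_, Finsupp.support_single_subset.trans (by simpa using hv), by simp⟩
  rw [Finsupp.single_apply]
  split_ifs <;> norm_num

theorem Bary.mono {s t : Finset ℕ} {w : ℕ →₀ ℝ} (h : Bary s w) (hst : s ⊆ t) : Bary t w :=
  ⟨h.1, h.2.1.trans hst, h.2.2⟩

theorem convex_setOf_bary (t : Finset ℕ) : Convex ℝ {w | Bary t w} := by
  rintro w hw w' hw' a b ha hb hab
  refine ⟨fun v => ?_, ?_, ?_⟩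
  · have := hw.1 v
    have := hw'.1 v
    simp only [Finsupp.add_apply, Finsupp.smul_apply, smul_eq_mul]
    positivity
  · exact Finsupp.support_add.trans (Finset.union_subset (Finsupp.support_smul.trans hw.2.1)
      (Finsupp.support_smul.trans hw'.2.1))
  · rw [map_add, map_smul, map_smul, hw.2.2, hw'.2.2]
    simpa using hab

theorem Bary.bpt_eq_sum {t : Finset ℕ} {w : ℕ →₀ ℝ} (hw : Bary t w) (pos : ℕ → X) :
    bpt pos w = ∑ v ∈ t, w v • pos v := by
  rw [bpt, Finsupp.linearCombination_apply, Finsupp.sum_of_support_subset _ hw.2.1 _ (by simp)]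

theorem Bary.sum_eq {t : Finset ℕ} {w : ℕ →₀ ℝ} (hw : Bary t w) : ∑ v ∈ t, w v = 1 := by
  have := hw.bpt_eq_sum (fun _ => (1 : ℝ))
  rw [bpt, hw.2.2] at this
  simpa using this.symm

theorem cell_eq_convexHull (pos : ℕ → X) (t : Finset ℕ) :
    cell pos t = convexHull ℝ (pos '' t) := by
  apply Set.Subset.antisymm
  · rintro _ ⟨w, hw, rfl⟩
    rw [hw.bpt_eq_sum]
    exact (convex_convexHull ℝ _).sum_mem (fun v _ => hw.1 v) hw.sum_eq fun v hv =>
      subset_convexHull ℝ _ ⟨v, hv, rfl⟩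
  · refine convexHull_min ?_ ((convex_setOf_bary t).linear_image _)
    rintro _ ⟨v, hv, rfl⟩
    exact ⟨_, Bary.single hv, by simp⟩

theorem cell_pair (pos : ℕ → X) (a b : ℕ) : cell pos {a, b} = segment ℝ (pos a) (pos b) := by
  rw [cell_eq_convexHull, Finset.coe_pair, Set.image_pair, convexHull_pair]

theorem cell_triple (pos : ℕ → E3) (a b c : ℕ) :
    cell pos {a, b, c} = tri (pos a) (pos b) (pos c) := by
  rw [cell_eq_convexHull, tri]
  congr 1
  simp [Set.image_insert_eq]

theorem cell_mono (pos : ℕ → X) {s t : Finset ℕ} (h : s ⊆ t) : cell pos s ⊆ cell pos t := by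
  rintro _ ⟨w, hw, rfl⟩
  exact ⟨w, hw.mono h, rfl⟩

theorem mem_cell_of_mem (pos : ℕ → X) {v : ℕ} {t : Finset ℕ} (h : v ∈ t) : pos v ∈ cell pos t :=
  ⟨_, Bary.single h, by simp⟩

theorem Bary.inter {s t : Finset ℕ} {w : ℕ →₀ ℝ} (hs : Bary s w) (ht : Bary t w) :
    Bary (s ∩ t) w := ⟨hs.1, Finset.subset_inter hs.2.1 ht.2.1, hs.2.2⟩

theorem Bary.nonempty {s : Finset ℕ} {w : ℕ →₀ ℝ} (hs : Bary s w) : s.Nonempty := by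
  rw [Finset.nonempty_iff_ne_empty]
  rintro rfl
  have := hs.sum_eq
  simp at this

/-- Cells of a geometric complex meet in the cell of their intersection. -/
theorem GeomInj.inter {T : Finset (Finset ℕ)} {pos : ℕ → X} (h : GeomInj T pos)
    {s t s' t' : Finset ℕ} (hs : s ∈ T) (ht : t ∈ T) (hs' : s' ⊆ s) (ht' : t' ⊆ t) :
    cell pos s' ∩ cell pos t' = cell pos (s' ∩ t') := by
  apply Set.Subset.antisymm
  · rintro _ ⟨⟨w, hw, rfl⟩, w', hw', he⟩
    obtain rfl := h t ht s hs w' w (hw'.mono ht') (hw.mono hs') he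
    exact ⟨w', hw.inter hw', rfl⟩
  · exact Set.subset_inter (cell_mono _ Finset.inter_subset_left)
      (cell_mono _ Finset.inter_subset_right)

end Cell

/-! ### Barycentric weights under bisection -/

section GeomBisect

variable {X : Type*} [AddCommGroup X] [Module ℝ X] {a b p : ℕ} {s : ℝ}

/-- The weights of the new vertex in a bisection. -/
noncomputable def midWt (a b : ℕ) (s : ℝ) : ℕ →₀ ℝ :=
  (1 - s) • Finsupp.single a 1 + s • Finsupp.single b 1

/-- Weights on the original complex, from weights on the bisected complex. -/
noncomputable def descend (a b p : ℕ) (s : ℝ) : (ℕ →₀ ℝ) →ₗ[ℝ] (ℕ →₀ ℝ) :=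
  Finsupp.linearCombination ℝ (Function.update (fun v => Finsupp.single v 1) p (midWt a b s))

theorem descend_eq (w : ℕ →₀ ℝ) :
    descend a b p s w = w + w p • (midWt a b s - Finsupp.single p 1) := by
  induction w using Finsupp.induction_linear with
  | zero => simp
  | add f g hf hg => rw [map_add, hf, hg, Finsupp.add_apply]; module
  | single v r =>
    rw [descend, Finsupp.linearCombination_single]
    by_cases hv : v = p
    · subst hv
      rw [Function.update_self, Finsupp.single_eq_same, smul_sub, Finsupp.smul_single, smul_eq_mul,
        mul_one]
      abel
    · rw [Function.update_of_ne hv, Finsupp.single_eq_of_ne (Ne.symm hv), Finsupp.smul_single]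
      simp

theorem bpt_descend (pos : ℕ → X) (w : ℕ →₀ ℝ) :
    bpt pos (descend a b p s w) =
      bpt (Function.update pos p ((1 - s) • pos a + s • pos b)) w := by
  induction w using Finsupp.induction_linear with
  | zero => simp
  | add f g hf hg => rw [map_add, map_add, hf, hg, map_add]
  | single v r =>
    rw [descend, Finsupp.linearCombination_single, map_smul, bpt, bpt,
      Finsupp.linearCombination_single]
    by_cases hv : v = p
    · subst hv
      simp only [midWt, Function.update_self, map_add, map_smul,
        Finsupp.linearCombination_single, one_smul]
    · simp [Function.update_of_ne hv]

theorem midWt_apply_of_ne {v : ℕ} (ha : v ≠ a) (hb : v ≠ b) : midWt a b s v = 0 := by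
  simp [midWt, ha.symm, hb.symm]

theorem midWt_left (hab : a ≠ b) : midWt a b s a = 1 - s := by
  simp [midWt, hab.symm]

theorem midWt_right (hab : a ≠ b) : midWt a b s b = s := by
  simp [midWt, hab]

theorem midWt_sum : Finsupp.linearCombination ℝ (fun _ => (1 : ℝ)) (midWt a b s) = 1 := by
  simp [midWt]

theorem bary_iff {t : Finset ℕ} {w : ℕ →₀ ℝ} : Bary t w ↔ (∀ v, 0 ≤ w v) ∧ (∀ v ∉ t, w v = 0) ∧
    Finsupp.linearCombination ℝ (fun _ => (1 : ℝ)) w = 1 := by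
  refine and_congr_right fun _ => and_congr_left fun _ => ?_
  constructor
  · exact fun h v hv => Finsupp.notMem_support_iff.1 fun hv' => hv (h hv')
  · exact fun h v hv => by_contra fun hv' => Finsupp.mem_support_iff.1 hv (h v hv')

theorem Bary.descend {t t' : Finset ℕ} {w : ℕ →₀ ℝ} (hab : a ≠ b) (hp : p ∉ t) (hs0 : 0 < s)
    (hs1 : s < 1) (ht : t' ∈ children a b p t) (hw : Bary t' w) :
    Bary t (LinkTheory.descend a b p s w) := by
  rw [bary_iff] at hw ⊢
  obtain ⟨h0, hsupp, hsum⟩ := hw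
  refine ⟨fun v => ?_, fun v hv => ?_, ?_⟩
  · rw [descend_eq]
    simp only [Finsupp.add_apply, Finsupp.smul_apply, Finsupp.sub_apply, smul_eq_mul]
    have h1 := h0 v
    have h2 := h0 p
    have h3 : 0 ≤ midWt a b s v := by
      by_cases ha : v = a
      · rw [ha, midWt_left hab]; linarith
      by_cases hb : v = b
      · rw [hb, midWt_right hab]; linarith
      · rw [midWt_apply_of_ne ha hb]
    by_cases hv : v = p
    · subst hv
      rw [Finsupp.single_eq_same]
      nlinarith [mul_nonneg h1 h3]
    · rw [Finsupp.single_eq_of_ne hv]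
      nlinarith [mul_nonneg h2 h3]
  · rw [descend_eq]
    simp only [Finsupp.add_apply, Finsupp.smul_apply, Finsupp.sub_apply, smul_eq_mul]
    by_cases habt : a ∈ t ∧ b ∈ t
    · have hva : v ≠ a := fun e => hv (e ▸ habt.1)
      have hvb : v ≠ b := fun e => hv (e ▸ habt.2)
      rw [midWt_apply_of_ne hva hvb]
      by_cases hvp : v = p
      · subst hvp; simp
      · rw [Finsupp.single_eq_of_ne hvp, hsupp v]
        · simp
        · rw [children, if_pos habt, Finset.mem_insert, Finset.mem_singleton] at ht
          rcases ht with rfl | rfl <;> simp [hvp, hv]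
    · rw [children, if_neg habt, Finset.mem_singleton] at ht
      subst ht
      rw [hsupp v hv, hsupp p hp]; simp
  · rw [descend_eq, map_add, map_smul, map_sub, midWt_sum, hsum]
    simp

theorem not_both_of_mem_children {t t' : Finset ℕ} (hpa : p ≠ a) (hpb : p ≠ b)
    (ht : t' ∈ children a b p t) : a ∉ t' ∨ b ∉ t' := by
  by_cases habt : a ∈ t ∧ b ∈ t
  · rw [children, if_pos habt, Finset.mem_insert, Finset.mem_singleton] at ht
    rcases ht with rfl | rfl
    · right; simp [hpb.symm]
    · left; simp [hpa.symm]
  · rw [children, if_neg habt, Finset.mem_singleton] at ht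
    subst ht
    tauto

/-- After `descend` the weights at `a` and `b` are `w a + w p * (1 - s)` and `w b + w p * s`. Since
`w a` or `w b` vanishes, `w p` is the smaller of the two quotients by `1 - s` and `s`, and so it is
determined. The other weights follow. -/
theorem descend_injOn {w w' : ℕ →₀ ℝ} (hab : a ≠ b) (hpa : p ≠ a) (hpb : p ≠ b) (hs0 : 0 < s)
    (hs1 : s < 1) (hw : ∀ v, 0 ≤ w v) (hw' : ∀ v, 0 ≤ w' v) (h : w a = 0 ∨ w b = 0)
    (h' : w' a = 0 ∨ w' b = 0) (he : descend a b p s w = descend a b p s w') : w = w' := by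
  have key : ∀ v, w v + w p * (midWt a b s v - Finsupp.single p 1 v) =
      w' v + w' p * (midWt a b s v - Finsupp.single p 1 v) := by
    intro v
    have := DFunLike.congr_fun he v
    rw [descend_eq, descend_eq] at this
    simpa using this
  have h1 := key a
  have h2 := key b
  rw [midWt_left hab, Finsupp.single_eq_of_ne hpa.symm] at h1
  rw [midWt_right hab, Finsupp.single_eq_of_ne hpb.symm] at h2
  have hpp : w p = w' p := by
    have := hw a
    have := hw b
    have := hw' a
    have := hw' b
    rcases lt_trichotomy (w p) (w' p) with hlt | heq | hgt
    · exfalso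
      rcases h with h | h <;> nlinarith
    · exact heq
    · exfalso
      rcases h' with h' | h' <;> nlinarith
  ext v
  have := key v
  rw [hpp] at this
  linarith

/-- Move the largest possible multiple of `midWt a b s` to the new vertex. Whichever of `a` and `b`
is exhausted decides the half containing the point. -/
theorem exists_bary_descend {t : Finset ℕ} {w : ℕ →₀ ℝ} (hab : a ≠ b) (hp : p ∉ t)
    (hpa : p ≠ a) (hpb : p ≠ b) (hs0 : 0 < s) (hs1 : s < 1) (hw : Bary t w) :
    ∃ t' ∈ children a b p t, ∃ w', Bary t' w' ∧ descend a b p s w' = w := by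
  rw [bary_iff] at hw
  obtain ⟨h0, hsupp, hsum⟩ := hw
  by_cases habt : a ∈ t ∧ b ∈ t
  swap
  · rw [children, if_neg habt]
    refine ⟨t, by simp, w, bary_iff.2 ⟨h0, hsupp, hsum⟩, ?_⟩
    rw [descend_eq, hsupp p hp]
    simp
  rw [children, if_pos habt]
  have main : ∀ P : ℝ, 0 ≤ P → P * (1 - s) ≤ w a → P * s ≤ w b → ∀ t' : Finset ℕ, p ∈ t' →
      (∀ v ∈ t, v ∉ t' → w v = P * midWt a b s v) →
      ∃ w', Bary t' w' ∧ descend a b p s w' = w := by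
    intro P hP ha hb t' hpt' ht'
    have hval : ∀ v, (w + P • (Finsupp.single p 1 - midWt a b s) : ℕ →₀ ℝ) v =
        w v + P * ((Finsupp.single p 1 : ℕ →₀ ℝ) v - midWt a b s v) := fun v => by simp
    refine ⟨w + P • (Finsupp.single p 1 - midWt a b s), bary_iff.2 ⟨fun v => ?_, fun v hv => ?_, ?_⟩,
      ?_⟩
    · rw [hval]
      by_cases hva : v = a
      · rw [hva, midWt_left hab, Finsupp.single_eq_of_ne hpa.symm]; linarith
      by_cases hvb : v = b
      · rw [hvb, midWt_right hab, Finsupp.single_eq_of_ne hpb.symm]; linarith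
      rw [midWt_apply_of_ne hva hvb]
      have := h0 v
      have h1 : (0 : ℝ) ≤ (Finsupp.single p 1 : ℕ →₀ ℝ) v := by
        rw [Finsupp.single_apply]; split_ifs <;> norm_num
      rw [sub_zero]
      positivity
    · rw [hval]
      have hvp : v ≠ p := fun e => hv (e ▸ hpt')
      rw [Finsupp.single_eq_of_ne hvp]
      by_cases hvt : v ∈ t
      · rw [ht' v hvt hv]; ring
      · rw [hsupp v hvt, midWt_apply_of_ne (fun e : v = a => hvt (e ▸ habt.1))
          (fun e : v = b => hvt (e ▸ habt.2))]
        ring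
    · rw [map_add, map_smul, map_sub, midWt_sum, hsum]; simp
    · rw [descend_eq, hval, hsupp p hp, midWt_apply_of_ne hpa hpb, Finsupp.single_eq_same]
      module
  have hwa := h0 a
  have hwb := h0 b
  have hs1' : 0 < 1 - s := by linarith
  rcases le_total (w a * s) (w b * (1 - s)) with hle | hle
  · refine ⟨insert p (t.erase a), by simp, main (w a / (1 - s)) (by positivity) ?_ ?_ _ (by simp) ?_⟩
    · rw [div_mul_cancel₀ _ hs1'.ne']
    · rw [div_mul_eq_mul_div, div_le_iff₀ hs1']; linarith
    · intro v hv hv'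
      have : v = a := by
        by_contra hne
        exact hv' (Finset.mem_insert_of_mem (Finset.mem_erase.2 ⟨hne, hv⟩))
      rw [this, midWt_left hab, div_mul_cancel₀ _ hs1'.ne']
  · refine ⟨insert p (t.erase b), by simp, main (w b / s) (by positivity) ?_ ?_ _ (by simp) ?_⟩
    · rw [div_mul_eq_mul_div, div_le_iff₀ hs0]; linarith
    · rw [div_mul_cancel₀ _ hs0.ne']
    · intro v hv hv'
      have : v = b := by
        by_contra hne
        exact hv' (Finset.mem_insert_of_mem (Finset.mem_erase.2 ⟨hne, hv⟩))
      rw [this, midWt_right hab, div_mul_cancel₀ _ hs0.ne']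

variable {pos : ℕ → X}

theorem cell_children_subset {t t' : Finset ℕ} (hab : a ≠ b) (hp : p ∉ t) (hs0 : 0 < s)
    (hs1 : s < 1) (ht : t' ∈ children a b p t) :
    cell (Function.update pos p ((1 - s) • pos a + s • pos b)) t' ⊆ cell pos t := by
  rintro _ ⟨w, hw, rfl⟩
  exact ⟨_, Bary.descend hab hp hs0 hs1 ht hw, bpt_descend _ _⟩

theorem biUnion_cell_bisect {C : Finset (Finset ℕ)} (hab : a ≠ b) (hp : ∀ t ∈ C, p ∉ t)
    (hpa : p ≠ a) (hpb : p ≠ b) (hs0 : 0 < s) (hs1 : s < 1) :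
    ⋃ t ∈ bisect a b p C, cell (Function.update pos p ((1 - s) • pos a + s • pos b)) t =
      ⋃ t ∈ C, cell pos t := by
  apply Set.Subset.antisymm
  · refine Set.iUnion₂_subset fun t' ht' => ?_
    obtain ⟨t, ht, htt'⟩ := mem_bisect.1 ht'
    exact (cell_children_subset hab (hp t ht) hs0 hs1 htt').trans
      (Set.subset_biUnion_of_mem (u := fun t => cell pos t) ht)
  · refine Set.iUnion₂_subset fun t ht => ?_
    rintro _ ⟨w, hw, rfl⟩
    obtain ⟨t', ht', w', hw', rfl⟩ := exists_bary_descend hab (hp t ht) hpa hpb hs0 hs1 hw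
    exact Set.mem_iUnion₂.2 ⟨t', mem_bisect.2 ⟨t, ht, ht'⟩, w', hw', (bpt_descend _ _).symm⟩

theorem GeomInj.bisect {T : Finset (Finset ℕ)} (h : GeomInj T pos) (hab : a ≠ b)
    (hp : ∀ t ∈ T, p ∉ t) (hpa : p ≠ a) (hpb : p ≠ b) (hs0 : 0 < s) (hs1 : s < 1) :
    GeomInj (bisect a b p T) (Function.update pos p ((1 - s) • pos a + s • pos b)) := by
  intro t₁ ht₁ t₂ ht₂ w₁ w₂ hw₁ hw₂ he
  obtain ⟨u₁, hu₁, hut₁⟩ := mem_bisect.1 ht₁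
  obtain ⟨u₂, hu₂, hut₂⟩ := mem_bisect.1 ht₂
  rw [← bpt_descend, ← bpt_descend] at he
  have hor : ∀ {t u : Finset ℕ} {w}, Bary t w → t ∈ children a b p u → w a = 0 ∨ w b = 0 :=
    fun hw htu => (not_both_of_mem_children hpa hpb htu).imp
      ((bary_iff.1 hw).2.1 _) ((bary_iff.1 hw).2.1 _)
  exact descend_injOn hab hpa hpb hs0 hs1 hw₁.1 hw₂.1 (hor hw₁ hut₁) (hor hw₂ hut₂)
    (h _ hu₁ _ hu₂ _ _ (hw₁.descend hab (hp _ hu₁) hs0 hs1 hut₁)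
      (hw₂.descend hab (hp _ hu₂) hs0 hs1 hut₂) he)

end GeomBisect
end LinkTheory

namespace LinkTheory

/-! ### Geometric triangulations of the standard annulus -/

/-- A triangulation of the standard annulus. -/
structure GeomAnnulus (T I O : Finset (Finset ℕ)) (pos : ℕ → ℝ × ℝ) : Prop extends
    IsAnnulus T I O where
  geomInj : GeomInj T pos
  cell_subset : ∀ t ∈ T, cell pos t ⊆ stdAnnulus
  inner_eq : ⋃ g ∈ I, cell pos g = Metric.sphere 0 1
  outer_eq : ⋃ g ∈ O, cell pos g = Metric.sphere 0 2

/-- The edges across which `l` changes sign. -/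
noncomputable def badEdges (T : Finset (Finset ℕ)) (pos : ℕ → ℝ × ℝ) (l : ℝ × ℝ →ᵃ[ℝ] ℝ) :
    Finset (Finset ℕ) := by
  classical
  exact (faceEdges T).filter fun g => ∃ a ∈ g, ∃ b ∈ g, l (pos a) < 0 ∧ 0 < l (pos b)

/-- The affine function `l` has one sign on `s`. -/
def Pure (l : ℝ × ℝ →ᵃ[ℝ] ℝ) (s : Set (ℝ × ℝ)) : Prop := (∀ x ∈ s, 0 ≤ l x) ∨ ∀ x ∈ s, l x ≤ 0

variable {T I O : Finset (Finset ℕ)} {pos : ℕ → ℝ × ℝ} {l : ℝ × ℝ →ᵃ[ℝ] ℝ}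

theorem mem_badEdges {g : Finset ℕ} : g ∈ badEdges T pos l ↔
    g ∈ faceEdges T ∧ ∃ a ∈ g, ∃ b ∈ g, l (pos a) < 0 ∧ 0 < l (pos b) := by
  simp [badEdges]

theorem pure_cell_of_badEdges_eq_empty (h : badEdges T pos l = ∅) {t : Finset ℕ} (ht : t ∈ T) :
    Pure l (cell pos t) := by
  have hcv : Convex ℝ {x | 0 ≤ l x} := by
    have := (convex_Ici (𝕜 := ℝ) (0 : ℝ)).affine_preimage l
    exact this
  have hcv' : Convex ℝ {x | l x ≤ 0} := by
    have := (convex_Iic (𝕜 := ℝ) (0 : ℝ)).affine_preimage l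
    exact this
  by_cases hneg : ∃ a ∈ t, l (pos a) < 0
  · right
    obtain ⟨a, ha, hla⟩ := hneg
    rw [cell_eq_convexHull]
    refine convexHull_min ?_ hcv'
    rintro _ ⟨b, hb, rfl⟩
    by_contra hlb
    have hlb : 0 < l (pos b) := not_le.1 hlb
    have hab : a ≠ b := fun e => by rw [e] at hla; linarith
    have : {a, b} ∈ badEdges T pos l := mem_badEdges.2 ⟨mem_faceEdges.2
      ⟨Finset.card_pair hab, t, ht, by
        simp only [Finset.insert_subset_iff, Finset.singleton_subset_iff]; exact ⟨ha, hb⟩⟩,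
      a, by simp, b, by simp, hla, hlb⟩
    simp [h] at this
  · left
    push Not at hneg
    rw [cell_eq_convexHull]
    refine convexHull_min ?_ hcv
    rintro _ ⟨b, hb, rfl⟩
    exact hneg b hb

/-- One step of the subdivision along the zero set of `l`. -/
theorem GeomAnnulus.cut_step (h : GeomAnnulus T I O pos) (hbad : (badEdges T pos l).Nonempty) :
    ∃ T' I' O' pos', GeomAnnulus T' I' O' pos' ∧
      (∀ t' ∈ T', ∃ t ∈ T, cell pos' t' ⊆ cell pos t) ∧
      (badEdges T' pos' l).card < (badEdges T pos l).card := by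
  obtain ⟨g, hg⟩ := hbad
  obtain ⟨hgT, a, ha, b, hb, hla, hlb⟩ := mem_badEdges.1 hg
  have hab : a ≠ b := fun e => by rw [e] at hla; linarith
  obtain rfl := eq_pair_of_mem hab (mem_faceEdges.1 hgT).1 ha hb
  obtain ⟨p, hp⟩ := Infinite.exists_notMem_finset (T.biUnion id)
  have hp : ∀ t ∈ T, p ∉ t := fun t ht hpt => hp (Finset.mem_biUnion.2 ⟨t, ht, hpt⟩)
  have hmem : ∀ {C : Finset (Finset ℕ)}, C ⊆ faceEdges T → ∀ g ∈ C, p ∉ g := by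
    intro C hC g hg hpg
    obtain ⟨-, t, ht, hgt⟩ := mem_faceEdges.1 (hC hg)
    exact hp t ht (hgt hpg)
  have hpab := hmem (Finset.Subset.refl _) _ hgT
  have hpa : p ≠ a := fun e => hpab (by simp [e])
  have hpb : p ≠ b := fun e => hpab (by simp [e])
  -- The new vertex is the zero of `l` on the edge.
  set s := l (pos a) / (l (pos a) - l (pos b)) with hs
  have hden : l (pos a) - l (pos b) < 0 := by linarith
  have hs0 : 0 < s := div_pos_of_neg_of_neg hla hden
  have hs1 : s < 1 := by rw [hs, div_lt_one_of_neg hden]; linarith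
  set pos' := Function.update pos p ((1 - s) • pos a + s • pos b) with hpos'
  have hlp : l (pos' p) = 0 := by
    have : (1 - s) • pos a + s • pos b = AffineMap.lineMap (pos a) (pos b) s := by
      rw [AffineMap.lineMap_apply_module]
    rw [hpos', Function.update_self, this, AffineMap.apply_lineMap, AffineMap.lineMap_apply_module,
      smul_eq_mul, smul_eq_mul, hs]
    have hden' := hden.ne
    field_simp
    ring
  have hold : ∀ v, v ≠ p → pos' v = pos v := fun v hv => Function.update_of_ne hv _ _
  refine ⟨bisect a b p T, bisect a b p I, bisect a b p O, pos',
    ⟨h.toIsAnnulus.bisect hab hgT hp, h.geomInj.bisect hab hp hpa hpb hs0 hs1, ?_, ?_, ?_⟩, ?_, ?_⟩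
  · intro t' ht'
    obtain ⟨t, ht, htt'⟩ := mem_bisect.1 ht'
    exact (cell_children_subset hab (hp t ht) hs0 hs1 htt').trans (h.cell_subset t ht)
  · exact (biUnion_cell_bisect hab (hmem h.inner_subset) hpa hpb hs0 hs1).trans h.inner_eq
  · exact (biUnion_cell_bisect hab (hmem h.outer_subset) hpa hpb hs0 hs1).trans h.outer_eq
  · intro t' ht'
    obtain ⟨t, ht, htt'⟩ := mem_bisect.1 ht'
    exact ⟨t, ht, cell_children_subset hab (hp t ht) hs0 hs1 htt'⟩
  -- Since `l` vanishes at `p`, no edge at `p` is bad. The other edges are old, and `ab` has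
  -- disappeared.
  · refine lt_of_le_of_lt (Finset.card_le_card (t := (badEdges T pos l).erase {a, b}) ?_)
      (Finset.card_erase_lt_of_mem hg)
    intro e he
    obtain ⟨heT, x, hx, y, hy, hlx, hly⟩ := mem_badEdges.1 he
    have hxp : x ≠ p := fun e => by rw [e, hlp] at hlx; exact lt_irrefl _ hlx
    have hyp : y ≠ p := fun e => by rw [e, hlp] at hly; exact lt_irrefl _ hly
    have hxy : x ≠ y := fun e => by rw [e] at hlx; linarith
    obtain rfl := eq_pair_of_mem hxy (mem_faceEdges.1 heT).1 hx hy
    rw [hold x hxp] at hlx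
    rw [hold y hyp] at hly
    have hpxy : p ∉ ({x, y} : Finset ℕ) := by simp [hxp.symm, hyp.symm]
    rcases (faceEdges_bisect hab hp h.card_tri).1 heT with he' | ⟨c, he', -⟩
    · rcases (mem_bisect_edges hab fun g hg => (mem_faceEdges.1 hg).1).1 he' with
        ⟨-, he' | he'⟩ | ⟨h1, h2⟩
      · exact absurd (by rw [he']; simp) hpxy
      · exact absurd (by rw [he']; simp) hpxy
      · exact Finset.mem_erase.2 ⟨h2, mem_badEdges.2 ⟨h1, x, hx, y, hy, hlx, hly⟩⟩
    · exact absurd (by rw [he']; simp) hpxy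

theorem GeomAnnulus.cut (h : GeomAnnulus T I O pos) (l : ℝ × ℝ →ᵃ[ℝ] ℝ) :
    ∃ T' I' O' pos', GeomAnnulus T' I' O' pos' ∧
      (∀ t' ∈ T', ∃ t ∈ T, cell pos' t' ⊆ cell pos t) ∧ ∀ t' ∈ T', Pure l (cell pos' t') := by
  induction hn : (badEdges T pos l).card using Nat.strong_induction_on generalizing T I O pos with
  | _ n ih =>
    rcases (badEdges T pos l).eq_empty_or_nonempty with he | hne
    · exact ⟨T, I, O, pos, h, fun t ht => ⟨t, ht, subset_rfl⟩,
        fun t ht => pure_cell_of_badEdges_eq_empty he ht⟩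
    · obtain ⟨T₁, I₁, O₁, pos₁, h₁, href, hlt⟩ := h.cut_step hne
      obtain ⟨T', I', O', pos', h', href', hpure⟩ := ih _ (hn ▸ hlt) h₁ rfl
      refine ⟨T', I', O', pos', h', fun t' ht' => ?_, hpure⟩
      obtain ⟨t₁, ht₁, hs₁⟩ := href' t' ht'
      obtain ⟨t, ht, hs⟩ := href t₁ ht₁
      exact ⟨t, ht, hs₁.trans hs⟩

/-- The cuts are made successively. Later cells lie in earlier ones, so signs already constant stay
constant. -/
theorem GeomAnnulus.cut_finite (h : GeomAnnulus T I O pos) {F : Set (ℝ × ℝ →ᵃ[ℝ] ℝ)}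
    (hF : F.Finite) : ∃ T' I' O' pos', GeomAnnulus T' I' O' pos' ∧
      ∀ l ∈ F, ∀ t' ∈ T', Pure l (cell pos' t') := by
  induction F, hF using Set.Finite.induction_on with
  | empty => exact ⟨T, I, O, pos, h, by simp⟩
  | @insert l F _ _ ih =>
    obtain ⟨T₁, I₁, O₁, pos₁, h₁, hp₁⟩ := ih
    obtain ⟨T', I', O', pos', h', href, hp'⟩ := h₁.cut l
    refine ⟨T', I', O', pos', h', ?_⟩
    rintro l' (rfl | hl') t' ht'
    · exact hp' t' ht'
    · obtain ⟨t, ht, hs⟩ := href t' ht'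
      exact (hp₁ l' hl' t ht).imp (fun h x hx => h x (hs hx)) (fun h x hx => h x (hs hx))

/-! ### The initial triangulation -/

/-- The triangles of a triangulation of the standard annulus. -/
def stdT : Finset (Finset ℕ) :=
  {{0, 1, 4}, {1, 4, 5}, {1, 2, 5}, {2, 5, 6}, {2, 3, 6}, {3, 6, 7}, {3, 0, 7}, {0, 7, 4}}

/-- The edges of its inner boundary. -/
def stdI : Finset (Finset ℕ) := {{0, 1}, {1, 2}, {2, 3}, {3, 0}}

/-- The edges of its outer boundary. -/
def stdO : Finset (Finset ℕ) := {{4, 5}, {5, 6}, {6, 7}, {7, 4}}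

/-- The positions of its vertices. -/
noncomputable def stdPos : ℕ → ℝ × ℝ
  | 0 => (1, 1)
  | 1 => (-1, 1)
  | 2 => (-1, -1)
  | 3 => (1, -1)
  | 4 => (2, 2)
  | 5 => (-2, 2)
  | 6 => (-2, -2)
  | 7 => (2, -2)
  | _ => 0

theorem std_touches : ∀ t ∈ stdT, Touches stdI t ∨ Touches stdO t := by
  unfold Touches; decide

instance : DecidableRel ShareEdge := fun s t =>
  decidable_of_iff (∃ g ∈ s.powerset, g.card = 2 ∧ g ⊆ t) (by
    simp only [ShareEdge, Finset.mem_powerset]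
    exact exists_congr fun g => by tauto)

/-- The triangle `s` may be `t` itself. In the ring of eight triangles those touching the two
boundaries alternate, so one step always suffices. -/
theorem std_neighbor (t : Finset ℕ) (ht : t ∈ stdT) :
    (∃ s ∈ stdT, ShareEdge t s ∧ Touches stdI s) ∧ ∃ s ∈ stdT, ShareEdge t s ∧ Touches stdO s := by
  revert t
  unfold Touches
  decide

theorem std_isAnnulus : IsAnnulus stdT stdI stdO where
  card_tri := by decide
  inner_subset := by decide
  outer_subset := by decide
  incidence_eq := by decide
  inner_regular := by
    intro v hv
    have : verts stdI = {0, 1, 2, 3} := by decide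
    rw [this] at hv
    simp only [Finset.mem_insert, Finset.mem_singleton] at hv
    have key : ∀ a b : ℕ, {a, b} ∈ stdI ↔ _ := fun a b => by
      rw [stdI, Finset.mem_insert, Finset.mem_insert, Finset.mem_insert, Finset.mem_singleton,
        pair_eq_pair_iff, pair_eq_pair_iff, pair_eq_pair_iff, pair_eq_pair_iff]
    rcases hv with rfl | rfl | rfl | rfl
    · exact ⟨1, 3, by decide, fun w => by rw [key]; omega⟩
    · exact ⟨0, 2, by decide, fun w => by rw [key]; omega⟩
    · exact ⟨1, 3, by decide, fun w => by rw [key]; omega⟩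
    · exact ⟨0, 2, by decide, fun w => by rw [key]; omega⟩
  inner_card := by decide
  euler := by decide
  conn_inner := by
    rintro W hW ⟨t, ht⟩
    obtain ⟨s, hs, hts, hsI⟩ := (std_neighbor t (hW.1 ht)).1
    exact ⟨s, hW.2 t ht s hs hts, hsI⟩
  conn_outer := by
    rintro W hW ⟨t, ht⟩
    obtain ⟨s, hs, hts, hsI⟩ := (std_neighbor t (hW.1 ht)).2
    exact ⟨s, hW.2 t ht s hs hts, hsI⟩
  conn_erase := by
    rintro r W hW ⟨t, ht⟩
    exact ⟨t, ht, std_touches t (Finset.mem_of_mem_erase (hW.1 ht))⟩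

end LinkTheory

/-! ### The initial triangulation as a geometric complex -/

namespace LinkTheory

/-- Supports of weights on the simplices of the initial triangulation. -/
def StdSupp (w0 w1 w2 w3 w4 w5 w6 w7 : ℝ) : Prop :=
  (w2 = 0 ∧ w3 = 0 ∧ w5 = 0 ∧ w6 = 0 ∧ w7 = 0) ∨ (w0 = 0 ∧ w2 = 0 ∧ w3 = 0 ∧ w6 = 0 ∧ w7 = 0) ∨
  (w0 = 0 ∧ w3 = 0 ∧ w4 = 0 ∧ w6 = 0 ∧ w7 = 0) ∨ (w0 = 0 ∧ w1 = 0 ∧ w3 = 0 ∧ w4 = 0 ∧ w7 = 0) ∨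
  (w0 = 0 ∧ w1 = 0 ∧ w4 = 0 ∧ w5 = 0 ∧ w7 = 0) ∨ (w0 = 0 ∧ w1 = 0 ∧ w2 = 0 ∧ w4 = 0 ∧ w5 = 0) ∨
  (w1 = 0 ∧ w2 = 0 ∧ w4 = 0 ∧ w5 = 0 ∧ w6 = 0) ∨ (w1 = 0 ∧ w2 = 0 ∧ w3 = 0 ∧ w5 = 0 ∧ w6 = 0)

-- For each of the 64 pairs of triangles, the two coordinates, the sum of the weights and their
-- signs determine the weights by linear arithmetic.
set_option maxHeartbeats 4000000 in
theorem std_weights_unique {a0 a1 a2 a3 a4 a5 a6 a7 b0 b1 b2 b3 b4 b5 b6 b7 : ℝ}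
    (ha0 : 0 ≤ a0) (ha1 : 0 ≤ a1) (ha2 : 0 ≤ a2) (ha3 : 0 ≤ a3) (ha4 : 0 ≤ a4) (ha5 : 0 ≤ a5)
    (ha6 : 0 ≤ a6) (ha7 : 0 ≤ a7) (hb0 : 0 ≤ b0) (hb1 : 0 ≤ b1) (hb2 : 0 ≤ b2) (hb3 : 0 ≤ b3)
    (hb4 : 0 ≤ b4) (hb5 : 0 ≤ b5) (hb6 : 0 ≤ b6) (hb7 : 0 ≤ b7)
    (ha : a0 + a1 + a2 + a3 + a4 + a5 + a6 + a7 = 1)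
    (hb : b0 + b1 + b2 + b3 + b4 + b5 + b6 + b7 = 1)
    (hx : a0 - a1 - a2 + a3 + 2 * (a4 - a5 - a6 + a7) =
      b0 - b1 - b2 + b3 + 2 * (b4 - b5 - b6 + b7))
    (hy : a0 + a1 - a2 - a3 + 2 * (a4 + a5 - a6 - a7) =
      b0 + b1 - b2 - b3 + 2 * (b4 + b5 - b6 - b7))
    (hsa : StdSupp a0 a1 a2 a3 a4 a5 a6 a7) (hsb : StdSupp b0 b1 b2 b3 b4 b5 b6 b7) :
    a0 = b0 ∧ a1 = b1 ∧ a2 = b2 ∧ a3 = b3 ∧ a4 = b4 ∧ a5 = b5 ∧ a6 = b6 ∧ a7 = b7 := by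
  unfold StdSupp at hsa hsb
  rcases hsa with ⟨rfl, rfl, rfl, rfl, rfl⟩ | ⟨rfl, rfl, rfl, rfl, rfl⟩ | ⟨rfl, rfl, rfl, rfl, rfl⟩ |
    ⟨rfl, rfl, rfl, rfl, rfl⟩ | ⟨rfl, rfl, rfl, rfl, rfl⟩ | ⟨rfl, rfl, rfl, rfl, rfl⟩ |
    ⟨rfl, rfl, rfl, rfl, rfl⟩ | ⟨rfl, rfl, rfl, rfl, rfl⟩ <;>
  rcases hsb with ⟨rfl, rfl, rfl, rfl, rfl⟩ | ⟨rfl, rfl, rfl, rfl, rfl⟩ | ⟨rfl, rfl, rfl, rfl, rfl⟩ |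
    ⟨rfl, rfl, rfl, rfl, rfl⟩ | ⟨rfl, rfl, rfl, rfl, rfl⟩ | ⟨rfl, rfl, rfl, rfl, rfl⟩ |
    ⟨rfl, rfl, rfl, rfl, rfl⟩ | ⟨rfl, rfl, rfl, rfl, rfl⟩ <;>
  refine ⟨?_, ?_, ?_, ?_, ?_, ?_, ?_, ?_⟩ <;> first | rfl | linarith

theorem Bary.std {t : Finset ℕ} {w : ℕ →₀ ℝ} (h : Bary t w) (ht : t ⊆ Finset.range 8) :
    w 0 + w 1 + w 2 + w 3 + w 4 + w 5 + w 6 + w 7 = 1 ∧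
    (bpt stdPos w).1 = w 0 - w 1 - w 2 + w 3 + 2 * (w 4 - w 5 - w 6 + w 7) ∧
    (bpt stdPos w).2 = w 0 + w 1 - w 2 - w 3 + 2 * (w 4 + w 5 - w 6 - w 7) := by
  have h' := h.mono ht
  refine ⟨?_, ?_, ?_⟩
  · rw [← h'.sum_eq]
    simp only [Finset.sum_range_succ, Finset.sum_range_zero, zero_add]
  · rw [h'.bpt_eq_sum]
    simp only [Finset.sum_range_succ, Finset.sum_range_zero, zero_add, stdPos, Prod.fst_add,
      Prod.smul_fst, smul_eq_mul]
    ring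
  · rw [h'.bpt_eq_sum]
    simp only [Finset.sum_range_succ, Finset.sum_range_zero, zero_add, stdPos, Prod.snd_add,
      Prod.smul_snd, smul_eq_mul]
    ring

theorem std_subset_range : ∀ t ∈ stdT, t ⊆ Finset.range 8 := by decide

theorem Bary.stdSupp {t : Finset ℕ} {w : ℕ →₀ ℝ} (h : Bary t w) (ht : t ∈ stdT) :
    StdSupp (w 0) (w 1) (w 2) (w 3) (w 4) (w 5) (w 6) (w 7) := by
  have h2 := (bary_iff.1 h).2.1
  unfold StdSupp
  simp only [stdT, Finset.mem_insert, Finset.mem_singleton] at ht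
  have key : ∀ a b c d e : ℕ, (a ∉ t ∧ b ∉ t ∧ c ∉ t ∧ d ∉ t ∧ e ∉ t) →
      w a = 0 ∧ w b = 0 ∧ w c = 0 ∧ w d = 0 ∧ w e = 0 := fun a b c d e h =>
    ⟨h2 a h.1, h2 b h.2.1, h2 c h.2.2.1, h2 d h.2.2.2.1, h2 e h.2.2.2.2⟩
  rcases ht with rfl | rfl | rfl | rfl | rfl | rfl | rfl | rfl
  · exact Or.inl (key _ _ _ _ _ (by decide))
  · exact Or.inr (Or.inl (key _ _ _ _ _ (by decide)))
  · exact Or.inr (Or.inr (Or.inl (key _ _ _ _ _ (by decide))))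
  · exact Or.inr (Or.inr (Or.inr (Or.inl (key _ _ _ _ _ (by decide)))))
  · exact Or.inr (Or.inr (Or.inr (Or.inr (Or.inl (key _ _ _ _ _ (by decide))))))
  · exact Or.inr (Or.inr (Or.inr (Or.inr (Or.inr (Or.inl (key _ _ _ _ _ (by decide)))))))
  · exact Or.inr (Or.inr (Or.inr (Or.inr (Or.inr (Or.inr (Or.inl (key _ _ _ _ _ (by decide))))))))
  · exact Or.inr (Or.inr (Or.inr (Or.inr (Or.inr (Or.inr (Or.inr (key _ _ _ _ _ (by decide))))))))

theorem sphere_eq_segments {r : ℝ} (hr : 0 < r) {x : ℝ × ℝ} : x ∈ Metric.sphere (0 : ℝ × ℝ) r ↔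
    x ∈ segment ℝ (r, r) (-r, r) ∨ x ∈ segment ℝ (-r, r) (-r, -r) ∨
      x ∈ segment ℝ (-r, -r) (r, -r) ∨ x ∈ segment ℝ (r, -r) (r, r) := by
  obtain ⟨x, y⟩ := x
  rw [mem_sphere_zero_iff_norm, Prod.norm_def, Real.norm_eq_abs, Real.norm_eq_abs]
  simp only [segment_eq_image, Set.mem_image, Prod.smul_mk, smul_eq_mul, Prod.mk_add_mk,
    Prod.mk.injEq, Set.mem_Icc]
  constructor
  · intro h
    have h1 := abs_le.1 ((le_max_left |x| |y|).trans h.le)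
    have h2 := abs_le.1 ((le_max_right |x| |y|).trans h.le)
    have hx0 : 0 ≤ (r - x) / (2 * r) := div_nonneg (by linarith) (by linarith)
    have hx1 : (r - x) / (2 * r) ≤ 1 := by rw [div_le_one (by linarith)]; linarith
    have hy0 : 0 ≤ (r - y) / (2 * r) := div_nonneg (by linarith) (by linarith)
    have hy1 : (r - y) / (2 * r) ≤ 1 := by rw [div_le_one (by linarith)]; linarith
    have h3 : x = r ∨ x = -r ∨ y = r ∨ y = -r := by
      rcases max_choice |x| |y| with hm | hm <;> rw [hm] at h
      · rcases (abs_eq hr.le).1 h with h | h <;> simp [h]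
      · rcases (abs_eq hr.le).1 h with h | h <;> simp [h]
    rcases h3 with rfl | rfl | rfl | rfl
    · right; right; right
      refine ⟨1 - (x - y) / (2 * x), ⟨by linarith, by linarith⟩, ?_, ?_⟩ <;> field_simp <;> ring
    · right; left
      refine ⟨(r - y) / (2 * r), ⟨by linarith, by linarith⟩, ?_, ?_⟩ <;> field_simp <;> ring
    · left
      refine ⟨(y - x) / (2 * y), ⟨by linarith, by linarith⟩, ?_, ?_⟩ <;> field_simp <;> ring
    · right; right; left
      refine ⟨1 - (r - x) / (2 * r), ⟨by linarith, by linarith⟩, ?_, ?_⟩ <;> field_simp <;> ring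
  · have key : ∀ s : ℝ, 0 ≤ s → s ≤ 1 → |(1 - s) * r + s * -r| ≤ r ∧ |(1 - s) * -r + s * r| ≤ r :=
      fun s h0 h1 => ⟨abs_le.2 ⟨by nlinarith, by nlinarith⟩, abs_le.2 ⟨by nlinarith, by nlinarith⟩⟩
    have e1 : ∀ s : ℝ, |(1 - s) * r + s * r| = r := fun s => by
      rw [show (1 - s) * r + s * r = r by ring, abs_of_pos hr]
    have e2 : ∀ s : ℝ, |(1 - s) * -r + s * -r| = r := fun s => by
      rw [show (1 - s) * -r + s * -r = -r by ring, abs_neg, abs_of_pos hr]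
    rintro (⟨s, ⟨h0, h1⟩, rfl, rfl⟩ | ⟨s, ⟨h0, h1⟩, rfl, rfl⟩ | ⟨s, ⟨h0, h1⟩, rfl, rfl⟩ |
      ⟨s, ⟨h0, h1⟩, rfl, rfl⟩)
    · rw [e1, max_eq_right (key s h0 h1).1]
    · rw [e2, max_eq_left (key s h0 h1).1]
    · rw [e2, max_eq_right (key s h0 h1).2]
    · rw [e1, max_eq_left (key s h0 h1).2]

theorem std_geomAnnulus : GeomAnnulus stdT stdI stdO stdPos where
  toIsAnnulus := std_isAnnulus
  geomInj := by
    intro s hs t ht w w' hw hw' he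
    have ws := hw.std (std_subset_range s hs)
    have wt := hw'.std (std_subset_range t ht)
    have hx : (bpt stdPos w).1 = (bpt stdPos w').1 := by rw [he]
    have hy : (bpt stdPos w).2 = (bpt stdPos w').2 := by rw [he]
    rw [ws.2.1, wt.2.1] at hx
    rw [ws.2.2, wt.2.2] at hy
    obtain ⟨h0, h1, h2, h3, h4, h5, h6, h7⟩ := std_weights_unique (hw.1 0) (hw.1 1) (hw.1 2) (hw.1 3)
      (hw.1 4) (hw.1 5) (hw.1 6) (hw.1 7) (hw'.1 0) (hw'.1 1) (hw'.1 2) (hw'.1 3) (hw'.1 4)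
      (hw'.1 5) (hw'.1 6) (hw'.1 7) ws.1 wt.1 hx hy (hw.stdSupp hs) (hw'.stdSupp ht)
    ext v
    by_cases hv : v < 8
    · interval_cases v <;> assumption
    · have : v ∉ Finset.range 8 := by simpa using hv
      rw [(bary_iff.1 (hw.mono (std_subset_range s hs))).2.1 v this,
        (bary_iff.1 (hw'.mono (std_subset_range t ht))).2.1 v this]
  cell_subset := by
    rintro t ht _ ⟨w, hw, rfl⟩
    obtain ⟨h1, hx, hy⟩ := hw.std (std_subset_range t ht)
    have hs := hw.stdSupp ht
    have h := hw.1
    have g0 := h 0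
    have g1 := h 1
    have g2 := h 2
    have g3 := h 3
    have g4 := h 4
    have g5 := h 5
    have g6 := h 6
    have g7 := h 7
    generalize w 0 = a0 at *
    generalize w 1 = a1 at *
    generalize w 2 = a2 at *
    generalize w 3 = a3 at *
    generalize w 4 = a4 at *
    generalize w 5 = a5 at *
    generalize w 6 = a6 at *
    generalize w 7 = a7 at *
    rw [stdAnnulus, Set.mem_ofPred_eq, Prod.norm_def, hx, hy, Real.norm_eq_abs, Real.norm_eq_abs]
    refine ⟨?_, max_le (abs_le.2 ⟨by linarith, by linarith⟩) (abs_le.2 ⟨by linarith, by linarith⟩)⟩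
    rw [le_max_iff, le_abs, le_abs]
    unfold StdSupp at hs
    rcases hs with ⟨rfl, rfl, rfl, rfl, rfl⟩ | ⟨rfl, rfl, rfl, rfl, rfl⟩ |
      ⟨rfl, rfl, rfl, rfl, rfl⟩ | ⟨rfl, rfl, rfl, rfl, rfl⟩ | ⟨rfl, rfl, rfl, rfl, rfl⟩ |
      ⟨rfl, rfl, rfl, rfl, rfl⟩ | ⟨rfl, rfl, rfl, rfl, rfl⟩ | ⟨rfl, rfl, rfl, rfl, rfl⟩
    · right; left; linarith
    · right; left; linarith
    · left; right; linarith
    · left; right; linarith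
    · right; right; linarith
    · right; right; linarith
    · left; left; linarith
    · left; left; linarith
  inner_eq := by
    ext x
    rw [sphere_eq_segments one_pos]
    simp [stdI, cell_pair, stdPos]
  outer_eq := by
    ext x
    rw [sphere_eq_segments two_pos]
    simp [stdO, cell_pair, stdPos]

end LinkTheory

namespace LinkTheory

/-! ### Triangulations adapted to a piecewise linear map -/

theorem Bary.map_bpt {X Y : Type*} [AddCommGroup X] [Module ℝ X] [AddCommGroup Y] [Module ℝ Y]
    {t : Finset ℕ} {w : ℕ →₀ ℝ} (hw : Bary t w) (g : X →ᵃ[ℝ] Y) (pos : ℕ → X) :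
    g (bpt pos w) = bpt (g ∘ pos) w := by
  have hg : ∀ x, g x = g.linear x + g 0 := fun x => congrFun g.decomp x
  have hsum : ∑ v ∈ t, w v • g (pos v) = ∑ v ∈ t, (w v • g.linear (pos v) + w v • g 0) :=
    Finset.sum_congr rfl fun v _ => by rw [hg (pos v), smul_add]
  rw [hg, hw.bpt_eq_sum, hw.bpt_eq_sum, map_sum]
  simp only [Function.comp_apply, map_smul]
  rw [hsum, Finset.sum_add_distrib, ← Finset.sum_smul, hw.sum_eq, one_smul]

/-- The open simplex. -/
def openCell {X : Type*} [AddCommGroup X] [Module ℝ X] (pos : ℕ → X) (t : Finset ℕ) : Set X :=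
  bpt pos '' {w | Bary t w ∧ ∀ v ∈ t, 0 < w v}

section

variable {pos : ℕ → ℝ × ℝ} {t : Finset ℕ}

theorem convex_openCell : Convex ℝ (openCell pos t) := by
  refine Convex.linear_image ?_ _
  rintro w ⟨hw, hw0⟩ w' ⟨hw', hw0'⟩ a b ha hb hab
  refine ⟨convex_setOf_bary t hw hw' ha hb hab, fun v hv => ?_⟩
  have h1 := hw0 v hv
  have h2 := hw0' v hv
  simp only [Finsupp.add_apply, Finsupp.smul_apply, smul_eq_mul]
  rcases ha.eq_or_lt with rfl | ha
  · rw [zero_add] at hab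
    rw [hab]
    linarith
  · positivity

theorem openCell_subset : openCell pos t ⊆ cell pos t := by
  rintro _ ⟨w, hw, rfl⟩
  exact ⟨w, hw.1, rfl⟩

theorem exists_mem_openCell (ht : t.Nonempty) : (openCell pos t).Nonempty := by
  classical
  have hc : (0 : ℝ) < t.card := by exact_mod_cast ht.card_pos
  refine ⟨_, ∑ v ∈ t, Finsupp.single v (t.card : ℝ)⁻¹, ⟨bary_iff.2 ⟨fun v => ?_, fun v hv => ?_, ?_⟩,
    fun v hv => ?_⟩, rfl⟩
  · rw [Finsupp.finsetSum_apply]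
    refine Finset.sum_nonneg fun u _ => ?_
    rw [Finsupp.single_apply]
    split_ifs <;> positivity
  · rw [Finsupp.finsetSum_apply]
    refine Finset.sum_eq_zero fun u hu => ?_
    rw [Finsupp.single_eq_of_ne]
    rintro rfl
    exact hv hu
  · rw [map_sum]
    simp [hc.ne']
  · rw [Finsupp.finsetSum_apply, Finset.sum_eq_single v]
    · rw [Finsupp.single_eq_same]; positivity
    · intro u _ huv
      rw [Finsupp.single_eq_of_ne huv.symm]
    · exact fun h => absurd hv h

theorem lineMap_mem_openCell {x y : ℝ × ℝ} (hx : x ∈ openCell pos t) (hy : y ∈ cell pos t) {s : ℝ}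
    (hs0 : 0 ≤ s) (hs1 : s < 1) : AffineMap.lineMap x y s ∈ openCell pos t := by
  obtain ⟨w, ⟨hw, hw0⟩, rfl⟩ := hx
  obtain ⟨w', hw', rfl⟩ := hy
  refine ⟨(1 - s) • w + s • w', ⟨convex_setOf_bary t hw hw' (by linarith) hs0 (by ring),
    fun v hv => ?_⟩, ?_⟩
  · have h1 := hw0 v hv
    have h2 := hw'.1 v
    have : 0 < 1 - s := by linarith
    simp only [Finsupp.add_apply, Finsupp.smul_apply, smul_eq_mul]
    positivity
  · rw [map_add, map_smul, map_smul, AffineMap.lineMap_apply_module]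

/-- An affine function of one sign vanishing inside a simplex vanishes on all of it. -/
theorem Pure.eqOn_zero {l : ℝ × ℝ →ᵃ[ℝ] ℝ} (h : Pure l (cell pos t)) {x : ℝ × ℝ}
    (hx : x ∈ openCell pos t) (hlx : l x = 0) : ∀ y ∈ cell pos t, l y = 0 := by
  obtain ⟨w, ⟨hw, hw0⟩, rfl⟩ := hx
  have hv0 : ∀ v ∈ t, l (pos v) = 0 := by
    rw [hw.map_bpt, hw.bpt_eq_sum] at hlx
    rcases h with h | h
    · intro v hv
      have := (Finset.sum_eq_zero_iff_of_nonneg fun u hu => by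
        have := h _ (mem_cell_of_mem pos hu)
        have := hw0 u hu
        simp only [Function.comp_apply, smul_eq_mul]
        positivity).1 hlx v hv
      simpa [(hw0 v hv).ne'] using this
    · intro v hv
      have := (Finset.sum_eq_zero_iff_of_nonpos fun u hu => by
        have := h _ (mem_cell_of_mem pos hu)
        have := hw0 u hu
        simp only [Function.comp_apply, smul_eq_mul]
        nlinarith).1 hlx v hv
      simpa [(hw0 v hv).ne'] using this
  rintro _ ⟨w', hw', rfl⟩
  rw [hw'.map_bpt, hw'.bpt_eq_sum]
  exact Finset.sum_eq_zero fun v hv => by simp [hv0 v hv]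

/-- Two of the affine maps that agree at an interior point of the cell agree on all of it, because
each coordinate of their difference has one sign there. So the coincidence sets of `f` with
essentially different maps are closed and disjoint in the open cell. That cell is connected, hence
only one map occurs. The boundary follows by continuity. -/
theorem exists_affine_eqOn {f : ℝ × ℝ → E3} {s : Set (ℝ × ℝ)} (hs : IsClosed s)
    (hf : ContinuousOn f s) {G : Set (ℝ × ℝ →ᵃ[ℝ] E3)} (hG : G.Finite)
    (hfG : ∀ x ∈ s, ∃ g ∈ G, f x = g x) (ht : t.Nonempty) (hts : cell pos t ⊆ s)
    (hpure : ∀ g ∈ G, ∀ g' ∈ G, ∀ i, Pure ((EuclideanSpace.proj i : E3 →L[ℝ] ℝ).toLinearMap.toAffineMap.comp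
      (g - g')) (cell pos t)) : ∃ g ∈ G, Set.EqOn f g (cell pos t) := by
  obtain ⟨x₀, hx₀⟩ := exists_mem_openCell (pos := pos) ht
  obtain ⟨g, hg, hfg⟩ := hfG x₀ (hts (openCell_subset hx₀))
  have hclosed : ∀ g : ℝ × ℝ →ᵃ[ℝ] E3, IsClosed {x ∈ s | f x = g x} := fun g => by
    have hc : ContinuousOn (fun x => f x - g x) s :=
      hf.sub g.continuous_of_finiteDimensional.continuousOn
    have := hc.preimage_isClosed_of_isClosed hs (isClosed_singleton (x := (0 : E3)))
    convert this using 1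
    ext x
    simp [sub_eq_zero]
  have hopen : openCell pos t ⊆ {x ∈ s | f x = g x} := by
    by_contra hnot
    obtain ⟨x₁, hx₁, hx₁'⟩ := Set.not_subset.1 hnot
    set B := ⋃ g' ∈ {g' ∈ G | ¬ Set.EqOn g' g (cell pos t)}, {x ∈ s | f x = g' x} with hB
    have hBc : IsClosed B := (hG.subset (Set.sep_subset _ _)).isClosed_biUnion fun g' _ => hclosed g'
    have hcov : openCell pos t ⊆ {x ∈ s | f x = g x} ∪ B := by
      intro x hx
      have hxs := hts (openCell_subset hx)
      obtain ⟨g', hg', hfx⟩ := hfG x hxs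
      by_cases he : Set.EqOn g' g (cell pos t)
      · exact Or.inl ⟨hxs, hfx.trans (he (openCell_subset hx))⟩
      · exact Or.inr (Set.mem_iUnion₂.2 ⟨g', ⟨hg', he⟩, hxs, hfx⟩)
    obtain ⟨x, hx, hxg, hxB⟩ := isPreconnected_closed_iff.1
      (convex_openCell (pos := pos) (t := t)).isPreconnected _ _ (hclosed g) hBc hcov
      ⟨x₀, hx₀, hts (openCell_subset hx₀), hfg⟩ ⟨x₁, hx₁, (hcov hx₁).resolve_left hx₁'⟩
    obtain ⟨g', ⟨hg', hne⟩, -, hfx⟩ := Set.mem_iUnion₂.1 hxB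
    refine hne fun y hy => ?_
    ext i
    have h0 : (g' x) i - (g x) i = 0 := by
      rw [← hfx, ← hxg.2, sub_self]
    have := (hpure g' hg' g hg i).eqOn_zero hx (by simpa using h0) y hy
    simpa [sub_eq_zero] using this
  refine ⟨g, hg, fun y hy => ?_⟩
  have hlim : Filter.Tendsto (fun s : ℝ => AffineMap.lineMap x₀ y s) (𝓝[<] 1) (𝓝 y) := by
    have : Continuous fun s : ℝ => (AffineMap.lineMap x₀ y s : ℝ × ℝ) := AffineMap.lineMap_continuous
    have := (this.tendsto 1).mono_left (nhdsWithin_le_nhds (s := Set.Iio 1))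
    simpa using this
  refine ((hclosed g).mem_of_tendsto hlim ?_).2
  have hI : Set.Ioo (0 : ℝ) 1 ∈ 𝓝[<] (1 : ℝ) := Ioo_mem_nhdsLT one_pos
  filter_upwards [hI] with s hs'
  exact hopen (lineMap_mem_openCell hx₀ hy hs'.1.le hs'.2)

end

theorem isClosed_stdAnnulus : IsClosed stdAnnulus :=
  (isClosed_le continuous_const continuous_norm).inter (isClosed_le continuous_norm continuous_const)

/-- A piecewise linear annulus has a triangulation with no triangle crossing the plane `z = 0`. -/
theorem IsPLAnnulus.exists_complex {A C C' : Set E3} (h : IsPLAnnulus A C C') :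
    ∃ T I O, ∃ pos : ℕ → E3, IsAnnulus T I O ∧ GeomInj T pos ∧ (∀ t ∈ T, cell pos t ⊆ A) ∧
      ⋃ g ∈ I, cell pos g = C ∧ ⋃ g ∈ O, cell pos g = C' ∧
      ∀ t ∈ T, (∀ v ∈ t, 0 ≤ pos v 2) ∨ ∀ v ∈ t, pos v 2 ≤ 0 := by
  obtain ⟨f, ⟨⟨hfc, G, hG, hfG⟩, hinj⟩, rfl, rfl, rfl⟩ := h
  set pr : Fin 3 → E3 →ᵃ[ℝ] ℝ := fun i =>
    (EuclideanSpace.proj i : E3 →L[ℝ] ℝ).toLinearMap.toAffineMap with hpr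
  -- Cutting along the first family makes `f` affine on every triangle. Cutting along the second
  -- then keeps each image triangle on one side of the plane.
  have hF : ((⋃ i, Set.image2 (fun g g' => (pr i).comp (g - g')) G G) ∪
      (fun g => (pr 2).comp g) '' G).Finite :=
    (Set.finite_iUnion fun i => Set.Finite.image2 _ hG hG).union (hG.image _)
  obtain ⟨T, I, O, pos, hGA, hpure⟩ := std_geomAnnulus.cut_finite hF
  have hTne : ∀ t ∈ T, t.Nonempty := fun t ht => by
    rw [← Finset.card_pos, hGA.card_tri t ht]; norm_num
  have haff : ∀ t ∈ T, ∃ g ∈ G, Set.EqOn f g (cell pos t) := fun t ht =>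
    exists_affine_eqOn isClosed_stdAnnulus hfc hG hfG (hTne t ht) (hGA.cell_subset t ht)
      fun g hg g' hg' i => hpure _ (Or.inl (Set.mem_iUnion.2 ⟨i, g, hg, g', hg', rfl⟩)) t ht
  have hmap : ∀ t ∈ T, ∀ w, Bary t w → f (bpt pos w) = bpt (f ∘ pos) w := by
    intro t ht w hw
    obtain ⟨g, -, hfg⟩ := haff t ht
    rw [hfg ⟨w, hw, rfl⟩, hw.map_bpt, hw.bpt_eq_sum, hw.bpt_eq_sum]
    exact Finset.sum_congr rfl fun v hv => by
      rw [Function.comp_apply, Function.comp_apply, hfg (mem_cell_of_mem pos hv)]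
  have himg : ∀ t ∈ T, ∀ g ⊆ t, f '' cell pos g = cell (f ∘ pos) g := by
    intro t ht g hg
    rw [cell, cell, Set.image_image]
    exact Set.image_congr fun w hw => hmap t ht w (Bary.mono hw hg)
  have hU : ∀ J ⊆ faceEdges T, ∀ S, ⋃ g ∈ J, cell pos g = S → ⋃ g ∈ J, cell (f ∘ pos) g = f '' S := by
    rintro J hJ _ rfl
    rw [Set.image_iUnion₂]
    refine Set.iUnion₂_congr fun g hg => ?_
    obtain ⟨-, t, ht, hgt⟩ := mem_faceEdges.1 (hJ hg)
    exact (himg t ht g hgt).symm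
  refine ⟨T, I, O, f ∘ pos, hGA.toIsAnnulus, ?_, ?_, hU I hGA.inner_subset _ hGA.inner_eq,
    hU O hGA.outer_subset _ hGA.outer_eq, ?_⟩
  · intro s hs t ht w w' hw hw' he
    rw [← hmap s hs w hw, ← hmap t ht w' hw'] at he
    exact hGA.geomInj s hs t ht w w' hw hw'
      (hinj (hGA.cell_subset s hs ⟨w, hw, rfl⟩) (hGA.cell_subset t ht ⟨w', hw', rfl⟩) he)
  · intro t ht
    rw [← himg t ht t subset_rfl]
    exact Set.image_mono (hGA.cell_subset t ht)
  · intro t ht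
    obtain ⟨g, hg, hfg⟩ := haff t ht
    refine (hpure _ (Or.inr ⟨g, hg, rfl⟩) t ht).imp (fun h v hv => ?_) (fun h v hv => ?_)
    · have h1 := h _ (mem_cell_of_mem pos hv)
      rw [Function.comp_apply, hfg (mem_cell_of_mem pos hv)]
      exact h1
    · have h1 := h _ (mem_cell_of_mem pos hv)
      rw [Function.comp_apply, hfg (mem_cell_of_mem pos hv)]
      exact h1

end LinkTheory

namespace LinkTheory

/-! ### Moving a curve across the triangles of an annulus -/

/-- The union of the cells of a complex. -/
def support (pos : ℕ → E3) (C : Finset (Finset ℕ)) : Set E3 := ⋃ g ∈ C, cell pos g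

section

variable {T I O C C' : Finset (Finset ℕ)} {pos : ℕ → E3}

theorem mem_support {x : E3} : x ∈ support pos C ↔ ∃ g ∈ C, x ∈ cell pos g := by simp [support]

theorem cell_subset_support {g : Finset ℕ} (hg : g ∈ C) : cell pos g ⊆ support pos C :=
  Set.subset_biUnion_of_mem (u := fun g => cell pos g) hg

theorem isCompact_cell (g : Finset ℕ) : IsCompact (cell pos g) := by
  rw [cell_eq_convexHull]
  exact (g.finite_toSet.image pos).isCompact_convexHull ℝ

theorem isCompact_support : IsCompact (support pos C) :=
  C.finite_toSet.isCompact_biUnion fun g _ => isCompact_cell g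

theorem cell_empty : cell pos ∅ = ∅ := by
  rw [cell_eq_convexHull]; simp

theorem cell_singleton (v : ℕ) : cell pos {v} = {pos v} := by
  rw [cell_eq_convexHull]; simp

theorem GeomInj.faceEdges (h : GeomInj T pos) : GeomInj (faceEdges T) pos := by
  intro s hs t ht w w' hw hw' he
  obtain ⟨-, s', hs', hss'⟩ := mem_faceEdges.1 hs
  obtain ⟨-, t', ht', htt'⟩ := mem_faceEdges.1 ht
  exact h s' hs' t' ht' w w' (hw.mono hss') (hw'.mono htt') he

theorem GeomInj.mono (h : GeomInj T pos) (hC : C ⊆ T) : GeomInj C pos :=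
  fun s hs t ht => h s (hC hs) t (hC ht)

theorem GeomInj.injOn (h : GeomInj C pos) {u v : ℕ} (hu : u ∈ verts C) (hv : v ∈ verts C)
    (he : pos u = pos v) : u = v := by
  obtain ⟨s, hs, hus⟩ := mem_verts.1 hu
  obtain ⟨t, ht, hvt⟩ := mem_verts.1 hv
  have := h s hs t ht _ _ (Bary.single hus) (Bary.single hvt) (by simpa using he)
  by_contra hne
  have := DFunLike.congr_fun this u
  rw [Finsupp.single_eq_same, Finsupp.single_eq_of_ne hne] at this
  exact one_ne_zero this

/-- A linear relation would allow the weights of the barycentre to be changed without moving the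
point. The factor `e` keeps the changed weights nonnegative. -/
theorem GeomInj.linearIndependent (h : GeomInj T pos) {a b c : ℕ} (hab : a ≠ b) (hac : a ≠ c)
    (hbc : b ≠ c) (ht : {a, b, c} ∈ T) : LinearIndependent ℝ ![pos b - pos a, pos c - pos a] := by
  rw [LinearIndependent.pair_iff]
  intro s t hst
  set e := (1 / 3 : ℝ) / (|s| + |t| + 1) with he
  have hpos : 0 < |s| + |t| + 1 := by positivity
  have he0 : 0 < e := by positivity
  have hbd : e * (|s| + |t|) ≤ 1 / 3 := by
    rw [he, div_mul_eq_mul_div, div_le_iff₀ hpos]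
    nlinarith [abs_nonneg s, abs_nonneg t]
  set w : ℝ → ℝ → ℕ →₀ ℝ := fun s t => (1 / 3 - e * (s + t)) • Finsupp.single a 1 +
    (1 / 3 + e * s) • Finsupp.single b 1 + (1 / 3 + e * t) • Finsupp.single c 1 with hw
  have hwa : ∀ s t, w s t a = 1 / 3 - e * (s + t) := fun s t => by
    simp [hw, hab.symm, hac.symm]
  have hwb : ∀ s t, w s t b = 1 / 3 + e * s := fun s t => by
    simp [hw, hab, hbc.symm]
  have hwc : ∀ s t, w s t c = 1 / 3 + e * t := fun s t => by
    simp [hw, hac, hbc]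
  have hbary : ∀ s t, e * (|s| + |t|) ≤ 1 / 3 → Bary {a, b, c} (w s t) := by
    intro s t hst
    have h1 := mul_le_mul_of_nonneg_left (neg_abs_le s) he0.le
    have h2 := mul_le_mul_of_nonneg_left (neg_abs_le t) he0.le
    have h3 := mul_le_mul_of_nonneg_left (le_abs_self s) he0.le
    have h4 := mul_le_mul_of_nonneg_left (le_abs_self t) he0.le
    have h5 := mul_nonneg he0.le (abs_nonneg s)
    have h6 := mul_nonneg he0.le (abs_nonneg t)
    refine bary_iff.2 ⟨fun v => ?_, fun v hv => ?_, ?_⟩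
    · by_cases hva : v = a
      · rw [hva, hwa]; linarith
      by_cases hvb : v = b
      · rw [hvb, hwb]; linarith
      by_cases hvc : v = c
      · rw [hvc, hwc]; linarith
      simp [hw, Ne.symm hva, Ne.symm hvb, Ne.symm hvc]
    · simp only [Finset.mem_insert, Finset.mem_singleton, not_or] at hv
      simp [hw, Ne.symm hv.1, Ne.symm hv.2.1, Ne.symm hv.2.2]
    · simp only [hw, map_add, map_smul, Finsupp.linearCombination_single, smul_eq_mul]
      ring
  have heq := h _ ht _ ht _ _ (hbary s t hbd) (hbary 0 0 (by norm_num)) (by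
    simp only [hw, map_add, map_smul, bpt, Finsupp.linearCombination_single, one_smul]
    have : (1 / 3 - e * (s + t)) • pos a + (1 / 3 + e * s) • pos b + (1 / 3 + e * t) • pos c =
      (1 / 3 - e * (0 + 0)) • pos a + (1 / 3 + e * 0) • pos b + (1 / 3 + e * 0) • pos c +
        e • (s • (pos b - pos a) + t • (pos c - pos a)) := by module
    rw [this, hst, smul_zero, add_zero])
  have h1 := DFunLike.congr_fun heq b
  have h2 := DFunLike.congr_fun heq c
  rw [hwb, hwb] at h1
  rw [hwc, hwc] at h2
  constructor
  · have : e * s = 0 := by linarith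
    exact (mul_eq_zero.1 this).resolve_left he0.ne'
  · have : e * t = 0 := by linarith
    exact (mul_eq_zero.1 this).resolve_left he0.ne'

/-- If two edges of a triangle meet a polygonal curve nicely, then the curve can be moved across the
triangle. -/
theorem moves_of_tri {a b c : ℕ} (hC2 : ∀ g ∈ C, g.card = 2) (hab : {a, b} ∈ C)
    (hind : LinearIndependent ℝ ![pos b - pos a, pos c - pos a])
    (hmeet : ∀ g ∈ C, g ≠ {a, b} →
      cell pos g ∩ tri (pos a) (pos b) (pos c) ⊆ cell pos (g ∩ {a, b}))
    {Z₀ : Set E3} (hZ₀ : IsCompact Z₀) (hZ₀' : Disjoint Z₀ (tri (pos a) (pos b) (pos c))) :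
    Moves Z₀ (support pos C) (support pos (insert {a, c} (insert {c, b} (C.erase {a, b})))) := by
  have hab' : a ≠ b := by
    rintro rfl
    have := hC2 _ hab
    simp at this
  -- Edges away from `a` and `b` join the compact set disjoint from the triangle. The edges at `a`
  -- and `b` are the segments allowed to touch the triangle at a corner.
  set F := (C.erase {a, b}).filter fun g => a ∉ g ∧ b ∉ g with hF
  set Qa : Set E3 := pos '' {y ∈ (verts C : Set ℕ) | {a, y} ∈ C ∧ y ≠ b} with hQa
  set Qb : Set E3 := pos '' {y ∈ (verts C : Set ℕ) | {b, y} ∈ C ∧ y ≠ a} with hQb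
  have hZ : IsCompact (Z₀ ∪ support pos F) := hZ₀.union isCompact_support
  have hdisj : Disjoint (Z₀ ∪ support pos F) (tri (pos a) (pos b) (pos c)) := by
    rw [Set.disjoint_union_left]
    refine ⟨hZ₀', Set.disjoint_left.2 fun x hx hxt => ?_⟩
    obtain ⟨g, hg, hxg⟩ := mem_support.1 hx
    obtain ⟨hg, hga, hgb⟩ := Finset.mem_filter.1 hg
    obtain ⟨hne, hgC⟩ := Finset.mem_erase.1 hg
    have := hmeet g hgC hne ⟨hxg, hxt⟩
    rw [show g ∩ {a, b} = ∅ by ext v; simp; rintro hv; exact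
      ⟨fun e => hga (e ▸ hv), fun e => hgb (e ▸ hv)⟩, cell_empty] at this
    exact this
  have hfin : ∀ s : ℕ, ∀ r : ℕ, (pos '' {y ∈ (verts C : Set ℕ) | {s, y} ∈ C ∧ y ≠ r}).Finite :=
    fun s r => ((verts C).finite_toSet.subset (Set.sep_subset _ _)).image _
  have hend : ∀ s r : ℕ, ({s, r} : Finset ℕ) = {a, b} →
      ∀ y ∈ pos '' {y ∈ (verts C : Set ℕ) | {s, y} ∈ C ∧ y ≠ r},
      segment ℝ (pos s) y ∩ tri (pos a) (pos b) (pos c) ⊆ {pos s} := by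
    rintro s r hsr _ ⟨y, ⟨-, hy, hyr⟩, rfl⟩
    have hys : y ≠ s := fun e => by
      have := hC2 _ hy
      simp [e] at this
    have hne : ({s, y} : Finset ℕ) ≠ {a, b} := fun e => by
      have : y ∈ ({s, r} : Finset ℕ) := by rw [hsr, ← e]; simp
      simp [hys, hyr] at this
    have := hmeet _ hy hne
    rw [cell_pair, ← hsr, show ({s, y} ∩ {s, r} : Finset ℕ) = {s} by
      ext v; simp only [Finset.mem_inter, Finset.mem_insert, Finset.mem_singleton]
      constructor
      · rintro ⟨rfl | rfl, h | h⟩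
        · exact h
        · rfl
        · exact h
        · exact absurd h hyr
      · rintro rfl; simp, cell_singleton] at this
    exact this
  obtain ⟨h, hiso, hpl, hfix, himg⟩ := moves_across_tri hind hZ hdisj (hfin a b) (hfin b a)
    (hend a b rfl) (hend b a (Finset.pair_comm _ _))
  refine ⟨h, hiso, hpl, fun x hx => hfix (Or.inl (Or.inl (Or.inl hx))), ?_⟩
  have hrest : ∀ g ∈ C.erase {a, b}, h '' cell pos g = cell pos g := by
    intro g hg
    refine Eq.trans (Set.image_congr fun x hx => hfix ?_) (Set.image_id _)
    obtain ⟨hne, hgC⟩ := Finset.mem_erase.1 hg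
    obtain ⟨x₁, y₁, hxy, rfl⟩ := Finset.card_eq_two.1 (hC2 g hgC)
    by_cases hga : a ∈ ({x₁, y₁} : Finset ℕ)
    · obtain ⟨y, hy⟩ : ∃ y, ({x₁, y₁} : Finset ℕ) = {a, y} := by
        simp only [Finset.mem_insert, Finset.mem_singleton] at hga
        rcases hga with rfl | rfl
        · exact ⟨_, rfl⟩
        · exact ⟨_, Finset.pair_comm _ _⟩
      rw [hy] at hx hne hgC
      rw [cell_pair] at hx
      refine Or.inl (Or.inr (Set.mem_iUnion₂.2 ⟨pos y, ⟨y, ⟨?_, hgC, ?_⟩, rfl⟩, hx⟩))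
      · exact mem_verts.2 ⟨_, hgC, by simp⟩
      · rintro rfl; exact hne rfl
    by_cases hgb : b ∈ ({x₁, y₁} : Finset ℕ)
    · obtain ⟨y, hy⟩ : ∃ y, ({x₁, y₁} : Finset ℕ) = {b, y} := by
        simp only [Finset.mem_insert, Finset.mem_singleton] at hgb
        rcases hgb with rfl | rfl
        · exact ⟨_, rfl⟩
        · exact ⟨_, Finset.pair_comm _ _⟩
      rw [hy] at hx hne hgC
      rw [cell_pair] at hx
      refine Or.inr (Set.mem_iUnion₂.2 ⟨pos y, ⟨y, ⟨?_, hgC, ?_⟩, rfl⟩, hx⟩)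
      · exact mem_verts.2 ⟨_, hgC, by simp⟩
      · rintro rfl; exact hne (Finset.pair_comm _ _)
    · exact Or.inl (Or.inl (Or.inr (mem_support.2 ⟨_, Finset.mem_filter.2 ⟨hg, hga, hgb⟩, hx⟩)))
  have h1 : support pos C = cell pos {a, b} ∪ support pos (C.erase {a, b}) := by
    conv_lhs => rw [← Finset.insert_erase hab]
    rw [support, Finset.set_biUnion_insert]
    rfl
  have h2 : h '' support pos (C.erase {a, b}) = support pos (C.erase {a, b}) := by
    rw [support, Set.image_iUnion₂]
    exact Set.iUnion₂_congr hrest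
  rw [h1, Set.image_union, h2, cell_pair, himg, support, support, Finset.set_biUnion_insert,
    Finset.set_biUnion_insert, cell_pair, cell_pair, Set.union_assoc]

/-- As the curve avoids the vertex `c`, cells of a geometric complex give that its other edges meet
the triangle only in `a` and `b`. -/
theorem moves_of_curveMove (hinj : GeomInj T pos) {a b c : ℕ} (ht : {a, b, c} ∈ T)
    (hC : C ⊆ faceEdges T) (hmv : CurveMove C C' a b c) {Z₀ : Set E3} (hZ₀ : IsCompact Z₀)
    (hdisj : ∀ t ∈ T, Disjoint Z₀ (cell pos t)) :
    Moves Z₀ (support pos C) (support pos C') := by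
  obtain ⟨hab, hac, hbc, habC, hcC, rfl⟩ := hmv
  refine moves_of_tri (fun g hg => (mem_faceEdges.1 (hC hg)).1) habC
    (hinj.linearIndependent hab hac hbc ht) ?_ hZ₀ (cell_triple pos a b c ▸ hdisj _ ht)
  intro g hg _
  obtain ⟨-, t, htT, hgt⟩ := mem_faceEdges.1 (hC hg)
  rw [← cell_triple, hinj.inter htT ht hgt subset_rfl]
  refine cell_mono _ fun v hv => ?_
  simp only [Finset.mem_inter, Finset.mem_insert, Finset.mem_singleton] at hv ⊢
  refine ⟨hv.1, ?_⟩
  rcases hv.2 with h | h | h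
  · exact Or.inl h
  · exact Or.inr h
  · exact absurd (mem_verts.2 ⟨g, hg, h ▸ hv.1⟩) hcC

/-- The inner boundary curve of an annulus with outer boundary above the plane `z = 0` can be moved
within the annulus to a curve each edge of which is in the plane, or in the inner boundary and not
below the plane. -/
theorem IsAnnulus.exists_flat_curve (h : IsAnnulus T I O) (hinj : GeomInj T pos)
    (hsign : ∀ t ∈ T, (∀ v ∈ t, 0 ≤ pos v 2) ∨ ∀ v ∈ t, pos v 2 ≤ 0)
    (hO : ∀ x ∈ support pos O, 0 < x 2) {Z₀ : Set E3} (hZ₀ : IsCompact Z₀)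
    (hdisj : ∀ t ∈ T, Disjoint Z₀ (cell pos t)) :
    ∃ C ⊆ faceEdges T, TwoRegular C ∧ Moves Z₀ (support pos I) (support pos C) ∧
      ∀ g ∈ C, (∀ v ∈ g, pos v 2 = 0) ∨ (g ∈ I ∧ ∀ v ∈ g, 0 ≤ pos v 2) := by
  obtain ⟨C, hQ, hreg, hCT, hC⟩ := h.exists_curve (fun t => ∀ v ∈ t, 0 ≤ pos v 2) (by
      rintro t ht ⟨g, hg, hgt⟩
      refine (hsign t ht).resolve_right fun hneg => ?_
      obtain ⟨v, hv⟩ : g.Nonempty := by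
        rw [← Finset.card_pos, (mem_faceEdges.1 (h.outer_subset hg)).1]; norm_num
      exact absurd (hneg v (hgt hv)) (not_le.2 (hO _ (cell_subset_support hg
        (mem_cell_of_mem pos hv)))))
    (Q := fun C => Moves Z₀ (support pos I) (support pos C)) (Moves.refl _ _) (by
      intro C C' a b c ht hC hC' hmv
      have := moves_of_curveMove hinj ht hC hmv hZ₀ hdisj
      exact ⟨fun h => h.trans this, fun h => h.trans this.symm⟩)
  refine ⟨C, hCT, hreg, hQ, fun g hg => ?_⟩
  obtain ⟨⟨t, ht, hgt, hup⟩, hg'⟩ := hC g hg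
  rcases hg' with hgI | ⟨s, hs, hgs, hdown⟩
  · exact Or.inr ⟨hgI, fun v hv => hup v (hgt hv)⟩
  -- An edge between an upper triangle and one that is not upper belongs to triangles on both sides
  -- of the plane, so it lies in the plane.
  · exact Or.inl fun v hv => le_antisymm (((hsign s hs).resolve_left hdown) v (hgs hv))
      (hup v (hgt hv))

end
end LinkTheory

namespace LinkTheory

/-! ### Local maxima of the height on a polygonal curve -/

section

variable {C : Finset (Finset ℕ)} {pos : ℕ → E3}

theorem bpt_apply (pos : ℕ → E3) (w : ℕ →₀ ℝ) (i : Fin 3) :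
    (bpt pos w) i = bpt (fun v => pos v i) w := by
  induction w using Finsupp.induction_linear with
  | zero => simp
  | add f g hf hg => rw [map_add, map_add, PiLp.add_apply, hf, hg]
  | single v r => simp

theorem Bary.bpt_le {t : Finset ℕ} {w : ℕ →₀ ℝ} (hw : Bary t w) {r : ℕ → ℝ} {c : ℝ}
    (h : ∀ v ∈ t, r v ≤ c) : bpt r w ≤ c := by
  rw [hw.bpt_eq_sum]
  calc ∑ v ∈ t, w v • r v ≤ ∑ v ∈ t, w v * c :=
        Finset.sum_le_sum fun v hv => mul_le_mul_of_nonneg_left (h v hv) (hw.1 v)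
    _ = c := by rw [← Finset.sum_mul, hw.sum_eq, one_mul]

theorem Bary.le_bpt {t : Finset ℕ} {w : ℕ →₀ ℝ} (hw : Bary t w) {r : ℕ → ℝ} {c : ℝ}
    (h : ∀ v ∈ t, c ≤ r v) : c ≤ bpt r w := by
  have := hw.bpt_le (r := fun v => - r v) (c := -c) fun v hv => neg_le_neg (h v hv)
  rw [hw.bpt_eq_sum] at this ⊢
  simp only [smul_neg, Finset.sum_neg_distrib] at this
  linarith

/-- Points of a cell: the minimal face containing them. -/
theorem Bary.support {t : Finset ℕ} {w : ℕ →₀ ℝ} (hw : Bary t w) :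
    Bary w.support w ∧ ∀ v ∈ w.support, 0 < w v :=
  ⟨⟨hw.1, subset_rfl, hw.2.2⟩, fun v hv => (hw.1 v).lt_of_ne' (Finsupp.mem_support_iff.1 hv)⟩

/-- The cells not containing the minimal face of the point form a compact set that misses the point.
-/
theorem GeomInj.eventually_mem (h : GeomInj C pos) {g : Finset ℕ} (hg : g ∈ C) {w : ℕ →₀ ℝ}
    (hw : Bary g w) : ∀ᶠ y in 𝓝[support pos C] (bpt pos w), ∃ g' ∈ C, w.support ⊆ g' ∧
      y ∈ cell pos g' := by
  set F := C.filter fun g' => ¬ w.support ⊆ g' with hF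
  have hcl : IsClosed (LinkTheory.support pos F) := isCompact_support.isClosed
  have hnot : bpt pos w ∈ (LinkTheory.support pos F)ᶜ := by
    intro hmem
    obtain ⟨g', hg', w', hw', he⟩ := mem_support.1 hmem
    obtain ⟨hg'C, hns⟩ := Finset.mem_filter.1 hg'
    obtain rfl := h g' hg'C g hg w' w hw' hw he
    exact hns hw'.2.1
  filter_upwards [mem_nhdsWithin_of_mem_nhds (hcl.isOpen_compl.mem_nhds hnot),
    self_mem_nhdsWithin] with y hy hyN
  obtain ⟨g', hg', hyg'⟩ := mem_support.1 hyN
  exact ⟨g', hg', by_contra fun hns =>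
    hy (mem_support.2 ⟨g', Finset.mem_filter.2 ⟨hg', hns⟩, hyg'⟩), hyg'⟩

/-- Near the point, the complex consists of parts of the cells containing its minimal face. The
height is affine on each of them, so a local maximum is a maximum over these whole cells. -/
theorem mem_localMaxima_iff (h : GeomInj C pos) {g : Finset ℕ} (hg : g ∈ C) {w : ℕ →₀ ℝ}
    (hw : Bary g w) : bpt pos w ∈ localMaxima (support pos C) ↔
      ∀ g' ∈ C, w.support ⊆ g' → ∀ v ∈ g', pos v 2 ≤ (bpt pos w) 2 := by
  constructor
  · rintro ⟨-, hmax⟩ g' hg' hwg' v hv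
    by_contra hlt
    push Not at hlt
    set x := bpt pos w with hx
    have hxg' : x ∈ cell pos g' := ⟨w, ⟨hw.1, hwg', hw.2.2⟩, rfl⟩
    have hcv : Convex ℝ (cell pos g') := (convex_setOf_bary g').linear_image _
    have htend : Filter.Tendsto (fun s : ℝ => AffineMap.lineMap x (pos v) s) (𝓝[>] 0)
        (𝓝[support pos C] x) := by
      refine tendsto_nhdsWithin_iff.2 ⟨?_, ?_⟩
      · have hc : Continuous fun s : ℝ => (AffineMap.lineMap x (pos v) s : E3) :=
          AffineMap.lineMap_continuous
        have := (hc.tendsto 0).mono_left (nhdsWithin_le_nhds (s := Set.Ioi 0))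
        simpa using this
      · filter_upwards [Ioo_mem_nhdsGT (one_pos : (0 : ℝ) < 1)] with s hs
        exact cell_subset_support hg' (hcv.lineMap_mem hxg' (mem_cell_of_mem pos hv)
          ⟨hs.1.le, hs.2.le⟩)
    have hev := (htend.eventually hmax).and (Ioo_mem_nhdsGT (one_pos : (0 : ℝ) < 1))
    obtain ⟨s, hs, hs0, -⟩ := hev.exists
    rw [AffineMap.lineMap_apply_module] at hs
    simp only [PiLp.add_apply, PiLp.smul_apply, smul_eq_mul] at hs
    nlinarith
  · intro hle
    refine ⟨cell_subset_support hg ⟨w, hw, rfl⟩, ?_⟩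
    filter_upwards [h.eventually_mem hg hw] with y hy
    obtain ⟨g', hg', hwg', w', hw', rfl⟩ := hy
    rw [bpt_apply _ w']
    exact hw'.bpt_le (hle g' hg' hwg')

theorem mem_localMaxima_iUnion {ι : Type*} [Finite ι] {N : ι → Set E3} (hN : ∀ i, IsCompact (N i))
    (hd : Pairwise (Function.onFun Disjoint N)) {i : ι} {x : E3} (hx : x ∈ N i) :
    x ∈ localMaxima (⋃ j, N j) ↔ x ∈ localMaxima (N i) := by
  have hev : 𝓝[⋃ j, N j] x = 𝓝[N i] x := by
    have hcl : IsClosed (⋃ j : {j // j ≠ i}, N j) :=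
      isClosed_iUnion_of_finite fun j => (hN j).isClosed
    have hnot : x ∈ (⋃ j : {j // j ≠ i}, N j)ᶜ := by
      intro hmem
      obtain ⟨j, hj⟩ := Set.mem_iUnion.1 hmem
      exact Set.disjoint_left.1 (hd j.2) hj hx
    refine nhdsWithin_eq_nhdsWithin hnot hcl.isOpen_compl ?_
    ext y
    constructor
    · rintro ⟨hy, hy'⟩
      obtain ⟨j, hj⟩ := Set.mem_iUnion.1 hy
      by_cases hji : j = i
      · exact ⟨hji ▸ hj, hy'⟩
      · exact absurd (Set.mem_iUnion.2 ⟨⟨j, hji⟩, hj⟩) hy'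
    · exact fun ⟨hy, hy'⟩ => ⟨Set.mem_iUnion.2 ⟨i, hy⟩, hy'⟩
  simp only [localMaxima, Set.mem_ofPred_eq, IsLocalMaxOn, hev, hx, Set.mem_iUnion.2 ⟨i, hx⟩,
    true_and]

/-! ### Vertical displacements of polygonal links -/

/-- By compactness of the set `K` of normalized differences of weights. On `K` the displacement is
nonzero, since a zero would give two different sets of weights for one point. -/
theorem GeomInj.exists_lower_bound (h : GeomInj C pos) {g g' : Finset ℕ} (hg : g ∈ C)
    (hg' : g' ∈ C) : ∃ c > 0, ∀ w w', Bary g w → Bary g' w' →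
      c * ∑ v ∈ g ∪ g', |w v - w' v| ≤ ‖bpt pos w - bpt pos w'‖ := by
  set s := g ∪ g' with hs
  set K : Set (ℕ → ℝ) := {u | (∀ v ∉ g', 0 ≤ u v) ∧ (∀ v ∉ g, u v ≤ 0) ∧ ∑ v ∈ s, u v = 0 ∧
    ∑ v ∈ s, |u v| = 1} with hK
  have hKc : IsCompact K := by
    refine IsCompact.of_isClosed_subset (isCompact_univ_pi fun _ : ℕ =>
      (isCompact_Icc : IsCompact (Set.Icc (-1 : ℝ) 1))) ?_ ?_
    · have h1 : IsClosed {u : ℕ → ℝ | ∀ v ∉ g', 0 ≤ u v} := by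
        simp only [Set.ofPred_forall]
        exact isClosed_iInter fun v => isClosed_iInter fun _ =>
          isClosed_le continuous_const (continuous_apply v)
      have h2 : IsClosed {u : ℕ → ℝ | ∀ v ∉ g, u v ≤ 0} := by
        simp only [Set.ofPred_forall]
        exact isClosed_iInter fun v => isClosed_iInter fun _ =>
          isClosed_le (continuous_apply v) continuous_const
      have h3 : IsClosed {u : ℕ → ℝ | ∑ v ∈ s, u v = 0} :=
        isClosed_eq (by fun_prop) continuous_const
      have h4 : IsClosed {u : ℕ → ℝ | ∑ v ∈ s, |u v| = 1} :=
        isClosed_eq (by fun_prop) continuous_const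
      exact h1.inter (h2.inter (h3.inter h4))
    · rintro u ⟨h1, h2, -, h4⟩ v -
      by_cases hv : v ∈ s
      · exact abs_le.1 (h4 ▸ Finset.single_le_sum (f := fun v => |u v|) (fun i _ => abs_nonneg _) hv)
      · rw [hs, Finset.mem_union, not_or] at hv
        have := le_antisymm (h2 v hv.1) (h1 v hv.2)
        rw [this]; norm_num
  have hpos : ∀ u ∈ K, 0 < ‖∑ v ∈ s, u v • pos v‖ := by
    rintro u ⟨h1, h2, h3, h4⟩
    rw [norm_pos_iff]
    intro h0
    -- The coordinates of `u` sum to 0 and their absolute values to 1, so positive and negative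
    -- parts each have total 1/2. Doubled, they are barycentric weights.
    set w : ℕ →₀ ℝ := Finsupp.onFinset s (fun v => if v ∈ s then 2 * max (u v) 0 else 0)
      (fun v hv => by by_contra hvs; simp [hvs] at hv) with hw
    set w' : ℕ →₀ ℝ := Finsupp.onFinset s (fun v => if v ∈ s then 2 * max (-u v) 0 else 0)
      (fun v hv => by by_contra hvs; simp [hvs] at hv) with hw'
    have hwv : ∀ v ∈ s, w v = 2 * max (u v) 0 := fun v hv => by simp [hw, hv]
    have hwv' : ∀ v ∈ s, w' v = 2 * max (-u v) 0 := fun v hv => by simp [hw', hv]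
    have hm : ∀ x : ℝ, 2 * max x 0 = |x| + x := fun x => by
      rcases le_total 0 x with hx | hx
      · rw [max_eq_left hx, abs_of_nonneg hx]; ring
      · rw [max_eq_right hx, abs_of_nonpos hx]; ring
    have hbw : Bary g w := by
      refine bary_iff.2 ⟨fun v => ?_, fun v hv => ?_, ?_⟩
      · simp only [hw, Finsupp.onFinset_apply]; split_ifs <;> positivity
      · simp only [hw, Finsupp.onFinset_apply]
        rw [max_eq_right (h2 v hv)]; simp
      · rw [Finsupp.linearCombination_apply, Finsupp.sum_of_support_subset (s := s) _
          Finsupp.support_onFinset_subset _ (by simp)]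
        simp only [smul_eq_mul, mul_one]
        rw [Finset.sum_congr rfl fun v hv => (hwv v hv).trans (hm _), Finset.sum_add_distrib, h3, h4,
          add_zero]
    have hbw' : Bary g' w' := by
      refine bary_iff.2 ⟨fun v => ?_, fun v hv => ?_, ?_⟩
      · simp only [hw', Finsupp.onFinset_apply]; split_ifs <;> positivity
      · simp only [hw', Finsupp.onFinset_apply]
        rw [max_eq_right (by have := h1 v hv; linarith)]; simp
      · rw [Finsupp.linearCombination_apply, Finsupp.sum_of_support_subset (s := s) _
          Finsupp.support_onFinset_subset _ (by simp)]
        simp only [smul_eq_mul, mul_one]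
        rw [Finset.sum_congr rfl fun v hv => (hwv' v hv).trans (hm _), Finset.sum_add_distrib,
          Finset.sum_neg_distrib, h3]
        simp [h4]
    have heq := h g hg g' hg' w w' hbw hbw' (by
      rw [(hbw.mono Finset.subset_union_left : Bary s w).bpt_eq_sum,
        (hbw'.mono Finset.subset_union_right : Bary s w').bpt_eq_sum, ← sub_eq_zero,
        ← Finset.sum_sub_distrib, ← smul_zero (2 : ℝ), ← h0, Finset.smul_sum]
      refine Finset.sum_congr rfl fun v hv => ?_
      rw [hwv v hv, hwv' v hv, hm, hm, abs_neg]
      module)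
    have : ∀ v ∈ s, |u v| = 0 := by
      intro v hv
      have := DFunLike.congr_fun heq v
      rw [hwv v hv, hwv' v hv, hm, hm, abs_neg] at this
      rw [abs_eq_zero]; linarith
    rw [Finset.sum_eq_zero this] at h4
    exact zero_ne_one h4
  obtain ⟨c, hc, hcK⟩ := hKc.exists_forall_le' (f := fun u : ℕ → ℝ => ‖∑ v ∈ s, u v • pos v‖)
    (by fun_prop) hpos
  refine ⟨c, hc, fun w w' hw hw' => ?_⟩
  rw [(hw.mono Finset.subset_union_left : Bary s w).bpt_eq_sum,
        (hw'.mono Finset.subset_union_right : Bary s w').bpt_eq_sum, ← Finset.sum_sub_distrib]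
  set S := ∑ v ∈ s, |w v - w' v| with hS
  have hS0 : 0 ≤ S := Finset.sum_nonneg fun v _ => abs_nonneg (w v - w' v)
  rcases hS0.eq_or_lt with h0 | h0
  · rw [← h0, mul_zero]; exact norm_nonneg _
  have hmem : (fun v => S⁻¹ * (w v - w' v)) ∈ K := by
    refine ⟨fun v hv => ?_, fun v hv => ?_, ?_, ?_⟩
    · simp only [(bary_iff.1 hw').2.1 v hv, sub_zero]
      exact mul_nonneg (inv_nonneg.2 h0.le) (hw.1 v)
    · simp only [(bary_iff.1 hw).2.1 v hv, zero_sub]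
      have := mul_nonneg (inv_nonneg.2 h0.le) (hw'.1 v)
      linarith
    · rw [← Finset.mul_sum, Finset.sum_sub_distrib,
        (hw.mono Finset.subset_union_left : Bary s w).sum_eq,
        (hw'.mono Finset.subset_union_right : Bary s w').sum_eq, sub_self, mul_zero]
    · simp only [abs_mul, abs_of_pos (inv_pos.2 h0)]
      rw [← Finset.mul_sum, ← hS, inv_mul_cancel₀ h0.ne']
  have := hcK _ hmem
  have he : ∑ v ∈ s, (S⁻¹ * (w v - w' v)) • pos v = S⁻¹ • ∑ v ∈ s, (w v • pos v - w' v • pos v) := by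
    rw [Finset.smul_sum]
    exact Finset.sum_congr rfl fun v _ => by module
  simp only [he, norm_smul, Real.norm_eq_abs, abs_of_pos (inv_pos.2 h0)] at this
  rwa [inv_mul_eq_div, le_div_iff₀ h0] at this

/-- Prescribed values at the vertices extend to a Lipschitz function, linear on cells. -/
theorem GeomInj.exists_lipschitz (h : GeomInj C pos) (r : ℕ → ℝ) :
    ∃ d : E3 → ℝ, (∃ K, LipschitzOnWith K d (support pos C)) ∧
      ∀ g ∈ C, ∀ w, Bary g w → d (bpt pos w) = bpt r w := by
  classical
  set d : E3 → ℝ := fun x => if hx : ∃ w, (∃ g ∈ C, Bary g w) ∧ bpt pos w = x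
    then bpt r hx.choose else 0 with hd
  have hdw : ∀ g ∈ C, ∀ w, Bary g w → d (bpt pos w) = bpt r w := by
    intro g hg w hw
    have hx : ∃ w', (∃ g ∈ C, Bary g w') ∧ bpt pos w' = bpt pos w := ⟨w, ⟨g, hg, hw⟩, rfl⟩
    obtain ⟨⟨g', hg', hw'⟩, he⟩ := hx.choose_spec
    simp only [hd, dif_pos hx]
    rw [h g' hg' g hg _ _ hw' hw he]
  refine ⟨d, ?_, hdw⟩
  have hpair : ∀ q : Finset ℕ × Finset ℕ, ∃ c > 0, q ∈ C ×ˢ C → ∀ w w', Bary q.1 w → Bary q.2 w' →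
      c * ∑ v ∈ q.1 ∪ q.2, |w v - w' v| ≤ ‖bpt pos w - bpt pos w'‖ := by
    intro q
    by_cases hq : q ∈ C ×ˢ C
    · obtain ⟨c, hc, hcw⟩ := h.exists_lower_bound (Finset.mem_product.1 hq).1
        (Finset.mem_product.1 hq).2
      exact ⟨c, hc, fun _ => hcw⟩
    · exact ⟨1, one_pos, fun h => absurd h hq⟩
  choose c hc0 hc using hpair
  set R := ∑ v ∈ verts C, |r v| with hR
  have hR0 : 0 ≤ R := Finset.sum_nonneg fun v _ => abs_nonneg _
  set K := ∑ q ∈ C ×ˢ C, R / c q with hK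
  have hK0 : ∀ q ∈ C ×ˢ C, 0 ≤ R / c q := fun q _ => div_nonneg hR0 (hc0 q).le
  refine ⟨⟨K, Finset.sum_nonneg hK0⟩, LipschitzOnWith.of_dist_le_mul ?_⟩
  rintro x hx y hy
  obtain ⟨g, hg, w, hw, rfl⟩ := mem_support.1 hx
  obtain ⟨g', hg', w', hw', rfl⟩ := mem_support.1 hy
  have hq : (g, g') ∈ C ×ˢ C := Finset.mem_product.2 ⟨hg, hg'⟩
  rw [hdw g hg w hw, hdw g' hg' w' hw', dist_eq_norm, dist_eq_norm, Real.norm_eq_abs]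
  have h1 := hc (g, g') hq w w' hw hw'
  have hKq : R / c (g, g') ≤ K := Finset.single_le_sum hK0 hq
  rw [(hw.mono Finset.subset_union_left : Bary (g ∪ g') w).bpt_eq_sum r,
    (hw'.mono Finset.subset_union_right : Bary (g ∪ g') w').bpt_eq_sum r, ← Finset.sum_sub_distrib]
  calc |∑ v ∈ g ∪ g', (w v • r v - w' v • r v)|
      ≤ ∑ v ∈ g ∪ g', |w v • r v - w' v • r v| := Finset.abs_sum_le_sum_abs _ _
    _ ≤ ∑ v ∈ g ∪ g', |w v - w' v| * R := by
        refine Finset.sum_le_sum fun v hv => ?_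
        rw [← sub_smul, smul_eq_mul, abs_mul]
        refine mul_le_mul_of_nonneg_left (Finset.single_le_sum (f := fun v => |r v|)
          (fun i _ => abs_nonneg _) ?_) (abs_nonneg _)
        rcases Finset.mem_union.1 hv with hv | hv
        · exact mem_verts.2 ⟨g, hg, hv⟩
        · exact mem_verts.2 ⟨g', hg', hv⟩
    _ = R / c (g, g') * (c (g, g') * ∑ v ∈ g ∪ g', |w v - w' v|) := by
        rw [← Finset.sum_mul]
        have := (hc0 (g, g')).ne'
        field_simp
    _ ≤ R / c (g, g') * ‖bpt pos w - bpt pos w'‖ := mul_le_mul_of_nonneg_left h1 (hK0 _ hq)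
    _ ≤ K * ‖bpt pos w - bpt pos w'‖ := mul_le_mul_of_nonneg_right hKq (norm_nonneg _)

end

/-- The upward unit vector. -/
noncomputable def up : E3 := EuclideanSpace.single 2 1

theorem up_two : up 2 = 1 := by simp [up]

theorem norm_up : ‖up‖ = 1 := by simp [up]

/-- A Lipschitz function on disjoint compact sets gives a small vertical displacement. -/
theorem exists_shift {ι : Type*} [Finite ι] {N : ι → Set E3} (hN : ∀ i, IsCompact (N i))
    (hd : Pairwise (Function.onFun Disjoint N)) {d : ι → E3 → ℝ}
    (hL : ∀ i, ∃ K, LipschitzOnWith K (d i) (N i)) : ∃ η₀ > 0, ∀ η, 0 < η → η ≤ η₀ →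
      ∃ f : E3 ≃ₜ E3, IsIsotopicToId f ∧ ∀ i, ∀ x ∈ N i, f x = x + (η * d i x) • up := by
  classical
  have hpair : ∀ i j, ∃ K : ℝ, 0 ≤ K ∧ ∀ x ∈ N i, ∀ y ∈ N j, |d i x - d j y| ≤ K * dist x y := by
    intro i j
    by_cases hij : i = j
    · subst hij
      obtain ⟨K, hK⟩ := hL i
      exact ⟨K, K.2, fun x hx y hy => by simpa [Real.dist_eq] using hK.dist_le_mul x hx y hy⟩
    -- Different components are a positive distance apart, so bounded values suffice for a Lipschitz
    -- estimate between them.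
    · obtain ⟨δ, hδ, hdist⟩ := (hd hij).exists_thickenings (hN i) (hN j).isClosed
      have hbd : ∀ k, ∃ B, ∀ x ∈ N k, |d k x| ≤ B := fun k => by
        obtain ⟨K, hK⟩ := hL k
        obtain ⟨B, hB⟩ := (hN k).exists_bound_of_continuousOn hK.continuousOn
        exact ⟨B, hB⟩
      obtain ⟨Bi, hBi⟩ := hbd i
      obtain ⟨Bj, hBj⟩ := hbd j
      refine ⟨(|Bi| + |Bj|) / δ, by positivity, fun x hx y hy => ?_⟩
      have hxy : δ ≤ dist x y := by
        by_contra hlt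
        push Not at hlt
        refine Set.disjoint_left.1 hdist (Metric.mem_thickening_iff.2 ⟨x, hx, ?_⟩)
          (Metric.self_subset_thickening hδ _ hy)
        rwa [dist_comm]
      calc |d i x - d j y| ≤ |d i x| + |d j y| := abs_sub _ _
        _ ≤ |Bi| + |Bj| := add_le_add ((hBi x hx).trans (le_abs_self _))
            ((hBj y hy).trans (le_abs_self _))
        _ = (|Bi| + |Bj|) / δ * δ := by field_simp
        _ ≤ _ := mul_le_mul_of_nonneg_left hxy (by positivity)
  choose k hk0 hk using hpair
  obtain ⟨K, hK0, hK⟩ : ∃ K : ℝ, 0 < K ∧ ∀ i j, k i j ≤ K := by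
    obtain ⟨K, hK⟩ := (Set.finite_range fun q : ι × ι => k q.1 q.2).bddAbove
    exact ⟨max K 1, by positivity, fun i j => (hK ⟨(i, j), rfl⟩).trans (le_max_left _ _)⟩
  set D : E3 → ℝ := fun x => if hx : ∃ i, x ∈ N i then d hx.choose x else 0 with hD
  have hDi : ∀ i, ∀ x ∈ N i, D x = d i x := by
    intro i x hx
    have hx' : ∃ i, x ∈ N i := ⟨i, hx⟩
    have : hx'.choose = i := by
      by_contra hne
      exact Set.disjoint_left.1 (hd hne) hx'.choose_spec hx
    simp only [hD, dif_pos hx']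
    rw [this]
  have hLip : LipschitzOnWith ⟨K, hK0.le⟩ D (⋃ i, N i) := by
    refine LipschitzOnWith.of_dist_le_mul fun x hx y hy => ?_
    obtain ⟨i, hi⟩ := Set.mem_iUnion.1 hx
    obtain ⟨j, hj⟩ := Set.mem_iUnion.1 hy
    rw [hDi i x hi, hDi j y hj, Real.dist_eq]
    exact (hk i j x hi y hj).trans (mul_le_mul_of_nonneg_right (hK i j) dist_nonneg)
  obtain ⟨G, hG, hGD⟩ := hLip.extend_real
  -- With this bound `η * G` is Lipschitz with constant 1/2, so it is a shear with `κ = 1 / 2`.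
  refine ⟨1 / (2 * K), by positivity, fun η hη hη' => ?_⟩
  have hηK : η * K ≤ 1 / 2 := by
    rw [le_div_iff₀ (by positivity)] at hη'
    linarith
  obtain ⟨f, hf, hfx⟩ := IsShear.exists_isotopy (u := up) (θ := fun x => η * G x)
    ⟨by have := hG.continuous; fun_prop, 1 / 2, by norm_num, by norm_num, fun x s hs => by
      have h1 := hG.dist_le_mul x (x + s • up)
      rw [Real.dist_eq, dist_self_add_right, norm_smul, norm_up, mul_one, Real.norm_eq_abs,
        abs_of_nonneg hs] at h1
      have h2 : G x - G (x + s • up) ≤ K * s := (le_abs_self _).trans h1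
      nlinarith [mul_le_mul_of_nonneg_left h2 hη.le]⟩
  exact ⟨f, hf, fun i x hx => by
    rw [hfx, ← hGD (Set.mem_iUnion.2 ⟨i, hx⟩), hDi i x hx]⟩

end LinkTheory

namespace LinkTheory

/-! ### Connectedness of polygons and ranks of vertices -/

theorem IsPolygon.isPreconnected {X : Set E3} (h : IsPolygon X) : IsPreconnected X := by
  obtain ⟨f, hf, rfl⟩ := h
  refine (isPreconnected_sphere ?_ 0 1).image f hf.1.1
  rw [← Module.finrank_eq_rank, Module.finrank_prod, Module.finrank_self]
  norm_num

section

variable {C I E : Finset (Finset ℕ)} {pos pos' : ℕ → E3}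

/-- If no edge left `S`, then the edges inside `S` and those disjoint from `S` would split the
connected support into two nonempty disjoint closed sets. -/
theorem GeomInj.exists_crossing (h : GeomInj C pos) (hpc : IsPreconnected (support pos C))
    (h2 : ∀ g ∈ C, g.card = 2) {S : Finset ℕ} (hS : S ⊆ verts C) (hne : S.Nonempty)
    (hS' : S ≠ verts C) : ∃ v ∈ S, ∃ w ∈ verts C, w ∉ S ∧ {v, w} ∈ C := by
  by_contra hnot
  push Not at hnot
  have hdich : ∀ g ∈ C, g ⊆ S ∨ Disjoint g S := by
    intro g hg
    by_contra hcon
    rw [not_or, Finset.not_subset, Finset.not_disjoint_iff] at hcon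
    obtain ⟨⟨w, hw, hwS⟩, v, hv, hvS⟩ := hcon
    have hvw : v ≠ w := fun e => hwS (e ▸ hvS)
    have := eq_pair_of_mem hvw (h2 g hg) hv hw
    exact hnot v hvS w (mem_verts.2 ⟨g, hg, hw⟩) hwS (this ▸ hg)
  have hcl : ∀ F : Finset (Finset ℕ), IsClosed (support pos F) := fun F =>
    isCompact_support.isClosed
  obtain ⟨v, hv⟩ := hne
  obtain ⟨g, hg, hvg⟩ := mem_verts.1 (hS hv)
  obtain ⟨w, hw, hwS⟩ : ∃ w ∈ verts C, w ∉ S := by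
    by_contra hcon
    push Not at hcon
    exact hS' (Finset.Subset.antisymm hS hcon)
  obtain ⟨g', hg', hwg'⟩ := mem_verts.1 hw
  obtain ⟨x, -, hx1, hx2⟩ := isPreconnected_closed_iff.1 hpc _ _ (hcl (C.filter (· ⊆ S)))
    (hcl (C.filter fun g => Disjoint g S)) (by
      intro x hx
      obtain ⟨e, he, hxe⟩ := mem_support.1 hx
      exact (hdich e he).imp (fun h => mem_support.2 ⟨e, Finset.mem_filter.2 ⟨he, h⟩, hxe⟩)
        (fun h => mem_support.2 ⟨e, Finset.mem_filter.2 ⟨he, h⟩, hxe⟩))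
    ⟨pos v, cell_subset_support hg (mem_cell_of_mem pos hvg), cell_subset_support
      (Finset.mem_filter.2 ⟨hg, (hdich g hg).resolve_right
        fun hd => Finset.disjoint_left.1 hd hvg hv⟩) (mem_cell_of_mem pos hvg)⟩
    ⟨pos w, cell_subset_support hg' (mem_cell_of_mem pos hwg'), cell_subset_support
      (Finset.mem_filter.2 ⟨hg', (hdich g' hg').resolve_left
        fun hd => hwS (hd hwg')⟩) (mem_cell_of_mem pos hwg')⟩
  obtain ⟨e, he, hxe⟩ := mem_support.1 hx1
  obtain ⟨e', he', hxe'⟩ := mem_support.1 hx2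
  obtain ⟨he, heS⟩ := Finset.mem_filter.1 he
  obtain ⟨he', heS'⟩ := Finset.mem_filter.1 he'
  have hmem : x ∈ cell pos (e ∩ e') := (h.inter he he' subset_rfl subset_rfl).subset ⟨hxe, hxe'⟩
  rw [Finset.disjoint_iff_inter_eq_empty.1 (heS'.symm.mono_left heS), cell_empty] at hmem
  exact hmem

/-- Ranks of the vertices in which `flat` holds, decreasing along paths to the other vertices or to
`b`. -/
theorem exists_rank {V : Finset ℕ} {adj : ℕ → ℕ → Prop} {flat : ℕ → Prop} {B : Finset ℕ}
    (hconn : ∀ S ⊆ V, S.Nonempty → S ≠ V → ∃ v ∈ S, ∃ w ∈ V, w ∉ S ∧ adj v w) (hBV : B ⊆ V)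
    (hB : B.card ≤ 1) (hne : (∃ v ∈ V, ¬ flat v) ∨ B.Nonempty) :
    ∃ r : ℕ → ℕ, (∀ v, ¬ flat v → r v = 0) ∧
      (∀ v ∈ V, ∀ w ∈ V, flat v → flat w → r v = r w → v = w) ∧
      ∀ v ∈ V, flat v → v ∉ B → ∃ w ∈ V, adj w v ∧ (¬ flat w ∨ r w < r v) := by
  classical
  have main : ∀ n : ℕ, ∀ S ⊆ V, S.Nonempty → (V \ S).card = n →
      (∀ v ∈ V, ¬ flat v → v ∈ S) → (∃ r : ℕ → ℕ, (∀ v, ¬ flat v → r v = 0) ∧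
        (∀ v ∈ S, ∀ w ∈ S, flat v → flat w → r v = r w → v = w) ∧
        ∀ v ∈ S, flat v → v ∉ B → ∃ w ∈ S, adj w v ∧ (¬ flat w ∨ r w < r v)) →
      ∃ r : ℕ → ℕ, (∀ v, ¬ flat v → r v = 0) ∧
      (∀ v ∈ V, ∀ w ∈ V, flat v → flat w → r v = r w → v = w) ∧
      ∀ v ∈ V, flat v → v ∉ B → ∃ w ∈ V, adj w v ∧ (¬ flat w ∨ r w < r v) := by
    intro n
    induction n with
    | zero =>
      intro S hS _ hn _ hr
      rw [Finset.card_eq_zero, Finset.sdiff_eq_empty_iff_subset] at hn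
      rwa [Finset.Subset.antisymm hS hn] at hr
    | succ n ih =>
      rintro S hS hSne hn hflat ⟨r, h0, hinj, hr⟩
      obtain ⟨v, hv, w, hw, hwS, hvw⟩ := hconn S hS hSne (by
        rintro rfl; simp at hn)
      have hwf : flat w := by_contra fun h => hwS (hflat w hw h)
      -- The new vertex is ranked above all earlier ones, so the neighbour `v` through which it was
      -- reached serves as its witness, whether or not `v` is flat.
      set m := S.sup r with hm
      have hle : ∀ u ∈ S, r u ≤ m := fun u hu => Finset.le_sup hu
      have hne' : ∀ u ∈ S, u ≠ w := fun u hu e => hwS (e ▸ hu)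
      refine ih (insert w S) (Finset.insert_subset hw hS) ⟨w, by simp⟩ ?_
        (fun u hu huf => Finset.mem_insert_of_mem (hflat u hu huf))
        ⟨Function.update r w (m + 1), ?_, ?_, ?_⟩
      · rw [Finset.sdiff_insert, Finset.card_erase_of_mem (Finset.mem_sdiff.2 ⟨hw, hwS⟩), hn]
        rfl
      · intro u hu
        rw [Function.update_of_ne (by rintro rfl; exact hu hwf), h0 u hu]
      · intro u hu u' hu' huf huf' he
        rcases Finset.mem_insert.1 hu with hu₁ | hu₁ <;>
          rcases Finset.mem_insert.1 hu' with hu₂ | hu₂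
        · rw [hu₁, hu₂]
        · rw [hu₁, Function.update_self, Function.update_of_ne (hne' _ hu₂)] at he
          have := hle _ hu₂
          omega
        · rw [hu₂, Function.update_self, Function.update_of_ne (hne' _ hu₁)] at he
          have := hle _ hu₁
          omega
        · rw [Function.update_of_ne (hne' _ hu₁), Function.update_of_ne (hne' _ hu₂)] at he
          exact hinj u hu₁ u' hu₂ huf huf' he
      · intro u hu huf huB
        rcases Finset.mem_insert.1 hu with rfl | hu
        · refine ⟨v, Finset.mem_insert_of_mem hv, hvw, Or.inr ?_⟩
          rw [Function.update_self, Function.update_of_ne (hne' _ hv)]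
          have := hle _ hv
          omega
        · obtain ⟨x, hx, hxu, hx'⟩ := hr u hu huf huB
          refine ⟨x, Finset.mem_insert_of_mem hx, hxu, ?_⟩
          rwa [Function.update_of_ne (hne' _ hu), Function.update_of_ne (hne' _ hx)]
  refine main _ (V.filter (fun v => ¬ flat v) ∪ B)
    (Finset.union_subset (Finset.filter_subset _ _) hBV) ?_ rfl
    (fun v hv hvf => Finset.mem_union_left _ (Finset.mem_filter.2 ⟨hv, hvf⟩)) ⟨fun _ => 0, ?_, ?_, ?_⟩
  · rcases hne with ⟨v, hv, hvf⟩ | ⟨b, hb⟩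
    · exact ⟨v, Finset.mem_union_left _ (Finset.mem_filter.2 ⟨hv, hvf⟩)⟩
    · exact ⟨b, Finset.mem_union_right _ hb⟩
  · exact fun _ _ => rfl
  · intro v hv w hw hvf hwf _
    have hin : ∀ u ∈ V.filter (fun v => ¬ flat v) ∪ B, flat u → u ∈ B := fun u hu huf => by
      rcases Finset.mem_union.1 hu with hu | hu
      · exact absurd huf (Finset.mem_filter.1 hu).2
      · exact hu
    exact Finset.card_le_one.1 hB v (hin v hv hvf) w (hin w hw hwf)
  · intro v hv hvf hvB
    rcases Finset.mem_union.1 hv with hv | hv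
    · exact absurd hvf (Finset.mem_filter.1 hv).2
    · exact absurd hv hvB

/-! ### Images of polygonal curves under maps linear on edges -/

theorem exists_affine_pair {a b : E3} (hab : a ≠ b) (a' b' : E3) :
    ∃ g : E3 →ᵃ[ℝ] E3, g a = a' ∧ g b = b' := by
  obtain ⟨φ, hφ⟩ := SeparatingDual.exists_eq_one (R := ℝ) (sub_ne_zero.2 hab.symm)
  rw [map_sub] at hφ
  refine ⟨(AffineMap.lineMap a' b' : ℝ →ᵃ[ℝ] E3).comp
    (φ.toLinearMap.toAffineMap - AffineMap.const ℝ E3 (φ a)), ?_, ?_⟩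
  · simp
  · simp [hφ]

theorem GeomInj.image (h : GeomInj C pos) {f : E3 ≃ₜ E3}
    (hf : ∀ g ∈ C, ∀ w, Bary g w → f (bpt pos w) = bpt pos' w) :
    GeomInj C pos' ∧ support pos' C = f '' support pos C := by
  refine ⟨fun s hs t ht w w' hw hw' he => h s hs t ht w w' hw hw' (f.injective ?_), ?_⟩
  · rw [hf s hs w hw, hf t ht w' hw', he]
  · rw [support, support, Set.image_iUnion₂]
    refine Set.iUnion₂_congr fun g hg => ?_
    rw [cell, cell, Set.image_image]
    exact (Set.image_congr fun w hw => hf g hg w hw).symm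

/-- The homeomorphism need not be piecewise linear on the whole space. This matters because the
displacement used later is extended off the link merely as a Lipschitz function. -/
theorem IsPolygon.image_of_linear (hC : IsPolygon (support pos C)) (h : GeomInj C pos)
    (h2 : ∀ g ∈ C, g.card = 2) {f : E3 ≃ₜ E3}
    (hf : ∀ g ∈ C, ∀ w, Bary g w → f (bpt pos w) = bpt pos' w) :
    IsPolygon (f '' support pos C) := by
  obtain ⟨p, ⟨hp, hinj⟩, hpC⟩ := hC
  have haff : ∀ g, ∃ A : E3 →ᵃ[ℝ] E3, g ∈ C → ∀ w, Bary g w → f (bpt pos w) = A (bpt pos w) := by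
    intro g
    by_cases hg : g ∈ C
    swap
    · exact ⟨AffineMap.id ℝ E3, fun h => absurd h hg⟩
    obtain ⟨a, b, hab, rfl⟩ := Finset.card_eq_two.1 (h2 g hg)
    have hpab : pos a ≠ pos b := fun e => hab (h.injOn (mem_verts.2 ⟨_, hg, by simp⟩)
      (mem_verts.2 ⟨_, hg, by simp⟩) e)
    obtain ⟨A, hAa, hAb⟩ := exists_affine_pair hpab (pos' a) (pos' b)
    refine ⟨A, fun _ w hw => ?_⟩
    rw [hf _ hg w hw, hw.map_bpt, hw.bpt_eq_sum, hw.bpt_eq_sum, Finset.sum_pair hab,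
      Finset.sum_pair hab, Function.comp_apply, Function.comp_apply, hAa, hAb]
  choose A hA using haff
  have hPL : PLOn f (support pos C) := by
    refine ⟨f.continuous.continuousOn, A '' C, C.finite_toSet.image A, fun x hx => ?_⟩
    obtain ⟨g, hg, w, hw, rfl⟩ := mem_support.1 hx
    exact ⟨A g, ⟨g, hg, rfl⟩, hA g hg w hw⟩
  refine ⟨f ∘ p, ⟨hPL.comp hp fun x hx => ?_, f.injective.comp_injOn hinj⟩, ?_⟩
  · exact hpC ▸ Set.mem_image_of_mem p hx
  · rw [Set.image_comp, hpC]

end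
end LinkTheory

namespace LinkTheory

/-! ### Links with all their edges in a plane or in the upper part of another link -/

/-- The polygon `C`, with edges in the complex `E`, consists of edges in the plane `z = 0` and of
edges of the polygon `I` not below this plane. -/
structure FlatCurve (E I C : Finset (Finset ℕ)) (pos : ℕ → E3) : Prop where
  card_edge : ∀ g ∈ E, g.card = 2
  geomInj : GeomInj E pos
  base_subset : I ⊆ E
  curve_subset : C ⊆ E
  base_regular : TwoRegular I
  curve_regular : TwoRegular C
  edges : ∀ g ∈ C, (∀ v ∈ g, pos v 2 = 0) ∨ (g ∈ I ∧ ∀ v ∈ g, 0 ≤ pos v 2)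
  polygon : IsPolygon (support pos C)

namespace FlatCurve

variable {E I C : Finset (Finset ℕ)} {pos : ℕ → E3}

theorem nonneg (h : FlatCurve E I C pos) {v : ℕ} (hv : v ∈ verts C) : 0 ≤ pos v 2 := by
  obtain ⟨g, hg, hvg⟩ := mem_verts.1 hv
  rcases h.edges g hg with h | h
  · exact (h v hvg).ge
  · exact h.2 v hvg

theorem mem_base (h : FlatCurve E I C pos) {g : Finset ℕ} (hg : g ∈ C) {v : ℕ} (hv : v ∈ g)
    (hpos : 0 < pos v 2) : g ∈ I := by
  rcases h.edges g hg with h | h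
  · exact absurd (h v hv) hpos.ne'
  · exact h.1

theorem mem_curve_of_base (h : FlatCurve E I C pos) {v w : ℕ} (hv : v ∈ verts C)
    (hpos : 0 < pos v 2) (hvw : {v, w} ∈ I) : {v, w} ∈ C := by
  obtain ⟨x, y, hxy, hC⟩ := h.curve_regular v hv
  have hx : {v, x} ∈ C := (hC x).2 (Or.inl rfl)
  have hy : {v, y} ∈ C := (hC y).2 (Or.inr rfl)
  have hxI := h.mem_base hx (Finset.mem_insert_self _ _) hpos
  have hyI := h.mem_base hy (Finset.mem_insert_self _ _) hpos
  obtain ⟨x', y', hxy', hI⟩ := h.base_regular v (mem_verts.2 ⟨_, hxI, Finset.mem_insert_self _ _⟩)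
  rw [hC]
  have h1 := (hI x).1 hxI
  have h2 := (hI y).1 hyI
  have h3 := (hI w).1 hvw
  grind

theorem isPreconnected (h : FlatCurve E I C pos) : IsPreconnected (support pos C) :=
  h.polygon.isPreconnected

theorem geomInj_curve (h : FlatCurve E I C pos) : GeomInj C pos := h.geomInj.mono h.curve_subset

theorem geomInj_base (h : FlatCurve E I C pos) : GeomInj I pos := h.geomInj.mono h.base_subset

theorem verts_nonempty (h : FlatCurve E I C pos) : (verts C).Nonempty := by
  obtain ⟨x, hx⟩ := h.polygon.nonempty
  obtain ⟨g, hg, w, hw, -⟩ := mem_support.1 hx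
  obtain ⟨v, hv⟩ := hw.nonempty
  exact ⟨v, mem_verts.2 ⟨g, hg, hv⟩⟩

/-- Ranks for the vertices in the plane. -/
theorem exists_rank (h : FlatCurve E I C pos) : ∃ r : ℕ → ℕ, ∃ B ⊆ verts C,
    ((∃ v ∈ verts C, 0 < pos v 2) → B = ∅) ∧ B.card ≤ 1 ∧ (∀ v, pos v 2 ≠ 0 → r v = 0) ∧
    (∀ v ∈ verts C, ∀ w ∈ verts C, pos v 2 = 0 → pos w 2 = 0 → r v = r w → v = w) ∧
      ∀ v ∈ verts C, pos v 2 = 0 → v ∉ B →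
        ∃ w ∈ verts C, {w, v} ∈ C ∧ (0 < pos w 2 ∨ pos w 2 = 0 ∧ r w < r v) := by
  have hconn : ∀ S ⊆ verts C, S.Nonempty → S ≠ verts C →
      ∃ v ∈ S, ∃ w ∈ verts C, w ∉ S ∧ {v, w} ∈ C := fun S hS hne hS' =>
    h.geomInj_curve.exists_crossing h.isPreconnected
      (fun g hg => h.card_edge g (h.curve_subset hg)) hS hne hS'
  have fin : ∀ B ⊆ verts C, B.card ≤ 1 → ((∃ v ∈ verts C, ¬ pos v 2 = 0) ∨ B.Nonempty) →
      ∃ r : ℕ → ℕ, (∀ v, pos v 2 ≠ 0 → r v = 0) ∧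
    (∀ v ∈ verts C, ∀ w ∈ verts C, pos v 2 = 0 → pos w 2 = 0 → r v = r w → v = w) ∧
      ∀ v ∈ verts C, pos v 2 = 0 → v ∉ B →
        ∃ w ∈ verts C, {w, v} ∈ C ∧ (0 < pos w 2 ∨ pos w 2 = 0 ∧ r w < r v) := by
    intro B hB hB1 hor
    obtain ⟨r, h0, hinj, hr⟩ := LinkTheory.exists_rank (adj := fun v w => {v, w} ∈ C) hconn hB hB1 hor
    refine ⟨r, h0, hinj, fun v hv hv0 hvB => ?_⟩
    obtain ⟨w, hw, hwv, hor⟩ := hr v hv hv0 hvB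
    refine ⟨w, hw, hwv, ?_⟩
    rcases (h.nonneg hw).eq_or_lt with h0 | h0
    · exact Or.inr ⟨h0.symm, hor.resolve_left fun h => h h0.symm⟩
    · exact Or.inl h0
  -- The ranking starts from the vertices above the plane. If there are none, one arbitrary vertex
  -- `v` is used as the start, and it may become the single extra maximum.
  by_cases hup : ∃ v ∈ verts C, 0 < pos v 2
  · obtain ⟨r, hr⟩ := fin ∅ (by simp) (by simp) (Or.inl (by
      obtain ⟨v, hv, h⟩ := hup
      exact ⟨v, hv, h.ne'⟩))
    exact ⟨r, ∅, by simp, fun _ => rfl, by simp, hr⟩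
  · obtain ⟨v, hv⟩ := h.verts_nonempty
    obtain ⟨r, hr⟩ := fin {v} (by simpa using hv) (by simp) (Or.inr (by simp))
    exact ⟨r, {v}, by simpa using hv, fun h => absurd h hup, by simp, hr⟩

/-- A vertex above the plane and not lower than its neighbours is a local maximum. -/
theorem pos_mem_localMaxima (h : FlatCurve E I C pos) {v : ℕ} (hv : v ∈ verts C)
    (hpos : 0 < pos v 2) (hle : ∀ u, {v, u} ∈ C → pos u 2 ≤ pos v 2) :
    pos v ∈ localMaxima (support pos I) ∩ {x | 0 < x 2} := by
  refine ⟨?_, hpos⟩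
  obtain ⟨g, hg, hvg⟩ := mem_verts.1 hv
  have := mem_localMaxima_iff h.geomInj_base (h.mem_base hg hvg hpos) (Bary.single hvg)
  simp only [Finsupp.linearCombination_single, one_smul, bpt,
    Finsupp.support_single _ (one_ne_zero : (1 : ℝ) ≠ 0), Finset.singleton_subset_iff] at this
  rw [this]
  intro g' hg' hvg' u hu
  by_cases huv : u = v
  · rw [huv]
  have he := eq_pair_of_mem (Ne.symm huv) (h.card_edge g' (h.base_subset hg')) hvg' hu
  exact hle u (h.mem_curve_of_base hv hpos (he ▸ hg'))

/-- Local maxima after pushing down the vertices in the plane. -/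
theorem localMaxima_subset (h : FlatCurve E I C pos) {r : ℕ → ℕ} {B : Finset ℕ}
    (h0 : ∀ v, pos v 2 ≠ 0 → r v = 0)
    (hinj : ∀ v ∈ verts C, ∀ w ∈ verts C, pos v 2 = 0 → pos w 2 = 0 → r v = r w → v = w)
    (hr : ∀ v ∈ verts C, pos v 2 = 0 → v ∉ B →
        ∃ w ∈ verts C, {w, v} ∈ C ∧ (0 < pos w 2 ∨ pos w 2 = 0 ∧ r w < r v)) {η : ℝ} (hη : 0 < η)
    {pos' : ℕ → E3} (hpos' : ∀ v, pos' v = pos v - (η * r v) • up) (hinj' : GeomInj C pos') :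
    localMaxima (support pos' C) ⊆ (localMaxima (support pos I) ∩ {x | 0 < x 2}) ∪ pos' '' B := by
  have hz : ∀ v, pos' v 2 = pos v 2 - η * r v := fun v => by simp [hpos', up_two]
  have hzflat : ∀ v, pos v 2 = 0 → pos' v 2 = - (η * r v) := fun v hv => by rw [hz, hv, zero_sub]
  have hflat : ∀ v, pos v 2 = 0 → pos' v 2 ≤ 0 := fun v hv => by
    rw [hzflat v hv]
    have := mul_nonneg hη.le (Nat.cast_nonneg (α := ℝ) (r v))
    linarith
  have heq : ∀ v, pos v 2 ≠ 0 → pos' v = pos v := fun v hv => by simp [hpos', h0 v hv]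
  intro x hx
  obtain ⟨g, hg, w, hw, rfl⟩ := mem_support.1 hx.1
  rw [mem_localMaxima_iff hinj' hg hw] at hx
  have hwg := hw.2.1
  have hws := hw.support
  have hg2 := h.card_edge g (h.curve_subset hg)
  have hne := hws.1.nonempty
  have hcard : w.support.card = 1 ∨ w.support.card = 2 := by
    have h1 := Finset.card_le_card hwg
    have h2 := hne.card_pos
    omega
  -- The point is a vertex or interior to an edge. A flat vertex outside `B` has a neighbour that is
  -- higher after pushing down, either above the plane or of smaller rank.
  rcases hcard with hcard | hcard
  · obtain ⟨v, hv⟩ := Finset.card_eq_one.1 hcard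
    have hw1 : w = Finsupp.single v 1 := by
      have hb := hws.1
      rw [hv] at hb
      have h1 := hb.sum_eq
      rw [Finset.sum_singleton] at h1
      ext u
      by_cases hu : u = v
      · rw [hu, h1, Finsupp.single_eq_same]
      · rw [Finsupp.single_eq_of_ne hu]
        exact (bary_iff.1 hb).2.1 u (by simpa using hu)
    have hxv : bpt pos' w = pos' v := by rw [hw1]; simp
    have hvg : v ∈ g := hwg (by rw [hv]; simp)
    have hvC : v ∈ verts C := mem_verts.2 ⟨g, hg, hvg⟩
    rw [hxv, hv] at hx
    simp only [Finset.singleton_subset_iff] at hx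
    rw [hxv]
    by_cases hv0 : pos v 2 = 0
    · right
      by_contra hvB
      obtain ⟨u, hu, huv, hor⟩ := hr v hvC hv0 fun hb => hvB ⟨v, hb, rfl⟩
      have hle := hx _ huv (by simp) u (by simp)
      have hvz := hflat v hv0
      rcases hor with hor | ⟨hor, hlt⟩
      · rw [heq u hor.ne'] at hle
        linarith
      · rw [hzflat u hor, hzflat v hv0] at hle
        have : (r u : ℝ) < r v := by exact_mod_cast hlt
        nlinarith
    · left
      have hvpos : 0 < pos v 2 := (h.nonneg hvC).lt_of_ne' hv0
      rw [heq v hv0] at hx ⊢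
      exact h.pos_mem_localMaxima hvC hvpos fun u hvu => by
        have hle := hx _ hvu (by simp) u (by simp)
        by_cases hu0 : pos u 2 = 0
        · rw [hu0]; exact hvpos.le
        · rwa [heq u hu0] at hle
  -- An edge with a local maximum in its interior is horizontal. Distinct ranks exclude an edge
  -- formerly in the plane, and an edge with one end above the plane and one in it stays slanted. So
  -- the edge was not moved and lies above the plane.
  · have hgw : w.support = g := Finset.eq_of_subset_of_card_le hwg (by omega)
    obtain ⟨a, b, hab, rfl⟩ := Finset.card_eq_two.1 hg2
    have hwa : 0 < w a := hws.2 a (by rw [hgw]; simp)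
    have hwb : 0 < w b := hws.2 b (by rw [hgw]; simp)
    have ha := hx _ hg hwg a (by simp)
    have hb := hx _ hg hwg b (by simp)
    have hx2 : (bpt pos' w) 2 = w a * pos' a 2 + w b * pos' b 2 := by
      rw [hw.bpt_eq_sum, Finset.sum_pair hab]; simp
    have hsum := hw.sum_eq
    rw [Finset.sum_pair hab] at hsum
    have haC : a ∈ verts C := mem_verts.2 ⟨_, hg, by simp⟩
    have hbC : b ∈ verts C := mem_verts.2 ⟨_, hg, by simp⟩
    rw [hx2] at ha hb
    have hwb' : w b = 1 - w a := by linarith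
    have hz : pos' a 2 = pos' b 2 := by
      rw [hwb'] at ha hb hwb
      apply le_antisymm <;> nlinarith
    have hnn : pos a 2 ≠ 0 ∧ pos b 2 ≠ 0 := by
      by_contra hcon
      rw [not_and_or, not_ne_iff, not_ne_iff] at hcon
      by_cases ha0 : pos a 2 = 0 <;> by_cases hb0 : pos b 2 = 0
      · rw [hzflat a ha0, hzflat b hb0, neg_inj] at hz
        have := mul_left_cancel₀ hη.ne' hz
        exact hab (hinj a haC b hbC ha0 hb0 (by exact_mod_cast this))
      · have h1 := hflat a ha0
        have h2 := (h.nonneg hbC).lt_of_ne' hb0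
        rw [hz, heq b hb0] at h1
        linarith
      · have h1 := hflat b hb0
        have h2 := (h.nonneg haC).lt_of_ne' ha0
        rw [← hz, heq a ha0] at h1
        linarith
      · tauto
    have hapos := (h.nonneg haC).lt_of_ne' hnn.1
    rw [heq a hnn.1, heq b hnn.2] at hz
    have hxx : bpt pos' w = bpt pos w := by
      rw [hw.bpt_eq_sum, hw.bpt_eq_sum, Finset.sum_pair hab, Finset.sum_pair hab, heq a hnn.1,
        heq b hnn.2]
    have hx2' : (bpt pos w) 2 = pos a 2 := by
      rw [← hxx, hx2, heq a hnn.1, heq b hnn.2, ← hz, ← add_mul, hsum, one_mul]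
    have hgI := h.mem_base hg (v := a) (by simp) hapos
    left
    rw [hxx]
    refine ⟨(mem_localMaxima_iff h.geomInj_base hgI hw).2 fun g' hg' hsub v hv => ?_, ?_⟩
    · rw [hgw] at hsub
      have : {a, b} = g' := Finset.eq_of_subset_of_card_le hsub
        (by rw [h.card_edge g' (h.base_subset hg'), hg2])
      rw [← this, Finset.mem_insert, Finset.mem_singleton] at hv
      rw [hx2']
      rcases hv with rfl | rfl
      · exact le_rfl
      · exact hz.ge
    · change 0 < (bpt pos w) 2
      rw [hx2']; exact hapos

end FlatCurve

variable {ι : Type*} [Finite ι] {E I C : ι → Finset (Finset ℕ)} {pos : ι → ℕ → E3}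

/-- The components contained in the plane. -/
def flatComponents (C : ι → Finset (Finset ℕ)) (pos : ι → ℕ → E3) : Set ι :=
  {i | ∀ v ∈ verts (C i), pos i v 2 = 0}

/-- Pushing the vertices in the plane down by `η` times their rank leaves the maxima of the base
link above the plane, and at most one more for each component without a vertex above it. -/
theorem bridgeNumber_le (h : ∀ i, FlatCurve (E i) (I i) (C i) (pos i))
    (hd : Pairwise (Function.onFun Disjoint fun i => support (pos i) (E i))) {L : ι → Set E3}
    (hL : Isotopic L fun i => support (pos i) (C i)) :
    bridgeNumber L ≤ (localMaxima (⋃ i, support (pos i) (I i)) ∩ {x | 0 < x 2}).encard +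
      (flatComponents C pos).encard := by
  have hsub : ∀ {F G : Finset (Finset ℕ)} {p : ℕ → E3}, F ⊆ G → support p F ⊆ support p G :=
    fun hFG => Set.biUnion_subset_biUnion_left hFG
  have hdC : Pairwise (Function.onFun Disjoint fun i => support (pos i) (C i)) := fun i j hij =>
    (hd hij).mono (hsub (h i).curve_subset) (hsub (h j).curve_subset)
  have hdI : Pairwise (Function.onFun Disjoint fun i => support (pos i) (I i)) := fun i j hij =>
    (hd hij).mono (hsub (h i).base_subset) (hsub (h j).base_subset)
  choose r B hBC hB hB1 h0 hinj hr using fun i => (h i).exists_rank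
  choose d hdL hdw using fun i => (h i).geomInj_curve.exists_lipschitz fun v => - (r i v : ℝ)
  obtain ⟨η, hη, hshift⟩ := exists_shift (fun i => isCompact_support) hdC hdL
  obtain ⟨f, hf, hfx⟩ := hshift η hη le_rfl
  set pos' : ι → ℕ → E3 := fun i v => pos i v - (η * r i v) • up with hpos'
  have hfw : ∀ i, ∀ g ∈ C i, ∀ w, Bary g w → f (bpt (pos i) w) = bpt (pos' i) w := by
    intro i g hg w hw
    rw [hfx i _ (cell_subset_support hg ⟨w, hw, rfl⟩), hdw i g hg w hw, hw.bpt_eq_sum,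
      hw.bpt_eq_sum, hw.bpt_eq_sum, Finset.mul_sum, Finset.sum_smul, ← Finset.sum_add_distrib]
    refine Finset.sum_congr rfl fun v _ => ?_
    simp only [hpos', smul_eq_mul]
    module
  have himg := fun i => (h i).geomInj_curve.image (hfw i)
  have hpoly : IsPolygonalLink fun i => support (pos' i) (C i) := by
    refine ⟨fun i => ?_, fun i j hij => ?_⟩
    · change IsPolygon (support (pos' i) (C i))
      rw [(himg i).2]
      exact (h i).polygon.image_of_linear (h i).geomInj_curve
        (fun g hg => (h i).card_edge g ((h i).curve_subset hg)) (hfw i)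
    · simp only [Function.onFun]
      rw [(himg i).2, (himg j).2]
      exact (Set.disjoint_image_iff f.injective).2 (hdC hij)
  have hmax : localMaxima (⋃ i, support (pos' i) (C i)) ⊆
      (localMaxima (⋃ i, support (pos i) (I i)) ∩ {x | 0 < x 2}) ∪
        ⋃ i ∈ flatComponents C pos, pos' i '' B i := by
    intro x hx
    obtain ⟨i, hi⟩ := Set.mem_iUnion.1 hx.1
    rw [mem_localMaxima_iUnion (fun i => isCompact_support) hpoly.2 hi] at hx
    rcases (h i).localMaxima_subset (h0 i) (hinj i) (hr i) hη (fun v => rfl) (himg i).1 hx with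
      ⟨hx1, hx2⟩ | ⟨v, hv, rfl⟩
    · exact Or.inl ⟨(mem_localMaxima_iUnion (fun i => isCompact_support) hdI hx1.1).2 hx1, hx2⟩
    · refine Or.inr (Set.mem_iUnion₂.2 ⟨i, fun u hu => ?_, v, hv, rfl⟩)
      by_contra hu0
      have := hB i ⟨u, hu, ((h i).nonneg hu).lt_of_ne' hu0⟩
      rw [this] at hv
      simp at hv
  calc bridgeNumber L ≤ (localMaxima (⋃ i, support (pos' i) (C i))).encard :=
        iInf_le_of_le _ (iInf_le_of_le hpoly (iInf_le_of_le
          (hL.trans ⟨f, hf, fun i => (himg i).2.symm⟩) le_rfl))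
    _ ≤ _ := Set.encard_le_encard hmax
    _ ≤ _ := Set.encard_union_le _ _
    _ ≤ _ := by
      gcongr
      have hne : ∀ i, ∃ x : E3, pos' i '' B i ⊆ {x} := fun i => by
        have : (pos' i '' (B i : Set ℕ)).Subsingleton :=
          (Finset.card_le_one_iff_subsingleton.1 (hB1 i)).image _
        rcases this.eq_empty_or_singleton with h | ⟨x, h⟩
        · exact ⟨0, by rw [h]; simp⟩
        · exact ⟨x, h.subset⟩
      choose y hy using hne
      refine (Set.encard_le_encard (?_ : _ ⊆ y '' flatComponents C pos)).trans
        (Set.encard_image_le _ _)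
      refine Set.iUnion₂_subset fun i hi x hx => ⟨i, hi, (hy i hx).symm⟩

end LinkTheory

namespace LinkTheory

/-! ### Cones over polygons -/

theorem exists_norm_functionals : ∃ S : Set (ℝ × ℝ →ₗ[ℝ] ℝ), S.Finite ∧ ∀ p, ∃ σ ∈ S, ‖p‖ = σ p := by
  refine ⟨{LinearMap.fst ℝ ℝ ℝ, -LinearMap.fst ℝ ℝ ℝ, LinearMap.snd ℝ ℝ ℝ, -LinearMap.snd ℝ ℝ ℝ},
    by simp, fun p => ?_⟩
  simp only [Set.mem_insert_iff, Set.mem_singleton_iff, exists_eq_or_imp, exists_eq_left,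
    LinearMap.neg_apply, LinearMap.fst_apply, LinearMap.snd_apply, Prod.norm_def, Real.norm_eq_abs]
  rcases max_choice |p.1| |p.2| with h | h <;> rw [h]
  · rcases abs_choice p.1 with h | h <;> simp [h]
  · rcases abs_choice p.2 with h | h <;> simp [h]

/-- The cone over a polygon in a plane, from a point outside the plane, is a disk. -/
theorem IsPolygon.exists_disk {C : Set E3} (hC : IsPolygon C) (l : E3 →ᵃ[ℝ] ℝ)
    (hl : ∀ x ∈ C, l x = 0) {v : E3} (hv : l v ≠ 0) :
    ∃ D, IsPLDisk D C ∧ D ⊆ convexHull ℝ (insert v C) := by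
  obtain ⟨f, ⟨⟨hfc, G, hG, hfG⟩, hinj⟩, rfl⟩ := hC
  set S := Metric.sphere (0 : ℝ × ℝ) 1 with hS
  have hmem : ∀ p : ℝ × ℝ, p ≠ 0 → ‖p‖⁻¹ • p ∈ S := fun p hp => by
    rw [hS, mem_sphere_zero_iff_norm, norm_smul, norm_inv, norm_norm,
      inv_mul_cancel₀ (norm_ne_zero_iff.2 hp)]
  set F : ℝ × ℝ → E3 := fun p => v + ‖p‖ • (f (‖p‖⁻¹ • p) - v) with hF
  have hF0 : F 0 = v := by simp [hF]
  have hFS : ∀ p ∈ S, F p = f p := fun p hp => by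
    rw [hS, mem_sphere_zero_iff_norm] at hp
    simp [hF, hp]
  have hlF : ∀ p, l (F p) = (1 - ‖p‖) * l v := by
    intro p
    by_cases hp : p = 0
    · rw [hp, hF0]; simp
    have : F p = AffineMap.lineMap v (f (‖p‖⁻¹ • p)) ‖p‖ := by
      rw [AffineMap.lineMap_apply_module']
      exact add_comm _ _
    rw [this, AffineMap.apply_lineMap, hl _ (Set.mem_image_of_mem f (hmem p hp)),
      AffineMap.lineMap_apply_module]
    simp
  refine ⟨F '' Metric.closedBall 0 1, ⟨F, ⟨⟨?_, ?_⟩, ?_⟩, rfl, ?_⟩, ?_⟩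
  · intro p _
    refine ContinuousAt.continuousWithinAt ?_
    by_cases hp : p = 0
    · subst hp
      obtain ⟨B, hB⟩ := (isCompact_sphere (0 : ℝ × ℝ) 1).exists_bound_of_continuousOn hfc
      have hB0 : ∀ p, ‖F p - v‖ ≤ ‖p‖ * (B + ‖v‖) := by
        intro p
        by_cases hp : p = 0
        · simp [hp, hF0]
        · simp only [hF, add_sub_cancel_left, norm_smul, norm_norm]
          exact mul_le_mul_of_nonneg_left ((norm_sub_le _ _).trans
            (add_le_add (hB _ (hmem p hp)) le_rfl)) (norm_nonneg _)
      rw [ContinuousAt, hF0, tendsto_iff_norm_sub_tendsto_zero]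
      refine squeeze_zero (fun _ => norm_nonneg _) hB0 ?_
      have : Continuous fun p : ℝ × ℝ => ‖p‖ * (B + ‖v‖) := by fun_prop
      simpa using this.tendsto 0
    · have h1 : ContinuousOn (fun p : ℝ × ℝ => ‖p‖⁻¹ • p) {0}ᶜ :=
        (continuous_norm.continuousOn.inv₀ fun p hp => norm_ne_zero_iff.2 hp).smul continuousOn_id
      have h2 : ContinuousOn (fun p : ℝ × ℝ => f (‖p‖⁻¹ • p)) {0}ᶜ := hfc.comp h1 fun p hp => hmem p hp
      have h3 : ContinuousOn F {0}ᶜ := continuousOn_const.add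
        (continuous_norm.continuousOn.smul (h2.sub continuousOn_const))
      exact h3.continuousAt (isOpen_compl_singleton.mem_nhds hp)
  -- On a sector where the norm equals `σ` and `f` equals `g` on the boundary, the cone is the
  -- affine map obtained by making `g` homogeneous with the help of `σ`.
  · obtain ⟨Q, hQ, hσ⟩ := exists_norm_functionals
    refine ⟨Set.image2 (fun (g : ℝ × ℝ →ᵃ[ℝ] E3) (σ : ℝ × ℝ →ₗ[ℝ] ℝ) =>
      (g.linear + σ.smulRight (g 0 - v)).toAffineMap + AffineMap.const ℝ (ℝ × ℝ) v) G Q,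
      hG.image2 _ hQ, fun p _ => ?_⟩
    obtain ⟨σ, hσS, hpσ⟩ := hσ p
    obtain ⟨q, hq, hpq⟩ : ∃ q ∈ S, p = ‖p‖ • q ∧ F p = v + ‖p‖ • (f q - v) := by
      by_cases hp : p = 0
      · exact ⟨(1, 0), by simp [hS, Prod.norm_def], by simp [hp, hF0]⟩
      · refine ⟨_, hmem p hp, ?_, rfl⟩
        rw [smul_smul, mul_inv_cancel₀ (norm_ne_zero_iff.2 hp), one_smul]
    obtain ⟨g, hg, hfg⟩ := hfG q hq
    refine ⟨_, Set.mem_image2_of_mem hg hσS, ?_⟩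
    have hgq : g q = g.linear q + g 0 := congrFun g.decomp q
    have hlin : g.linear p = ‖p‖ • g.linear q := by
      conv_lhs => rw [hpq.1]
      rw [map_smul]
    simp only [AffineMap.coe_add, Pi.add_apply, LinearMap.coe_toAffineMap, LinearMap.add_apply,
      LinearMap.smulRight_apply, AffineMap.const_apply]
    rw [← hpσ, hpq.2, hfg, hgq, hlin]
    module
  · intro p hp q hq hpq
    have h1 := hlF p
    rw [hpq, hlF q] at h1
    have hn : ‖q‖ = ‖p‖ := by
      have := mul_right_cancel₀ hv h1
      linarith
    by_cases hp0 : p = 0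
    · rw [hp0, norm_zero, norm_eq_zero] at hn
      rw [hp0, hn]
    have hq0 : q ≠ 0 := by
      rw [← norm_ne_zero_iff, hn]; exact norm_ne_zero_iff.2 hp0
    have hpn := norm_ne_zero_iff.2 hp0
    simp only [hF, hn] at hpq
    have h2 := smul_right_injective E3 hpn (add_left_cancel hpq)
    have h3 := hinj (hmem p hp0) (hn ▸ hmem q hq0) (sub_left_injective h2)
    exact smul_right_injective (ℝ × ℝ) (inv_ne_zero hpn) h3
  · exact Set.image_congr hFS
  · rintro _ ⟨p, hp, rfl⟩
    by_cases hp0 : p = 0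
    · rw [hp0, hF0]
      exact subset_convexHull ℝ _ (Set.mem_insert _ _)
    have : F p = AffineMap.lineMap v (f (‖p‖⁻¹ • p)) ‖p‖ := by
      rw [AffineMap.lineMap_apply_module']
      exact add_comm _ _
    rw [this]
    exact (convex_convexHull ℝ _).lineMap_mem (subset_convexHull ℝ _ (Set.mem_insert _ _))
      (subset_convexHull ℝ _ (Set.mem_insert_of_mem _ (Set.mem_image_of_mem f (hmem p hp0))))
      ⟨norm_nonneg _, by simpa using hp⟩

/-! ### Turning space upside down -/

theorem isShear_linear {u : E3} (θ : E3 →ₗ[ℝ] ℝ) (hu : θ u = 0) : IsShear u θ :=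
  ⟨θ.continuous_of_finiteDimensional, 1, one_pos, le_rfl, fun x s _ => by simp [hu]⟩

/-- Three shears in the plane of the last two coordinates compose to a quarter turn. The quarter
turn is applied twice. -/
theorem exists_flip : ∃ f : E3 ≃ₜ E3, IsIsotopicToId f ∧ ∀ x, f x 2 = - x 2 := by
  obtain ⟨f, hf, hfx⟩ := (isShear_linear (u := EuclideanSpace.single 1 1)
    (EuclideanSpace.proj 2 : E3 →L[ℝ] ℝ).toLinearMap (by simp)).exists_isotopy
  obtain ⟨g, hg, hgx⟩ := (isShear_linear (u := EuclideanSpace.single 2 1)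
    (-(EuclideanSpace.proj 1 : E3 →L[ℝ] ℝ).toLinearMap) (by simp)).exists_isotopy
  have hk := (hf.trans hg).trans hf
  refine ⟨_, hk.trans hk, fun x => ?_⟩
  simp [hfx, hgx]

theorem exists_translation (c : ℝ) : ∃ f : E3 ≃ₜ E3, IsIsotopicToId f ∧ ∀ x, f x = x + c • up :=
  IsShear.exists_isotopy (θ := fun _ => c) ⟨continuous_const, 1, one_pos, le_rfl, by simp⟩

/-! ### Components in the plane are unknotted and split -/

/-- The height as an affine function. -/
noncomputable def heightAff : E3 →ᵃ[ℝ] ℝ := (EuclideanSpace.proj 2 : E3 →L[ℝ] ℝ).toLinearMap.toAffineMap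

theorem heightAff_apply (x : E3) : heightAff x = x 2 := rfl

theorem FlatCurve.support_nonneg {E I C : Finset (Finset ℕ)} {pos : ℕ → E3}
    (h : FlatCurve E I C pos) {x : E3} (hx : x ∈ support pos C) : 0 ≤ x 2 := by
  obtain ⟨g, hg, w, hw, rfl⟩ := mem_support.1 hx
  rw [bpt_apply]
  exact hw.le_bpt fun v hv => h.nonneg (mem_verts.2 ⟨g, hg, hv⟩)

theorem support_flat {C : Finset (Finset ℕ)} {pos : ℕ → E3} (h : ∀ v ∈ verts C, pos v 2 = 0)
    {x : E3} (hx : x ∈ support pos C) : x 2 = 0 := by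
  obtain ⟨g, hg, w, hw, rfl⟩ := mem_support.1 hx
  rw [bpt_apply]
  exact le_antisymm (hw.bpt_le fun v hv => (h v (mem_verts.2 ⟨g, hg, hv⟩)).le)
    (hw.le_bpt fun v hv => (h v (mem_verts.2 ⟨g, hg, hv⟩)).ge)

variable {ι : Type*} [Finite ι] {E I C : ι → Finset (Finset ℕ)} {pos : ι → ℕ → E3}

/-- A cone from a point off the plane shows that the component is unknotted. Nothing else lies below
the plane, so lowering this component alone separates it from the rest. -/
theorem flatComponents_subset (h : ∀ i, FlatCurve (E i) (I i) (C i) (pos i))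
    (hd : Pairwise (Function.onFun Disjoint fun i => support (pos i) (C i))) {L : ι → Set E3}
    (hL : Isotopic L fun i => support (pos i) (C i)) :
    flatComponents C pos ⊆ unknottedSplitComponents L := by
  classical
  intro i hi
  constructor
  · obtain ⟨f, hf, hfL⟩ := hL
    obtain ⟨D, hD, -⟩ := (h i).polygon.exists_disk heightAff (v := up) (fun x hx => support_flat hi hx)
      (by rw [heightAff_apply, up_two]; exact one_ne_zero)
    exact ⟨f, hf, D, hfL i ▸ hD⟩
  -- Lower component `i` by `η`, raise everything by `η / 2` and turn upside down: the component
  -- ends at height `η / 2`, the others at most at `-η / 2`.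
  · obtain ⟨η, hη, hshift⟩ := exists_shift (fun i => isCompact_support) hd
      (d := fun j _ => if j = i then -1 else 0) (fun j => ⟨0, (LipschitzWith.const _).lipschitzOnWith⟩)
    obtain ⟨f, hf, hfx⟩ := hshift η hη le_rfl
    obtain ⟨g, hg, hgx⟩ := exists_translation (η / 2)
    obtain ⟨k, hk, hkx⟩ := exists_flip
    refine ⟨_, hL.trans ⟨_, (hf.trans hg).trans hk, fun j => rfl⟩, ?_, fun j hj => ?_⟩
    · rintro _ ⟨x, hx, rfl⟩
      have h0 := support_flat hi hx
      simp only [Homeomorph.trans_apply, hkx, hgx, hfx i x hx]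
      simp [up_two, h0]
      linarith
    · rintro _ ⟨x, hx, rfl⟩
      have h0 := (h j).support_nonneg hx
      simp only [Homeomorph.trans_apply, hkx, hgx, hfx j x hx]
      simp [up_two, hj]
      linarith

theorem reducedBridgeNumber_le (h : ∀ i, FlatCurve (E i) (I i) (C i) (pos i))
    (hd : Pairwise (Function.onFun Disjoint fun i => support (pos i) (E i))) {L : ι → Set E3}
    (hL : Isotopic L fun i => support (pos i) (C i)) :
    reducedBridgeNumber L ≤
      (localMaxima (⋃ i, support (pos i) (I i)) ∩ {x | 0 < x 2}).encard := by
  have hdC : Pairwise (Function.onFun Disjoint fun i => support (pos i) (C i)) := fun i j hij =>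
    (hd hij).mono (Set.biUnion_subset_biUnion_left (h i).curve_subset)
      (Set.biUnion_subset_biUnion_left (h j).curve_subset)
  rw [reducedBridgeNumber, tsub_le_iff_right]
  exact (bridgeNumber_le h hd hL).trans
    (add_le_add le_rfl (Set.encard_le_encard (flatComponents_subset h hdC hL)))

end LinkTheory

namespace LinkTheory

/-! ### A piecewise linear roof over the projection of a polygonal link -/

/-- The parameter of the point of the line `ab` closest to `x`, in the projection. -/
noncomputable def tau (a b x : E3) : ℝ :=
  ((x 0 - a 0) * (b 0 - a 0) + (x 1 - a 1) * (b 1 - a 1)) / ((b 0 - a 0) ^ 2 + (b 1 - a 1) ^ 2)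

/-- A function measuring the distance of `x` from the line `ab`, in the projection. -/
def nu (a b x : E3) : ℝ := (x 0 - a 0) * (b 1 - a 1) - (x 1 - a 1) * (b 0 - a 0)

/-- A function measuring the distance of `x` from the segment `ab`, in the projection. -/
noncomputable def segDist (a b x : E3) : ℝ := |nu a b x| + (max (- tau a b x) 0 + max (tau a b x - 1) 0)

/-- The height of `x` above the line `ab`. -/
noncomputable def heightOver (a b x : E3) : ℝ := x 2 - (a 2 + tau a b x * (b 2 - a 2))

section

variable {a b : E3}

theorem plOn_coord (i : Fin 3) : PLOn (fun x : E3 => x i) Set.univ :=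
  PLOn.of_affine (EuclideanSpace.proj i : E3 →L[ℝ] ℝ).toLinearMap.toAffineMap _

theorem plOn_coord_sub (i : Fin 3) (c : ℝ) : PLOn (fun x : E3 => x i - c) Set.univ :=
  ((plOn_coord i).add (PLOn.const (-c) _)).congr fun x _ => by simp [sub_eq_add_neg]

theorem plOn_tau (a b : E3) : PLOn (tau a b) Set.univ :=
  ((((plOn_coord_sub 0 (a 0)).const_mul (b 0 - a 0)).add
    ((plOn_coord_sub 1 (a 1)).const_mul (b 1 - a 1))).const_mul
      ((b 0 - a 0) ^ 2 + (b 1 - a 1) ^ 2)⁻¹).congr fun x _ => by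
    simp only [tau]; ring

theorem plOn_nu : PLOn (nu a b) Set.univ :=
  (((plOn_coord_sub 0 (a 0)).const_mul (b 1 - a 1)).add
    ((plOn_coord_sub 1 (a 1)).const_mul (-(b 0 - a 0)))).congr fun x _ => by
    simp only [nu]; ring

theorem plOn_segDist : PLOn (segDist a b) Set.univ :=
  plOn_nu.abs.add (((plOn_tau a b).neg.max (PLOn.const 0 _)).add
    ((((plOn_tau a b).add (PLOn.const (-1) _)).congr fun x _ => by simp [sub_eq_add_neg]).max
      (PLOn.const 0 _)))

theorem plOn_heightOver : PLOn (heightOver a b) Set.univ :=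
  ((plOn_coord 2).add ((((plOn_tau a b).const_mul (b 2 - a 2)).add (PLOn.const (a 2) _)).neg)).congr
    fun x _ => by simp only [heightOver]; ring

theorem tau_add_smul (x u : E3) (s : ℝ) : tau a b (x + s • u) =
    tau a b x + s * ((u 0 * (b 0 - a 0) + u 1 * (b 1 - a 1)) /
      ((b 0 - a 0) ^ 2 + (b 1 - a 1) ^ 2)) := by
  simp only [tau, PiLp.add_apply, PiLp.smul_apply, smul_eq_mul]
  ring

theorem nu_add_smul (x u : E3) (s : ℝ) : nu a b (x + s • u) =
    nu a b x + s * (u 0 * (b 1 - a 1) - u 1 * (b 0 - a 0)) := by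
  simp only [nu, PiLp.add_apply, PiLp.smul_apply, smul_eq_mul]
  ring

theorem segDist_nonneg (x : E3) : 0 ≤ segDist a b x := by
  unfold segDist; positivity

theorem up_zero : up 0 = 0 := by simp [up]

theorem up_one : up 1 = 0 := by simp [up]

theorem segDist_add_up (x : E3) (s : ℝ) : segDist a b (x + s • up) = segDist a b x := by
  simp [segDist, tau_add_smul, nu_add_smul, up_zero, up_one]

theorem heightOver_add_up (x : E3) (s : ℝ) : heightOver a b (x + s • up) = heightOver a b x + s := by
  simp only [heightOver, tau_add_smul, up_zero, up_one, PiLp.add_apply, PiLp.smul_apply, up_two]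
  simp
  ring

theorem sq_pos_of_proj_ne (hab : proj a ≠ proj b) : 0 < (b 0 - a 0) ^ 2 + (b 1 - a 1) ^ 2 := by
  by_contra h
  push Not at h
  have h0 : b 0 - a 0 = 0 := by nlinarith [sq_nonneg (b 0 - a 0), sq_nonneg (b 1 - a 1)]
  have h1 : b 1 - a 1 = 0 := by nlinarith [sq_nonneg (b 0 - a 0), sq_nonneg (b 1 - a 1)]
  exact hab (by rw [proj, proj, sub_eq_zero.1 h0, sub_eq_zero.1 h1])

theorem on_segment (hab : proj a ≠ proj b) {y : E3} (hy : y ∈ segment ℝ a b) :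
    segDist a b y = 0 ∧ heightOver a b y = 0 := by
  obtain ⟨s, ⟨hs0, hs1⟩, rfl⟩ := (segment_eq_image' ℝ a b).subset hy
  have hpos := sq_pos_of_proj_ne hab
  have ht : tau a b (a + s • (b - a)) = s := by
    rw [tau_add_smul]
    simp only [tau, sub_self, zero_mul, add_zero, zero_div, zero_add, PiLp.sub_apply]
    field_simp
  have hn : nu a b (a + s • (b - a)) = 0 := by
    rw [nu_add_smul]
    simp only [nu, PiLp.sub_apply]
    ring
  refine ⟨?_, ?_⟩
  · rw [segDist, ht, hn, max_eq_right (by linarith), max_eq_right (by linarith)]; simp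
  · rw [heightOver, ht]
    simp

theorem exists_below (hab : proj a ≠ proj b) {x : E3} (hx : segDist a b x = 0) :
    ∃ y ∈ segment ℝ a b, proj x = proj y ∧ heightOver a b x = x 2 - y 2 := by
  have hpos := sq_pos_of_proj_ne hab
  have h1 := abs_nonneg (nu a b x)
  have h2 := le_max_right (-tau a b x) 0
  have h3 := le_max_right (tau a b x - 1) 0
  have h4 := le_max_left (-tau a b x) 0
  have h5 := le_max_left (tau a b x - 1) 0
  rw [segDist] at hx
  have hn : nu a b x = 0 := abs_eq_zero.1 (by linarith)
  refine ⟨a + tau a b x • (b - a), (segment_eq_image' ℝ a b).superset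
    ⟨_, ⟨by linarith, by linarith⟩, rfl⟩, ?_, ?_⟩
  · have ht : tau a b x * ((b 0 - a 0) ^ 2 + (b 1 - a 1) ^ 2) =
        (x 0 - a 0) * (b 0 - a 0) + (x 1 - a 1) * (b 1 - a 1) := div_mul_cancel₀ _ hpos.ne'
    rw [nu] at hn
    simp only [proj, PiLp.add_apply, PiLp.smul_apply, PiLp.sub_apply, smul_eq_mul, Prod.mk.injEq]
    constructor
    · apply mul_right_cancel₀ hpos.ne'
      linear_combination (-(b 0 - a 0)) * ht + (b 1 - a 1) * hn
    · apply mul_right_cancel₀ hpos.ne'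
      linear_combination (-(b 1 - a 1)) * ht - (b 0 - a 0) * hn
  · simp [heightOver]

/-- The distance from the segment grows along lines through points over it. -/
theorem segDist_along {x u : E3} (hx : segDist a b x = 0) {t s : ℝ} (hs0 : 0 ≤ s) (hs1 : s ≤ 1) :
    segDist a b (x + ((1 - s) * t) • u) + s * (|t| * |u 0 * (b 1 - a 1) - u 1 * (b 0 - a 0)|) ≤
      segDist a b (x + t • u) := by
  have h1 := abs_nonneg (nu a b x)
  have h2 := le_max_right (-tau a b x) 0
  have h3 := le_max_right (tau a b x - 1) 0
  have h4 := le_max_left (-tau a b x) 0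
  have h5 := le_max_left (tau a b x - 1) 0
  rw [segDist] at hx
  have hn : nu a b x = 0 := abs_eq_zero.1 (by linarith)
  have ht0 : 0 ≤ tau a b x := by linarith
  have ht1 : tau a b x ≤ 1 := by linarith
  simp only [segDist, tau_add_smul, nu_add_smul, hn, zero_add]
  set c := u 0 * (b 1 - a 1) - u 1 * (b 0 - a 0)
  set d := (u 0 * (b 0 - a 0) + u 1 * (b 1 - a 1)) / ((b 0 - a 0) ^ 2 + (b 1 - a 1) ^ 2)
  set T := tau a b x
  have e1 : |(1 - s) * t * c| = (1 - s) * (|t| * |c|) := by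
    rw [abs_mul, abs_mul, abs_of_nonneg (by linarith : 0 ≤ 1 - s)]; ring
  have e2 : max (-(T + (1 - s) * t * d)) 0 ≤ max (-(T + t * d)) 0 := by
    refine max_le ?_ (le_max_right _ _)
    rcases le_total 0 (T + t * d) with h | h
    · exact le_trans (by nlinarith) (le_max_right _ _)
    · exact le_trans (by nlinarith) (le_max_left _ _)
  have e3 : max (T + (1 - s) * t * d - 1) 0 ≤ max (T + t * d - 1) 0 := by
    refine max_le ?_ (le_max_right _ _)
    rcases le_total (T + t * d - 1) 0 with h | h
    · exact le_trans (by nlinarith) (le_max_right _ _)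
    · exact le_trans (by nlinarith) (le_max_left _ _)
  rw [e1, abs_mul]
  linarith

theorem heightOver_along (x u : E3) : ∃ β : ℝ, ∀ t, heightOver a b (x + t • u) =
    heightOver a b x + t * β := by
  refine ⟨u 2 - (u 0 * (b 0 - a 0) + u 1 * (b 1 - a 1)) /
      ((b 0 - a 0) ^ 2 + (b 1 - a 1) ^ 2) * (b 2 - a 2), fun t => ?_⟩
  rw [heightOver, heightOver, tau_add_smul]
  simp only [PiLp.add_apply, PiLp.smul_apply, smul_eq_mul]
  ring

/-- The height over a steep roof above the segment `ab`. -/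
noncomputable def overRoof (m : ℕ) (a b x : E3) : ℝ :=
  heightOver a b x - (m + 1) * segDist a b x + 1 / ((m : ℝ) + 1)

/-- As `m` grows, `overRoof` decreases to `heightOver` over the segment and to minus infinity
elsewhere. Monotonicity and compactness make the conclusion uniform. -/
theorem eventually_overRoof_neg {K : Set E3} (hK : IsCompact K)
    (h : ∀ x ∈ K, 0 < segDist a b x ∨ heightOver a b x < 0) :
    ∀ᶠ m : ℕ in Filter.atTop, ∀ x ∈ K, overRoof m a b x < 0 := by
  have hmono : ∀ {m m' : ℕ}, m ≤ m' → ∀ x, overRoof m' a b x ≤ overRoof m a b x := by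
    intro m m' hm x
    have h1 : (m : ℝ) ≤ m' := by exact_mod_cast hm
    have h2 : 1 / ((m' : ℝ) + 1) ≤ 1 / ((m : ℝ) + 1) :=
      one_div_le_one_div_of_le (by positivity) (by linarith)
    have h3 := mul_le_mul_of_nonneg_right h1 (segDist_nonneg (a := a) (b := b) x)
    unfold overRoof
    linarith
  have hcont : ∀ m : ℕ, Continuous (overRoof m a b) := fun m => by
    have h1 : Continuous (heightOver a b) := continuousOn_univ.1 plOn_heightOver.1
    have h2 : Continuous (segDist a b) := continuousOn_univ.1 plOn_segDist.1
    unfold overRoof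
    fun_prop
  obtain ⟨m, hm⟩ := hK.elim_directed_cover (fun m : ℕ => {x | overRoof m a b x < 0})
    (fun m => isOpen_lt (hcont m) continuous_const) (by
      intro x hx
      refine Set.mem_iUnion.2 ?_
      have hlim : Filter.Tendsto (fun m : ℕ => 1 / ((m : ℝ) + 1)) Filter.atTop (𝓝 0) :=
        tendsto_one_div_add_atTop_nhds_zero_nat
      rcases h x hx with hx | hx
      · obtain ⟨m, hm⟩ := exists_nat_gt ((heightOver a b x + 1) / segDist a b x)
        rw [div_lt_iff₀ hx] at hm
        refine ⟨m, ?_⟩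
        have : 1 / ((m : ℝ) + 1) ≤ 1 := by
          rw [div_le_one (by positivity)]
          have : (0 : ℝ) ≤ m := Nat.cast_nonneg m
          linarith
        simp only [Set.mem_ofPred_eq, overRoof]
        linarith
      · obtain ⟨m, hm⟩ := (hlim.eventually (gt_mem_nhds (neg_pos.2 hx))).exists
        refine ⟨m, ?_⟩
        have := mul_nonneg (by positivity : (0 : ℝ) ≤ m + 1) (segDist_nonneg (a := a) (b := b) x)
        simp only [Set.mem_ofPred_eq, overRoof]
        linarith)
    (directed_of_isDirected_le fun m m' hm x hx => lt_of_le_of_lt (hmono hm x) hx)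
  filter_upwards [Filter.eventually_ge_atTop m] with m' hm' x hx
  exact lt_of_le_of_lt (hmono hm' x) (hm hx)

/-- Along a transverse line, the height over a steep roof increases towards the crossing. -/
theorem eventually_overRoof_lt {x u : E3} (hx : segDist a b x = 0)
    (hu : u 0 * (b 1 - a 1) - u 1 * (b 0 - a 0) ≠ 0) :
    ∀ᶠ m : ℕ in Filter.atTop, ∀ t s : ℝ, t ≠ 0 → 0 < s → s ≤ 1 →
      overRoof m a b (x + t • u) < overRoof m a b (x + ((1 - s) * t) • u) := by
  obtain ⟨β, hβ⟩ := heightOver_along (a := a) (b := b) x u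
  set c := |u 0 * (b 1 - a 1) - u 1 * (b 0 - a 0)| with hc
  have hc0 : 0 < c := abs_pos.2 hu
  -- Beyond `m₀` the steepness outweighs the slope `β` of the strand relative to the segment.
  obtain ⟨m₀, hm₀⟩ := exists_nat_gt (|β| / c)
  filter_upwards [Filter.eventually_ge_atTop m₀] with m hm t s ht hs0 hs1
  have h1 := segDist_along (u := u) hx (t := t) hs0.le hs1
  rw [← hc] at h1
  have hm' : |β| < (m + 1) * c := by
    rw [div_lt_iff₀ hc0] at hm₀
    have : (m₀ : ℝ) ≤ m := by exact_mod_cast hm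
    nlinarith
  have h2 : t * β ≤ |t| * |β| := by rw [← abs_mul]; exact le_abs_self _
  have h3 : 0 < |t| := abs_pos.2 ht
  have h4 : s * (|t| * |β|) < s * (|t| * ((m + 1) * c)) :=
    mul_lt_mul_of_pos_left (mul_lt_mul_of_pos_left hm' h3) hs0
  have h5 : s * (t * β) ≤ s * (|t| * |β|) := mul_le_mul_of_nonneg_left h2 hs0.le
  have h6 := mul_le_mul_of_nonneg_left h1 (by positivity : (0 : ℝ) ≤ m + 1)
  simp only [overRoof, hβ]
  nlinarith

end
end LinkTheory

namespace LinkTheory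

/-! ### Straightening a partitioned link -/

/-- An endpoint of the segment different from `y` can be pulled towards `y` into the ball where the
set is a line. -/
theorem IsStraightAt.exists_smul {X : Set E3} {y v a b : E3} (h : IsStraightAt X y v) (hab : a ≠ b)
    (hy : y ∈ segment ℝ a b) (hX : segment ℝ a b ⊆ X) : ∃ c : ℝ, c ≠ 0 ∧ b - a = c • v := by
  obtain ⟨ε, hε, hs⟩ := h
  have key : ∀ e ∈ segment ℝ a b, e ≠ y → ∃ c : ℝ, c ≠ 0 ∧ e - y = c • v := by
    intro e he hey
    have hpos : 0 < ‖e - y‖ := norm_pos_iff.2 (sub_ne_zero.2 hey)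
    set s := min 1 (ε / (2 * ‖e - y‖)) with hsdef
    have hs0 : 0 < s := by positivity
    have hmem : y + s • (e - y) ∈ segment ℝ a b := by
      have := (convex_segment a b).lineMap_mem hy he (t := s) ⟨hs0.le, min_le_left _ _⟩
      rwa [AffineMap.lineMap_apply_module', add_comm] at this
    have hball : y + s • (e - y) ∈ Metric.ball y ε := by
      rw [mem_ball_iff_norm, add_sub_cancel_left, norm_smul, Real.norm_eq_abs, abs_of_pos hs0]
      have : s * ‖e - y‖ ≤ ε / (2 * ‖e - y‖) * ‖e - y‖ :=
        mul_le_mul_of_nonneg_right (min_le_right _ _) hpos.le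
      rw [div_mul_eq_mul_div, mul_div_mul_right _ _ hpos.ne'] at this
      linarith
    obtain ⟨t, ht⟩ := (hs _ hball).1 (hX hmem)
    have ht := add_left_cancel ht
    refine ⟨s⁻¹ * t, ?_, ?_⟩
    · refine mul_ne_zero (inv_ne_zero hs0.ne') ?_
      rintro rfl
      rw [zero_smul, smul_eq_zero] at ht
      exact ht.elim hs0.ne' (sub_ne_zero.2 hey)
    · rw [mul_smul, ← ht, smul_smul, inv_mul_cancel₀ hs0.ne', one_smul]
  obtain ⟨r, -, rfl⟩ := (segment_eq_image' ℝ a b).subset hy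
  by_cases hr : r = 0
  · subst hr
    obtain ⟨c, hc, hcv⟩ := key b (right_mem_segment ℝ a b) (by simpa using hab.symm)
    exact ⟨c, hc, by simpa using hcv⟩
  · obtain ⟨c, hc, hcv⟩ := key a (left_mem_segment ℝ a b) (by
      simpa [sub_eq_zero, hr] using hab.symm)
    refine ⟨-(r⁻¹ * c), by simp [hr, hc], ?_⟩
    rw [neg_smul, mul_smul, ← hcv, sub_add_cancel_left, smul_neg, smul_smul, inv_mul_cancel₀ hr,
      one_smul, neg_neg]

theorem plOn_sup' {σ : Type*} {S : Finset σ} (hS : S.Nonempty) {F : σ → E3 → ℝ}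
    (hF : ∀ q ∈ S, PLOn (F q) Set.univ) : PLOn (fun x => S.sup' hS fun q => F q x) Set.univ := by
  induction hS using Finset.Nonempty.cons_induction with
  | singleton a => simpa using hF a (by simp)
  | cons a s ha hs ih =>
    refine ((hF a (by simp)).max (ih fun q hq => hF q (by simp [hq]))).congr fun x _ => ?_
    rw [Finset.sup'_cons hs]

theorem plOn_overRoof (m : ℕ) (a b : E3) : PLOn (overRoof m a b) Set.univ :=
  ((plOn_heightOver.add (plOn_segDist.const_mul (-((m : ℝ) + 1)))).add
    (PLOn.const (1 / ((m : ℝ) + 1)) _)).congr fun x _ => by simp only [overRoof]; ring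

theorem overRoof_add_up (m : ℕ) (a b x : E3) (s : ℝ) :
    overRoof m a b (x + s • up) = overRoof m a b x + s := by
  rw [overRoof, overRoof, heightOver_add_up, segDist_add_up]; ring

/-- The shear taking a roof over finitely many segments to the plane `z = 0`. -/
theorem exists_roof_shear (m : ℕ) {S : Finset (E3 × E3)} (hS : S.Nonempty) :
    ∃ g : E3 ≃ₜ E3, IsIsotopicToId g ∧ PLOn g Set.univ ∧
      (∀ x, g x 2 = S.sup' hS fun q => overRoof m q.1 q.2 x) ∧
        ∀ x, g x 0 = x 0 ∧ g x 1 = x 1 := by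
  have hPL : PLOn (fun x : E3 => (S.sup' hS fun q => overRoof m q.1 q.2 x) - x 2) Set.univ :=
    ((plOn_sup' hS fun q _ => plOn_overRoof m q.1 q.2).add (plOn_coord 2).neg).congr
      fun x _ => by rw [sub_eq_add_neg]
  -- Each `overRoof` has slope one upwards, hence so has the maximum, and the displacement does not
  -- decrease along vertical lines.
  have hshear : IsShear up (fun x : E3 => (S.sup' hS fun q => overRoof m q.1 q.2 x) - x 2) := by
    refine ⟨continuousOn_univ.1 hPL.1, 1, one_pos, le_rfl, fun x s _ => ?_⟩
    obtain ⟨q, hq, he⟩ := S.exists_mem_eq_sup' hS fun q => overRoof m q.1 q.2 x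
    have := S.le_sup' (fun q => overRoof m q.1 q.2 (x + s • up)) hq
    simp only [overRoof_add_up] at this
    simp only [he, overRoof_add_up, PiLp.add_apply, PiLp.smul_apply, up_two, smul_eq_mul]
    linarith
  obtain ⟨g, hg, hgx⟩ := hshear.exists_isotopy
  exact ⟨g, hg, hPL.shear hgx, fun x => by simp [hgx, up_two], fun x => by simp [hgx, up_zero, up_one]⟩

variable {M M' : Set E3} {S : Finset (E3 × E3)}

/-- The local picture at an overcrossing. -/
theorem exists_crossing_ball (hM' : IsCompact M') (hdisj : Disjoint M M')
    (hreg : HasRegularProjection (M ∪ M')) (hS : ∀ x, x ∈ M' ↔ ∃ q ∈ S, x ∈ segment ℝ q.1 q.2)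
    (hSne : ∀ q ∈ S, q.1 ≠ q.2) (hSp : ∀ q ∈ S, proj q.1 ≠ proj q.2) (hM : IsCompact M) {x y : E3}
    (hxy : (x, y) ∈ overcrossings M M') : ∃ ρ > 0, ∃ u : E3, 0 < u 0 ^ 2 + u 1 ^ 2 ∧
      (∀ w ∈ Metric.closedBall x ρ, w ∈ M ↔ ∃ t : ℝ, w = x + t • u) ∧
      ∀ q ∈ S, ∀ᶠ m : ℕ in Filter.atTop,
        (∀ w ∈ M ∩ Metric.closedBall x ρ, overRoof m q.1 q.2 w < 0) ∨
        ∀ t s : ℝ, t ≠ 0 → 0 < s → s ≤ 1 →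
          overRoof m q.1 q.2 (x + t • u) < overRoof m q.1 q.2 (x + ((1 - s) * t) • u) := by
  obtain ⟨hx, hy, hp, -⟩ := hxy
  simp only at hx hy hp
  have hne : x ≠ y := fun e => Set.disjoint_left.1 hdisj hx (e ▸ hy)
  obtain ⟨u, v, hu, hv, huv⟩ := hreg.2 x (Or.inl hx) y (Or.inr hy) hne hp
  have hqX : ∀ q ∈ S, segment ℝ q.1 q.2 ⊆ M ∪ M' := fun q hq z hz => Or.inr ((hS z).2 ⟨q, hq, hz⟩)
  -- There are no triple points, so a segment not through `y` has no point on the vertical line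
  -- through `x`.
  have hfar : ∀ q ∈ S, y ∉ segment ℝ q.1 q.2 → 0 < segDist q.1 q.2 x := by
    intro q hq hyq
    refine (segDist_nonneg x).lt_of_ne' fun h0 => ?_
    obtain ⟨y', hy', hpy, -⟩ := exists_below (hSp q hq) h0
    have hy'M := (hS y').2 ⟨q, hq, hy'⟩
    rcases hreg.1 x (Or.inl hx) y (Or.inr hy) y' (Or.inr hy'M) hp (hp.symm.trans hpy) with h | h | h
    · exact hne h
    · exact hyq (h ▸ hy')
    · exact Set.disjoint_left.1 hdisj hx (h ▸ hy'M)
  obtain ⟨ε, hε, hst⟩ := hu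
  have hev : ∀ᶠ w in 𝓝 x, w ∈ Metric.ball x ε ∧ w ∉ M' ∧
      ∀ q ∈ S, y ∉ segment ℝ q.1 q.2 → 0 < segDist q.1 q.2 w := by
    refine Filter.Eventually.and (Metric.ball_mem_nhds x hε) (Filter.Eventually.and
      (hM'.isClosed.isOpen_compl.mem_nhds (Set.disjoint_left.1 hdisj hx)) ?_)
    refine (Filter.eventually_all_finset S).2 fun q hq => ?_
    by_cases hyq : y ∈ segment ℝ q.1 q.2
    · exact Filter.Eventually.of_forall fun w h => absurd hyq h
    · have hc : Continuous (segDist q.1 q.2) := continuousOn_univ.1 plOn_segDist.1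
      filter_upwards [hc.continuousAt.eventually (lt_mem_nhds (hfar q hq hyq))] with w hw _
      exact hw
  obtain ⟨ρ, hρ, hball⟩ := Metric.nhds_basis_closedBall.eventually_iff.1 hev
  refine ⟨ρ, hρ, u, ?_, fun w hw => ?_, fun q hq => ?_⟩
  · by_contra hcon
    push Not at hcon
    have h0 : u 0 = 0 := by nlinarith [sq_nonneg (u 0), sq_nonneg (u 1)]
    have h1 : u 1 = 0 := by nlinarith [sq_nonneg (u 0), sq_nonneg (u 1)]
    rw [h0, h1] at huv
    simp at huv
  · rw [← hst w (hball hw).1]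
    exact ⟨Or.inl, fun h => h.resolve_right (hball hw).2.1⟩
  -- A segment through `y` has the direction of the strand at `y`, which is transverse to `u`. The
  -- other segments stay away in the projection and become negative.
  · by_cases hyq : y ∈ segment ℝ q.1 q.2
    · obtain ⟨c, hc, hcv⟩ := hv.exists_smul (hSne q hq) hyq (hqX q hq)
      have hc0 : q.2 0 - q.1 0 = c * v 0 := by
        have := congrArg (fun z : E3 => z 0) hcv
        simpa using this
      have hc1 : q.2 1 - q.1 1 = c * v 1 := by
        have := congrArg (fun z : E3 => z 1) hcv
        simpa using this
      have hx0 : segDist q.1 q.2 x = 0 := by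
        have hx0' : x 0 = y 0 := congrArg Prod.fst hp
        have hx1' : x 1 = y 1 := congrArg Prod.snd hp
        rw [← (on_segment (hSp q hq) hyq).1]
        simp only [segDist, nu, tau, hx0', hx1']
      filter_upwards [eventually_overRoof_lt (u := u) hx0 (by
        rw [hc0, hc1]
        intro h0
        refine huv (mul_left_cancel₀ hc ?_)
        linear_combination h0)] with m hm
      exact Or.inr hm
    · filter_upwards [eventually_overRoof_neg (a := q.1) (b := q.2)
        (hM.inter_right Metric.isClosed_closedBall) fun w hw =>
          Or.inl ((hball hw.2).2.2 q hq hyq)] with m hm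
      exact Or.inl hm

/-- The link `M'` acquires heights at least `1 / (m + 1)`. On `M`, nonnegative height occurs only
near overcrossings. There the segment realizing the height at a local maximum passes under the
crossing, and moving towards the crossing would increase the height, so the maximum is the crossing
itself. With one crossing, the part of `M` in question lies on a single straight strand before the
shear, and the shear keeps the horizontal coordinates. -/
theorem exists_straightening (hM : IsCompact M) (hM' : IsCompact M') (hdisj : Disjoint M M')
    (hreg : HasRegularProjection (M ∪ M')) (hS : ∀ x, x ∈ M' ↔ ∃ q ∈ S, x ∈ segment ℝ q.1 q.2)
    (hSne : ∀ q ∈ S, q.1 ≠ q.2) (hS0 : S.Nonempty) (hfin : (overcrossings M M').Finite) :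
    ∃ g : E3 ≃ₜ E3, IsIsotopicToId g ∧ PLOn g Set.univ ∧ (∀ x ∈ M', 0 < g x 2) ∧
      (localMaxima (g '' M) ∩ {x | 0 < x 2}).encard ≤ (overcrossings M M').encard ∧
      ((overcrossings M M').encard ≤ 1 →
        ∃ t : E3 →ₗ[ℝ] ℝ, Set.InjOn t (g '' M ∩ {x | 0 ≤ x 2})) := by
  -- A vertical segment would make its endpoints a double point with a vertical strand, which cannot
  -- cross transversally.
  have hSp : ∀ q ∈ S, proj q.1 ≠ proj q.2 := by
    intro q hq he
    have hsub : segment ℝ q.1 q.2 ⊆ M ∪ M' := fun z hz => Or.inr ((hS z).2 ⟨q, hq, hz⟩)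
    have h1 := left_mem_segment ℝ q.1 q.2
    have h2 := right_mem_segment ℝ q.1 q.2
    obtain ⟨u, v, hu, -, huv⟩ := hreg.2 _ (hsub h1) _ (hsub h2) (hSne q hq) he
    obtain ⟨c, hc, hcv⟩ := hu.exists_smul (hSne q hq) h1 hsub
    have hc0 : q.2 0 - q.1 0 = c * u 0 := by
      have := congrArg (fun z : E3 => z 0) hcv
      simpa using this
    have hc1 : q.2 1 - q.1 1 = c * u 1 := by
      have := congrArg (fun z : E3 => z 1) hcv
      simpa using this
    have he0 : q.1 0 = q.2 0 := congrArg Prod.fst he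
    have he1 : q.1 1 = q.2 1 := congrArg Prod.snd he
    rw [he0, sub_self] at hc0
    rw [he1, sub_self] at hc1
    rw [(mul_eq_zero.1 hc0.symm).resolve_left hc, (mul_eq_zero.1 hc1.symm).resolve_left hc] at huv
    simp at huv
  set P : Set E3 := Prod.fst '' overcrossings M M' with hP
  have hPfin : P.Finite := hfin.image _
  have hPn : P.encard ≤ (overcrossings M M').encard := Set.encard_image_le _ _
  have hover : ∀ x : P, ∃ y, ((x : E3), y) ∈ overcrossings M M' := by
    rintro ⟨_, ⟨x, y⟩, hxy, rfl⟩
    exact ⟨y, hxy⟩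
  choose y hy using hover
  choose ρ hρ u hu hline hroof using fun x : P =>
    exists_crossing_ball hM' hdisj hreg hS hSne hSp hM (hy x)
  have : Finite P := hPfin
  set K := M \ ⋃ x : P, Metric.ball (x : E3) (ρ x) with hK
  have hKc : IsCompact K := hM.diff (isOpen_iUnion fun x => Metric.isOpen_ball)
  -- A point of `M` over a segment of `M'` and not below it is an overcrossing, and these have been
  -- removed from `K`.
  have hKneg : ∀ q ∈ S, ∀ w ∈ K, 0 < segDist q.1 q.2 w ∨ heightOver q.1 q.2 w < 0 := by
    intro q hq w hw
    by_contra hcon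
    push Not at hcon
    obtain ⟨y, hy, hpy, hh⟩ := exists_below (hSp q hq) (le_antisymm hcon.1 (segDist_nonneg w))
    have hyM := (hS y).2 ⟨q, hq, hy⟩
    have hlt : y 2 < w 2 := by
      refine lt_of_le_of_ne (by linarith [hcon.2]) fun he => ?_
      have : w = y := by
        ext i
        fin_cases i
        · exact congrArg Prod.fst hpy
        · exact congrArg Prod.snd hpy
        · exact he.symm
      exact Set.disjoint_left.1 hdisj hw.1 (this ▸ hyM)
    have hwP : w ∈ P := ⟨(w, y), ⟨hw.1, hyM, hpy, hlt⟩, rfl⟩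
    exact hw.2 (Set.mem_iUnion.2 ⟨⟨w, hwP⟩, Metric.mem_ball_self (hρ _)⟩)
  obtain ⟨m, hm1, hm2⟩ := (((Filter.eventually_all_finset S).2 fun q hq =>
    eventually_overRoof_neg hKc (hKneg q hq)).and (Filter.eventually_all.2 fun x : P =>
      (Filter.eventually_all_finset S).2 (hroof x))).exists
  obtain ⟨g, hg, hgPL, hg2, hg01⟩ := exists_roof_shear m hS0
  have hin : ∀ w ∈ M, 0 ≤ g w 2 → ∃ x : P, w ∈ Metric.ball (x : E3) (ρ x) := by
    intro w hw h0
    by_contra hcon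
    obtain ⟨q, hq, he⟩ := S.exists_mem_eq_sup' hS0 fun q => overRoof m q.1 q.2 w
    have hwK : w ∈ K := ⟨hw, fun h => hcon (Set.mem_iUnion.1 h)⟩
    have := hm1 q hq w hwK
    rw [hg2, he] at h0
    linarith
  refine ⟨g, hg, hgPL, fun y hy => ?_, ?_, fun h1 => ?_⟩
  · obtain ⟨q, hq, hyq⟩ := (hS y).1 hy
    rw [hg2]
    refine lt_of_lt_of_le ?_ (S.le_sup' (fun q => overRoof m q.1 q.2 y) hq)
    simp only [overRoof, on_segment (hSp q hq) hyq]
    simp only [mul_zero, sub_zero, zero_add]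
    positivity
  · refine le_trans (Set.encard_le_encard (?_ : _ ⊆ g '' P)) ((Set.encard_image_le _ _).trans hPn)
    rintro _ ⟨⟨⟨w, hw, rfl⟩, hmax⟩, hpos⟩
    have hpos : 0 < g w 2 := hpos
    obtain ⟨x, hx⟩ := hin w hw hpos.le
    obtain ⟨t, ht⟩ := (hline x w (Metric.ball_subset_closedBall hx)).1 hw
    refine ⟨x, x.2, congrArg g ?_⟩
    by_contra hne
    have ht0 : t ≠ 0 := by
      rintro rfl
      exact hne (by simp [ht])
    obtain ⟨q, hq, he⟩ := S.exists_mem_eq_sup' hS0 fun q => overRoof m q.1 q.2 w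
    -- The segment `q` gives a positive height at `w`, so it is not one of the segments that are
    -- negative in this ball.
    have hinc := (hm2 x q hq).resolve_left fun hneg => by
      have := hneg w ⟨hw, Metric.ball_subset_closedBall hx⟩
      rw [hg2, he] at hpos
      linarith
    have hmem : ∀ s : ℝ, 0 < s → s ≤ 1 → (x : E3) + ((1 - s) * t) • u x ∈ M := by
      intro s hs0 hs1
      refine (hline x _ ?_).2 ⟨_, rfl⟩
      rw [mem_closedBall_iff_norm, add_sub_cancel_left, mul_smul, norm_smul, Real.norm_eq_abs,
        abs_of_nonneg (by linarith)]
      rw [ht, mem_ball_iff_norm, add_sub_cancel_left] at hx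
      nlinarith [norm_nonneg (t • u x)]
    have hlim : Filter.Tendsto (fun s : ℝ => g ((x : E3) + ((1 - s) * t) • u x)) (𝓝[>] 0)
        (𝓝[g '' M] (g w)) := by
      refine tendsto_nhdsWithin_iff.2 ⟨?_, ?_⟩
      · have hc : Continuous fun s : ℝ => g ((x : E3) + ((1 - s) * t) • u x) := by fun_prop
        have := (hc.tendsto 0).mono_left (nhdsWithin_le_nhds (s := Set.Ioi 0))
        simpa [ht] using this
      · filter_upwards [Ioc_mem_nhdsGT (one_pos : (0 : ℝ) < 1)] with s hs
        exact Set.mem_image_of_mem g (hmem s hs.1 hs.2)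
    obtain ⟨s, hs, hs0, hs1⟩ := ((hlim.eventually hmax).and
      (Ioc_mem_nhdsGT (one_pos : (0 : ℝ) < 1))).exists
    have h1 := hinc t s ht0 hs0 hs1
    have h2 := S.le_sup' (fun q => overRoof m q.1 q.2 ((x : E3) + ((1 - s) * t) • u x)) hq
    rw [← hg2] at h2
    rw [← ht, ← he, ← hg2] at h1
    exact absurd hs (not_le.2 (h1.trans_le h2))
  · have hsub : ∀ x x' : P, x = x' := fun x x' =>
      Subtype.ext (Set.encard_le_one_iff.1 (hPn.trans h1) _ _ x.2 x'.2)
    by_cases hPe : Nonempty P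
    · obtain ⟨x⟩ := hPe
      -- The form is the horizontal scalar product with the direction of the strand, which is not
      -- vertical.
      refine ⟨(u x 0) • (EuclideanSpace.proj 0 : E3 →L[ℝ] ℝ).toLinearMap +
        (u x 1) • (EuclideanSpace.proj 1 : E3 →L[ℝ] ℝ).toLinearMap, ?_⟩
      have hex : ∀ w ∈ M, 0 ≤ g w 2 → ∃ t : ℝ, w = (x : E3) + t • u x := by
        intro w hw h0
        obtain ⟨x', hx'⟩ := hin w hw h0
        obtain rfl := hsub x x'
        exact (hline x w (Metric.ball_subset_closedBall hx')).1 hw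
      rintro _ ⟨⟨w, hw, rfl⟩, hw0⟩ _ ⟨⟨w', hw', rfl⟩, hw0'⟩ he
      obtain ⟨t, ht⟩ := hex w hw hw0
      obtain ⟨t', ht'⟩ := hex w' hw' hw0'
      have he : u x 0 * g w 0 + u x 1 * g w 1 = u x 0 * g w' 0 + u x 1 * g w' 1 := he
      rw [(hg01 w).1, (hg01 w).2, (hg01 w').1, (hg01 w').2, ht, ht'] at he
      simp only [PiLp.add_apply, PiLp.smul_apply, smul_eq_mul] at he
      have : t = t' := by
        refine mul_right_cancel₀ (hu x).ne' ?_
        linear_combination he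
      rw [ht, ht', this]
    · refine ⟨0, ?_⟩
      rintro _ ⟨⟨w, hw, rfl⟩, hw0⟩
      obtain ⟨x, -⟩ := hin w hw hw0
      exact absurd ⟨x⟩ hPe

end LinkTheory

namespace LinkTheory

/-! ### Parallel copies give flat curves -/

theorem IsPLEmbedding.comp_homeomorph {f : ℝ × ℝ → E3} {s : Set (ℝ × ℝ)} (hf : IsPLEmbedding f s)
    {h : E3 ≃ₜ E3} (hh : PLOn h Set.univ) : IsPLEmbedding (h ∘ f) s :=
  ⟨PLOn.comp hh hf.1 (Set.mapsTo_univ _ _), h.injective.comp_injOn hf.2⟩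

theorem IsPolygon.image {C : Set E3} (hC : IsPolygon C) {h : E3 ≃ₜ E3} (hh : PLOn h Set.univ) :
    IsPolygon (h '' C) := by
  obtain ⟨f, hf, rfl⟩ := hC
  exact ⟨_, hf.comp_homeomorph hh, Set.image_comp _ _ _⟩

theorem IsPLAnnulus.image {A C C' : Set E3} (hA : IsPLAnnulus A C C') {h : E3 ≃ₜ E3}
    (hh : PLOn h Set.univ) : IsPLAnnulus (h '' A) (h '' C) (h '' C') := by
  obtain ⟨f, hf, rfl, rfl, rfl⟩ := hA
  exact ⟨_, hf.comp_homeomorph hh, Set.image_comp _ _ _, Set.image_comp _ _ _, Set.image_comp _ _ _⟩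

theorem IsPLAnnulus.isCompact {A C C' : Set E3} (hA : IsPLAnnulus A C C') : IsCompact A := by
  obtain ⟨f, hf, rfl, -, -⟩ := hA
  refine IsCompact.image_of_continuousOn ?_ hf.1.1
  refine (isCompact_closedBall (0 : ℝ × ℝ) 2).of_isClosed_subset isClosed_stdAnnulus fun p hp => ?_
  rw [mem_closedBall_zero_iff]
  exact hp.2

/-- The outer boundary of an annulus is a finite union of segments. -/
theorem IsPLAnnulus.exists_segments {A C C' : Set E3} (hA : IsPLAnnulus A C C') :
    ∃ S : Finset (E3 × E3), (∀ x, x ∈ C' ↔ ∃ q ∈ S, x ∈ segment ℝ q.1 q.2) ∧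
      ∀ q ∈ S, q.1 ≠ q.2 := by
  classical
  obtain ⟨T, I, O, pos, hT, hinj, -, -, rfl, -⟩ := hA.exists_complex
  have hpair : ∀ g, ∃ q : E3 × E3, g ∈ O → cell pos g = segment ℝ q.1 q.2 ∧ q.1 ≠ q.2 := by
    intro g
    by_cases hg : g ∈ O
    · have hgT := hT.outer_subset hg
      obtain ⟨a, b, hab, rfl⟩ := Finset.card_eq_two.1 (mem_faceEdges.1 hgT).1
      exact ⟨(pos a, pos b), fun _ => ⟨cell_pair _ _ _, fun he =>
        hab (hinj.faceEdges.injOn (mem_verts.2 ⟨_, hgT, by simp⟩)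
          (mem_verts.2 ⟨_, hgT, by simp⟩) he)⟩⟩
    · exact ⟨0, fun h => absurd h hg⟩
  choose q hq using hpair
  refine ⟨O.image q, fun x => ?_, fun p hp => ?_⟩
  · simp only [Set.mem_iUnion, Finset.mem_image, exists_exists_and_eq_and, exists_prop]
    exact exists_congr fun g => and_congr_right fun hg => by rw [(hq g hg).1]
  · obtain ⟨g, hg, rfl⟩ := Finset.mem_image.1 hp
    exact (hq g hg).2

theorem image_trans (f g : E3 ≃ₜ E3) (X : Set E3) : f.trans g '' X = g '' (f '' X) :=
  Set.image_comp g f X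

/-- Each move fixes the sets `A j` of all other components, so the moves can be performed one after
another without interference. -/
theorem exists_simultaneous {ι : Type*} [Finite ι] {X Y A : ι → Set E3}
    (hX : ∀ i, X i ⊆ A i) (hY : ∀ i, Y i ⊆ A i)
    (h : ∀ i, Moves (⋃ j : {j // j ≠ i}, A j) (X i) (Y i)) :
    ∃ f : E3 ≃ₜ E3, IsIsotopicToId f ∧ PLOn f Set.univ ∧ ∀ i, f '' X i = Y i := by
  classical
  have := Fintype.ofFinite ι
  suffices ∀ s : Finset ι, ∃ f : E3 ≃ₜ E3, IsIsotopicToId f ∧ PLOn f Set.univ ∧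
      (∀ i ∈ s, f '' X i = Y i) ∧ ∀ i ∉ s, Set.EqOn f id (A i) by
    obtain ⟨f, hf, hpl, hs, -⟩ := this Finset.univ
    exact ⟨f, hf, hpl, fun i => hs i (Finset.mem_univ i)⟩
  intro s
  induction s using Finset.induction_on with
  | empty =>
    exact ⟨_, IsIsotopicToId.refl, PLOn.of_affine (AffineMap.id ℝ E3) _, by simp,
      fun i _ x _ => rfl⟩
  | insert i s hi ih =>
    obtain ⟨f, hf, hpl, hs, hfix⟩ := ih
    obtain ⟨g, hg, hgpl, hgfix, hgX⟩ := h i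
    have hgA : ∀ j, j ≠ i → Set.EqOn g id (A j) := fun j hj x hx =>
      hgfix (Set.mem_iUnion.2 ⟨⟨j, hj⟩, hx⟩)
    refine ⟨f.trans g, hf.trans hg, hpl.trans hgpl, fun j hj => ?_, fun j hj x hx => ?_⟩
    · rw [image_trans]
      rcases Finset.mem_insert.1 hj with rfl | hjs
      · rw [Set.EqOn.image_eq_self ((hfix _ hi).mono (hX _)), hgX]
      · rw [hs j hjs]
        exact Set.EqOn.image_eq_self ((hgA j fun e => hi (e ▸ hjs)).mono (hY j))
    · rw [Finset.mem_insert, not_or] at hj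
      rw [Homeomorph.trans_apply, hfix j hj.2 hx]
      exact hgA j hj.1 hx

/-- The pair is straightened, each annulus is triangulated compatibly with the plane, and each
component is slid within its own annulus to a curve of the required kind. All moves are piecewise
linear at the end, so the curves remain polygons. -/
theorem exists_flatCurves {ι : Type*} [Finite ι] [Nonempty ι] {L K K' : ι → Set E3}
    (hLK : Isotopic L K) (hKK' : IsParallelCopy K K') {N : ι ⊕ ι → Set E3} (hN : IsPolygonalLink N)
    (hKN : PLIsotopic (Sum.elim K K') N) (hreg : HasRegularProjection (⋃ i, N i))
    (hfin : (overcrossings (⋃ i, N (Sum.inl i)) (⋃ j, N (Sum.inr j))).Finite) :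
    ∃ (E I C : ι → Finset (Finset ℕ)) (pos : ι → ℕ → E3),
      (∀ i, FlatCurve (E i) (I i) (C i) (pos i)) ∧
      Pairwise (Function.onFun Disjoint fun i => support (pos i) (E i)) ∧
      (Isotopic L fun i => support (pos i) (C i)) ∧
      (localMaxima (⋃ i, support (pos i) (I i)) ∩ {x | 0 < x 2}).encard ≤
        (overcrossings (⋃ i, N (Sum.inl i)) (⋃ j, N (Sum.inr j))).encard ∧
      ((overcrossings (⋃ i, N (Sum.inl i)) (⋃ j, N (Sum.inr j))).encard ≤ 1 →
        ∃ t : E3 →ₗ[ℝ] ℝ, Set.InjOn t ((⋃ i, support (pos i) (I i)) ∩ {x | 0 ≤ x 2})) := by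
  classical
  obtain ⟨h, hh, hhPL, hhN⟩ := hKN
  obtain ⟨-, -, A, hA, hAd⟩ := hKK'
  have hl : ∀ i, h '' K i = N (Sum.inl i) := fun i => hhN (Sum.inl i)
  have hr : ∀ i, h '' K' i = N (Sum.inr i) := fun i => hhN (Sum.inr i)
  set M := ⋃ i, N (Sum.inl i) with hM
  set M' := ⋃ j, N (Sum.inr j) with hM'
  have hMc : IsCompact M := isCompact_iUnion fun i => (hN.1 _).isCompact
  have hMc' : IsCompact M' := isCompact_iUnion fun i => (hN.1 _).isCompact
  have hdisj : Disjoint M M' := by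
    simp only [hM, hM', Set.disjoint_iUnion_left, Set.disjoint_iUnion_right]
    exact fun i j => hN.2 (by simp)
  rw [Set.iUnion_sum] at hreg
  choose S hS hSne using fun i => ((hA i).image hhPL).exists_segments
  have := Fintype.ofFinite ι
  have hS' : ∀ x, x ∈ M' ↔ ∃ q ∈ Finset.univ.biUnion S, x ∈ segment ℝ q.1 q.2 := by
    intro x
    simp only [hM', Set.mem_iUnion, ← hr, hS, Finset.mem_biUnion, Finset.mem_univ, true_and]
    exact ⟨fun ⟨i, q, hq, hx⟩ => ⟨q, ⟨i, hq⟩, hx⟩, fun ⟨q, ⟨i, hq⟩, hx⟩ => ⟨i, q, hq, hx⟩⟩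
  obtain ⟨g, hg, hgPL, hgpos, hmax, ht⟩ := exists_straightening hMc hMc' hdisj hreg hS' (by
      intro q hq
      obtain ⟨i, -, hq⟩ := Finset.mem_biUnion.1 hq
      exact hSne i q hq) (by
      obtain ⟨i⟩ := ‹Nonempty ι›
      obtain ⟨x, hx⟩ := (hN.1 (Sum.inr i)).nonempty
      obtain ⟨q, hq, -⟩ := (hS' x).1 (Set.mem_iUnion.2 ⟨i, hx⟩)
      exact ⟨q, hq⟩) hfin
  have hA' : ∀ i, IsPLAnnulus (g '' (h '' A i)) (g '' N (Sum.inl i)) (g '' N (Sum.inr i)) := fun i => by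
    rw [← hl, ← hr]
    exact ((hA i).image hhPL).image hgPL
  have hAd' : Pairwise (Function.onFun Disjoint fun i => g '' (h '' A i)) := fun i j hij =>
    (Set.disjoint_image_iff g.injective).2 ((Set.disjoint_image_iff h.injective).2 (hAd hij))
  choose T I O pos hT hinj hTA hI hO hsign using fun i => (hA' i).exists_complex
  have hflat := fun i => (hT i).exists_flat_curve (hinj i) (hsign i) (by
      intro x hx
      have hx : x ∈ ⋃ g ∈ O i, cell (pos i) g := hx
      rw [hO i] at hx
      obtain ⟨y, hy, rfl⟩ := hx
      exact hgpos y (Set.mem_iUnion.2 ⟨i, hy⟩))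
    (Z₀ := ⋃ j : {j // j ≠ i}, g '' (h '' A j)) (isCompact_iUnion fun j => (hA' j).isCompact) (by
      intro t ht
      rw [Set.disjoint_iUnion_left]
      exact fun j => (hAd' j.2).mono_right (hTA i t ht))
  choose C hCT hCreg hmove hedges using hflat
  have hsub : ∀ i, support (pos i) (faceEdges (T i)) ⊆ g '' (h '' A i) := by
    intro i
    refine Set.iUnion₂_subset fun e he => ?_
    obtain ⟨-, t, ht, het⟩ := mem_faceEdges.1 he
    exact (cell_mono _ het).trans (hTA i t ht)
  have hmono : ∀ {F G : Finset (Finset ℕ)} {p : ℕ → E3}, F ⊆ G → support p F ⊆ support p G :=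
    fun hFG => Set.biUnion_subset_biUnion_left hFG
  obtain ⟨φ, hφ, hφPL, hφI⟩ := exists_simultaneous
    (fun i => (hmono (hT i).inner_subset).trans (hsub i)) (fun i => (hmono (hCT i)).trans (hsub i))
    hmove
  have hIM : ⋃ i, support (pos i) (I i) = g '' M := by
    rw [hM, Set.image_iUnion]
    exact Set.iUnion_congr hI
  refine ⟨fun i => faceEdges (T i), I, C, pos, fun i => ⟨fun e he => (mem_faceEdges.1 he).1,
    (hinj i).faceEdges, (hT i).inner_subset, hCT i, (hT i).inner_regular, hCreg i, hedges i, ?_⟩,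
    fun i j hij => (hAd' hij).mono (hsub i) (hsub j), ?_, ?_, ?_⟩
  · rw [← hφI i, support, hI i]
    exact ((hN.1 _).image hgPL).image hφPL
  · refine hLK.trans ⟨_, (hh.trans hg).trans hφ, fun i => ?_⟩
    change _ = support (pos i) (C i)
    rw [← hφI i, support, hI i, ← hl i, image_trans, image_trans]
  · rw [hIM]; exact hmax
  · rw [hIM]; exact ht

end LinkTheory

namespace LinkTheory

/-! ### Removing vertices of a polygon -/

/-- The edges of `C` form a simple closed polygon. -/
structure SimpleCurve (C : Finset (Finset ℕ)) (pos : ℕ → E3) : Prop where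
  card_edge : ∀ g ∈ C, g.card = 2
  geomInj : GeomInj C pos
  regular : TwoRegular C
  conn : IsPreconnected (support pos C)

theorem FlatCurve.simpleCurve {E I C : Finset (Finset ℕ)} {pos : ℕ → E3}
    (h : FlatCurve E I C pos) : SimpleCurve C pos :=
  ⟨fun g hg => h.card_edge g (h.curve_subset hg), h.geomInj_curve, h.curve_regular,
    h.isPreconnected⟩

theorem Bary.eq_of_pair {pos : ℕ → E3} {a b : ℕ} (hab : pos a ≠ pos b) {w w' : ℕ →₀ ℝ}
    (hw : Bary {a, b} w) (hw' : Bary {a, b} w') (he : bpt pos w = bpt pos w') : w = w' := by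
  have hne : a ≠ b := fun h => hab (h ▸ rfl)
  have h1 := hw.sum_eq
  have h2 := hw'.sum_eq
  rw [hw.bpt_eq_sum, hw'.bpt_eq_sum] at he
  rw [Finset.sum_pair hne] at h1 h2 he
  rw [Finset.sum_pair hne] at he
  have h3 : (w b - w' b) • (pos b - pos a) = 0 := by
    rw [show w a = 1 - w b by linarith, show w' a = 1 - w' b by linarith] at he
    have := sub_eq_zero.2 he
    rw [← this]
    module
  have h4 : w b = w' b :=
    sub_eq_zero.1 ((smul_eq_zero.1 h3).resolve_right (sub_ne_zero.2 hab.symm))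
  ext v
  by_cases hva : v = a
  · rw [hva]; linarith
  by_cases hvb : v = b
  · rw [hvb, h4]
  rw [(bary_iff.1 hw).2.1 v (by simp [hva, hvb]), (bary_iff.1 hw').2.1 v (by simp [hva, hvb])]

theorem segment_eq_union {a b c : E3} {k : ℝ} (h0 : 0 ≤ k) (h1 : k ≤ 1)
    (hc : k • (b - a) = c - a) : segment ℝ a b = segment ℝ a c ∪ segment ℝ c b := by
  have e0 : AffineMap.lineMap a b (0 : ℝ) = a := AffineMap.lineMap_apply_zero _ _
  have e1 : AffineMap.lineMap a b (1 : ℝ) = b := AffineMap.lineMap_apply_one _ _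
  have ek : AffineMap.lineMap a b k = c := by
    rw [AffineMap.lineMap_apply_module', hc, sub_add_cancel]
  have hs : ∀ x y : ℝ, x ≤ y → segment ℝ (AffineMap.lineMap a b x : E3) (AffineMap.lineMap a b y) =
      AffineMap.lineMap a b '' Set.Icc x y := fun x y hxy => by
    rw [← segment_eq_Icc hxy, image_segment]
  have h01 := hs 0 1 zero_le_one
  have h0k := hs 0 k h0
  have hk1 := hs k 1 h1
  rw [e0, e1] at h01
  rw [e0, ek] at h0k
  rw [ek, e1] at hk1
  rw [h01, h0k, hk1, ← Set.image_union, Set.Icc_union_Icc_eq_Icc h0 h1]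

namespace SimpleCurve

variable {C : Finset (Finset ℕ)} {pos : ℕ → E3} {a b c : ℕ}

/-- This reverses the slide of `ab` across the triangle with corner `c`. If the three vertices are
collinear there is no triangle, but then the support does not change at all. -/
theorem remove (h : SimpleCurve C pos) (hab : a ≠ b) (hac : a ≠ c) (hbc : b ≠ c)
    (h1 : {a, c} ∈ C) (h2 : {c, b} ∈ C) (h3 : {a, b} ∉ C)
    (hmeet : ∀ g ∈ C, c ∉ g →
      cell pos g ∩ tri (pos a) (pos b) (pos c) ⊆ cell pos (g ∩ {a, b})) :
    ∃ C', SimpleCurve C' pos ∧ C'.card < C.card ∧ (∀ g, g ∈ C' ↔ g = {a, b} ∨ g ∈ C ∧ c ∉ g) ∧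
      ∀ Z₀, IsCompact Z₀ → Disjoint Z₀ (tri (pos a) (pos b) (pos c)) →
        Moves Z₀ (support pos C) (support pos C') := by
  obtain ⟨hreg, -, -, -, habC', hcC', hCeq⟩ := h.regular.remove hab hac hbc h1 h2 h3 h.card_edge
  set C' := insert {a, b} ((C.erase {a, c}).erase {c, b}) with hC'
  have hmem : ∀ g, g ∈ C' ↔ g = {a, b} ∨ g ∈ C ∧ c ∉ g := by
    intro g
    rw [hC', Finset.mem_insert, Finset.mem_erase, Finset.mem_erase]
    refine or_congr_right ⟨fun hg => ⟨hg.2.2, fun hc => hcC' (mem_verts.2 ⟨g, ?_, hc⟩)⟩,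
      fun hg => ⟨fun e => hg.2 (e ▸ by simp), fun e => hg.2 (e ▸ by simp), hg.1⟩⟩
    rw [hC', Finset.mem_insert, Finset.mem_erase, Finset.mem_erase]
    exact Or.inr hg
  have hposab : pos a ≠ pos b := fun he =>
    hab (h.geomInj.injOn (mem_verts.2 ⟨_, h1, by simp⟩) (mem_verts.2 ⟨_, h2, by simp⟩) he)
  have hcard' : ∀ g ∈ C', g.card = 2 := by
    intro g hg
    rcases (hmem g).1 hg with rfl | hg
    · exact Finset.card_pair hab
    · exact h.card_edge g hg.1
  have hsub : segment ℝ (pos a) (pos b) ⊆ tri (pos a) (pos b) (pos c) := by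
    rw [← convexHull_pair, tri]
    exact convexHull_mono (by grind)
  have hnew : ∀ g ∈ C, c ∉ g → ∀ w w', Bary {a, b} w → Bary g w' → bpt pos w = bpt pos w' →
      w = w' := by
    intro g hg hcg w w' hw hw' he
    have hx : bpt pos w ∈ cell pos (g ∩ {a, b}) :=
      hmeet g hg hcg ⟨⟨w', hw', he.symm⟩, hsub (cell_pair pos a b ▸ ⟨w, hw, rfl⟩)⟩
    obtain ⟨w₁, hw₁, he₁⟩ := hx
    rw [← Bary.eq_of_pair hposab (hw₁.mono Finset.inter_subset_right) hw he₁]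
    exact h.geomInj g hg g hg _ _ (hw₁.mono Finset.inter_subset_left) hw' (he₁.trans he)
  have hinj' : GeomInj C' pos := by
    intro s hs t ht w w' hw hw' he
    rcases (hmem s).1 hs with hs | hs <;> rcases (hmem t).1 ht with ht | ht
    · subst hs; subst ht
      exact Bary.eq_of_pair hposab hw hw' he
    · subst hs
      exact hnew t ht.1 ht.2 w w' hw hw' he
    · subst ht
      exact (hnew s hs.1 hs.2 w' w hw' hw he.symm).symm
    · exact h.geomInj s hs.1 t ht.1 w w' hw hw' he
  have hmoves : ∀ Z₀, IsCompact Z₀ → Disjoint Z₀ (tri (pos a) (pos b) (pos c)) →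
        Moves Z₀ (support pos C) (support pos C') := by
    intro Z₀ hZ₀ hd
    by_cases hind : LinearIndependent ℝ ![pos b - pos a, pos c - pos a]
    · have := moves_of_tri hcard' habC' hind (fun g hg hne => by
        have hg' := ((hmem g).1 hg).resolve_left hne
        exact hmeet g hg'.1 hg'.2) hZ₀ hd
      rw [hCeq]
      exact this.symm
    -- Here `c` lies on the line `ab`. If it were outside the segment, one of the edges at `c` would
    -- contain the far end of the other.
    · rw [LinearIndependent.pair_iff' (sub_ne_zero.2 hposab.symm)] at hind
      push Not at hind
      obtain ⟨k, hk⟩ := hind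
      have hk0 : 0 ≤ k := by
        by_contra hneg
        push Not at hneg
        have hxa : pos a ∈ cell pos {c, b} := by
          rw [cell_pair]
          refine ⟨1 / (1 - k), -k / (1 - k), by apply div_nonneg <;> linarith,
            by apply div_nonneg <;> linarith, ?_, ?_⟩
          · have : 1 - k ≠ 0 := by linarith
            field_simp
            ring
          · rw [show pos c = pos a + k • (pos b - pos a) by rw [hk]; abel]
            have : 1 - k ≠ 0 := by linarith
            match_scalars <;> field_simp <;> ring
        have := (h.geomInj.inter h1 h2 (s' := {a}) (by simp) subset_rfl).subset
          ⟨mem_cell_of_mem pos (by simp), hxa⟩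
        rw [show ({a} ∩ {c, b} : Finset ℕ) = ∅ by ext; simp; grind, cell_empty] at this
        exact this
      have hk1 : k ≤ 1 := by
        by_contra hneg
        push Not at hneg
        have hxb : pos b ∈ cell pos {a, c} := by
          rw [cell_pair]
          refine ⟨(k - 1) / k, 1 / k, by apply div_nonneg <;> linarith,
            by apply div_nonneg <;> linarith, ?_, ?_⟩
          · have : k ≠ 0 := by linarith
            field_simp
            ring
          · rw [show pos c = pos a + k • (pos b - pos a) by rw [hk]; abel]
            have : k ≠ 0 := by linarith
            match_scalars <;> field_simp
            ring
        have := (h.geomInj.inter h2 h1 (s' := {b}) (by simp) subset_rfl).subset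
          ⟨mem_cell_of_mem pos (by simp), hxb⟩
        rw [show ({b} ∩ {a, c} : Finset ℕ) = ∅ by ext; simp; grind, cell_empty] at this
        exact this
      have hseg := segment_eq_union hk0 hk1 hk
      have : support pos C = support pos C' := by
        conv_lhs => rw [hCeq]
        conv_rhs => rw [← Finset.insert_erase habC']
        rw [support, support, Finset.set_biUnion_insert, Finset.set_biUnion_insert,
          Finset.set_biUnion_insert, cell_pair, cell_pair, cell_pair, hseg, Set.union_assoc]
      rw [this]
      exact Moves.refl _ _
  refine ⟨C', ⟨hcard', hinj', hreg, ?_⟩, ?_, hmem, hmoves⟩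
  · obtain ⟨f, -, -, -, himg⟩ := hmoves ∅ isCompact_empty (Set.empty_disjoint _)
    rw [← himg]
    exact h.conn.image _ f.continuous.continuousOn
  · have hne : ({c, b} : Finset ℕ) ∈ C.erase {a, c} := by
      refine Finset.mem_erase.2 ⟨fun e => ?_, h2⟩
      rw [pair_eq_pair_iff] at e
      grind
    have e1 := Finset.card_erase_add_one hne
    have e2 := Finset.card_erase_add_one h1
    have e3 := Finset.card_insert_le ({a, b} : Finset ℕ) ((C.erase {a, c}).erase {c, b})
    rw [← hC'] at e3
    omega

/-- A polygon with three edges forming a triangle has no other edges. -/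
theorem subset_of_triangle (h : SimpleCurve C pos) (hab : a ≠ b) (hac : a ≠ c) (hbc : b ≠ c)
    (h1 : {a, c} ∈ C) (h2 : {c, b} ∈ C) (h3 : {a, b} ∈ C) : ∀ g ∈ C, g ⊆ {a, b, c} := by
  have hnbr : ∀ x y z : ℕ, y ≠ z → {x, y} ∈ C → {x, z} ∈ C → ∀ w, {x, w} ∈ C → w = y ∨ w = z := by
    intro x y z hyz hy hz w hw
    obtain ⟨p, q, hpq, hC⟩ := h.regular x (mem_verts.2 ⟨_, hy, by simp⟩)
    have := (hC y).1 hy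
    have := (hC z).1 hz
    have := (hC w).1 hw
    grind
  have hverts : ({a, b, c} : Finset ℕ) = verts C := by
    by_contra hne
    obtain ⟨v, hv, w, -, hw, hvw⟩ := h.geomInj.exists_crossing h.conn h.card_edge
      (S := {a, b, c}) (by
        simp only [Finset.insert_subset_iff, Finset.singleton_subset_iff]
        exact ⟨mem_verts.2 ⟨_, h1, by simp⟩, mem_verts.2 ⟨_, h2, by simp⟩,
          mem_verts.2 ⟨_, h1, by simp⟩⟩) (by simp) hne
    have h1' : {c, a} ∈ C := by rwa [Finset.pair_comm]
    have h2' : {b, c} ∈ C := by rwa [Finset.pair_comm]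
    have h3' : {b, a} ∈ C := by rwa [Finset.pair_comm]
    simp only [Finset.mem_insert, Finset.mem_singleton] at hv hw
    rcases hv with hv | hv | hv
    · subst hv
      have := hnbr v b c hbc h3 h1 w hvw
      grind
    · subst hv
      have := hnbr v a c hac h3' h2' w hvw
      grind
    · subst hv
      have := hnbr v a b hab h1' h2 w hvw
      grind
  intro g hg v hv
  rw [hverts]
  exact mem_verts.2 ⟨g, hg, hv⟩

end SimpleCurve
end LinkTheory

/-! ### Reducing a polygon with one peak to a triangle -/

namespace LinkTheory

namespace SimpleCurve

variable {C : Finset (Finset ℕ)} {pos : ℕ → E3} {a b c : ℕ}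

/-- The polygon can be moved to a triangle, without moving anything below the plane `z = 0`. -/
def MovesToTriangle (C : Finset (Finset ℕ)) (pos : ℕ → E3) : Prop :=
  ∃ C', SimpleCurve C' pos ∧ (∃ a b c, ∀ g ∈ C', g ⊆ {a, b, c}) ∧
    (∀ v ∈ verts C', 0 ≤ pos v 2) ∧
    ∀ Z₀, IsCompact Z₀ → (∀ x ∈ Z₀, x 2 < 0) → Moves Z₀ (support pos C) (support pos C')

theorem disjoint_tri {a b c : E3} (ha : 0 ≤ a 2) (hb : 0 ≤ b 2) (hc : 0 ≤ c 2) {Z₀ : Set E3}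
    (hZ : ∀ x ∈ Z₀, x 2 < 0) : Disjoint Z₀ (tri a b c) := by
  refine Set.disjoint_left.2 fun x hx hxt => ?_
  have hcv : Convex ℝ {x : E3 | 0 ≤ x 2} := by
    have := convex_halfSpace_ge (𝕜 := ℝ) (f := fun x : E3 => x 2)
      ⟨fun _ _ => rfl, fun _ _ => rfl⟩ 0
    exact this
  have : x ∈ {x : E3 | 0 ≤ x 2} := by
    refine convexHull_min ?_ hcv hxt
    rintro y (rfl | rfl | rfl) <;> assumption
  exact absurd (hZ x hx) (not_lt.2 this)

/-- A neighbour other than a given one. -/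
theorem exists_other (h : SimpleCurve C pos) (hac : {a, c} ∈ C) :
    ∃ b, a ≠ b ∧ b ≠ c ∧ a ≠ c ∧ {c, b} ∈ C ∧ ∀ w, {c, w} ∈ C → w = a ∨ w = b := by
  obtain ⟨x, y, hxy, hC⟩ := h.regular c (mem_verts.2 ⟨_, hac, by simp⟩)
  have hne : ∀ w, {c, w} ∈ C → w ≠ c := fun w hw e => by
    have := h.card_edge _ hw
    simp [e] at this
  have hca : {c, a} ∈ C := by rwa [Finset.pair_comm]
  rcases (hC a).1 hca with rfl | rfl
  · have := (hC y).2 (Or.inr rfl)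
    exact ⟨y, hxy, hne y this, hne a hca, this, fun w hw => (hC w).1 hw⟩
  · have := (hC x).2 (Or.inl rfl)
    exact ⟨x, hxy.symm, hne x this, hne a hca, this, fun w hw => ((hC w).1 hw).symm⟩

theorem movesToTriangle_of_edge (h : SimpleCurve C pos) (hnn : ∀ v ∈ verts C, 0 ≤ pos v 2)
    (hab : a ≠ b) (hac : a ≠ c) (hbc : b ≠ c)
    (h1 : {a, c} ∈ C) (h2 : {c, b} ∈ C) (h3 : {a, b} ∈ C) : MovesToTriangle C pos :=
  ⟨C, h, ⟨a, b, c, h.subset_of_triangle hab hac hbc h1 h2 h3⟩, hnn, fun _ _ _ => Moves.refl _ _⟩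

theorem movesToTriangle_of_remove {C' : Finset (Finset ℕ)} (hnn : ∀ v ∈ verts C, 0 ≤ pos v 2)
    (h1 : {a, c} ∈ C) (h2 : {c, b} ∈ C)
    (hmoves : ∀ Z₀, IsCompact Z₀ → Disjoint Z₀ (tri (pos a) (pos b) (pos c)) →
        Moves Z₀ (support pos C) (support pos C'))
    (h' : MovesToTriangle C' pos) : MovesToTriangle C pos := by
  obtain ⟨D, hD, htri, hDnn, hDm⟩ := h'
  refine ⟨D, hD, htri, hDnn, fun Z₀ hZ₀ hZ => (hmoves Z₀ hZ₀ ?_).trans (hDm Z₀ hZ₀ hZ)⟩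
  exact disjoint_tri (hnn a (mem_verts.2 ⟨_, h1, by simp⟩)) (hnn b (mem_verts.2 ⟨_, h2, by simp⟩))
    (hnn c (mem_verts.2 ⟨_, h1, by simp⟩)) hZ

theorem verts_remove {C' : Finset (Finset ℕ)} (h1 : {a, c} ∈ C) (h2 : {c, b} ∈ C)
    (hmem : ∀ g, g ∈ C' ↔ g = {a, b} ∨ g ∈ C ∧ c ∉ g) : verts C' ⊆ verts C := by
  intro v hv
  obtain ⟨g, hg, hvg⟩ := mem_verts.1 hv
  rcases (hmem g).1 hg with rfl | hg
  · rcases Finset.mem_insert.1 hvg with rfl | hvg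
    · exact mem_verts.2 ⟨_, h1, by simp⟩
    · rw [Finset.mem_singleton.1 hvg]
      exact mem_verts.2 ⟨_, h2, by simp⟩
  · exact mem_verts.2 ⟨g, hg.1, hvg⟩

theorem mem_verts_remove {C' : Finset (Finset ℕ)} (h : SimpleCurve C pos)
    (hc : ∀ w, {c, w} ∈ C → w = a ∨ w = b)
    (hmem : ∀ g, g ∈ C' ↔ g = {a, b} ∨ g ∈ C ∧ c ∉ g) {v : ℕ} (hv : v ∈ verts C) (hvc : v ≠ c) :
    v ∈ verts C' := by
  obtain ⟨g, hg, hvg⟩ := mem_verts.1 hv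
  by_cases hcg : c ∈ g
  · obtain rfl := eq_pair_of_mem hvc.symm (h.card_edge g hg) hcg hvg
    exact mem_verts.2 ⟨{a, b}, (hmem _).2 (Or.inl rfl), by simpa using hc v hg⟩
  · exact mem_verts.2 ⟨g, (hmem _).2 (Or.inr ⟨hg, hcg⟩), hvg⟩

/-- Points at height zero of a cell not below the plane `z = 0`. -/
theorem _root_.LinkTheory.Bary.support_flat {g : Finset ℕ} {w : ℕ →₀ ℝ} (hw : Bary g w)
    (hg : ∀ v ∈ g, 0 ≤ pos v 2) (h0 : (bpt pos w) 2 = 0) : ∀ v ∈ w.support, pos v 2 = 0 := by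
  intro v hv
  rw [bpt_apply, hw.bpt_eq_sum, Finset.sum_eq_zero_iff_of_nonneg fun v hv =>
    smul_nonneg (hw.1 v) (hg v hv)] at h0
  have := h0 v (hw.2.1 hv)
  exact (smul_eq_zero.1 this).resolve_left (Finsupp.mem_support_iff.1 hv)

theorem bpt_flat {g : Finset ℕ} {w : ℕ →₀ ℝ} (hw : Bary g w)
    (hg : ∀ v ∈ g, pos v 2 = 0) : (bpt pos w) 2 = 0 := by
  rw [bpt_apply, hw.bpt_eq_sum]
  exact Finset.sum_eq_zero fun v hv => by rw [hg v hv, smul_zero]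

/-- A polygon in the plane `z = 0`, except for one vertex. -/
theorem movesToTriangle_of_one (h : SimpleCurve C pos) (hnn : ∀ v ∈ verts C, 0 ≤ pos v 2) {v : ℕ}
    (hv : v ∈ verts C) (hpos : 0 < pos v 2) (hflat : ∀ u ∈ verts C, u ≠ v → pos u 2 = 0) :
    MovesToTriangle C pos := by
  induction hn : C.card using Nat.strong_induction_on generalizing C with
  | _ n ih =>
  obtain ⟨u, y, -, hvC⟩ := h.regular v hv
  have hvu : {v, u} ∈ C := (hvC u).2 (Or.inl rfl)
  obtain ⟨w, hvw, hwu, hvu', huw, hnbr⟩ := h.exists_other hvu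
  have hu := hflat u (mem_verts.2 ⟨_, hvu, by simp⟩) hvu'.symm
  have hw := hflat w (mem_verts.2 ⟨_, huw, by simp⟩) hvw.symm
  by_cases hvw' : {v, w} ∈ C
  · exact h.movesToTriangle_of_edge hnn hvw hvu' hwu hvu huw hvw'
  -- At height zero the triangle is just the edge `uw`, which meets other edges properly. Above the
  -- plane there is only the other edge `vx` at `v`. If it met the triangle outside `v`, projecting
  -- from `v` would put `x` on `uw`, forcing `x` to be `w` or `u`, and both are excluded.
  obtain ⟨C', hC', hcard, hmem, hmoves⟩ := h.remove hvw hvu' hwu hvu huw hvw' (by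
    rintro g hg hug _ ⟨⟨q, hq, rfl⟩, hx⟩
    rw [← cell_triple] at hx
    obtain ⟨r, hr, he⟩ := hx
    have hgnn : ∀ x ∈ g, 0 ≤ pos x 2 := fun x hx => hnn x (mem_verts.2 ⟨g, hg, hx⟩)
    have hslice : ∀ {r : ℕ →₀ ℝ}, Bary {w, u} r → bpt pos r ∈ cell pos g →
        bpt pos r ∈ cell pos (g ∩ {v, w}) := by
      intro r hr hrg
      have := (h.geomInj.inter hg huw subset_rfl subset_rfl).subset
        ⟨hrg, ⟨r, hr.mono (by grind), rfl⟩⟩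
      refine cell_mono pos ?_ this
      grind
    have hz : (bpt pos r) 2 = r v * pos v 2 := by
      rw [bpt_apply, hr.bpt_eq_sum, Finset.sum_insert (by simp [hvw, hvu']),
        Finset.sum_pair hwu, hu, hw]
      simp
    by_cases hvg : v ∈ g
    · obtain ⟨x, rfl⟩ : ∃ x, g = {v, x} := by
        obtain ⟨p, q, hpq, rfl⟩ := Finset.card_eq_two.1 (h.card_edge g hg)
        rcases Finset.mem_insert.1 hvg with rfl | hvq
        · exact ⟨q, rfl⟩
        · rw [Finset.mem_singleton.1 hvq]
          exact ⟨p, Finset.pair_comm _ _⟩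
      have hxv : v ≠ x := fun e => by
        have := h.card_edge _ hg
        simp [e] at this
      have hx0 := hflat x (mem_verts.2 ⟨_, hg, by simp⟩) hxv.symm
      have hz' : (bpt pos q) 2 = q v * pos v 2 := by
        rw [bpt_apply, hq.bpt_eq_sum, Finset.sum_pair hxv, hx0]
        simp
      have hqr : q v = r v := by
        have : q v * pos v 2 = r v * pos v 2 := by rw [← hz, ← hz', he]
        exact mul_right_cancel₀ hpos.ne' this
      have hq1 := hq.sum_eq
      have hr1 := hr.sum_eq
      rw [Finset.sum_pair hxv] at hq1
      rw [Finset.sum_insert (by simp [hvw, hvu']), Finset.sum_pair hwu] at hr1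
      rw [hr.bpt_eq_sum, hq.bpt_eq_sum, Finset.sum_insert (by simp [hvw, hvu']),
        Finset.sum_pair hwu, Finset.sum_pair hxv, hqr] at he
      have he' := add_left_cancel he
      rcases (hq.1 x).eq_or_lt with h0 | h0
      · have : bpt pos q = pos v := by
          rw [hq.bpt_eq_sum, Finset.sum_pair hxv, ← h0, show q v = 1 by linarith]
          simp
        rw [this]
        exact mem_cell_of_mem pos (by simp)
      · exfalso
        have hxm : pos x ∈ cell pos {w, u} := by
          rw [cell_pair]
          refine ⟨r w / q x, r u / q x, div_nonneg (hr.1 w) h0.le, div_nonneg (hr.1 u) h0.le,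
            ?_, ?_⟩
          · field_simp
            linarith
          · rw [div_eq_inv_mul, div_eq_inv_mul, mul_smul, mul_smul, ← smul_add, he', smul_smul,
              inv_mul_cancel₀ h0.ne', one_smul]
        have := (h.geomInj.inter hg huw (s' := {x}) (t' := {w, u}) (by simp) (by grind)).subset
          ⟨mem_cell_of_mem pos (by simp), hxm⟩
        obtain ⟨o, ho, -⟩ := this
        obtain ⟨o', ho'⟩ := ho.nonempty
        have : x = w ∨ x = u := by grind
        rcases this with rfl | rfl
        · exact hvw' hg
        · exact hug (by simp)
    · have hz' := bpt_flat hq fun x hx => hflat x (mem_verts.2 ⟨g, hg, hx⟩) fun e => hvg (e ▸ hx)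
      rw [← he] at hz' ⊢
      refine hslice ?_ ⟨q, hq, he.symm⟩
      rw [hz'] at hz
      have h0 := (mul_eq_zero.1 hz.symm).resolve_right hpos.ne'
      refine bary_iff.2 ⟨hr.1, fun x hx => ?_, hr.2.2⟩
      by_cases hxv : x = v
      · rw [hxv, h0]
      · exact (bary_iff.1 hr).2.1 x (by grind))
  have hverts := verts_remove hvu huw hmem
  exact movesToTriangle_of_remove hnn hvu huw hmoves (ih _ (hn ▸ hcard) hC'
    (fun x hx => hnn x (hverts hx)) (h.mem_verts_remove hnbr hmem hv hvu')
    (fun x hx => hflat x (hverts hx)) rfl)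

end SimpleCurve
end LinkTheory

namespace LinkTheory

/-- The path is connected and contains all three corners, so its image is an interval containing the
values at the corners. -/
theorem exists_mem_path (t : E3 →ₗ[ℝ] ℝ) {a b c x : E3} (hx : x ∈ tri a b c) :
    ∃ q ∈ segment ℝ a c ∪ segment ℝ c b, t q = t x := by
  have hpre : IsPreconnected (segment ℝ a c ∪ segment ℝ c b) :=
    (convex_segment a c).isPreconnected.union c (right_mem_segment ℝ a c)
      (left_mem_segment ℝ c b) (convex_segment c b).isPreconnected
  have hcv : Convex ℝ (t '' (segment ℝ a c ∪ segment ℝ c b)) :=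
    Real.convex_iff_isPreconnected.2
      (hpre.image _ t.continuous_of_finiteDimensional.continuousOn)
  have hsub : tri a b c ⊆ t ⁻¹' (t '' (segment ℝ a c ∪ segment ℝ c b)) := by
    refine convexHull_min ?_ (hcv.linear_preimage t)
    rintro y (rfl | rfl | rfl)
    · exact ⟨_, Or.inl (left_mem_segment ℝ _ _), rfl⟩
    · exact ⟨_, Or.inr (right_mem_segment ℝ _ _), rfl⟩
    · exact ⟨_, Or.inl (right_mem_segment ℝ _ _), rfl⟩
  exact hsub hx

theorem injOn_segment (t : E3 →ₗ[ℝ] ℝ) {a b : E3} (hab : t a ≠ t b) :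
    Set.InjOn t (segment ℝ a b) := by
  intro x hx y hy he
  rw [segment_eq_image'] at hx hy
  obtain ⟨r, -, rfl⟩ := hx
  obtain ⟨s, -, rfl⟩ := hy
  simp only [map_add, map_smul, map_sub, smul_eq_mul] at he
  have h1 : r = s := mul_right_cancel₀ (sub_ne_zero.2 hab.symm) (add_left_cancel he)
  rw [h1]

namespace SimpleCurve

variable {C : Finset (Finset ℕ)} {pos : ℕ → E3} {a b c : ℕ}

/-- The union of the edges with a vertex above the plane `z = 0`. -/
def upper (C : Finset (Finset ℕ)) (pos : ℕ → E3) : Set E3 :=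
  {x | ∃ g ∈ C, (∃ v ∈ g, 0 < pos v 2) ∧ x ∈ cell pos g}

/-- A polygon the upper part of which has one local maximum and is mapped injectively by a linear
form. -/
theorem movesToTriangle (h : SimpleCurve C pos) (hnn : ∀ v ∈ verts C, 0 ≤ pos v 2) {v : ℕ}
    (hv : v ∈ verts C) (hpos : 0 < pos v 2)
    (hup : ∀ u ∈ verts C, 0 < pos u 2 → u ≠ v → ∃ w, {w, u} ∈ C ∧ pos u 2 < pos w 2)
    (t : E3 →ₗ[ℝ] ℝ) (ht : Set.InjOn t (upper C pos)) : MovesToTriangle C pos := by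
  induction hn : C.card using Nat.strong_induction_on generalizing C with
  | _ n ih =>
  by_cases hone : ∀ u ∈ verts C, u ≠ v → pos u 2 = 0
  · exact h.movesToTriangle_of_one hnn hv hpos hone
  push Not at hone
  obtain ⟨u₀, hu₀, hu₀v, hu₀z⟩ := hone
  -- The lowest vertex above the plane other than `v` is removed. It is nobody's higher neighbour
  -- among the remaining ones, so the hypothesis `hup` survives.
  obtain ⟨u, hu, hmin⟩ := ((verts C).filter fun u => u ≠ v ∧ 0 < pos u 2).exists_min_image
    (fun u => pos u 2)
    ⟨u₀, Finset.mem_filter.2 ⟨hu₀, hu₀v, (hnn u₀ hu₀).lt_of_ne' hu₀z⟩⟩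
  obtain ⟨huC, huv, huz⟩ := Finset.mem_filter.1 hu
  obtain ⟨a, hau, haz⟩ := hup u huC huz huv
  obtain ⟨b, hab, hbu, hau', hub, hnbr⟩ := h.exists_other hau
  by_cases hab' : {a, b} ∈ C
  · exact h.movesToTriangle_of_edge hnn hab hau' hbu hau hub hab'
  have haC : a ∈ verts C := mem_verts.2 ⟨_, hau, by simp⟩
  have hbC : b ∈ verts C := mem_verts.2 ⟨_, hub, by simp⟩
  have hau_up : cell pos {a, u} ⊆ upper C pos := fun x hx => ⟨_, hau, ⟨u, by simp, huz⟩, hx⟩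
  have hub_up : cell pos {u, b} ⊆ upper C pos := fun x hx => ⟨_, hub, ⟨u, by simp, huz⟩, hx⟩
  -- A value of `t` on the triangle is also taken on the two edges at `u`. These belong to the upper
  -- part, where `t` is injective, so a point `p` of the upper part with that value lies on one of
  -- these edges.
  have key : ∀ g ∈ C, u ∉ g → (∃ v ∈ g, 0 < pos v 2) → ∀ p ∈ cell pos g,
      ∀ x ∈ tri (pos a) (pos b) (pos u), t x = t p → p ∈ cell pos (g ∩ {a, b}) := by
    intro g hg hug hgup p hp x hx hxp
    obtain ⟨q, hq, hqx⟩ := exists_mem_path t hx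
    rw [← cell_pair, ← cell_pair] at hq
    have hpq : q = p := ht (hq.elim (fun h => hau_up h) (fun h => hub_up h)) ⟨g, hg, hgup, hp⟩
      (hqx.trans hxp)
    subst hpq
    rcases hq with hq | hq
    · exact cell_mono pos (by grind) ((h.geomInj.inter hg hau subset_rfl subset_rfl).subset
        ⟨hp, hq⟩)
    · exact cell_mono pos (by grind) ((h.geomInj.inter hg hub subset_rfl subset_rfl).subset
        ⟨hp, hq⟩)
  obtain ⟨C', hC', hcard, hmem, hmoves⟩ := h.remove hab hau' hbu hau hub hab' (by
    rintro g hg hug x ⟨hxg, hx⟩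
    by_cases hgup : ∃ v ∈ g, 0 < pos v 2
    · exact key g hg hug hgup x hxg x hx rfl
    · push Not at hgup
      -- For an edge in the plane, only height zero matters. Since `a` and `u` are above the plane,
      -- the triangle has at most the corner `b` there.
      have hx0 : x 2 = 0 := by
        obtain ⟨w, hw, rfl⟩ := hxg
        exact bpt_flat hw fun y hy =>
          le_antisymm (hgup y hy) (hnn y (mem_verts.2 ⟨g, hg, hy⟩))
      rw [← cell_triple] at hx
      obtain ⟨w, hw, rfl⟩ := hx
      have hsupp := hw.support_flat (pos := pos) (by
        simp only [Finset.mem_insert, Finset.mem_singleton]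
        rintro y (rfl | rfl | rfl)
        exacts [hnn _ haC, hnn _ hbC, huz.le]) hx0
      have hwb : Bary {b} w := by
        refine ⟨hw.1, fun y hy => ?_, hw.2.2⟩
        have h1 := hw.2.1 hy
        have h2 := hsupp y hy
        simp only [Finset.mem_insert, Finset.mem_singleton] at h1
        rcases h1 with rfl | rfl | rfl
        · linarith
        · simp
        · linarith
      exact cell_mono pos (by grind) ((h.geomInj.inter hg hub (s' := g) (t' := {b}) subset_rfl
        (by simp)).subset ⟨hxg, ⟨w, hwb, rfl⟩⟩))
  have hverts := verts_remove hau hub hmem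
  have hposab : t (pos a) ≠ t (pos b) := fun e => hab <| h.geomInj.injOn haC hbC <|
    ht (hau_up (mem_cell_of_mem pos (by simp))) (hub_up (mem_cell_of_mem pos (by simp))) e
  have hsub : cell pos {a, b} ⊆ tri (pos a) (pos b) (pos u) := by
    rw [← cell_triple]
    exact cell_mono pos (by grind)
  have hinj_ab : Set.InjOn t (cell pos {a, b}) := by
    rw [cell_pair]
    exact injOn_segment t hposab
  -- The new edge keeps `t` injective: `t` is injective on it because its ends have different
  -- values, and a common value with another upper edge puts the point of that edge on the new edge
  -- too.
  have hnew : ∀ g ∈ C, u ∉ g → (∃ v ∈ g, 0 < pos v 2) → ∀ p ∈ cell pos g,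
      ∀ x ∈ cell pos {a, b}, t x = t p → x = p := fun g hg hug hgup p hp x hx he =>
    hinj_ab hx (cell_mono pos Finset.inter_subset_right (key g hg hug hgup p hp x (hsub hx) he)) he
  refine movesToTriangle_of_remove hnn hau hub hmoves (ih _ (hn ▸ hcard) hC'
    (fun x hx => hnn x (hverts hx)) (h.mem_verts_remove hnbr hmem hv huv.symm) ?_ ?_ rfl)
  · intro x hx hxz hxv
    have hxC := hverts hx
    obtain ⟨y, hyx, hyz⟩ := hup x hxC hxz hxv
    have hxu : u ≠ x := by
      rintro rfl
      obtain ⟨g, hg, hug⟩ := mem_verts.1 hx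
      rcases (hmem g).1 hg with rfl | hg
      · grind
      · exact hg.2 hug
    have hle := hmin x (Finset.mem_filter.2 ⟨hxC, hxv, hxz⟩)
    have hyu : u ≠ y := by
      rintro rfl
      linarith
    exact ⟨y, (hmem _).2 (Or.inr ⟨hyx, by simp [hxu, hyu]⟩), hyz⟩
  · rintro x ⟨g, hg, hgup, hxg⟩ y ⟨g', hg', hgup', hyg⟩ he
    rcases (hmem g).1 hg with hg | hg <;> rcases (hmem g').1 hg' with hg' | hg'
    · subst hg; subst hg'
      exact hinj_ab hxg hyg he
    · subst hg
      exact hnew g' hg'.1 hg'.2 hgup' y hyg x hxg he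
    · subst hg'
      exact (hnew g hg.1 hg.2 hgup x hxg y hyg he.symm).symm
    · exact ht ⟨g, hg.1, hgup, hxg⟩ ⟨g', hg'.1, hgup', hyg⟩ he

end SimpleCurve
end LinkTheory

namespace LinkTheory

/-! ### Triviality -/

/-- A triangle not below the plane `z = 0` bounds a disk not below this plane. -/
theorem exists_disk_of_triangle {C : Finset (Finset ℕ)} {pos : ℕ → E3}
    (hp : IsPolygon (support pos C)) {a b c : ℕ} (h : ∀ g ∈ C, g ⊆ {a, b, c})
    (hnn : ∀ v ∈ verts C, 0 ≤ pos v 2) :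
    ∃ D, IsPLDisk D (support pos C) ∧ ∀ x ∈ D, 0 ≤ x 2 := by
  classical
  -- Two vectors do not span the space, so some nonzero linear form `φ` is constant on the three
  -- corners.
  have hspan : Submodule.span ℝ (({pos b - pos a, pos c - pos a} : Finset E3) : Set E3) < ⊤ := by
    refine lt_top_iff_ne_top.2 fun htop => ?_
    have h1 := finrank_span_finset_le_card (R := ℝ) ({pos b - pos a, pos c - pos a} : Finset E3)
    rw [Set.finrank, htop, finrank_top, finrank_euclideanSpace_fin] at h1
    have h2 := Finset.card_le_two (a := pos b - pos a) (b := pos c - pos a)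
    omega
  obtain ⟨φ, hφ, hker⟩ := Submodule.exists_le_ker_of_lt_top _ hspan
  have hφv : ∀ x ∈ ({pos b - pos a, pos c - pos a} : Finset E3), φ x = 0 := fun x hx =>
    hker (Submodule.subset_span hx)
  have hb : φ (pos b) = φ (pos a) := by
    rw [← sub_eq_zero, ← map_sub]; exact hφv _ (by simp)
  have hc : φ (pos c) = φ (pos a) := by
    rw [← sub_eq_zero, ← map_sub]; exact hφv _ (by simp)
  have hl : ∀ x ∈ support pos C, φ x = φ (pos a) := by
    intro x hx
    obtain ⟨g, hg, hxg⟩ := mem_support.1 hx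
    have hxt := cell_mono pos (h g hg) hxg
    rw [cell_triple] at hxt
    have : tri (pos a) (pos b) (pos c) ⊆ φ ⁻¹' {φ (pos a)} := by
      refine convexHull_min ?_ ((convex_singleton _).linear_preimage φ)
      rintro y (rfl | rfl | rfl)
      exacts [rfl, hb, hc]
    exact this hxt
  have hnn' : ∀ x ∈ support pos C, 0 ≤ x 2 := by
    intro x hx
    obtain ⟨g, hg, w, hw, rfl⟩ := mem_support.1 hx
    rw [bpt_apply]
    exact hw.le_bpt fun v hv => hnn v (mem_verts.2 ⟨g, hg, hv⟩)
  obtain ⟨x₀, hx₀⟩ := hp.nonempty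
  -- The apex of the cone must be off the plane of the triangle but not below `z = 0`. Up to sign,
  -- any vector not killed by `φ` leads there.
  obtain ⟨y, hy, hy2⟩ : ∃ y, φ y ≠ 0 ∧ 0 ≤ y 2 := by
    obtain ⟨y, hy⟩ : ∃ y, φ y ≠ 0 := by
      by_contra! hcon
      exact hφ (LinearMap.ext hcon)
    rcases le_total 0 (y 2) with h | h
    · exact ⟨y, hy, h⟩
    · exact ⟨-y, by simpa using hy, by simpa using h⟩
  obtain ⟨D, hD, hDsub⟩ := hp.exists_disk (φ.toAffineMap - AffineMap.const ℝ E3 (φ (pos a)))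
    (fun x hx => sub_eq_zero.2 (hl x hx)) (v := x₀ + y) (by
      change φ (x₀ + y) - φ (pos a) ≠ 0
      rw [map_add, hl x₀ hx₀, add_sub_cancel_left]
      exact hy)
  refine ⟨D, hD, fun x hx => ?_⟩
  have hcv : Convex ℝ {x : E3 | 0 ≤ x 2} :=
    (convex_Ici (0 : ℝ)).linear_preimage (EuclideanSpace.proj 2 : E3 →L[ℝ] ℝ).toLinearMap
  refine convexHull_min (s := insert (x₀ + y) (support pos C)) ?_ hcv (hDsub hx)
  rintro z (rfl | hz)
  · exact add_nonneg (hnn' _ hx₀) hy2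
  · exact hnn' z hz

/-- A polygon in a horizontal plane bounds a disk in a slab below this plane. -/
theorem IsPolygon.exists_disk_of_horizontal {C : Set E3} (hC : IsPolygon C) {c : ℝ}
    (hc : ∀ x ∈ C, x 2 = c) {ε : ℝ} (hε : 0 < ε) :
    ∃ D, IsPLDisk D C ∧ ∀ x ∈ D, x 2 ∈ Set.Icc (c - ε) c := by
  obtain ⟨D, hD, hDsub⟩ := hC.exists_disk (heightAff - AffineMap.const ℝ E3 c)
    (fun x hx => sub_eq_zero.2 (hc x hx)) (v := (c - ε) • up) (by
      change ((c - ε) • up) 2 - c ≠ 0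
      simp [up_two, hε.ne'])
  refine ⟨D, hD, fun x hx => ?_⟩
  have hcv : Convex ℝ {x : E3 | x 2 ∈ Set.Icc (c - ε) c} :=
    (convex_Icc (c - ε) c).linear_preimage (EuclideanSpace.proj 2 : E3 →L[ℝ] ℝ).toLinearMap
  refine convexHull_min (s := insert ((c - ε) • up) C) ?_ hcv (hDsub hx)
  rintro z (rfl | hz)
  · simp [up_two, hε.le]
  · simp [hc z hz, hε.le]

theorem IsPolygon.translate {C : Set E3} (hC : IsPolygon C) (y : E3) :
    IsPolygon ((fun x => x + y) '' C) :=
  hC.image (h := Homeomorph.addRight y)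
    (PLOn.of_affine (AffineMap.id ℝ E3 + AffineMap.const ℝ E3 y) _)

variable {ι : Type*} {E I C : ι → Finset (Finset ℕ)} {pos : ι → ℕ → E3}

theorem FlatCurve.exists_top {E I C : Finset (Finset ℕ)} {pos : ℕ → E3}
    (h : FlatCurve E I C pos) (hC : ¬ ∀ v ∈ verts C, pos v 2 = 0) :
    ∃ v ∈ verts C, 0 < pos v 2 ∧ pos v ∈ localMaxima (support pos I) ∩ {x | 0 < x 2} := by
  obtain ⟨v, hv, hmax⟩ := (verts C).exists_max_image (fun v => pos v 2) h.verts_nonempty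
  push Not at hC
  obtain ⟨u, hu, hu0⟩ := hC
  have hpos := ((h.nonneg hu).lt_of_ne' hu0).trans_le (hmax u hu)
  exact ⟨v, hv, hpos, h.pos_mem_localMaxima hv hpos fun u huv =>
    hmax u (mem_verts.2 ⟨_, huv, by simp⟩)⟩

/-- A vertex above the plane without a higher neighbour would be a local maximum of the base, and
there is only one. -/
theorem FlatCurve.movesToTriangle {E I C : Finset (Finset ℕ)} {pos : ℕ → E3}
    (h : FlatCurve E I C pos) (hC : ¬ ∀ v ∈ verts C, pos v 2 = 0)
    (hone : (localMaxima (support pos I) ∩ {x | 0 < x 2}).Subsingleton)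
    {t : E3 →ₗ[ℝ] ℝ} (ht : Set.InjOn t (support pos I ∩ {x | 0 ≤ x 2})) :
    SimpleCurve.MovesToTriangle C pos := by
  obtain ⟨v, hv, hpos, hmax⟩ := h.exists_top hC
  refine h.simpleCurve.movesToTriangle (fun v hv => h.nonneg hv) hv hpos (fun u hu hupos huv => ?_) t
    (ht.mono ?_)
  · by_contra! hcon
    refine huv (h.geomInj_curve.injOn hu hv (hone (h.pos_mem_localMaxima hu hupos fun w hw => ?_) hmax))
    exact hcon w (by rwa [Finset.pair_comm])
  · rintro x ⟨g, hg, ⟨u, hu, hupos⟩, hx⟩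
    exact ⟨cell_subset_support (h.mem_base hg hu hupos) hx,
      h.support_nonneg (cell_subset_support hg hx)⟩

/-- Each component leaving the plane has its own maximum above it, so there is at most one such
component. The flat components are put out of its way at distinct negative heights. Then the
exceptional one is reduced to a triangle by moves fixing everything below the plane. -/
theorem isTrivialLink_of_flatCurves [Finite ι] (h : ∀ i, FlatCurve (E i) (I i) (C i) (pos i))
    (hd : Pairwise (Function.onFun Disjoint fun i => support (pos i) (E i))) {L : ι → Set E3}
    (hL : Isotopic L fun i => support (pos i) (C i))
    (hone : (localMaxima (⋃ i, support (pos i) (I i)) ∩ {x | 0 < x 2}).Subsingleton)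
    {t : E3 →ₗ[ℝ] ℝ} (ht : Set.InjOn t ((⋃ i, support (pos i) (I i)) ∩ {x | 0 ≤ x 2})) :
    IsTrivialLink L := by
  classical
  have hsub : ∀ {F G : Finset (Finset ℕ)} {p : ℕ → E3}, F ⊆ G → support p F ⊆ support p G :=
    fun hFG => Set.biUnion_subset_biUnion_left hFG
  have hdC : Pairwise (Function.onFun Disjoint fun i => support (pos i) (C i)) := fun i j hij =>
    (hd hij).mono (hsub (h i).curve_subset) (hsub (h j).curve_subset)
  have hdI : Pairwise (Function.onFun Disjoint fun i => support (pos i) (I i)) := fun i j hij =>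
    (hd hij).mono (hsub (h i).base_subset) (hsub (h j).base_subset)
  set F := flatComponents C pos with hF
  have hlift : ∀ i, localMaxima (support (pos i) (I i)) ∩ {x | 0 < x 2} ⊆
      localMaxima (⋃ i, support (pos i) (I i)) ∩ {x | 0 < x 2} := fun i x hx =>
    ⟨(mem_localMaxima_iUnion (fun i => isCompact_support) hdI hx.1.1).2 hx.1, hx.2⟩
  have huniq : ∀ i ∉ F, ∀ j ∉ F, i = j := by
    intro i hi j hj
    by_contra hij
    obtain ⟨v, -, -, hv⟩ := (h i).exists_top hi
    obtain ⟨w, -, -, hw⟩ := (h j).exists_top hj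
    have := hone (hlift i hv) (hlift j hw)
    exact Set.disjoint_left.1 (hdI hij) hv.1.1 (this ▸ hw.1.1)
  obtain ⟨idx, hidx⟩ := Countable.exists_injective_nat ι
  -- The added 1 puts every flat component strictly below the plane.
  obtain ⟨η, hη, hshift⟩ := exists_shift (fun i => isCompact_support) hdC
    (d := fun j _ => if j ∈ F then -(idx j + 1 : ℝ) else 0)
    (fun j => ⟨0, (LipschitzWith.const _).lipschitzOnWith⟩)
  obtain ⟨f, hf, hfx⟩ := hshift η hη le_rfl
  set c : ι → ℝ := fun j => η * -(idx j + 1 : ℝ) with hc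
  have hc0 : ∀ j, c j < 0 := fun j => mul_neg_of_pos_of_neg hη (by
    have : (0 : ℝ) ≤ idx j := Nat.cast_nonneg _
    linarith)
  have hflatimg : ∀ j ∈ F, f '' support (pos j) (C j) =
      (fun x => x + c j • up) '' support (pos j) (C j) := fun j hj =>
    Set.image_congr fun x hx => by rw [hfx j x hx, if_pos hj]
  have hflatz : ∀ j ∈ F, ∀ x ∈ f '' support (pos j) (C j), x 2 = c j := by
    intro j hj x hx
    rw [hflatimg j hj] at hx
    obtain ⟨y, hy, rfl⟩ := hx
    simp [support_flat hj hy, up_two]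
  have hfixed : ∀ j ∉ F, f '' support (pos j) (C j) = support (pos j) (C j) := fun j hj =>
    Set.EqOn.image_eq_self fun x hx => by rw [hfx j x hx, if_neg hj]; simp
  obtain ⟨k, hk, hkF, hkD⟩ : ∃ k : E3 ≃ₜ E3, IsIsotopicToId k ∧
      (∀ j ∈ F, k '' (f '' support (pos j) (C j)) = f '' support (pos j) (C j)) ∧
      ∀ j ∉ F, ∃ D, IsPLDisk D (k '' (f '' support (pos j) (C j))) ∧ ∀ x ∈ D, 0 ≤ x 2 := by
    by_cases hall : ∀ j, j ∈ F
    · exact ⟨_, IsIsotopicToId.refl, fun j _ => Set.image_id _, fun j hj => absurd (hall j) hj⟩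
    · push Not at hall
      obtain ⟨i, hi⟩ := hall
      obtain ⟨C', -, ⟨p, q, r, htri⟩, hnn, hmoves⟩ := (h i).movesToTriangle hi
        (hone.anti (hlift i)) (ht.mono (Set.inter_subset_inter_left _
          (Set.subset_iUnion (fun i => support (pos i) (I i)) i)))
      obtain ⟨k, hk, hkPL, hkfix, hkC⟩ := hmoves (⋃ j : F, f '' support (pos j) (C j))
        (isCompact_iUnion fun j => isCompact_support.image f.continuous) (by
          intro x hx
          obtain ⟨j, hj⟩ := Set.mem_iUnion.1 hx
          rw [hflatz j j.2 x hj]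
          exact hc0 j)
      refine ⟨k, hk, fun j hj => Set.EqOn.image_eq_self
        (hkfix.mono (Set.subset_iUnion (fun j : F => f '' support (pos j) (C j)) ⟨j, hj⟩)), ?_⟩
      intro j hj
      obtain rfl := huniq i hi j hj
      rw [hfixed i hi, hkC]
      exact exists_disk_of_triangle (hkC ▸ (h i).polygon.image hkPL) htri hnn
  -- The levels are at least `η` apart, so disks in slabs of thickness `η / 2` below them are
  -- disjoint.
  have hD : ∀ j, ∃ D, IsPLDisk D (k '' (f '' support (pos j) (C j))) ∧
      (j ∈ F → ∀ x ∈ D, x 2 ∈ Set.Icc (c j - η / 2) (c j)) ∧ (j ∉ F → ∀ x ∈ D, 0 ≤ x 2) := by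
    intro j
    by_cases hj : j ∈ F
    · obtain ⟨D, hD, hDz⟩ := IsPolygon.exists_disk_of_horizontal
        (hflatimg j hj ▸ (h j).polygon.translate (c j • up)) (hflatz j hj) (half_pos hη)
      exact ⟨D, (hkF j hj).symm ▸ hD, fun _ => hDz, fun hj' => absurd hj hj'⟩
    · obtain ⟨D, hD, hDz⟩ := hkD j hj
      exact ⟨D, hD, fun hj' => absurd hj' hj, fun _ => hDz⟩
  choose D hD hDF hDF' using hD
  refine ⟨_, D, hL.trans ⟨_, hf.trans hk, fun j => image_trans _ _ _⟩, hD, fun i j hij => ?_⟩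
  refine Set.disjoint_left.2 fun x hxi hxj => ?_
  by_cases hi : i ∈ F <;> by_cases hj : j ∈ F
  · have h1 := hDF i hi x hxi
    have h2 := hDF j hj x hxj
    have hlt : ∀ i j, idx i < idx j → c j + η ≤ c i := fun i j hij => by
      have : (idx i + 1 : ℝ) ≤ idx j := by exact_mod_cast hij
      simp only [hc]
      nlinarith
    rcases lt_or_gt_of_ne (hidx.ne hij) with hlt' | hlt'
    · linarith [hlt i j hlt', h1.1, h2.2]
    · linarith [hlt j i hlt', h2.1, h1.2]
  · linarith [(hDF i hi x hxi).2, hDF' j hj x hxj, hc0 i]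
  · linarith [(hDF j hj x hxj).2, hDF' i hi x hxi, hc0 j]
  · exact hij (huniq i hi j hj)

end LinkTheory

namespace LinkTheory

/-! ### The theorem -/

theorem reducedBridgeNumber_eq_zero {ι : Type*} [IsEmpty ι] (L : ι → Set E3) :
    reducedBridgeNumber L = 0 := by
  have h : bridgeNumber L ≤ 0 := by
    refine iInf_le_of_le L (iInf_le_of_le ⟨fun i => isEmptyElim i, fun i => isEmptyElim i⟩
      (iInf_le_of_le ⟨_, IsIsotopicToId.refl, fun i => isEmptyElim i⟩ ?_))
    simp [localMaxima]
  exact le_antisymm (tsub_le_self.trans h) zero_le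

theorem isTrivialLink_of_isEmpty {ι : Type*} [IsEmpty ι] (L : ι → Set E3) : IsTrivialLink L :=
  ⟨L, L, ⟨_, IsIsotopicToId.refl, fun i => isEmptyElim i⟩, fun i => isEmptyElim i,
    fun i => isEmptyElim i⟩

/-- Infinitely many crossings count as `⊤`, so finiteness may be assumed without proving it for
regular projections. -/
theorem le_parallelOvercrossingNumber {ι : Type*} {L : ι → Set E3} {n : ℕ∞}
    (h : ∀ K K' : ι → Set E3, Isotopic L K → IsParallelCopy K K' → ∀ N, IsPolygonalLink N →
      PLIsotopic (Sum.elim K K') N → HasRegularProjection (⋃ i, N i) →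
      (overcrossings (⋃ i, N (Sum.inl i)) (⋃ j, N (Sum.inr j))).Finite →
      n ≤ (overcrossings (⋃ i, N (Sum.inl i)) (⋃ j, N (Sum.inr j))).encard) :
    n ≤ parallelOvercrossingNumber L := by
  refine le_iInf fun K => le_iInf fun _ => le_iInf fun hLK => le_iInf fun K' => le_iInf fun hKK' =>
    le_iInf fun N => le_iInf fun hN => le_iInf fun hKN => le_iInf fun hreg => ?_
  by_cases hfin : (overcrossings (⋃ i, N (Sum.inl i)) (⋃ j, N (Sum.inr j))).Finite
  · exact h K K' hLK hKK' N hN hKN hreg hfin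
  · rw [Set.Infinite.encard_eq hfin]
    exact le_top

end LinkTheory

theorem mainTheorem8 {ι : Type*} [Finite ι] (L : ι → Set E3) (hL : IsTameLink L) :
    reducedBridgeNumber L ≤ parallelOvercrossingNumber L ∧
      (¬ IsTrivialLink L → 2 ≤ parallelOvercrossingNumber L) := by
  -- The empty link is treated apart, because the straightening needs at least one segment to lay a
  -- trough under.
  rcases isEmpty_or_nonempty ι with _ | _
  · exact ⟨reducedBridgeNumber_eq_zero L ▸ zero_le,
      fun h => absurd (isTrivialLink_of_isEmpty L) h⟩
  constructor
  · refine le_parallelOvercrossingNumber fun K K' hLK hKK' N hN hKN hreg hfin => ?_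
    obtain ⟨E, I, C, pos, h, hd, hLC, hmax, -⟩ := exists_flatCurves hLK hKK' hN hKN hreg hfin
    exact (reducedBridgeNumber_le h hd hLC).trans hmax
  · intro hnt
    refine le_parallelOvercrossingNumber fun K K' hLK hKK' N hN hKN hreg hfin => ?_
    obtain ⟨E, I, C, pos, h, hd, hLC, hmax, hinj⟩ := exists_flatCurves hLK hKK' hN hKN hreg hfin
    by_contra hlt
    rw [not_le, ← one_add_one_eq_two] at hlt
    have hle := Order.le_of_lt_add_one hlt
    obtain ⟨t, ht⟩ := hinj hle
    exact hnt (isTrivialLink_of_flatCurves h hd hLC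
      (Set.encard_le_one_iff_subsingleton.1 (hmax.trans hle)) ht)
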